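/- **Conventions.** A temporal relation is a relation $R\subseteq\mathbb Q^k$ that is first-order definable in $(\mathbb Q,<)$; it is ll-closed if it is preserved by an operation $ll:\mathbb Q^2\to\mathbb Q$ such that $ll(a,b)<ll(a',b')$ whenever (i) $a\le 0$ and $a<a'$, or (ii) $a\le 0$, $a=a'$ and $b<b'$, or (iii) $a,a'>0$ and $b<b'$, or (iv) $a,a'>0$, $b=b'$ and $a<a'$. An instance $\Phi$ is a finite set of constraints $R(x_1,\dots,x_k)$, $k\ge 1$, on a finite set $X$ of variables; a solution is a map $X\to\mathbb Q$ satisfying all constraints. A relation is represented either by a set of weak linear orders on its entries (it consists of the tuples ordered as one of them prescribes), or by an ll-Horn formula, i.e. a conjunction of clauses $(x_1=y_1\wedge\dots\wedge x_p=y_p)\to(z_0>z_1\vee\dots\vee z_0>z_l)$ or $(x_1=y_1\wedge\dots\wedge x_p=y_p)\to(z_0>z_1\vee\dots\vee z_0>z_l\vee z_0=z_1=\dots=z_l)$ with $p,l\ge 0$. The constraint graph $G_\Phi$ has vertex set $X$ and an edge from $x$ to $y$ if some constraint $\phi$ on $x$ and $y$ is such that, in each solution of $\phi$ in which $x$ has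 the minimal value among the variables of $\phi$, $y$ has the minimal value as well. A variable $x$ is blocked if some constraint on $x$ has no solution in which $x$ has the minimal value. A sink component is a strongly connected component of $G_\Phi$ that no edge leaves and that contains no blocked variable; a sink is a vertex forming a sink component of size one. The procedure Spec$(\Phi)$ starts with $\Phi':=\Phi$ and, as long as $G_{\Phi'}$ has a sink $s$, replaces $\Phi'$ by its projection $\{\exists s.\phi \mid \phi\in\Phi'\}$ to the remaining variables. If no variable remains it returns true; otherwise, if $G_{\Phi'}$ has a sink component $S$, it returns $S$; otherwise it returns false. The procedure Solve$(\Phi)$ calls Spec$(\Phi)$; if the result is a truth value it returns this value, and if the result is a set $S$ it returns Solve$(\Phi'')$, where $\Phi''$ arises from $\Phi$ by replacing all variables in $S$ by a single one of them. Sinks, sink components and representatives are chosen arbitrarily. **Theorem.** (1) For every instance $\Phi$ with ll-closed temporal constraints (hence for both representations of the relations), Solve$(\Phi)$ decides whether $\Phi$ has a solution: every execution terminates, and returns true if and only if $\Phi$ has a solution. (2) There is an implementation of the algorithm that runs in time $O(nm)$, where $n\ge 1$ is the number of variables and $m$ is the size of the input. More precisely, there are a random access machine program (unit cost; addition, truncated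 subtraction and comparison of natural numbers; finitely many registers and arrays; an output stream) and a constant $C$ such that the following holds for every instance with ll-closed constraints on the variables $0,\dots,n-1$ in which every relation is represented by a set of weak linear orders or by an ll-Horn formula, given as a list of $m$ natural numbers. The program halts and outputs the sequence of stripped sinks, contracted sink components and the final answer of an execution of Solve on the instance (each ll-Horn clause being treated as one constraint); this answer is true if and only if the instance has a solution; and if $n\ge 1$, the program halts after at most $C\,n\,m$ steps. -/

import Mathlib

namespace TCSP

/-! ### Temporal relations and closure under `ll` -/

/-- `f` is an `ll` operation on the rationals. The four cases compare any two distinct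
arguments, so that the order of the values of `f` is completely determined. -/
def IsLL (f : ℚ → ℚ → ℚ) : Prop :=
  ∀ a b a' b' : ℚ,
    ((a ≤ 0 ∧ a < a') ∨ (a ≤ 0 ∧ a = a' ∧ b < b') ∨
      (0 < a ∧ 0 < a' ∧ b < b') ∨ (0 < a ∧ 0 < a' ∧ b = b' ∧ a < a')) →
    f a b < f a' b'

/-- The relation `R` is preserved by an `ll` operation (applied componentwise). For temporal
relations it does not matter which `ll` operation is taken. -/
def LLClosed {k : ℕ} (R : Set (Fin k → ℚ)) : Prop :=
  ∃ f : ℚ → ℚ → ℚ, IsLL f ∧ ∀ t ∈ R, ∀ t' ∈ R, (fun i => f (t i) (t' i)) ∈ R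

/-- A temporal relation: first-order definable (without parameters) in the ordered set of the
rationals. -/
def IsTemporal {k : ℕ} (R : Set (Fin k → ℚ)) : Prop :=
  letI : FirstOrder.Language.order.Structure ℚ := FirstOrder.Language.orderStructure ℚ
  (∅ : Set ℚ).Definable FirstOrder.Language.order R

/-- An atomic formula `R(x₁, …, x_k)` with `k ≥ 1`; arguments may be repeated. -/
structure Atom (V : Type*) where
  arity : ℕ
  arity_pos : 0 < arity
  rel : Set (Fin arity → ℚ)
  args : Fin arity → V

/-- The atoms `Φ` have a common solution over the rationals. -/
def Satisfiable {V : Type*} (Φ : List (Atom V)) : Prop :=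
  ∃ s : V → ℚ, ∀ φ ∈ Φ, (fun i => s (φ.args i)) ∈ φ.rel

/-! ### Instances, as they occur during the execution of the algorithm

Starting from atoms, the algorithm quantifies variables existentially and identifies variables.
A constraint is therefore a formula, given by its free variables and its solutions. -/

/-- A constraint: a formula with free variables `scope`, given by its satisfying assignments. -/
structure Constraint (V : Type*) where
  scope : Finset V
  sols : Set (V → ℚ)
  sols_congr : ∀ s s' : V → ℚ, (∀ x ∈ scope, s x = s' x) → s ∈ sols → s' ∈ sols

namespace Constraint

variable {V : Type*} [DecidableEq V]

/-- Among the variables of `φ`, the variable `x` has the minimal value in `s`. -/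
def MinAt (φ : Constraint V) (s : V → ℚ) (x : V) : Prop :=
  x ∈ φ.scope ∧ ∀ y ∈ φ.scope, s x ≤ s y

/-- The constraint expressed by an atomic formula. -/
def ofAtom (φ : Atom V) : Constraint V where
  scope := Finset.univ.image φ.args
  sols := {s | (fun i => s (φ.args i)) ∈ φ.rel}
  sols_congr := by
    intro s s' h hs
    have e : (fun i => s' (φ.args i)) = fun i => s (φ.args i) := by
      funext i
      exact (h _ (Finset.mem_image_of_mem _ (Finset.mem_univ i))).symm
    simpa only [Set.mem_ofPred_eq, e] using hs

/-- `∃ y. φ`. -/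
def project (φ : Constraint V) (y : V) : Constraint V where
  scope := φ.scope.erase y
  sols := {s | ∃ a : ℚ, Function.update s y a ∈ φ.sols}
  sols_congr := by
    rintro s s' h ⟨a, ha⟩
    refine ⟨a, φ.sols_congr _ _ ?_ ha⟩
    intro x hx
    by_cases hxy : x = y
    · subst hxy; simp
    · simpa [Function.update_of_ne hxy] using h x (Finset.mem_erase.2 ⟨hxy, hx⟩)

/-- The formula obtained from `φ` by replacing every variable `x` by `g x`. -/
def rename (φ : Constraint V) (g : V → V) : Constraint V where
  scope := φ.scope.image g
  sols := {s | (fun x => s (g x)) ∈ φ.sols}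
  sols_congr := by
    intro s s' h hs
    exact φ.sols_congr _ _ (fun x hx => h _ (Finset.mem_image_of_mem g hx)) hs

end Constraint

/-- An instance: a finite set of variables with constraints on them. -/
structure Instance (V : Type*) where
  vars : Finset V
  constraints : List (Constraint V)
  scope_subset : ∀ φ ∈ constraints, φ.scope ⊆ vars

namespace Instance

variable {V : Type*} [DecidableEq V]

/-- The instance given by atoms whose variables are the elements of the finite type `V`. -/
def ofAtoms [Fintype V] (Φ : List (Atom V)) : Instance V where
  vars := Finset.univ
  constraints := Φ.map Constraint.ofAtom
  scope_subset := fun _ _ => Finset.subset_univ _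

/-- The projection of `Φ` to all variables but `y`. -/
def project (Φ : Instance V) (y : V) : Instance V where
  vars := Φ.vars.erase y
  constraints := Φ.constraints.map fun φ => φ.project y
  scope_subset := by
    intro φ hφ
    obtain ⟨ψ, hψ, rfl⟩ := List.mem_map.1 hφ
    exact Finset.erase_subset_erase _ (Φ.scope_subset ψ hψ)

/-- Replace every variable `x` by `g x`. -/
def rename (Φ : Instance V) (g : V → V) : Instance V where
  vars := Φ.vars.image g
  constraints := Φ.constraints.map fun φ => φ.rename g
  scope_subset := by
    intro φ hφ
    obtain ⟨ψ, hψ, rfl⟩ := List.mem_map.1 hφ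
    exact Finset.image_subset_image (Φ.scope_subset ψ hψ)

/-- The contraction of the variables in the list `S` into the single variable `r`. -/
def contract (Φ : Instance V) (r : V) (S : List V) : Instance V :=
  Φ.rename fun x => if x ∈ S then r else x

/-- The edges of the constraint graph `G_Φ`: for some constraint, whenever `x` has the minimal
value in a solution of this constraint, `y` has the minimal value as well. -/
def Edge (Φ : Instance V) (x y : V) : Prop :=
  ∃ φ ∈ Φ.constraints, x ∈ φ.scope ∧ y ∈ φ.scope ∧
    ∀ s ∈ φ.sols, φ.MinAt s x → φ.MinAt s y

/-- Some constraint on `x` has no solution in which `x` has the minimal value. -/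
def Blocked (Φ : Instance V) (x : V) : Prop :=
  ∃ φ ∈ Φ.constraints, x ∈ φ.scope ∧ ∀ s ∈ φ.sols, ¬ φ.MinAt s x

/-- There is a directed path from `x` to `y` in the constraint graph. -/
def Reach (Φ : Instance V) : V → V → Prop :=
  Relation.ReflTransGen Φ.Edge

/-- `K` is a strongly connected component of the constraint graph. -/
def IsSCC (Φ : Instance V) (K : Set V) : Prop :=
  ∃ x ∈ Φ.vars, K = {y | Φ.Reach x y ∧ Φ.Reach y x}

/-- A strongly connected component that no edge leaves and that has no blocked variable. -/
def IsSinkComponent (Φ : Instance V) (K : Set V) : Prop :=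
  Φ.IsSCC K ∧ (∀ x ∈ K, ∀ y, Φ.Edge x y → y ∈ K) ∧ ∀ x ∈ K, ¬ Φ.Blocked x

/-- A vertex that forms a sink component of size one. -/
def IsSink (Φ : Instance V) (x : V) : Prop :=
  Φ.IsSinkComponent {x}

end Instance

/-! ### The procedures `Spec` and `Solve`

The procedures choose sinks and sink components freely, so their executions are described by a
transition system. In a configuration `running Φ Φ'`, the instance `Φ` is the argument of the
current call of `Solve` and of the call of `Spec` that it makes, and `Φ'` is the projection of `Φ`
that `Spec` has reached. The variables of `Φ'` are those in `X \ Y`. -/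

/-- The visible actions of an execution. -/
inductive Event (V : Type*) where
  /-- `Spec` strips the sink `s` -/
  | strip (s : V)
  /-- `Spec` returns the sink component whose members are listed in `S`, and `Solve` calls itself
  on the instance in which `S` is contracted -/
  | contract (S : List V)
  /-- `Spec`, and with it `Solve`, returns the truth value `b` -/
  | answer (b : Bool)

/-- The configurations of an execution. -/
inductive Config (V : Type*) where
  | running (Φ Φ' : Instance V)
  | done (b : Bool)

/-- The steps of an execution of `Solve`. -/
inductive Step {V : Type*} [DecidableEq V] : Config V → Event V → Config V → Prop
  /-- the body of the while-loop of `Spec` -/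
  | strip (Φ Φ' : Instance V) (s : V) (hs : Φ'.IsSink s) :
      Step (.running Φ Φ') (.strip s) (.running Φ (Φ'.project s))
  /-- no sink is left and `Y = X` -/
  | accept (Φ Φ' : Instance V) (no_sink : ∀ s, ¬ Φ'.IsSink s) (hY : Φ'.vars = ∅) :
      Step (.running Φ Φ') (.answer true) (.done true)
  /-- no sink is left, `Y ≠ X`, and there is a sink component, listed by `r :: S`; all its members
  are replaced by `r` in the argument `Φ` of the current call -/
  | contract (Φ Φ' : Instance V) (no_sink : ∀ s, ¬ Φ'.IsSink s) (hY : Φ'.vars ≠ ∅)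
      (r : V) (S : List V) (nodup : (r :: S).Nodup)
      (hS : Φ'.IsSinkComponent {x | x ∈ r :: S}) :
      Step (.running Φ Φ') (.contract (r :: S))
        (.running (Φ.contract r (r :: S)) (Φ.contract r (r :: S)))
  /-- no sink is left, `Y ≠ X`, and there is no sink component -/
  | reject (Φ Φ' : Instance V) (no_sink : ∀ s, ¬ Φ'.IsSink s) (hY : Φ'.vars ≠ ∅)
      (no_comp : ∀ K, ¬ Φ'.IsSinkComponent K) :
      Step (.running Φ Φ') (.answer false) (.done false)

/-- `Run c es c'`: the events `es` lead from `c` to `c'`. -/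
inductive Run {V : Type*} [DecidableEq V] : Config V → List (Event V) → Config V → Prop
  | nil (c : Config V) : Run c [] c
  | cons {c c' c'' : Config V} {e : Event V} {es : List (Event V)} :
      Step c e c' → Run c' es c'' → Run c (e :: es) c''

/-- The initial configuration of the call `Solve(Φ)`. -/
def Config.start {V : Type*} [DecidableEq V] [Fintype V] (Φ : List (Atom V)) : Config V :=
  .running (Instance.ofAtoms Φ) (Instance.ofAtoms Φ)

/-- `Solve` decides whether `Φ` has a solution: every execution terminates, and whenever an
execution cannot be continued it has returned the correct truth value. -/
def SolveDecides {V : Type*} [DecidableEq V] [Fintype V] (Φ : List (Atom V)) : Prop :=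
  (¬ ∃ c : ℕ → Config V, c 0 = Config.start Φ ∧ ∀ i, ∃ e, Step (c i) e (c (i + 1))) ∧
  ∀ es c, Run (Config.start Φ) es c → (¬ ∃ e c', Step c e c') →
    ∃ b : Bool, c = .done b ∧ (b = true ↔ Satisfiable Φ)

/-! ### The two representations of relations -/

/-- An `ll`-Horn clause on the entries of a `k`-tuple. With `eqs = [(x₁, y₁), …, (x_p, y_p)]`,
`head = z₀` and `tail = [z₁, …, z_l]`, where `p, l ≥ 0`, it is the clause
`(x₁ = y₁ ∧ … ∧ x_p = y_p) → (z₀ > z₁ ∨ … ∨ z₀ > z_l)` if `weak = false`, and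
`(x₁ = y₁ ∧ … ∧ x_p = y_p) → (z₀ > z₁ ∨ … ∨ z₀ > z_l ∨ z₀ = z₁ = … = z_l)` if `weak = true`. -/
structure HornClause (k : ℕ) where
  eqs : List (Fin k × Fin k)
  head : Fin k
  tail : List (Fin k)
  weak : Bool

/-- The relation defined by an `ll`-Horn clause. -/
def HornClause.rel {k : ℕ} (c : HornClause k) : Set (Fin k → ℚ) :=
  {t | (∀ p ∈ c.eqs, t p.1 = t p.2) →
    (∃ z ∈ c.tail, t z < t c.head) ∨ (c.weak = true ∧ ∀ z ∈ c.tail, t z = t c.head)}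

/-- A weak linear order on the `k` entries, given by assigning a rank to every entry; entries of
the same rank are equivalent. -/
abbrev WeakOrder (k : ℕ) := Fin k → Fin k

/-- The tuples that are ordered as `w` prescribes. -/
def WeakOrder.rel {k : ℕ} (w : WeakOrder k) : Set (Fin k → ℚ) :=
  {t | ∀ i j, t i ≤ t j ↔ w i ≤ w j}

/-- A representation of a `k`-ary relation: a set of weak linear orders, or an `ll`-Horn formula,
which is a conjunction of `ll`-Horn clauses. -/
inductive RelRep (k : ℕ) where
  | orders (ws : List (WeakOrder k))
  | horn (cs : List (HornClause k))

/-- The relation that is represented. -/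
def RelRep.rel {k : ℕ} : RelRep k → Set (Fin k → ℚ)
  | .orders ws => {t | ∃ w ∈ ws, t ∈ w.rel}
  | .horn cs => {t | ∀ c ∈ cs, t ∈ c.rel}

/-- A constraint on the variables `0, …, n - 1` whose relation is given by a representation. -/
structure RepConstraint (n : ℕ) where
  arity : ℕ
  arity_pos : 0 < arity
  args : Fin arity → Fin n
  rep : RelRep arity

/-- The atomic formula that is represented. -/
def RepConstraint.atom {n : ℕ} (c : RepConstraint n) : Atom (Fin n) :=
  ⟨c.arity, c.arity_pos, c.rep.rel, c.args⟩

/-- The constraints that the implementation works with: a conjunction of `ll`-Horn clauses is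
treated as one constraint for each of the clauses. -/
def RepConstraint.conjuncts {n : ℕ} (c : RepConstraint n) : List (Atom (Fin n)) :=
  match c.rep with
  | .orders ws => [⟨c.arity, c.arity_pos, (RelRep.orders ws).rel, c.args⟩]
  | .horn cs => cs.map fun d => ⟨c.arity, c.arity_pos, d.rel, c.args⟩

/-! ### Words: input and output -/

/-- The words describing an `ll`-Horn clause. -/
def HornClause.encode {k : ℕ} (c : HornClause k) : List ℕ :=
  c.weak.toNat :: c.eqs.length :: c.eqs.flatMap (fun p => [p.1.val, p.2.val]) ++
    c.head.val :: c.tail.length :: c.tail.map (fun z => z.val)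

/-- The words describing a relation. -/
def RelRep.encode {k : ℕ} : RelRep k → List ℕ
  | .orders ws => 0 :: ws.length :: ws.flatMap fun w => List.ofFn fun i => (w i).val
  | .horn cs => 1 :: cs.length :: cs.flatMap HornClause.encode

/-- The words describing a constraint. -/
def RepConstraint.encode {n : ℕ} (c : RepConstraint n) : List ℕ :=
  c.arity :: (List.ofFn fun i => (c.args i).val) ++ c.rep.encode

/-- The input that describes an instance. The size of the input is the length of this list. -/
def encodeInput {n : ℕ} (I : List (RepConstraint n)) : List ℕ :=
  n :: I.length :: I.flatMap RepConstraint.encode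

/-- The words by which an implementation reports an action. -/
def Event.encode {n : ℕ} : Event (Fin n) → List ℕ
  | .strip s => [0, s.val]
  | .contract S => 1 :: S.length :: S.map fun x => x.val
  | .answer b => [2, b.toNat]

/-! ### Random access machines

Programs have finitely many registers and arrays and an output stream. The instructions compute
with additions, subtractions and comparisons of natural numbers; there is no multiplication. The
execution of an elementary instruction or of a test takes one step. -/

/-- Expressions. -/
inductive Exp where
  | lit (c : ℕ)
  | reg (r : ℕ)
  /-- the entry of the array `a` at the given index -/
  | get (a : ℕ) (i : Exp)
  | plus (e f : Exp)
  /-- truncated subtraction -/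
  | minus (e f : Exp)
  /-- `1` if the first value is smaller than the second one, and `0` otherwise -/
  | less (e f : Exp)
  /-- `1` if the values are equal, and `0` otherwise -/
  | equal (e f : Exp)

/-- Programs. -/
inductive Cmd where
  | skip
  | set (r : ℕ) (e : Exp)
  /-- store the value of `e` in the array `a` at index `i` -/
  | put (a : ℕ) (i e : Exp)
  /-- append the value of `e` to the output -/
  | emit (e : Exp)
  | seq (p q : Cmd)
  /-- branch on whether the value of `e` is nonzero -/
  | cond (e : Exp) (p q : Cmd)
  /-- repeat `p` as long as the value of `e` is nonzero -/
  | loop (e : Exp) (p : Cmd)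

/-- The state of the machine. -/
structure State where
  regs : ℕ → ℕ
  arrays : ℕ → ℕ → ℕ
  out : List ℕ

/-- The value of an expression. -/
def Exp.eval (σ : State) : Exp → ℕ
  | .lit c => c
  | .reg r => σ.regs r
  | .get a i => σ.arrays a (i.eval σ)
  | .plus e f => e.eval σ + f.eval σ
  | .minus e f => e.eval σ - f.eval σ
  | .less e f => if e.eval σ < f.eval σ then 1 else 0
  | .equal e f => if e.eval σ = f.eval σ then 1 else 0

/-- `Exec p σ t τ`: started in state `σ`, the program `p` halts after `t` steps in state `τ`. -/
inductive Exec : Cmd → State → ℕ → State → Prop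
  | skip (σ : State) : Exec .skip σ 1 σ
  | set (r : ℕ) (e : Exp) (σ : State) :
      Exec (.set r e) σ 1 { σ with regs := Function.update σ.regs r (e.eval σ) }
  | put (a : ℕ) (i e : Exp) (σ : State) :
      Exec (.put a i e) σ 1
        { σ with
          arrays := Function.update σ.arrays a
            (Function.update (σ.arrays a) (i.eval σ) (e.eval σ)) }
  | emit (e : Exp) (σ : State) :
      Exec (.emit e) σ 1 { σ with out := σ.out ++ [e.eval σ] }
  | seq {p q : Cmd} {σ τ υ : State} {t u : ℕ} :
      Exec p σ t τ → Exec q τ u υ → Exec (.seq p q) σ (t + u) υ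
  | cond_true {e : Exp} {p q : Cmd} {σ τ : State} {t : ℕ} :
      e.eval σ ≠ 0 → Exec p σ t τ → Exec (.cond e p q) σ (t + 1) τ
  | cond_false {e : Exp} {p q : Cmd} {σ τ : State} {t : ℕ} :
      e.eval σ = 0 → Exec q σ t τ → Exec (.cond e p q) σ (t + 1) τ
  | loop_done {e : Exp} {p : Cmd} {σ : State} :
      e.eval σ = 0 → Exec (.loop e p) σ 1 σ
  | loop_step {e : Exp} {p : Cmd} {σ τ υ : State} {t u : ℕ} :
      e.eval σ ≠ 0 → Exec p σ t τ → Exec (.loop e p) τ u υ →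
      Exec (.loop e p) σ (t + u + 1) υ

/-- The initial state: the input stands in array `0`, everything else is zero. -/
def State.init (input : List ℕ) : State where
  regs := fun _ => 0
  arrays := fun a i => if a = 0 then input.getD i 0 else 0
  out := []

end TCSP

/-!
# Correctness and running time of the algorithm for ll-closed constraints

**Correctness.** Closure under `ll` enters through one property. Two solutions of an ll-closed
temporal constraint, with the minimum of the second placed at `0` and the operation applied
suitably, yield a solution whose minimal variables are those that are minimal in both
(`Constraint.Nice.exists_minAt_inter`). Hence, among the solutions in which `x` is minimal, there
is a least set of minimal variables; the edges of `x` lead to its members. Call a set `U` of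
variables *admissible* if for every constraint on a member `x` of `U` some solution has `x` among
its minimal variables, all of which are in `U`. The sink components are then exactly the minimal
nonempty admissible sets (`Instance.Nice.isSinkComponent_iff`), and every step is sound:

* *strip*: an injective solution of the projection extends to an injective solution with the sink
  as a new value (`Instance.Nice.exists_injOn_of_project`), so that stripping all variables proves
  satisfiability, and with it the answer `true`;
* *contract*: every solution is constant on a sink component
  (`Instance.Nice.eq_on_sinkComponent`);
* *reject*: the variables at which a solution is minimal form an admissible set, which contains a
  sink component (`Instance.Nice.exists_isSinkComponent_of_sol`).

Each step decreases the pair of the numbers of variables of the two instances lexicographically.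

**The implementation.** Both representations are translated into *groups*. A group has governed
variables and options; an option is a weak linear order of some variables, and a set `U` is
admissible for the group if for each governed `x` in `U` some option has `x` in its first class,
and that class is contained in `U`. A set of weak orders is one group. A Horn clause admits too
many weak orders for a list of them; its groups have a few cells for each entry of the clause, and
use auxiliary variables. A variable `e`, one for each clause, can be stripped once a premise
equates two variables that have not been contracted into one; every variable of the clause can
then be the only minimal one. A variable `d`, one for each conjunction, for which all variables of
the conjunction wait, can be stripped once no clause is violated by the contractions alone. The
groups have linear size, and once all sinks are stripped, including auxiliary ones, the admissible
sets of the instance and of its groups coincide (`adm_of_gAdm`, `gAdm_of_adm`).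

A round carries out one call of `Spec` on the tables of the groups, in time linear in their size
(`wp_cmdRound`). It counts, for each class of an option, the live variables that it contains, and
keeps for each option the first class that still has one. A variable is queued as a sink when each
of its groups has an option whose first class consists of it alone. If variables remain, each
governed one that is not blocked chooses an option with a smallest first class; because the sets
of minimal variables are closed under intersection, that class is the least one. A backward search
removes the variables from which a blocked one can be reached. From the variables left, searches
in the reverse graph are started in turn until all are visited; the last start lies in a sink
component, and a forward search finds its members.

A contracted component has at least two members, all of them governed, so every round but the last
decreases the number of representatives of governed variables. There are thus at most
`min n (62 * m) + 1` rounds of cost `O(n + m)` each, which is `O(n * m)` in total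
(`rounds_bound`).
-/

namespace TCSP

set_option linter.unusedSectionVars false

open Function (update update_of_ne update_self update_apply)
open List (mem_map mem_cons mem_singleton mem_of_getElem? mem_ofFn' ofFn mem_append mem_flatMap
  length_append flatMap_append getElem?_eq_getElem mem_cons_self not_mem_nil mem_map_of_mem
  mem_cons_of_mem mem_range getElem?_append_left getElem?_append_right length_ofFn map_cons
  flatMap_cons length_cons length_singleton foldl_cons map_congr_left getElem?_singleton
  mem_iff_getElem? map_append append_assoc finRange length_finRange getElem?_cons_zero
  mem_append_left flatMap_singleton)
open Nat (lt_succ_iff_lt_or_eq exists_eq_succ_of_ne_zero reduceEqDiff)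

/-! ### Temporal relations are invariant under order isomorphisms -/

/-- The order of `ℚ` is ultrahomogeneous: a finite partial isomorphism extends to an automorphism.
-/
theorem exists_orderIso_eqOn {ι : Type*} (A : Finset ι) (s s' : ι → ℚ)
    (h : ∀ x ∈ A, ∀ y ∈ A, s x ≤ s y ↔ s' x ≤ s' y) :
    ∃ α : ℚ ≃o ℚ, ∀ x ∈ A, α (s x) = s' x := by
  classical
  open Order Order.PartialIso in
  have hcmp : ∀ x ∈ A, ∀ y ∈ A, cmp (s x) (s y) = cmp (s' x) (s' y) := by
    intro x hx y hy
    have h1 := h x hx y hy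
    have h2 := h y hy x hx
    rcases lt_trichotomy (s x) (s y) with hlt | heq | hgt
    · have : s' x < s' y := lt_of_not_ge fun hc => absurd (h2.2 hc) (not_le.2 hlt)
      rw [cmp_eq_lt_iff _ _ |>.2 hlt, cmp_eq_lt_iff _ _ |>.2 this]
    · have : s' x = s' y := le_antisymm (h1.1 heq.le) (h2.1 heq.ge)
      simp_all
    · have : s' y < s' x := lt_of_not_ge fun hc => absurd (h1.2 hc) (not_le.2 hgt)
      rw [cmp_eq_gt_iff _ _ |>.2 hgt, cmp_eq_gt_iff _ _ |>.2 this]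
  let p0 : PartialIso ℚ ℚ := ⟨A.image fun x => (s x, s' x), by
    intro p hp q hq
    obtain ⟨x, hx, rfl⟩ := Finset.mem_image.1 hp
    obtain ⟨y, hy, rfl⟩ := Finset.mem_image.1 hq
    exact hcmp x hx y hy⟩
  let to_cofinal : ℚ ⊕ ℚ → Cofinal (PartialIso ℚ ℚ) := fun p ↦
    Sum.recOn p (definedAtLeft ℚ) (definedAtRight ℚ)
  let I : Ideal (PartialIso ℚ ℚ) := idealOfCofinals p0 to_cofinal
  let F a := funOfIdeal a I (cofinal_meets_idealOfCofinals _ to_cofinal (Sum.inl a))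
  let G b := invOfIdeal b I (cofinal_meets_idealOfCofinals _ to_cofinal (Sum.inr b))
  refine ⟨OrderIso.ofCmpEqCmp (fun a ↦ (F a).val) (fun b ↦ (G b).val) fun a b ↦ ?_, ?_⟩
  · rcases (F a).prop with ⟨f, hf, ha⟩
    rcases (G b).prop with ⟨g, hg, hb⟩
    rcases I.directed _ hf _ hg with ⟨m, _, fm, gm⟩
    exact m.prop (a, _) (fm ha) (_, b) (gm hb)
  · intro x hx
    change (F (s x)).val = s' x
    rcases (F (s x)).prop with ⟨f, hf, ha⟩
    rcases I.directed _ hf _ (mem_idealOfCofinals p0 to_cofinal) with ⟨m, _, fm, gm⟩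
    have hb : (s x, s' x) ∈ m.val := gm (Finset.mem_image_of_mem _ hx)
    have := m.prop _ (fm ha) _ hb
    simp only [cmp_self_eq_eq] at this
    exact (cmp_eq_eq_iff _ _).1 this.symm

theorem IsTemporal.orderIso_mem {k : ℕ} {R : Set (Fin k → ℚ)} (hR : IsTemporal R) (α : ℚ ≃o ℚ)
    {t : Fin k → ℚ} (ht : t ∈ R) : (fun i => α (t i)) ∈ R := by
  let : FirstOrder.Language.order.Structure ℚ := FirstOrder.Language.orderStructure ℚ
  have : FirstOrder.Language.order.OrderedStructure ℚ := ⟨fun _ => Iff.rfl⟩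
  obtain ⟨φ, hφ⟩ := Set.empty_definable_iff.1 (show (∅ : Set ℚ).Definable _ R from hR)
  subst hφ
  exact (FirstOrder.Language.StrongHomClass.realize_formula α φ (v := t)).2 ht

/-! ### Constraints preserved by an `ll` operation -/

namespace Constraint

variable {V : Type*}

/-- The constraint is invariant under the automorphisms of `(ℚ, <)` and under an `ll` operation. -/
def Nice (φ : Constraint V) : Prop :=
  (∀ α : ℚ ≃o ℚ, ∀ s ∈ φ.sols, (fun x => α (s x)) ∈ φ.sols) ∧
    ∃ f : ℚ → ℚ → ℚ, IsLL f ∧ ∀ s ∈ φ.sols, ∀ s' ∈ φ.sols, (fun x => f (s x) (s' x)) ∈ φ.sols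

theorem Nice.project [DecidableEq V] {φ : Constraint V} (h : φ.Nice) (y : V) :
    (φ.project y).Nice := by
  obtain ⟨h1, f, hf, h2⟩ := h
  refine ⟨?_, f, hf, ?_⟩
  · rintro α s ⟨a, ha⟩
    refine ⟨α a, ?_⟩
    convert h1 α _ ha using 1
    funext x
    by_cases hx : x = y
    · subst hx; simp
    · simp [update_of_ne hx]
  · rintro s ⟨a, ha⟩ s' ⟨a', ha'⟩
    refine ⟨f a a', ?_⟩
    convert h2 _ ha _ ha' using 1
    funext x
    by_cases hx : x = y
    · subst hx; simp
    · simp [update_of_ne hx]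

theorem Nice.rename [DecidableEq V] {φ : Constraint V} (h : φ.Nice) (g : V → V) :
    (φ.rename g).Nice := by
  obtain ⟨h1, f, hf, h2⟩ := h
  exact ⟨fun α s hs => h1 α _ hs, f, hf, fun s hs s' hs' => h2 _ hs _ hs'⟩

theorem nice_ofAtom [DecidableEq V] {φ : Atom V}
    (h : ∀ α : ℚ ≃o ℚ, ∀ t ∈ φ.rel, (fun i => α (t i)) ∈ φ.rel) (h' : LLClosed φ.rel) :
    (ofAtom φ).Nice := by
  obtain ⟨f, hf, h2⟩ := h'
  exact ⟨fun α s hs => h α _ hs, f, hf, fun s hs s' hs' => h2 _ hs _ hs'⟩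

/-- Only the order of the values on the scope matters. -/
theorem Nice.mem_of_pattern {φ : Constraint V} (h : φ.Nice) {s s' : V → ℚ} (hs : s ∈ φ.sols)
    (hp : ∀ x ∈ φ.scope, ∀ y ∈ φ.scope, s x ≤ s y ↔ s' x ≤ s' y) : s' ∈ φ.sols := by
  obtain ⟨α, hα⟩ := exists_orderIso_eqOn φ.scope s s' hp
  exact φ.sols_congr _ _ hα (h.1 α s hs)

/-- `u` orders the variables as the `ll` operation applied to `s` and `t`, with threshold `b`,
prescribes: values of `s` up to `b` come first, ordered by `s` and then by `t`; the remaining ones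
are ordered by `t` and then by `s`. -/
structure LLCombine (b : ℚ) (s t u : V → ℚ) : Prop where
  low : ∀ y z, s y ≤ b → s y < s z → u y < u z
  low_tie : ∀ y z, s y ≤ b → s y = s z → t y < t z → u y < u z
  high : ∀ y z, b < s y → b < s z → t y < t z → u y < u z
  high_tie : ∀ y z, b < s y → b < s z → t y = t z → s y < s z → u y < u z
  tie : ∀ y z, s y = s z → t y = t z → u y = u z

theorem Nice.exists_llCombine {φ : Constraint V} (h : φ.Nice) {s t : V → ℚ} (hs : s ∈ φ.sols)
    (ht : t ∈ φ.sols) (b : ℚ) : ∃ u ∈ φ.sols, LLCombine b s t u := by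
  obtain ⟨h1, f, hf, h2⟩ := h
  refine ⟨_, h2 _ (h1 (OrderIso.addRight (-b)) _ hs) _ ht, ?_, ?_, ?_, ?_, ?_⟩
  · intro y z h3 h4
    exact hf _ _ _ _ (Or.inl (by simp; constructor <;> linarith))
  · intro y z h3 h4 h5
    exact hf _ _ _ _ (Or.inr (Or.inl (by simp; refine ⟨?_, h4, h5⟩; linarith)))
  · intro y z h3 h4 h5
    exact hf _ _ _ _ (Or.inr (Or.inr (Or.inl (by simp; refine ⟨?_, ?_, h5⟩ <;> linarith))))
  · intro y z h3 h4 h5 h6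
    exact hf _ _ _ _ (Or.inr (Or.inr (Or.inr (by simp; refine ⟨?_, ?_, h5, ?_⟩ <;> linarith))))
  · simp_all

variable [DecidableEq V]

/-- The sets of minimal variables of the solutions are closed under nonempty intersections. -/
theorem Nice.exists_minAt_inter {φ : Constraint V} (h : φ.Nice) {s t : V → ℚ} (hs : s ∈ φ.sols)
    (ht : t ∈ φ.sols) {x : V} (hsx : φ.MinAt s x) (htx : φ.MinAt t x) :
    ∃ u ∈ φ.sols, φ.MinAt u x ∧ ∀ y, φ.MinAt u y → φ.MinAt s y ∧ φ.MinAt t y := by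
  obtain ⟨u, hu, hc⟩ := h.exists_llCombine hs ht (s x)
  have key : ∀ y ∈ φ.scope, (s x = s y ∧ t x = t y) ∨ u x < u y := by
    intro y hy
    rcases (hsx.2 y hy).lt_or_eq with h1 | h1
    · exact Or.inr (hc.low _ _ le_rfl h1)
    · rcases (htx.2 y hy).lt_or_eq with h2 | h2
      · exact Or.inr (hc.low_tie _ _ le_rfl h1 h2)
      · exact Or.inl ⟨h1, h2⟩
  refine ⟨u, hu, ⟨hsx.1, fun y hy => ?_⟩, fun y hy => ?_⟩
  · rcases key y hy with h1 | h1
    · exact (hc.tie _ _ h1.1 h1.2).le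
    · exact h1.le
  · rcases key y hy.1 with h1 | h1
    · exact ⟨⟨hy.1, fun z hz => h1.1 ▸ hsx.2 z hz⟩, ⟨hy.1, fun z hz => h1.2 ▸ htx.2 z hz⟩⟩
    · exact absurd (hy.2 x hsx.1) (not_le.2 h1)

/-- If `x` can be minimal, there is a solution that realizes the least set of minimal variables
containing `x`. -/
theorem Nice.exists_least {φ : Constraint V} (h : φ.Nice) {x : V}
    (hx : ∃ s ∈ φ.sols, φ.MinAt s x) :
    ∃ u ∈ φ.sols, φ.MinAt u x ∧
      ∀ y, φ.MinAt u y → ∀ s ∈ φ.sols, φ.MinAt s x → φ.MinAt s y := by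
  have key : ∀ A : Finset V, ∃ u ∈ φ.sols, φ.MinAt u x ∧
      ∀ y ∈ A, φ.MinAt u y → ∀ s ∈ φ.sols, φ.MinAt s x → φ.MinAt s y := by
    intro A
    induction A using Finset.induction_on with
    | empty =>
      obtain ⟨s, hs, hsx⟩ := hx
      exact ⟨s, hs, hsx, by simp⟩
    | insert a A _ ih =>
      obtain ⟨u, hu, hux, hA⟩ := ih
      by_cases ha : ∀ s ∈ φ.sols, φ.MinAt s x → φ.MinAt s a
      · grind
      · push Not at ha
        obtain ⟨s, hs, hsx, hsa⟩ := ha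
        obtain ⟨v, hv, hvx, hvy⟩ := h.exists_minAt_inter hu hs hux hsx
        grind
  obtain ⟨u, hu, hux, hA⟩ := key φ.scope
  exact ⟨u, hu, hux, fun y hy => hA y hy.1 hy⟩

end Constraint

/-! ### Admissible sets and sink components -/

namespace Instance

variable {V : Type*} [DecidableEq V]

/-- All constraints are preserved by `ll` operations. -/
def Nice (Φ : Instance V) : Prop := ∀ φ ∈ Φ.constraints, φ.Nice

theorem Nice.project {Φ : Instance V} (h : Φ.Nice) (y : V) : (Φ.project y).Nice := by
  intro φ hφ
  obtain ⟨ψ, hψ, rfl⟩ := mem_map.1 hφ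
  exact (h ψ hψ).project y

theorem Nice.rename {Φ : Instance V} (h : Φ.Nice) (g : V → V) : (Φ.rename g).Nice := by
  intro φ hφ
  obtain ⟨ψ, hψ, rfl⟩ := mem_map.1 hφ
  exact (h ψ hψ).rename g

/-- Every constraint on a variable of `U` has a solution in which this variable is minimal and all
minimal variables belong to `U`. -/
def Adm (Φ : Instance V) (U : Set V) : Prop :=
  ∀ x ∈ U, ∀ φ ∈ Φ.constraints, x ∈ φ.scope →
    ∃ s ∈ φ.sols, φ.MinAt s x ∧ ∀ y, φ.MinAt s y → y ∈ U

theorem Nice.adm_iff {Φ : Instance V} (h : Φ.Nice) (U : Set V) :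
    Φ.Adm U ↔ (∀ x ∈ U, ∀ y, Φ.Edge x y → y ∈ U) ∧ ∀ x ∈ U, ¬ Φ.Blocked x := by
  constructor
  · intro hU
    refine ⟨?_, ?_⟩
    · rintro x hx y ⟨φ, hφ, hxφ, hyφ, he⟩
      obtain ⟨s, hs, hsx, hsU⟩ := hU x hx φ hφ hxφ
      exact hsU y (he s hs hsx)
    · rintro x hx ⟨φ, hφ, hxφ, hb⟩
      obtain ⟨s, hs, hsx, hsU⟩ := hU x hx φ hφ hxφ
      exact hb s hs hsx
  · rintro ⟨h1, h2⟩ x hx φ hφ hxφ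
    have : ∃ s ∈ φ.sols, φ.MinAt s x := by
      by_contra! hc
      exact h2 x hx ⟨φ, hφ, hxφ, hc⟩
    obtain ⟨u, hu, hux, hl⟩ := (h φ hφ).exists_least this
    exact ⟨u, hu, hux, fun y hy => h1 x hx y ⟨φ, hφ, hxφ, hy.1, hl y hy⟩⟩

theorem Edge.mem_vars {Φ : Instance V} {x y : V} (h : Φ.Edge x y) : y ∈ Φ.vars := by
  obtain ⟨φ, hφ, -, hy, -⟩ := h
  exact Φ.scope_subset φ hφ hy

theorem Reach.mem_of_closed {Φ : Instance V} {U : Set V}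
    (hU : ∀ x ∈ U, ∀ y, Φ.Edge x y → y ∈ U) {x y : V} (h : Φ.Reach x y) (hx : x ∈ U) : y ∈ U := by
  induction h with
  | refl => exact hx
  | tail _ h2 ih => exact hU _ ih _ h2

/-- Sink components are the minimal nonempty admissible sets of variables. -/
theorem Nice.isSinkComponent_iff {Φ : Instance V} (h : Φ.Nice) (K : Set V) :
    Φ.IsSinkComponent K ↔ K.Nonempty ∧ K ⊆ Φ.vars ∧ Φ.Adm K ∧
      ∀ U ⊆ K, U.Nonempty → Φ.Adm U → K ⊆ U := by
  constructor
  · rintro ⟨⟨x, hx, rfl⟩, h1, h2⟩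
    have hxx : Φ.Reach x x := Relation.ReflTransGen.refl
    refine ⟨⟨x, hxx, hxx⟩, ?_, (h.adm_iff _).2 ⟨h1, h2⟩, ?_⟩
    · rintro y ⟨hy, -⟩
      exact Reach.mem_of_closed (U := Φ.vars) (fun _ _ _ he => he.mem_vars) hy hx
    · rintro U hUK ⟨z, hz⟩ hU y hy
      exact Reach.mem_of_closed ((h.adm_iff U).1 hU).1 ((hUK hz).2.trans hy.1) hz
  · rintro ⟨⟨x, hx⟩, hv, hK, hmin⟩
    obtain ⟨h1, h2⟩ := (h.adm_iff K).1 hK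
    have hmin' : ∀ y ∈ K, K ⊆ {z | Φ.Reach y z} := by
      intro y hy
      have hsub : {z | Φ.Reach y z} ⊆ K := fun z hz => Reach.mem_of_closed h1 hz hy
      refine hmin _ hsub ⟨y, Relation.ReflTransGen.refl⟩ ((h.adm_iff _).2 ⟨?_, ?_⟩)
      · intro a ha b hab
        exact Relation.ReflTransGen.tail ha hab
      · grind
    refine ⟨⟨x, hv hx, ?_⟩, h1, h2⟩
    ext y
    constructor
    · grind
    · rintro ⟨hy, -⟩
      exact Reach.mem_of_closed h1 hy hx

theorem Nice.isSink_iff {Φ : Instance V} (h : Φ.Nice) (x : V) :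
    Φ.IsSink x ↔ x ∈ Φ.vars ∧ Φ.Adm {x} := by
  unfold IsSink
  rw [h.isSinkComponent_iff]
  constructor
  · simp_all
  · rintro ⟨hv, ha⟩
    refine ⟨⟨x, rfl⟩, by simpa using hv, ha, ?_⟩
    rintro U hU ⟨y, hy⟩ - z rfl
    grind

/-- A nonempty admissible set contains a sink component. -/
theorem Nice.exists_isSinkComponent {Φ : Instance V} (h : Φ.Nice) {U : Set V} (hne : U.Nonempty)
    (hv : U ⊆ Φ.vars) (hU : Φ.Adm U) : ∃ K ⊆ U, Φ.IsSinkComponent K := by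
  have hfin : {W : Set V | W ⊆ U ∧ W.Nonempty ∧ Φ.Adm W}.Finite :=
    ((Φ.vars.finite_toSet.subset hv).finite_subsets).subset fun W hW => hW.1
  obtain ⟨K, hK, hmin⟩ := hfin.exists_minimal ⟨U, subset_rfl, hne, hU⟩
  refine ⟨K, hK.1, (h.isSinkComponent_iff K).2 ⟨hK.2.1, hK.1.trans hv, hK.2.2, ?_⟩⟩
  grind

/-! ### Soundness of the steps -/

/-- The constraints have a common solution. -/
def Sat (Φ : Instance V) : Prop := ∃ s : V → ℚ, ∀ φ ∈ Φ.constraints, s ∈ φ.sols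

theorem sols_project {Φ : Instance V} {s : V → ℚ} (hs : ∀ φ ∈ Φ.constraints, s ∈ φ.sols) (y : V) :
    ∀ φ ∈ (Φ.project y).constraints, s ∈ φ.sols := by
  intro φ hφ
  obtain ⟨ψ, hψ, rfl⟩ := mem_map.1 hφ
  exact ⟨s y, by simpa using hs ψ hψ⟩

/-- A solution that is injective after stripping the sink `y` can be extended by giving `y` a value
below all other values. -/
theorem Nice.exists_injOn_of_project {Φ : Instance V} (h : Φ.Nice) {y : V} (hy : Φ.Adm {y})
    {s : V → ℚ} (hs : ∀ φ ∈ (Φ.project y).constraints, s ∈ φ.sols)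
    (hinj : Set.InjOn s (Φ.project y).vars) :
    ∃ s' : V → ℚ, (∀ φ ∈ Φ.constraints, s' ∈ φ.sols) ∧ Set.InjOn s' Φ.vars := by
  obtain ⟨a, ha⟩ : ∃ a : ℚ, ∀ x ∈ Φ.vars, a < s x := by
    obtain ⟨m, hm⟩ := (Φ.vars.image s).finite_toSet.bddBelow
    exact ⟨m - 1, fun x hx => by
      have := hm (Finset.mem_image_of_mem s hx)
      linarith⟩
  refine ⟨update s y a, ?_, ?_⟩
  · intro φ hφ
    obtain ⟨c, hc⟩ := hs _ (mem_map_of_mem hφ)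
    by_cases hyφ : y ∈ φ.scope
    · obtain ⟨t, ht, hty, htU⟩ := hy y rfl φ hφ hyφ
      obtain ⟨u, hu, hcb⟩ := (h φ hφ).exists_llCombine ht hc (t y)
      have hlt : ∀ x ∈ φ.scope, x ≠ y → t y < t x := by
        intro x hx hxy
        refine lt_of_le_of_ne (hty.2 x hx) fun he => hxy ?_
        exact htU x ⟨hx, fun z hz => he ▸ hty.2 z hz⟩
      have hsv : ∀ x ∈ φ.scope, x ∈ Φ.vars := fun x hx => Φ.scope_subset φ hφ hx
      have hord : ∀ x ∈ φ.scope, ∀ z ∈ φ.scope, update s y a x < update s y a z →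
          u x < u z := by
        intro x hx z hz hxz
        by_cases hxy : x = y
        · subst hxy
          have hzx : z ≠ x := by grind
          exact hcb.low _ _ le_rfl (hlt z hz hzx)
        · by_cases hzy : z = y
          · grind
          · rw [update_of_ne hxy, update_of_ne hzy] at hxz
            refine hcb.high _ _ (hlt x hx hxy) (hlt z hz hzy) ?_
            simp_all
      refine (h φ hφ).mem_of_pattern hu fun x hx z hz => ?_
      constructor
      · grind
      · intro hle
        rcases hle.lt_or_eq with hlt' | heq
        · exact (hord x hx z hz hlt').le
        · have : x = z := by
            by_contra hne
            by_cases hxy : x = y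
            · grind
            · by_cases hzy : z = y
              · grind
              · rw [update_of_ne hxy, update_of_ne hzy] at heq
                exact hne (hinj (Finset.mem_erase.2 ⟨hxy, hsv x hx⟩)
                  (Finset.mem_erase.2 ⟨hzy, hsv z hz⟩) heq)
          rw [this]
    · refine φ.sols_congr _ _ (fun x hx => ?_) hc
      grind
  · intro x hx z hz hxz
    by_cases hxy : x = y
    · grind
    · by_cases hzy : z = y
      · grind
      · rw [update_of_ne hxy, update_of_ne hzy] at hxz
        exact hinj (Finset.mem_erase.2 ⟨hxy, hx⟩) (Finset.mem_erase.2 ⟨hzy, hz⟩) hxz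

/-- A solution is constant on every sink component `K`: otherwise the variables of `K` on which it
is smallest would form a smaller admissible set. -/
theorem Nice.eq_on_sinkComponent {Φ : Instance V} (h : Φ.Nice) {K : Set V}
    (hK : Φ.IsSinkComponent K) {t : V → ℚ} (ht : ∀ φ ∈ Φ.constraints, t ∈ φ.sols) {x y : V}
    (hx : x ∈ K) (hy : y ∈ K) : t x = t y := by
  obtain ⟨-, hv, hadm, hmin⟩ := (h.isSinkComponent_iff K).1 hK
  have hfin : K.Finite := Φ.vars.finite_toSet.subset hv
  have hsub := hmin {z | z ∈ K ∧ ∀ w ∈ K, t z ≤ t w} (fun z hz => hz.1) ?_ ?_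
  · exact le_antisymm ((hsub hx).2 y hy) ((hsub hy).2 x hx)
  · obtain ⟨z, hz, hz'⟩ := hfin.exists_minimalFor t K ⟨x, hx⟩
    exact ⟨z, hz, fun w hw => by
      rcases le_total (t z) (t w) with h1 | h1
      · exact h1
      · exact hz' hw h1⟩
  · rintro z ⟨hzK, hz⟩ φ hφ hzφ
    obtain ⟨s, hs, hsz, hsK⟩ := hadm z hzK φ hφ hzφ
    obtain ⟨u, hu, hcb⟩ := (h φ hφ).exists_llCombine hs (ht φ hφ) (s z)
    have key : ∀ w ∈ φ.scope, (w ∈ K ∧ s z = s w ∧ t z = t w) ∨ u z < u w := by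
      intro w hw
      rcases (hsz.2 w hw).lt_or_eq with h1 | h1
      · exact Or.inr (hcb.low _ _ le_rfl h1)
      · have hwK : w ∈ K := hsK w ⟨hw, fun v hv => h1 ▸ hsz.2 v hv⟩
        rcases (hz w hwK).lt_or_eq with h2 | h2
        · exact Or.inr (hcb.low_tie _ _ le_rfl h1 h2)
        · exact Or.inl ⟨hwK, h1, h2⟩
    refine ⟨u, hu, ⟨hzφ, fun w hw => ?_⟩, fun w hw => ?_⟩
    · rcases key w hw with h1 | h1
      · exact (hcb.tie _ _ h1.2.1 h1.2.2).le
      · exact h1.le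
    · rcases key w hw.1 with h1 | h1
      · exact ⟨h1.1, fun v hv => h1.2.2 ▸ hz v hv⟩
      · exact absurd (hw.2 z hzφ) (not_le.2 h1)

/-- The variables on which a solution is smallest form an admissible set. -/
theorem adm_of_sol {Φ : Instance V} {t : V → ℚ} (ht : ∀ φ ∈ Φ.constraints, t ∈ φ.sols) :
    Φ.Adm {x | x ∈ Φ.vars ∧ ∀ y ∈ Φ.vars, t x ≤ t y} := by
  rintro x ⟨hx, hmin⟩ φ hφ hxφ
  refine ⟨t, ht φ hφ, ⟨hxφ, fun y hy => hmin y (Φ.scope_subset φ hφ hy)⟩, fun y hy => ?_⟩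
  exact ⟨Φ.scope_subset φ hφ hy.1, fun z hz => (hy.2 x hxφ).trans (hmin z hz)⟩

theorem Nice.exists_isSinkComponent_of_sol {Φ : Instance V} (h : Φ.Nice) (hne : Φ.vars ≠ ∅)
    {t : V → ℚ} (ht : ∀ φ ∈ Φ.constraints, t ∈ φ.sols) : ∃ K, Φ.IsSinkComponent K := by
  obtain ⟨x, hx, hx'⟩ := Φ.vars.exists_min_image t (Finset.nonempty_iff_ne_empty.2 hne)
  obtain ⟨K, -, hK⟩ := h.exists_isSinkComponent (U := {x | x ∈ Φ.vars ∧ ∀ y ∈ Φ.vars, t x ≤ t y})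
    ⟨x, hx, hx'⟩ (fun y hy => hy.1) (adm_of_sol ht)
  exact ⟨K, hK⟩

end Instance

/-! ### Correctness of `Solve` -/

variable {V : Type*} [DecidableEq V]

/-- What holds of every configuration that occurs in the execution on an instance whose
satisfiability is described by `P`. -/
structure Reachable (P : Prop) (Φ Φ' : Instance V) : Prop where
  sat_iff : Φ.Sat ↔ P
  nice : Φ.Nice
  nice' : Φ'.Nice
  scope_ne : ∀ φ ∈ Φ.constraints, φ.scope ≠ ∅
  vars_subset : Φ'.vars ⊆ Φ.vars
  sol : ∀ s : V → ℚ, (∀ φ ∈ Φ.constraints, s ∈ φ.sols) → ∀ φ ∈ Φ'.constraints, s ∈ φ.sols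
  sat_of_injOn : (∃ s : V → ℚ, (∀ φ ∈ Φ'.constraints, s ∈ φ.sols) ∧ Set.InjOn s Φ'.vars) → Φ.Sat
  /-- constraints without variables have been solved -/
  sols_ne : ∀ φ ∈ Φ'.constraints, φ.scope = ∅ → φ.sols.Nonempty

theorem Reachable.start {P : Prop} {Φ : Instance V} (h : Φ.Nice) (hs : Φ.Sat ↔ P)
    (hne : ∀ φ ∈ Φ.constraints, φ.scope ≠ ∅) : Reachable P Φ Φ where
  sat_iff := hs
  nice := h
  nice' := h
  scope_ne := hne
  vars_subset := subset_rfl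
  sol := fun _ h => h
  sat_of_injOn := fun ⟨s, hs, _⟩ => ⟨s, hs⟩
  sols_ne := fun φ hφ he => absurd he (hne φ hφ)

theorem Reachable.strip {P : Prop} {Φ Φ' : Instance V} (h : Reachable P Φ Φ') {s : V}
    (hs : Φ'.IsSink s) : Reachable P Φ (Φ'.project s) where
  sat_iff := h.sat_iff
  nice := h.nice
  nice' := h.nice'.project s
  scope_ne := h.scope_ne
  vars_subset := (Finset.erase_subset _ _).trans h.vars_subset
  sol := fun t ht => Instance.sols_project (h.sol t ht) s
  sat_of_injOn := by
    rintro ⟨t, ht, hinj⟩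
    exact h.sat_of_injOn (h.nice'.exists_injOn_of_project ((h.nice'.isSink_iff s).1 hs).2 ht hinj)
  sols_ne := by
    intro φ hφ he
    obtain ⟨ψ, hψ, rfl⟩ := mem_map.1 hφ
    have hne : ψ.sols.Nonempty := by
      by_cases hsψ : s ∈ ψ.scope
      · obtain ⟨t, ht, -⟩ := ((h.nice'.isSink_iff s).1 hs).2 s rfl ψ hψ hsψ
        exact ⟨t, ht⟩
      · exact h.sols_ne ψ hψ ((Finset.erase_eq_of_notMem hsψ).symm.trans he)
    obtain ⟨t, ht⟩ := hne
    exact ⟨t, t s, by simpa using ht⟩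

theorem Reachable.contract {P : Prop} {Φ Φ' : Instance V} (h : Reachable P Φ Φ') {r : V}
    {S : List V} (hS : Φ'.IsSinkComponent {x | x ∈ r :: S}) :
    Reachable P (Φ.contract r (r :: S)) (Φ.contract r (r :: S)) := by
  refine Reachable.start (h.nice.rename _) ?_ ?_
  · rw [← h.sat_iff]
    constructor
    · rintro ⟨s, hs⟩
      exact ⟨fun x => s (if x ∈ r :: S then r else x), fun φ hφ =>
        hs (φ.rename fun x => if x ∈ r :: S then r else x) (mem_map_of_mem hφ)⟩
    · rintro ⟨s, hs⟩
      refine ⟨s, fun φ hφ => ?_⟩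
      obtain ⟨ψ, hψ, rfl⟩ := mem_map.1 hφ
      refine ψ.sols_congr _ _ (fun x _ => ?_) (hs ψ hψ)
      by_cases hx : x ∈ r :: S
      · simp only [if_pos hx]
        exact h.nice'.eq_on_sinkComponent hS (h.sol s hs) hx (by simp)
      · simp only [if_neg hx]
  · intro φ hφ
    obtain ⟨ψ, hψ, rfl⟩ := mem_map.1 hφ
    simpa [Constraint.rename] using h.scope_ne ψ hψ

theorem Reachable.accept {P : Prop} {Φ Φ' : Instance V} (h : Reachable P Φ Φ')
    (hY : Φ'.vars = ∅) : P := by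
  refine h.sat_iff.1 (h.sat_of_injOn ⟨fun _ => 0, fun φ hφ => ?_, by simp [hY]⟩)
  have he : φ.scope = ∅ := Finset.subset_empty.1 (hY ▸ Φ'.scope_subset φ hφ)
  obtain ⟨t, ht⟩ := h.sols_ne φ hφ he
  exact φ.sols_congr _ _ (by simp [he]) ht

theorem Reachable.reject {P : Prop} {Φ Φ' : Instance V} (h : Reachable P Φ Φ')
    (hY : Φ'.vars ≠ ∅) (no_comp : ∀ K, ¬ Φ'.IsSinkComponent K) : ¬ P := by
  intro hP
  obtain ⟨s, hs⟩ := h.sat_iff.2 hP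
  obtain ⟨K, hK⟩ := h.nice'.exists_isSinkComponent_of_sol hY (h.sol s hs)
  exact no_comp K hK

/-- What holds of every configuration: the answer is correct. -/
def Config.Correct (P : Prop) : Config V → Prop
  | .running Φ Φ' => Reachable P Φ Φ'
  | .done b => (b = true ↔ P)

theorem Config.Correct.step {P : Prop} {c c' : Config V} {e : Event V} (h : c.Correct P)
    (hs : Step c e c') : c'.Correct P := by
  cases hs with
  | strip Φ Φ' s hs => exact Reachable.strip h hs
  | accept Φ Φ' _ hY => exact iff_of_true rfl (Reachable.accept h hY)
  | contract Φ Φ' _ _ r S _ hS => exact Reachable.contract h hS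
  | reject Φ Φ' _ hY hc => exact iff_of_false (by simp) (Reachable.reject h hY hc)

theorem Config.Correct.run {P : Prop} {c c' : Config V} {es : List (Event V)} (h : c.Correct P)
    (hs : Run c es c') : c'.Correct P := by
  induction hs with
  | nil => exact h
  | cons h1 _ ih => exact ih (h.step h1)

/-- Every configuration that is not final has a successor. -/
theorem exists_step (Φ Φ' : Instance V) :
    ∃ e c', Step (.running Φ Φ') e c' := by
  by_cases h1 : ∃ s, Φ'.IsSink s
  · obtain ⟨s, hs⟩ := h1
    exact ⟨_, _, .strip Φ Φ' s hs⟩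
  push Not at h1
  by_cases hY : Φ'.vars = ∅
  · exact ⟨_, _, .accept Φ Φ' h1 hY⟩
  by_cases h2 : ∃ K, Φ'.IsSinkComponent K
  · obtain ⟨K, hK⟩ := h2
    have hfin : K.Finite := by
      obtain ⟨⟨x, hx, rfl⟩, -, -⟩ := hK
      refine Φ'.vars.finite_toSet.subset fun y hy => ?_
      exact Instance.Reach.mem_of_closed (U := Φ'.vars) (fun _ _ _ he => he.mem_vars) hy.1 hx
    have hne : K.Nonempty := by
      obtain ⟨⟨x, hx, rfl⟩, -, -⟩ := hK
      exact ⟨x, Relation.ReflTransGen.refl, Relation.ReflTransGen.refl⟩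
    have hl : ∃ r S, hfin.toFinset.toList = r :: S := by
      rcases hl : hfin.toFinset.toList with _ | ⟨r, S⟩
      · simp_all
      · exact ⟨r, S, rfl⟩
    obtain ⟨r, S, hrS⟩ := hl
    have hKe : {x | x ∈ r :: S} = K := by
      ext x
      rw [← hrS]
      simp
    exact ⟨_, _, .contract Φ Φ' h1 hY r S (hrS ▸ Finset.nodup_toList _) (hKe ▸ hK)⟩
  · push Not at h2
    exact ⟨_, _, .reject Φ Φ' h1 hY h2⟩

/-- A sink component consists of at least two variables if there is no sink. -/
theorem contract_vars_card_lt {P : Prop} {Φ Φ' : Instance V} (h : Reachable P Φ Φ')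
    (no_sink : ∀ s, ¬ Φ'.IsSink s) {r : V} {S : List V} (nodup : (r :: S).Nodup)
    (hS : Φ'.IsSinkComponent {x | x ∈ r :: S}) :
    (Φ.contract r (r :: S)).vars.card < Φ.vars.card := by
  have hv := ((h.nice'.isSinkComponent_iff _).1 hS).2.1
  rcases S with _ | ⟨y, S⟩
  · refine absurd ?_ (no_sink r)
    have : {x | x ∈ [r]} = {r} := by ext; simp
    rwa [this] at hS
  have hyr : y ≠ r := by
    rintro rfl
    simp at nodup
  have hsub : (Φ.contract r (r :: y :: S)).vars ⊆ Φ.vars.erase y := by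
    intro z hz
    obtain ⟨x, hx, rfl⟩ := Finset.mem_image.1 hz
    by_cases hxS : x ∈ r :: y :: S
    · rw [if_pos hxS]
      exact Finset.mem_erase.2 ⟨hyr.symm, h.vars_subset (hv (by simp))⟩
    · simp_all
  calc _ ≤ (Φ.vars.erase y).card := Finset.card_le_card hsub
    _ < Φ.vars.card := Finset.card_erase_lt_of_mem (h.vars_subset (hv (by simp)))

/-- The remaining work of an execution decreases lexicographically. -/
def Config.work : Config V → ℕ ×ₗ ℕ
  | .running Φ Φ' => toLex (Φ.vars.card + 1, Φ'.vars.card)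
  | .done _ => toLex (0, 0)

theorem Config.Correct.work_lt {P : Prop} {c c' : Config V} {e : Event V} (h : c.Correct P)
    (hs : Step c e c') : c'.work < c.work := by
  cases hs with
  | strip Φ Φ' s hs =>
    refine Prod.Lex.toLex_lt_toLex.2 (Or.inr ⟨rfl, ?_⟩)
    exact Finset.card_erase_lt_of_mem ((Instance.Nice.isSink_iff (Reachable.nice' h) s).1 hs).1
  | accept Φ Φ' _ hY => exact Prod.Lex.toLex_lt_toLex.2 (Or.inl (Nat.succ_pos _))
  | contract Φ Φ' h1 _ r S h2 hS =>
    exact Prod.Lex.toLex_lt_toLex.2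
      (Or.inl (Nat.succ_lt_succ (contract_vars_card_lt h h1 h2 hS)))
  | reject Φ Φ' _ hY hc => exact Prod.Lex.toLex_lt_toLex.2 (Or.inl (Nat.succ_pos _))

variable [Fintype V]

theorem sat_ofAtoms (Φ : List (Atom V)) : (Instance.ofAtoms Φ).Sat ↔ Satisfiable Φ := by
  constructor
  · rintro ⟨s, hs⟩
    exact ⟨s, fun φ hφ => hs _ (mem_map_of_mem hφ)⟩
  · rintro ⟨s, hs⟩
    refine ⟨s, fun φ hφ => ?_⟩
    obtain ⟨ψ, hψ, rfl⟩ := mem_map.1 hφ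
    exact hs ψ hψ

theorem correct_start {Φ : List (Atom V)} (h : ∀ φ ∈ Φ, (Constraint.ofAtom φ).Nice) :
    (Config.start Φ).Correct (Satisfiable Φ) := by
  refine Reachable.start ?_ (sat_ofAtoms Φ) ?_
  · intro φ hφ
    obtain ⟨ψ, hψ, rfl⟩ := mem_map.1 hφ
    exact h ψ hψ
  · intro φ hφ
    obtain ⟨ψ, hψ, rfl⟩ := mem_map.1 hφ
    have : Nonempty (Fin ψ.arity) := ⟨⟨0, ψ.arity_pos⟩⟩
    simp [Constraint.ofAtom, Finset.univ_eq_empty_iff]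

theorem solveDecides_of_nice {Φ : List (Atom V)} (h : ∀ φ ∈ Φ, (Constraint.ofAtom φ).Nice) :
    SolveDecides Φ := by
  refine ⟨?_, ?_⟩
  · rintro ⟨c, h0, hc⟩
    have hcorr : ∀ i, (c i).Correct (Satisfiable Φ) := by
      intro i
      induction i with
      | zero => rw [h0]; exact correct_start h
      | succ i ih =>
        obtain ⟨e, he⟩ := hc i
        exact ih.step he
    refine not_strictAnti_of_wellFoundedLT (fun i => (c i).work) (strictAnti_nat_of_succ_lt fun i
        => ?_)
    obtain ⟨e, he⟩ := hc i
    exact (hcorr i).work_lt he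
  · intro es c hrun hstuck
    have hcorr := (correct_start h).run hrun
    cases c with
    | running Φ1 Φ2 => exact absurd (exists_step Φ1 Φ2) hstuck
    | done b => exact ⟨b, rfl, hcorr⟩

/-- Every execution of `Solve` on `ll`-closed temporal constraints terminates with the correct
answer. -/
theorem solveDecides {Φ : List (Atom V)} (h : ∀ φ ∈ Φ, IsTemporal φ.rel ∧ LLClosed φ.rel) :
    SolveDecides Φ :=
  solveDecides_of_nice fun φ hφ =>
    Constraint.nice_ofAtom (fun α _ ht => (h φ hφ).1.orderIso_mem α ht) (h φ hφ).2

/-! ### The represented relations are `ll`-closed and invariant -/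

/-- An `ll` operation is injective, so the premises hold in the image only if they hold in both
arguments. A variable below the head in the first argument stays below it if its value is at most
`0`; otherwise the second argument decides, and the first one breaks ties. -/
theorem HornClause.llClosed {k : ℕ} (c : HornClause k) {f : ℚ → ℚ → ℚ} (hf : IsLL f)
    {t t' : Fin k → ℚ} (ht : t ∈ c.rel) (ht' : t' ∈ c.rel) : (fun i => f (t i) (t' i)) ∈ c.rel := by
  have hinj : ∀ a b a' b', f a b = f a' b' → a = a' ∧ b = b' := by
    intro a b a' b' h
    by_contra hne
    have hlt : f a b < f a' b' ∨ f a' b' < f a b := by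
      rcases le_or_gt a 0 with ha | ha
      · rcases lt_trichotomy a a' with h1 | h1 | h1
        · exact Or.inl (hf _ _ _ _ (Or.inl ⟨ha, h1⟩))
        · rcases lt_trichotomy b b' with h2 | h2 | h2
          · exact Or.inl (hf _ _ _ _ (Or.inr (Or.inl ⟨ha, h1, h2⟩)))
          · exact absurd ⟨h1, h2⟩ hne
          · exact Or.inr (hf _ _ _ _ (Or.inr (Or.inl ⟨h1 ▸ ha, h1.symm, h2⟩)))
        · exact Or.inr (hf _ _ _ _ (Or.inl ⟨h1.le.trans ha, h1⟩))
      · rcases le_or_gt a' 0 with ha' | ha'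
        · exact Or.inr (hf _ _ _ _ (Or.inl ⟨ha', ha'.trans_lt ha⟩))
        · rcases lt_trichotomy b b' with h2 | h2 | h2
          · exact Or.inl (hf _ _ _ _ (Or.inr (Or.inr (Or.inl ⟨ha, ha', h2⟩))))
          · rcases lt_trichotomy a a' with h1 | h1 | h1
            · exact Or.inl (hf _ _ _ _ (Or.inr (Or.inr (Or.inr ⟨ha, ha', h2, h1⟩))))
            · exact absurd ⟨h1, h2⟩ hne
            · exact Or.inr (hf _ _ _ _ (Or.inr (Or.inr (Or.inr ⟨ha', ha, h2.symm, h1⟩))))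
          · exact Or.inr (hf _ _ _ _ (Or.inr (Or.inr (Or.inl ⟨ha', ha, h2⟩))))
    simp_all
  intro heq
  have h1 := ht fun p hp => (hinj _ _ _ _ (heq p hp)).1
  have h2 := ht' fun p hp => (hinj _ _ _ _ (heq p hp)).2
  rcases h1 with ⟨z, hz, hlt⟩ | ⟨hw, hall⟩
  · rcases le_or_gt (t z) 0 with hz0 | hz0
    · exact Or.inl ⟨z, hz, hf _ _ _ _ (Or.inl ⟨hz0, hlt⟩)⟩
    · rcases h2 with ⟨y, hy, hlt'⟩ | ⟨hw', hall'⟩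
      · rcases le_or_gt (t y) 0 with hy0 | hy0
        · exact Or.inl ⟨y, hy, hf _ _ _ _ (Or.inl ⟨hy0, hy0.trans_lt (hz0.trans hlt)⟩)⟩
        · exact Or.inl ⟨y, hy, hf _ _ _ _ (Or.inr (Or.inr (Or.inl ⟨hy0, hz0.trans hlt, hlt'⟩)))⟩
      · exact Or.inl ⟨z, hz, hf _ _ _ _
          (Or.inr (Or.inr (Or.inr ⟨hz0, hz0.trans hlt, hall' z hz, hlt⟩)))⟩
  · rcases h2 with ⟨y, hy, hlt'⟩ | ⟨hw', hall'⟩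
    · rcases le_or_gt (t y) 0 with hy0 | hy0
      · exact Or.inl ⟨y, hy, hf _ _ _ _ (Or.inr (Or.inl ⟨hy0, hall y hy, hlt'⟩))⟩
      · exact Or.inl ⟨y, hy, hf _ _ _ _ (Or.inr (Or.inr (Or.inl ⟨hy0, hall y hy ▸ hy0, hlt'⟩)))⟩
    · exact Or.inr ⟨hw, fun y hy => by simp only [hall y hy, hall' y hy]⟩

theorem HornClause.orderIso_mem {k : ℕ} (c : HornClause k) (α : ℚ ≃o ℚ) {t : Fin k → ℚ}
    (ht : t ∈ c.rel) : (fun i => α (t i)) ∈ c.rel := by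
  intro heq
  rcases ht fun p hp => α.injective (heq p hp) with ⟨z, hz, hlt⟩ | ⟨hw, hall⟩
  · exact Or.inl ⟨z, hz, α.strictMono hlt⟩
  · exact Or.inr ⟨hw, fun y hy => by simp only [hall y hy]⟩

theorem orders_orderIso_mem {k : ℕ} (ws : List (WeakOrder k)) (α : ℚ ≃o ℚ) {t : Fin k → ℚ}
    (ht : t ∈ (RelRep.orders ws).rel) : (fun i => α (t i)) ∈ (RelRep.orders ws).rel := by
  obtain ⟨w, hw, h⟩ := ht
  exact ⟨w, hw, fun i j => (α.le_iff_le).trans (h i j)⟩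

/-- An `ll` operation exists: `(a, b)` is mapped to the lexicographic rank of `(a, b)` or
`(b, a)`, using that every countable linear order embeds into `ℚ`. -/
theorem exists_isLL : ∃ f : ℚ → ℚ → ℚ, IsLL f := by
  let key : ℚ × ℚ → Bool ×ₗ (ℚ ×ₗ ℚ) := fun p =>
    if p.1 ≤ 0 then toLex (false, toLex (p.1, p.2)) else toLex (true, toLex (p.2, p.1))
  have : Countable (Bool ×ₗ (ℚ ×ₗ ℚ)) :=
    show Countable (Bool × (ℚ × ℚ)) from inferInstance
  obtain ⟨g⟩ := Order.embedding_from_countable_to_dense (Bool ×ₗ (ℚ ×ₗ ℚ)) ℚ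
  refine ⟨fun a b => g (key (a, b)), fun a b a' b' h => g.strictMono ?_⟩
  rcases h with ⟨h1, h2⟩ | ⟨h1, h2, h3⟩ | ⟨h1, h2, h3⟩ | ⟨h1, h2, h3, h4⟩
  · by_cases h : a' ≤ 0
    · simp [key, h1, h, Prod.Lex.toLex_lt_toLex, h2]
    · simp [key, h1, h, Prod.Lex.toLex_lt_toLex]
  · subst h2
    simp [key, h1, Prod.Lex.toLex_lt_toLex, h3]
  · simp [key, not_le.2 h1, not_le.2 h2, Prod.Lex.toLex_lt_toLex, h3]
  · simp [key, not_le.2 h1, not_le.2 h2, Prod.Lex.toLex_lt_toLex, h3, h4]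

theorem RepConstraint.nice_conjuncts {n : ℕ} {c : RepConstraint n} (h : LLClosed c.rep.rel) :
    ∀ a ∈ c.conjuncts, (Constraint.ofAtom a).Nice := by
  obtain ⟨k, hk, args, rep⟩ := c
  cases rep with
  | orders ws =>
    intro a ha
    simp only [RepConstraint.conjuncts, mem_singleton] at ha
    subst ha
    exact Constraint.nice_ofAtom (fun α t ht => orders_orderIso_mem ws α ht) h
  | horn cs =>
    intro a ha
    simp only [RepConstraint.conjuncts, mem_map] at ha
    obtain ⟨d, -, rfl⟩ := ha
    obtain ⟨f, hf⟩ := exists_isLL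
    exact Constraint.nice_ofAtom (fun α t ht => d.orderIso_mem α ht)
      ⟨f, hf, fun t ht t' ht' => d.llClosed hf ht ht'⟩

theorem satisfiable_conjuncts {n : ℕ} (I : List (RepConstraint n)) :
    Satisfiable (I.flatMap RepConstraint.conjuncts) ↔
      Satisfiable (I.map RepConstraint.atom) := by
  have key : ∀ (s : Fin n → ℚ) (c : RepConstraint n),
      (∀ a ∈ c.conjuncts, (fun i => s (a.args i)) ∈ a.rel) ↔
        (fun i => s (c.atom.args i)) ∈ c.atom.rel := by
    intro s c
    obtain ⟨k, hk, args, rep⟩ := c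
    cases rep with
    | orders ws => 
      simp only [RepConstraint.conjuncts, mem_singleton, forall_eq]
      exact Iff.rfl
    | horn cs => 
      simp only [RepConstraint.conjuncts, mem_map, forall_exists_index, and_imp,
        forall_apply_eq_imp_iff₂]
      exact Iff.rfl
  unfold Satisfiable
  refine exists_congr fun s => ?_
  simp only [mem_flatMap, mem_map, forall_exists_index, and_imp, forall_apply_eq_imp_iff₂]
  constructor
  · intro h c hc
    exact (key s c).1 fun a ha => h a c hc ha
  · intro h a c hc ha
    exact (key s c).2 (h c hc) a ha

/-! ### Horn clauses: which variables can be minimal -/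

section Horn

variable {n k : ℕ}

/-- Some premise of the clause equates distinct variables. -/
def HornClause.Nontriv (c : HornClause k) {W : Type*} (w : Fin k → W) : Prop :=
  ∃ p ∈ c.eqs, w p.1 ≠ w p.2

/-- After the substitution `w`, the clause is satisfiable. -/
def HornClause.Consistent (c : HornClause k) {W : Type*} (w : Fin k → W) : Prop :=
  c.Nontriv w ∨ c.weak = true ∨ ∃ z ∈ c.tail, w z ≠ w c.head

/-- In some tuple of `R`, substituted by `w`, the variable `x` is minimal among the variables
outside of `Y`, and all variables that are minimal with it belong to `U`. -/
def MinIn {k : ℕ} (R : Set (Fin k → ℚ)) (w : Fin k → Fin n) (Y : Set ℕ) (x : Fin n)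
    (U : Set ℕ) : Prop :=
  ∃ s : Fin n → ℚ, (fun i => s (w i)) ∈ R ∧
    ∀ i, (w i).val ∉ Y → s x ≤ s (w i) ∧ (s (w i) ≤ s x → (w i).val ∈ U)

/-- A variable other than the head can be made the only minimal one. The head can be minimal if a
premise fails, if a stripped variable lies below it, or if all variables of the conclusion are
equal, in which case those that are not stripped have to be in `U`. -/
theorem HornClause.minIn_iff (c : HornClause k) (w : Fin k → Fin n) (Y U : Set ℕ) (j : Fin k)
    (hj : (w j).val ∉ Y) :
    MinIn c.rel w Y (w j) U ↔ (w j).val ∈ U ∧ c.Consistent w ∧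
      (w j = w c.head → c.Nontriv w ∨ (∃ z ∈ c.tail, w z ≠ w c.head ∧ (w z).val ∈ Y) ∨
        (c.weak = true ∧ ∀ z ∈ c.tail, (w z).val ∉ Y → (w z).val ∈ U)) := by
  constructor
  · rintro ⟨s, hs, hmin⟩
    refine ⟨(hmin j hj).2 le_rfl, ?_, ?_⟩
    · by_contra hcon
      simp only [HornClause.Consistent, HornClause.Nontriv, not_or, not_exists, not_and, not_not]
        at hcon
      obtain ⟨h1, h2, h3⟩ := hcon
      rcases hs fun p hp => by simp only [h1 p hp] with ⟨z, hz, hlt⟩ | ⟨hw, -⟩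
      · simp only [h3 z hz, lt_self_iff_false] at hlt
      · exact h2 hw
    · intro hx
      by_cases hE : c.Nontriv w
      · exact Or.inl hE
      refine Or.inr ?_
      simp only [HornClause.Nontriv, not_exists, not_and, not_not] at hE
      rcases hs fun p hp => by simp only [hE p hp] with ⟨z, hz, hlt⟩ | ⟨hw, hall⟩
      · grind
      · exact Or.inr ⟨hw, fun z hz hY => (hmin z hY).2 (by rw [hx]; exact (hall z hz).le)⟩
  · rintro ⟨hU, hcons, hhead⟩
    have hnt : c.Nontriv w → MinIn c.rel w Y (w j) U := by
      rintro ⟨p, hp, hne⟩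
      refine ⟨fun v => if v = w j then -1 else (v.val : ℚ), ?_, ?_⟩
      · intro h
        have := h p hp
        refine absurd ?_ hne
        dsimp only at this
        split_ifs at this with h1 h2 h2
        · rw [h1, h2]
        · grind
        · grind
        · exact Fin.ext (by exact_mod_cast this)
      · grind
    by_cases hx : w j = w c.head
    · rcases hhead hx with h1 | ⟨z, hz, hne, hzY⟩ | ⟨hw, hall⟩
      · exact hnt h1
      · refine ⟨fun v => if v = w z then -2 else if v = w j then -1 else 0, ?_, ?_⟩
        · intro _
          grind
        · grind
      · classical
        refine ⟨fun v => if v = w j ∨ ∃ z ∈ c.tail, v = w z then 0 else 1, ?_, ?_⟩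
        · intro _
          grind
        · grind
    · rcases hcons with h1 | hw | ⟨z, hz, hne⟩
      · exact hnt h1
      · refine ⟨fun v => if v = w j then -1 else 0, ?_, ?_⟩
        · intro _
          grind
        · grind
      · refine ⟨fun v => if v = w j then -1 else if v = w c.head then 1 else 0, ?_, ?_⟩
        · intro _
          grind
        · grind

end Horn

/-! ### The uniform representation of constraints by groups of weak orders -/

/-- An entry of an option: a variable with its rank. The number `pair` is `i + 1` if the cell stands
for the `i`-th governed variable of the group, and `0` if it stands for none. -/
structure Cell where
  var : ℕ
  pair : ℕ
  rank : ℕ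

/-- A group: governed variables and options; an option is a weak linear order, given by ranks, of
the variables in its cells. A group demands of each governed variable `x` that for some option
the first class of the order contains `x`. -/
structure Group where
  gov : List ℕ
  opts : List (List Cell)

/-- After the substitution `ρ`, every variable has only one rank in the option. -/
def OptValid (ρ : ℕ → ℕ) (o : List Cell) : Prop :=
  ∀ c ∈ o, ∀ c' ∈ o, ρ c.var = ρ c'.var → c.rank = c'.rank

/-- After the substitution `ρ`, the variable `x` has the smallest rank in the option, when the
variables of `Y` are disregarded. -/
def OptMin (ρ : ℕ → ℕ) (Y : Set ℕ) (o : List Cell) (x : ℕ) : Prop :=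
  x ∉ Y ∧ ∃ c ∈ o, ρ c.var = x ∧ ∀ c' ∈ o, ρ c'.var ∉ Y → c.rank ≤ c'.rank

/-- Some option of the group has `x` among its minimal variables, all of which are in `U`. -/
def Group.Good (ρ : ℕ → ℕ) (Y : Set ℕ) (g : Group) (x : ℕ) (U : Set ℕ) : Prop :=
  ∃ o ∈ g.opts, OptValid ρ o ∧ OptMin ρ Y o x ∧ ∀ u, OptMin ρ Y o u → u ∈ U

/-- Admissibility of a set with respect to groups. -/
def GAdm (ρ : ℕ → ℕ) (Y : Set ℕ) (G : List Group) (U : Set ℕ) : Prop :=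
  ∀ x ∈ U, x ∉ Y ∧ ∀ g ∈ G, x ∈ g.gov.map ρ → g.Good ρ Y x U

/-- The group of the auxiliary variable `e` of a clause; `e` can be stripped if some premise of
the clause equates distinct variables. -/
def premiseGroup {k : ℕ} (a : Fin k → ℕ) (e : ℕ) (c : HornClause k) : Group :=
  ⟨[e], c.eqs.map fun p => [⟨e, 1, 0⟩, ⟨a p.1, 0, 1⟩, ⟨a p.2, 0, 2⟩]⟩

/-- The group of the head variable of a clause. -/
def headGroup {k : ℕ} (a : Fin k → ℕ) (e : ℕ) (c : HornClause k) : Group :=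
  ⟨[a c.head], [⟨e, 0, 0⟩, ⟨a c.head, 1, 1⟩] ::
    (c.tail.map (fun z => [⟨a z, 0, 0⟩, ⟨a c.head, 1, 1⟩]) ++
      if c.weak then [⟨a c.head, 1, 0⟩ :: c.tail.map fun z => ⟨a z, 0, 0⟩] else [])⟩

/-- The group by which the auxiliary variable `d` of a conjunction of clauses demands that one of
the clauses is satisfiable. -/
def consistencyGroup {k : ℕ} (a : Fin k → ℕ) (d e : ℕ) (c : HornClause k) : Group :=
  ⟨[d], [⟨e, 0, 0⟩, ⟨d, 1, 1⟩] ::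
    ((if c.weak then [[⟨d, 1, 0⟩]] else []) ++
      c.tail.map fun z => [⟨d, 1, 0⟩, ⟨a z, 0, 1⟩, ⟨a c.head, 0, 2⟩])⟩

/-- The group by which a variable of a conjunction waits for the auxiliary variable `d`. -/
def scopeGroup (d x : ℕ) : Group := ⟨[x], [[⟨d, 0, 0⟩, ⟨x, 1, 1⟩]]⟩

/-- The group of a relation given by weak linear orders. -/
def ordersGroup {k : ℕ} (a : Fin k → ℕ) (ws : List (WeakOrder k)) : Group :=
  ⟨ofFn a, ws.map fun w => ofFn fun i => ⟨a i, i + 1, w i⟩⟩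

/-- The groups of a clause, apart from those by which the variables wait for `d`. -/
def clauseGroups {k : ℕ} (a : Fin k → ℕ) (d e : ℕ) (c : HornClause k) : List Group :=
  [premiseGroup a e c, headGroup a e c, consistencyGroup a d e c]

/-- The variables of a constraint as natural numbers. -/
def RepConstraint.nargs {n : ℕ} (c : RepConstraint n) (i : Fin c.arity) : ℕ := (c.args i).val

/-- The number of auxiliary variables. -/
def RepConstraint.dummies {n : ℕ} (c : RepConstraint n) : ℕ :=
  match c.rep with
  | .orders _ => 0
  | .horn cs => 1 + cs.length

/-- The groups of a constraint; its auxiliary variables are numbered from `b` on. -/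
def RepConstraint.groups {n : ℕ} (b : ℕ) (c : RepConstraint n) : List Group :=
  match c.rep with
  | .orders ws => [ordersGroup c.nargs ws]
  | .horn cs => (ofFn c.nargs).map (scopeGroup b) ++
      (cs.zipIdx (b + 1)).flatMap fun p => clauseGroups c.nargs b p.2 p.1

/-- The constraints together with the first number of an auxiliary variable of each. -/
def blocks {n : ℕ} : ℕ → List (RepConstraint n) → List (ℕ × RepConstraint n)
  | _, [] => []
  | b, c :: I => (b, c) :: blocks (b + c.dummies) I

/-- The groups of an instance; the auxiliary variables are numbered from `b` on. -/
def allGroups {n : ℕ} (b : ℕ) (I : List (RepConstraint n)) : List Group :=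
  (blocks b I).flatMap fun p => p.2.groups p.1

/-- The number of variables, including the auxiliary ones. -/
def numVars {n : ℕ} (b : ℕ) (I : List (RepConstraint n)) : ℕ :=
  b + (I.map RepConstraint.dummies).sum

section blocks

variable {n : ℕ}

theorem le_of_mem_blocks {b : ℕ} {I : List (RepConstraint n)} {p : ℕ × RepConstraint n}
    (h : p ∈ blocks b I) : b ≤ p.1 := by
  induction I generalizing b with
  | nil => simp [blocks] at h
  | cons c I ih =>
    rcases mem_cons.1 h with rfl | h
    · exact le_rfl
    · exact (Nat.le_add_right _ _).trans (ih h)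

theorem blocks_unique {b : ℕ} {I : List (RepConstraint n)} {p q : ℕ × RepConstraint n}
    (hp : p ∈ blocks b I) (hq : q ∈ blocks b I) {v : ℕ} (hpv : p.1 ≤ v)
    (hpv' : v < p.1 + p.2.dummies) (hqv : q.1 ≤ v) (hqv' : v < q.1 + q.2.dummies) : p = q := by
  induction I generalizing b with
  | nil => simp [blocks] at hp
  | cons c I ih =>
    rcases mem_cons.1 hp with rfl | hp <;> rcases mem_cons.1 hq with rfl | hq
    · rfl
    · have := le_of_mem_blocks hq
      dsimp only at *
      omega
    · have := le_of_mem_blocks hp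
      dsimp only at *
      omega
    · exact ih hp hq

theorem exists_block {b : ℕ} {I : List (RepConstraint n)} {v : ℕ} (hb : b ≤ v)
    (hv : v < numVars b I) : ∃ p ∈ blocks b I, p.1 ≤ v ∧ v < p.1 + p.2.dummies := by
  induction I generalizing b with
  | nil => simp [numVars] at hv; omega
  | cons c I ih =>
    by_cases h : v < b + c.dummies
    · exact ⟨_, mem_cons_self, hb, h⟩
    · obtain ⟨p, hp, h1⟩ := ih (not_lt.1 h) (by simpa [numVars, add_assoc] using hv)
      exact ⟨p, mem_cons_of_mem _ hp, h1⟩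

theorem add_dummies_le_numVars {b : ℕ} {I : List (RepConstraint n)} {p : ℕ × RepConstraint n}
    (h : p ∈ blocks b I) : p.1 + p.2.dummies ≤ numVars b I := by
  induction I generalizing b with
  | nil => simp [blocks] at h
  | cons c I ih =>
    rcases mem_cons.1 h with rfl | h
    · simp [numVars]
    · have := ih h
      simp only [numVars, map_cons, List.sum_cons] at this ⊢
      omega

theorem mem_of_mem_blocks {b : ℕ} {I : List (RepConstraint n)} {p : ℕ × RepConstraint n}
    (h : p ∈ blocks b I) : p.2 ∈ I := by
  induction I generalizing b with
  | nil => simp [blocks] at h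
  | cons c I ih =>
    rcases mem_cons.1 h with rfl | h
    · simp
    · exact mem_cons_of_mem _ (ih h)

theorem exists_block_of_mem {b : ℕ} {I : List (RepConstraint n)} {c : RepConstraint n}
    (h : c ∈ I) : ∃ d, (d, c) ∈ blocks b I := by
  induction I generalizing b with
  | nil => simp at h
  | cons c' I ih =>
    rcases mem_cons.1 h with rfl | h
    · exact ⟨b, mem_cons_self⟩
    · obtain ⟨d, hd⟩ := ih (b := b + c'.dummies) h
      exact ⟨d, mem_cons_of_mem _ hd⟩

end blocks

/-! ### Options of the groups of a conjunction of Horn clauses -/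

section Good

variable {k : ℕ} {ρ : ℕ → ℕ} {Y U : Set ℕ} {a : Fin k → ℕ} {d e : ℕ} {c : HornClause k}

theorem good_scopeGroup {x : ℕ} (hd : ρ d = d) (hx : ρ x ≠ d) (hxY : ρ x ∉ Y) :
    (scopeGroup d x).Good ρ Y (ρ x) U ↔ ρ x ∈ U ∧ d ∈ Y := by
  constructor
  · rintro ⟨o, ho, -, hm, hU⟩
    refine ⟨hU _ hm, ?_⟩
    simp only [scopeGroup, mem_singleton] at ho
    subst ho
    obtain ⟨-, c, hc, hcx, hmin⟩ := hm
    by_contra hdY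
    have h1 := hmin ⟨d, 0, 0⟩ (by simp) (by simpa [hd] using hdY)
    grind
  · rintro ⟨h1, h2⟩
    refine ⟨_, mem_singleton.2 rfl, ?_, ⟨hxY, ⟨x, 1, 1⟩, by simp, rfl, ?_⟩, ?_⟩
    · simp [OptValid, hd, hx, Ne.symm hx]
    · simp [hd, h2]
    · rintro u ⟨huY, c, hc, rfl, -⟩
      grind

theorem good_premiseGroup (he : ρ e = e) (hne : ∀ i, ρ (a i) ≠ e) (heY : e ∉ Y) :
    (premiseGroup a e c).Good ρ Y e U ↔ e ∈ U ∧ c.Nontriv (fun i => ρ (a i)) := by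
  constructor
  · rintro ⟨o, ho, hv, hm, hU⟩
    refine ⟨hU _ hm, ?_⟩
    simp only [premiseGroup, mem_map] at ho
    obtain ⟨p, hp, rfl⟩ := ho
    refine ⟨p, hp, fun h => ?_⟩
    have := hv ⟨a p.1, 0, 1⟩ (by simp) ⟨a p.2, 0, 2⟩ (by simp) h
    simp at this
  · rintro ⟨h1, p, hp, hpne⟩
    refine ⟨_, mem_map.2 ⟨p, hp, rfl⟩, ?_, ⟨heY, ⟨e, 1, 0⟩, by simp, he, by simp⟩, ?_⟩
    · simp [OptValid, he, hne, Ne.symm (hne _), hpne, Ne.symm hpne]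
    · rintro u ⟨huY, c, hc, rfl, hmin⟩
      have h0 := hmin ⟨e, 1, 0⟩ (by simp) (by simpa [he] using heY)
      grind

theorem good_consistencyGroup (hd : ρ d = d) (he : ρ e = e) (hed : e ≠ d)
    (hne : ∀ i, ρ (a i) ≠ d) (hdY : d ∉ Y) :
    (consistencyGroup a d e c).Good ρ Y d U ↔
      d ∈ U ∧ (e ∈ Y ∨ c.weak = true ∨ ∃ z ∈ c.tail, ρ (a z) ≠ ρ (a c.head)) := by
  constructor
  · rintro ⟨o, ho, hv, hm, hU⟩
    refine ⟨hU _ hm, ?_⟩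
    simp only [consistencyGroup, mem_cons, mem_append, mem_map] at ho
    rcases ho with rfl | ho | ⟨z, hz, rfl⟩
    · left
      by_contra heY
      obtain ⟨-, c, hc, hcx, hmin⟩ := hm
      have h1 := hmin ⟨e, 0, 0⟩ (by simp) (by simpa [he] using heY)
      grind
    · simp_all
    · right; right
      refine ⟨z, hz, fun h => ?_⟩
      have := hv ⟨a z, 0, 1⟩ (by simp) ⟨a c.head, 0, 2⟩ (by simp) h
      simp at this
  · rintro ⟨h1, heY | hw | ⟨z, hz, hzne⟩⟩
    · refine ⟨_, mem_cons_self, ?_, ⟨hdY, ⟨d, 1, 1⟩, by simp, hd, by simp [he, heY]⟩, ?_⟩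
      · simp [OptValid, he, hd, hed, Ne.symm hed]
      · rintro u ⟨huY, c, hc, rfl, -⟩
        grind
    · refine ⟨[⟨d, 1, 0⟩], by simp [consistencyGroup, hw], by simp [OptValid],
        ⟨hdY, ⟨d, 1, 0⟩, by simp, hd, by simp⟩, ?_⟩
      rintro u ⟨huY, c, hc, rfl, -⟩
      simp_all
    · refine ⟨[⟨d, 1, 0⟩, ⟨a z, 0, 1⟩, ⟨a c.head, 0, 2⟩],
        mem_cons_of_mem _ (List.mem_append_right _ (mem_map.2 ⟨z, hz, rfl⟩)), ?_,
        ⟨hdY, ⟨d, 1, 0⟩, by simp, hd, by simp⟩, ?_⟩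
      · simp [OptValid, hd, hne, Ne.symm (hne _), hzne, Ne.symm hzne]
      · rintro u ⟨huY, c, hc, rfl, hmin⟩
        have h0 := hmin ⟨d, 1, 0⟩ (by simp) (by simpa [hd] using hdY)
        grind

/-- The condition under which the group of the head is satisfied is, with `e ∈ Y` for a nontrivial
premise, the one in `HornClause.minIn_iff`. -/
theorem good_headGroup (he : ρ e = e) (hne : ∀ i, ρ (a i) ≠ e) (hx : ρ (a c.head) ∉ Y) :
    (headGroup a e c).Good ρ Y (ρ (a c.head)) U ↔ ρ (a c.head) ∈ U ∧
      (e ∈ Y ∨ (∃ z ∈ c.tail, ρ (a z) ≠ ρ (a c.head) ∧ ρ (a z) ∈ Y) ∨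
        (c.weak = true ∧ ∀ z ∈ c.tail, ρ (a z) ∉ Y → ρ (a z) ∈ U)) := by
  constructor
  · rintro ⟨o, ho, hv, hm, hU⟩
    refine ⟨hU _ hm, ?_⟩
    simp only [headGroup, mem_cons, mem_append, mem_map] at ho
    rcases ho with rfl | ⟨z, hz, rfl⟩ | ho
    · left
      by_contra heY
      obtain ⟨-, c', hc, hcx, hmin⟩ := hm
      have h1 := hmin ⟨e, 0, 0⟩ (by simp) (by simpa [he] using heY)
      grind
    · right; left
      have hzne : ρ (a z) ≠ ρ (a c.head) := by
        intro h
        have := hv ⟨a z, 0, 0⟩ (by simp) ⟨a c.head, 1, 1⟩ (by simp) h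
        simp at this
      refine ⟨z, hz, hzne, ?_⟩
      by_contra hzY
      obtain ⟨-, c', hc, hcx, hmin⟩ := hm
      have h1 := hmin ⟨a z, 0, 0⟩ (by simp) hzY
      grind
    · right; right
      by_cases hw : c.weak = true
      · refine ⟨hw, fun z hz hzY => hU _ ⟨hzY, ⟨a z, 0, 0⟩, ?_, rfl, by simp⟩⟩
        grind
      · simp [hw] at ho
  · rintro ⟨h1, heY | ⟨z, hz, hzne, hzY⟩ | ⟨hw, hall⟩⟩
    · refine ⟨_, mem_cons_self, ?_,
        ⟨hx, ⟨a c.head, 1, 1⟩, by simp, rfl, by simp [he, heY]⟩, ?_⟩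
      · simp [OptValid, he, hne, Ne.symm (hne _)]
      · rintro u ⟨huY, c', hc, rfl, -⟩
        grind
    · refine ⟨[⟨a z, 0, 0⟩, ⟨a c.head, 1, 1⟩], mem_cons_of_mem _
        (mem_append_left _ (mem_map.2 ⟨z, hz, rfl⟩)), ?_,
        ⟨hx, ⟨a c.head, 1, 1⟩, by simp, rfl, by simp [hzY]⟩, ?_⟩
      · simp [OptValid, hzne, Ne.symm hzne]
      · rintro u ⟨huY, c', hc, rfl, -⟩
        grind
    · refine ⟨⟨a c.head, 1, 0⟩ :: c.tail.map fun z => ⟨a z, 0, 0⟩, by simp [headGroup, hw], ?_,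
        ⟨hx, ⟨a c.head, 1, 0⟩, by simp, rfl, by simp⟩, ?_⟩
      · have hr : ∀ c' ∈ (⟨a c.head, 1, 0⟩ :: c.tail.map fun z => ⟨a z, 0, 0⟩ : List Cell),
            c'.rank = 0 := by simp
        intro c1 h1 c2 h2 _
        rw [hr c1 h1, hr c2 h2]
      · rintro u ⟨huY, c', hc, rfl, -⟩
        grind

end Good

/-! ### Options of the group of a set of weak orders -/

/-- The solutions of a set of weak orders are, up to order isomorphism, the orders themselves. -/
theorem good_ordersGroup {n k : ℕ} {ρ : ℕ → ℕ} {Y U : Set ℕ} {a : Fin k → ℕ} {w : Fin k → Fin n}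
    (ha : ∀ i, ρ (a i) = (w i).val) (ws : List (WeakOrder k)) (j : Fin k) (hj : (w j).val ∉ Y) :
    (ordersGroup a ws).Good ρ Y (w j).val U ↔ MinIn (RelRep.orders ws).rel w Y (w j) U := by
  constructor
  · rintro ⟨o, ho, hv, ⟨-, c, hc, hcx, hmin⟩, hU⟩
    simp only [ordersGroup, mem_map] at ho
    obtain ⟨r, hr, rfl⟩ := ho
    have hval : ∀ i i', w i = w i' → r i = r i' := by
      intro i i' h
      exact Fin.ext (hv ⟨a i, i + 1, r i⟩ ((mem_ofFn' _ _).2 ⟨i, rfl⟩) ⟨a i', i' + 1, r i'⟩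
        ((mem_ofFn' _ _).2 ⟨i', rfl⟩) (by simp only [ha, h]))
    have hs : ∃ s : Fin n → ℚ, ∀ i, s (w i) = (r i).val := by
      classical
      refine ⟨fun v => if h : ∃ i, w i = v then ((r h.choose).val : ℚ) else 0, fun i => ?_⟩
      have h : ∃ i', w i' = w i := ⟨i, rfl⟩
      grind
    obtain ⟨s, hs⟩ := hs
    obtain ⟨j', rfl⟩ := (mem_ofFn' _ _).1 hc
    have hjj' : w j' = w j := Fin.ext (by simpa [ha] using hcx)
    have hmin' : ∀ i, (w i).val ∉ Y → r j ≤ r i := by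
      intro i hi
      have := hmin ⟨a i, i + 1, r i⟩ ((mem_ofFn' _ _).2 ⟨i, rfl⟩) (by simpa [ha] using hi)
      grind
    refine ⟨s, ⟨r, hr, fun i i' => ?_⟩, fun i hi => ⟨?_, fun h => ?_⟩⟩
    · simp only [hs, Nat.cast_le, Fin.val_fin_le]
    · simp_all
    · rw [hs, hs] at h
      have h' : r i ≤ r j := by exact_mod_cast h
      refine hU _ ⟨hi, ⟨a i, i + 1, r i⟩, (mem_ofFn' _ _).2 ⟨i, rfl⟩, ha i, ?_⟩
      grind
  · rintro ⟨s, ⟨r, hr, hord⟩, hmin⟩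
    have hle : ∀ i i', s (w i) ≤ s (w i') ↔ r i ≤ r i' := hord
    refine ⟨_, mem_map.2 ⟨r, hr, rfl⟩, ?_, ⟨hj, ⟨a j, j + 1, r j⟩,
      (mem_ofFn' _ _).2 ⟨j, rfl⟩, ha j, ?_⟩, ?_⟩
    · intro c hc c' hc' heq
      obtain ⟨i, rfl⟩ := (mem_ofFn' _ _).1 hc
      obtain ⟨i', rfl⟩ := (mem_ofFn' _ _).1 hc'
      have : w i = w i' := Fin.ext (by simpa [ha] using heq)
      exact congrArg Fin.val (le_antisymm ((hle i i').1 (by rw [this])) ((hle i' i).1 (by rw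
          [this])))
    · simp_all
    · rintro u ⟨huY, c, hc, rfl, hcmin⟩
      obtain ⟨i, rfl⟩ := (mem_ofFn' _ _).1 hc
      simp_all

/-! ### Groups describe the constraint graph -/

theorem HornClause.nontriv_val {n k : ℕ} {c : HornClause k} {w : Fin k → Fin n} {w' : Fin k → ℕ}
    (h : ∀ i, w' i = (w i).val) : c.Nontriv w' ↔ c.Nontriv w := by
  simp only [HornClause.Nontriv, h, ne_eq, Fin.val_inj]

theorem HornClause.consistent_val {n k : ℕ} {c : HornClause k} {w : Fin k → Fin n}
    {w' : Fin k → ℕ} (h : ∀ i, w' i = (w i).val) : c.Consistent w' ↔ c.Consistent w := by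
  simp only [HornClause.Consistent, HornClause.nontriv_val h, h, ne_eq, Fin.val_inj]

section Interface

variable {n : ℕ}

/-- `ρ` acts on the variables `0, …, n - 1` as `σ` and fixes the auxiliary variables. -/
structure Contracts (n : ℕ) (ρ : ℕ → ℕ) (σ : Fin n → Fin n) : Prop where
  val : ∀ v : Fin n, ρ v.val = (σ v).val
  fix : ∀ v, n ≤ v → ρ v = v

/-- Auxiliary variables are stripped only if the condition that they stand for is satisfied. -/
def Legit (ρ : ℕ → ℕ) (Y : Set ℕ) (I : List (RepConstraint n)) : Prop :=
  ∀ p ∈ blocks n I, ∀ cs, p.2.rep = .horn cs →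
    (∀ q ∈ cs.zipIdx (p.1 + 1), q.2 ∈ Y → q.1.Nontriv fun i => ρ (p.2.nargs i)) ∧
      (p.1 ∈ Y → ∀ q ∈ cs, q.Consistent fun i => ρ (p.2.nargs i))

/-- All auxiliary variables whose condition is satisfied have been stripped. -/
def Complete (ρ : ℕ → ℕ) (Y : Set ℕ) (I : List (RepConstraint n)) : Prop :=
  ∀ p ∈ blocks n I, ∀ cs, p.2.rep = .horn cs →
    (∀ q ∈ cs.zipIdx (p.1 + 1), q.1.Nontriv (fun i => ρ (p.2.nargs i)) → q.2 ∈ Y) ∧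
      ((∀ q ∈ cs, q.Consistent fun i => ρ (p.2.nargs i)) → p.1 ∈ Y)

variable {ρ : ℕ → ℕ} {σ : Fin n → Fin n} {Y U : Set ℕ} {I : List (RepConstraint n)}

theorem Contracts.nargs (h : Contracts n ρ σ) (c : RepConstraint n) (i : Fin c.arity) :
    ρ (c.nargs i) = (σ (c.args i)).val := h.val _

theorem Contracts.nargs_ne (h : Contracts n ρ σ) (c : RepConstraint n) {e : ℕ} (he : n ≤ e)
    (i : Fin c.arity) : ρ (c.nargs i) ≠ e := by
  rw [h.nargs]
  have := (σ (c.args i)).isLt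
  omega

theorem mem_zipIdx_le {α : Type*} {l : List α} {b : ℕ} {q : α × ℕ} (h : q ∈ l.zipIdx b) :
    b ≤ q.2 ∧ q.2 < b + l.length := by grind

theorem mem_zipIdx_unique {α : Type*} {l : List α} {b : ℕ} {q q' : α × ℕ} (h : q ∈ l.zipIdx b)
    (h' : q' ∈ l.zipIdx b) (he : q.2 = q'.2) : q = q' := by grind

theorem mem_groups_horn {b : ℕ} {c : RepConstraint n} {cs : List (HornClause c.arity)}
    (h : c.rep = .horn cs) (g : Group) : g ∈ c.groups b ↔
      (∃ i, scopeGroup b (c.nargs i) = g) ∨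
        ∃ q ∈ cs.zipIdx (b + 1), g = premiseGroup c.nargs q.2 q.1 ∨ g = headGroup c.nargs q.2 q.1 ∨
          g = consistencyGroup c.nargs b q.2 q.1 := by
  unfold RepConstraint.groups
  rw [h]
  simp only [mem_append, mem_map, mem_flatMap, clauseGroups, mem_cons,
    not_mem_nil, or_false, mem_ofFn', Set.mem_range, exists_exists_eq_and]

theorem mem_groups_orders {b : ℕ} {c : RepConstraint n} {ws : List (WeakOrder c.arity)}
    (h : c.rep = .orders ws) (g : Group) : g ∈ c.groups b ↔ g = ordersGroup c.nargs ws := by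
  unfold RepConstraint.groups
  rw [h]
  simp only [mem_singleton]

theorem dummies_horn {c : RepConstraint n} {cs : List (HornClause c.arity)}
    (h : c.rep = .horn cs) : c.dummies = 1 + cs.length := by
  unfold RepConstraint.dummies
  rw [h]

theorem mem_zipIdx_of_mem {α : Type*} {l : List α} (b : ℕ) {x : α} (h : x ∈ l) :
    ∃ e, (x, e) ∈ l.zipIdx b := by
  obtain ⟨i, hi, rfl⟩ := List.getElem_of_mem h
  exact ⟨b + i, List.mk_add_mem_zipIdx_iff_getElem?.2 (by simp [hi])⟩

theorem fst_mem_of_mem_zipIdx {α : Type*} {l : List α} {b : ℕ} {q : α × ℕ} (h : q ∈ l.zipIdx b) :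
    q.1 ∈ l := by grind

/-- The groups of a constraint reflect the solutions of the constraint in which a variable is
minimal. -/
theorem minIn_of_good (hρ : Contracts n ρ σ) (hL : Legit ρ Y I) {b : ℕ} {c : RepConstraint n}
    (hc : (b, c) ∈ blocks n I) {x : Fin n} (hx : x.val ∉ Y)
    (hg : ∀ g ∈ c.groups b, x.val ∈ g.gov.map ρ → g.Good ρ Y x.val U) :
    ∀ a ∈ c.conjuncts, (∃ j, σ (a.args j) = x) →
      MinIn a.rel (fun i => σ (a.args i)) Y x U := by
  have hb := le_of_mem_blocks hc
  cases hrep : c.rep with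
  | orders ws =>
    have hcon : c.conjuncts = [⟨c.arity, c.arity_pos, (RelRep.orders ws).rel, c.args⟩] := by
      unfold RepConstraint.conjuncts
      rw [hrep]
    rw [hcon]
    rintro a ha ⟨j, rfl⟩
    simp only [mem_singleton] at ha
    subst ha
    refine (good_ordersGroup (a := c.nargs) (fun i => hρ.nargs c i) ws j hx).1
      (hg _ ((mem_groups_orders hrep _).2 rfl) ?_)
    rw [← hρ.nargs c j]
    exact mem_map_of_mem ((mem_ofFn' _ _).2 ⟨j, rfl⟩)
  | horn cs =>
    have hcon : c.conjuncts = cs.map fun d => ⟨c.arity, c.arity_pos, d.rel, c.args⟩ := by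
      unfold RepConstraint.conjuncts
      rw [hrep]
    rw [hcon]
    rintro a ha ⟨j, rfl⟩
    obtain ⟨d, hd, rfl⟩ := mem_map.1 ha
    obtain ⟨hL1, hL2⟩ := hL _ hc cs hrep
    obtain ⟨e, he⟩ := mem_zipIdx_of_mem (b + 1) hd
    have hge := (mem_zipIdx_le he).1
    dsimp only at hge j hx hg hb hL1 hL2 ⊢
    refine (d.minIn_iff (fun i => σ (c.args i)) Y U j hx).2 ?_
    have hs := hg _ ((mem_groups_horn hrep _).2 (Or.inl ⟨j, rfl⟩))
      (by simp [scopeGroup, hρ.nargs])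
    rw [← hρ.nargs c j, good_scopeGroup (hρ.fix b hb) (hρ.nargs_ne c hb j)
      (by rw [hρ.nargs]; exact hx), hρ.nargs] at hs
    refine ⟨hs.1, (HornClause.consistent_val (fun i => hρ.nargs c i)).1 (hL2 hs.2 d hd), ?_⟩
    intro hj
    have hh := hg _ ((mem_groups_horn hrep _).2 (Or.inr ⟨_, he, Or.inr (Or.inl rfl)⟩))
      (by simp [headGroup, hρ.nargs, hj])
    rw [hj, ← hρ.nargs c d.head, good_headGroup (hρ.fix e (by omega))
      (hρ.nargs_ne c (by omega)) (by rw [hρ.nargs, ← hj]; exact hx)] at hh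
    simp only [hρ.nargs] at hh
    rcases hh.2 with h1 | ⟨z, hz, hne, hzY⟩ | h1
    · exact Or.inl ((HornClause.nontriv_val (fun i => hρ.nargs c i)).1 (hL1 _ he h1))
    · exact Or.inr (Or.inl ⟨z, hz, fun h => hne (congrArg Fin.val h), hzY⟩)
    · exact Or.inr (Or.inr h1)

/-- Converse of `minIn_of_good` when `Y` is complete. -/
theorem good_of_minIn (hρ : Contracts n ρ σ) (hC : Complete ρ Y I) {b : ℕ} {c : RepConstraint n}
    (hc : (b, c) ∈ blocks n I) {x : Fin n} (hx : x.val ∉ Y) (hxU : x.val ∈ U)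
    (hm : ∀ a ∈ c.conjuncts, (∃ j, σ (a.args j) = x) →
      MinIn a.rel (fun i => σ (a.args i)) Y x U) :
    ∀ g ∈ c.groups b, x.val ∈ g.gov.map ρ → g.Good ρ Y x.val U := by
  have hb := le_of_mem_blocks hc
  cases hrep : c.rep with
  | orders ws =>
    have hcon : c.conjuncts = [⟨c.arity, c.arity_pos, (RelRep.orders ws).rel, c.args⟩] := by
      unfold RepConstraint.conjuncts
      rw [hrep]
    rw [hcon] at hm
    intro g hg hgov
    rw [mem_groups_orders hrep] at hg
    subst hg
    obtain ⟨v, hv, hvx⟩ := mem_map.1 hgov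
    obtain ⟨j, rfl⟩ := (mem_ofFn' _ _).1 hv
    have hjx : σ (c.args j) = x := Fin.ext ((hρ.nargs c j).symm.trans hvx)
    subst hjx
    exact (good_ordersGroup (a := c.nargs) (fun i => hρ.nargs c i) ws j hx).2
      (hm _ (mem_singleton.2 rfl) ⟨j, rfl⟩)
  | horn cs =>
    have hcon : c.conjuncts = cs.map fun d => ⟨c.arity, c.arity_pos, d.rel, c.args⟩ := by
      unfold RepConstraint.conjuncts
      rw [hrep]
    rw [hcon] at hm
    obtain ⟨hC1, hC2⟩ := hC _ hc cs hrep
    intro g hg hgov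
    have hm' : ∀ d ∈ cs, ∀ j, σ (c.args j) = x → MinIn d.rel (fun i => σ (c.args i)) Y x U :=
      fun d hd j hj => hm _ (mem_map_of_mem hd) ⟨j, hj⟩
    rcases (mem_groups_horn hrep _).1 hg with ⟨j, rfl⟩ | ⟨⟨d, e⟩, he, rfl | rfl | rfl⟩
    · have hjx : σ (c.args j) = x := by
        refine Fin.ext ?_
        simpa [scopeGroup, hρ.nargs, eq_comm] using hgov
      subst hjx
      have := (good_scopeGroup (ρ := ρ) (Y := Y) (U := U) (hρ.fix b hb) (hρ.nargs_ne c hb j)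
        (by rw [hρ.nargs]; exact hx)).2
      rw [hρ.nargs] at this
      refine this ⟨hxU, hC2 fun d hd => ?_⟩
      exact (HornClause.consistent_val (fun i => hρ.nargs c i)).2
        ((d.minIn_iff _ Y U j hx).1 (hm' d hd j rfl)).2.1
    · have hge := (mem_zipIdx_le he).1
      have hge' : n ≤ e := hb.trans (by simp only at hge ⊢; omega)
      have : x.val = e := by simpa [premiseGroup, hρ.fix e hge'] using hgov
      have := x.isLt
      omega
    · have hge := (mem_zipIdx_le he).1
      have hge' : n ≤ e := hb.trans (by simp only at hge ⊢; omega)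
      have hjx : σ (c.args d.head) = x := by
        refine Fin.ext ((hρ.nargs c d.head).symm.trans (mem_singleton.1 ?_).symm)
        exact hgov
      subst hjx
      have hh := (good_headGroup (ρ := ρ) (Y := Y) (U := U) (c := d) (hρ.fix e hge')
        (hρ.nargs_ne c hge') (by rw [hρ.nargs]; exact hx)).2
      simp only [hρ.nargs] at hh
      refine hh ⟨hxU, ?_⟩
      rcases ((d.minIn_iff _ Y U d.head hx).1 (hm' d (fst_mem_of_mem_zipIdx he) _ rfl)).2.2 rfl
        with h1 | ⟨z, hz, hne, hzY⟩ | h1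
      · exact Or.inl (hC1 _ he ((HornClause.nontriv_val (fun i => hρ.nargs c i)).2 h1))
      · exact Or.inr (Or.inl ⟨z, hz, fun h => hne (Fin.ext h), hzY⟩)
      · exact Or.inr (Or.inr h1)
    · have hbx : x.val = b := by
        have := hρ.fix b hb
        simpa [consistencyGroup, this] using hgov
      omega

/-- Stripping a variable, even an auxiliary one, that the groups admit as a sink keeps `Y`
legitimate. -/
theorem Legit.insert (hρ : Contracts n ρ σ) (hL : Legit ρ Y I) {x : ℕ}
    (hx : GAdm ρ Y (allGroups n I) {x}) : Legit ρ (insert x Y) I := by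
  obtain ⟨hxY, hxg⟩ := hx x rfl
  rintro ⟨b, c⟩ hc cs hrep
  obtain ⟨hL1, hL2⟩ := hL _ hc cs hrep
  have hb := le_of_mem_blocks hc
  dsimp only at hL1 hL2 hb hrep ⊢
  have hmem : ∀ g ∈ c.groups b, g ∈ allGroups n I := fun g hg =>
    mem_flatMap.2 ⟨_, hc, hg⟩
  refine ⟨?_, ?_⟩
  · rintro ⟨d, e⟩ he heY
    rcases heY with rfl | heY
    · have hge := (mem_zipIdx_le he).1
      have hge' : n ≤ e := hb.trans (by simp only at hge ⊢; omega)
      have := hxg _ (hmem _ ((mem_groups_horn hrep _).2 (Or.inr ⟨_, he, Or.inl rfl⟩)))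
        (by simp [premiseGroup, hρ.fix e hge'])
      exact ((good_premiseGroup (hρ.fix e hge') (hρ.nargs_ne c hge') hxY).1 this).2
    · exact hL1 _ he heY
  · rintro hbY d hd
    rcases hbY with hbx | hbY
    · subst hbx
      obtain ⟨e, he⟩ := mem_zipIdx_of_mem (b + 1) hd
      have hge := (mem_zipIdx_le he).1
      have hge' : n ≤ e := hb.trans (by simp only at hge ⊢; omega)
      have := hxg _ (hmem _ ((mem_groups_horn hrep _).2 (Or.inr ⟨_, he, Or.inr (Or.inr rfl)⟩)))
        (by simp [consistencyGroup, hρ.fix b hb])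
      rcases ((good_consistencyGroup (hρ.fix b hb) (hρ.fix e hge')
        (by simp only at hge; omega) (hρ.nargs_ne c hb) hxY).1 this).2 with h1 | h1 | h1
      · exact Or.inl (hL1 _ he h1)
      · exact Or.inr (Or.inl h1)
      · exact Or.inr (Or.inr h1)
    · exact hL2 hbY d hd

/-- The only groups that govern an auxiliary variable are those made for it. -/
theorem gov_aux (hρ : Contracts n ρ σ) {b : ℕ} {c : RepConstraint n}
    (hc : (b, c) ∈ blocks n I) {v : ℕ} (hv : n ≤ v) (hbv : b ≤ v) (hv' : v < b + c.dummies)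
    {g : Group} (hg : g ∈ allGroups n I) (hgov : v ∈ g.gov.map ρ) :
    ∃ cs, c.rep = .horn cs ∧ ∃ q ∈ cs.zipIdx (b + 1),
      (g = premiseGroup c.nargs q.2 q.1 ∧ v = q.2) ∨
        (g = consistencyGroup c.nargs b q.2 q.1 ∧ v = b) := by
  obtain ⟨⟨b', c'⟩, hc', hg'⟩ := mem_flatMap.1 hg
  have hb' := le_of_mem_blocks hc'
  cases hrep : c'.rep with
  | orders ws =>
    rw [mem_groups_orders hrep] at hg'
    subst hg'
    obtain ⟨u, hu, huv⟩ := mem_map.1 hgov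
    obtain ⟨j, rfl⟩ := (mem_ofFn' _ _).1 hu
    exact absurd huv (hρ.nargs_ne c' hv j)
  | horn cs =>
    rcases (mem_groups_horn hrep _).1 hg' with ⟨j, rfl⟩ | ⟨⟨d, e⟩, he, hge⟩
    · exact absurd (by simpa [scopeGroup, eq_comm] using hgov) (hρ.nargs_ne c' hv j)
    · have hle := mem_zipIdx_le he
      have hd := dummies_horn hrep
      have hee := hρ.fix e (hb'.trans (by simp only at hle ⊢; omega))
      have hbb := hρ.fix b' hb'
      dsimp only at hle hge hd hb'
      rcases hge with rfl | rfl | rfl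
      · have hve : v = e := by simpa [premiseGroup, hee] using hgov
        subst hve
        obtain ⟨rfl, rfl⟩ := Prod.ext_iff.1
          (blocks_unique hc hc' hbv hv' (by simp only; omega) (by simp only; omega))
        grind
      · exact absurd (mem_singleton.1 hgov).symm (hρ.nargs_ne c' hv _)
      · have hve : v = b' := by simpa [consistencyGroup, hbb] using hgov
        subst hve
        obtain ⟨rfl, rfl⟩ := Prod.ext_iff.1
          (blocks_unique hc hc' hbv hv' (by simp only; omega) (by simp only; omega))
        grind

/-- `Y` is complete when no auxiliary variable can be stripped any more. -/
theorem complete_of_exhausted (hρ : Contracts n ρ σ)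
    (hex : ∀ x < numVars n I, n ≤ x → x ∉ Y → ¬ GAdm ρ Y (allGroups n I) {x}) :
    Complete ρ Y I := by
  rintro ⟨b, c⟩ hc cs hrep
  have hb := le_of_mem_blocks hc
  have hd := dummies_horn hrep
  have htot := add_dummies_le_numVars hc
  dsimp only at hb hd htot hrep ⊢
  have h1 : ∀ q ∈ cs.zipIdx (b + 1), q.1.Nontriv (fun i => ρ (c.nargs i)) → q.2 ∈ Y := by
    rintro ⟨d, e⟩ he hnt
    have hle := mem_zipIdx_le he
    dsimp only at hle hnt ⊢
    have hge : n ≤ e := by omega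
    by_contra heY
    refine hex e (by omega) hge heY ?_
    rintro x rfl
    refine ⟨heY, fun g hg hgov => ?_⟩
    obtain ⟨cs', hrep', q, hq, ⟨rfl, hv⟩ | ⟨rfl, hv⟩⟩ :=
      gov_aux hρ hc hge (by omega) (by omega) hg hgov
    · obtain rfl : cs = cs' := by simp_all
      obtain rfl := mem_zipIdx_unique he hq hv
      exact (good_premiseGroup (hρ.fix _ hge) (hρ.nargs_ne c hge) heY).2 ⟨rfl, hnt⟩
    · omega
  refine ⟨h1, fun hcons => ?_⟩
  by_contra hbY
  refine hex b (by omega) hb hbY ?_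
  rintro x rfl
  refine ⟨hbY, fun g hg hgov => ?_⟩
  obtain ⟨cs', hrep', q, hq, ⟨rfl, hv⟩ | ⟨rfl, hv⟩⟩ :=
    gov_aux hρ hc hb le_rfl (by omega) hg hgov
  · grind
  · obtain rfl : cs = cs' := by simp_all
    have hle := mem_zipIdx_le hq
    refine (good_consistencyGroup (hρ.fix x hb) (hρ.fix _ (by omega)) (by omega)
      (hρ.nargs_ne c hb) hbY).2 ⟨rfl, ?_⟩
    rcases hcons _ (fst_mem_of_mem_zipIdx hq) with h2 | h2 | h2
    · exact Or.inl (h1 _ hq h2)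
    · exact Or.inr (Or.inl h2)
    · exact Or.inr (Or.inr h2)

/-- When all possible auxiliary variables have been stripped, no admissible set contains any of
those that are left. -/
theorem GAdm.lt_of_exhausted (hρ : Contracts n ρ σ) (hL : Legit ρ Y I)
    (hC : Complete ρ Y I) (hU : GAdm ρ Y (allGroups n I) U) (hUN : ∀ x ∈ U, x < numVars n I) :
    ∀ x ∈ U, x < n := by
  intro x hx
  by_contra! hxn
  obtain ⟨⟨b, c⟩, hc, hbx, hxb⟩ := exists_block hxn (hUN x hx)
  obtain ⟨hxY, hxg⟩ := hU x hx
  dsimp only at hbx hxb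
  cases hrep : c.rep with
  | orders ws =>
    have : c.dummies = 0 := by
      unfold RepConstraint.dummies
      rw [hrep]
    omega
  | horn cs =>
    have hd := dummies_horn hrep
    obtain ⟨hL1, hL2⟩ := hL _ hc cs hrep
    obtain ⟨hC1, hC2⟩ := hC _ hc cs hrep
    have hb := le_of_mem_blocks hc
    dsimp only at hL1 hL2 hC1 hC2 hb
    have hmem : ∀ g ∈ c.groups b, g ∈ allGroups n I := fun g hg =>
      mem_flatMap.2 ⟨_, hc, hg⟩
    rcases hbx.eq_or_lt with rfl | hlt
    · refine hxY (hC2 fun d hd => ?_)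
      obtain ⟨e, he⟩ := mem_zipIdx_of_mem (b + 1) hd
      have hle := mem_zipIdx_le he
      dsimp only at hle
      have := hxg _ (hmem _ ((mem_groups_horn hrep _).2 (Or.inr ⟨_, he, Or.inr (Or.inr rfl)⟩)))
        (by simp [consistencyGroup, hρ.fix b hb])
      rcases ((good_consistencyGroup (hρ.fix b hb) (hρ.fix e (by omega))
        (by omega) (hρ.nargs_ne c hb) hxY).1 this).2 with h1 | h1 | h1
      · exact Or.inl (hL1 _ he h1)
      · exact Or.inr (Or.inl h1)
      · exact Or.inr (Or.inr h1)
    · have hi : x - (b + 1) < cs.length := by omega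
      have he : (cs[x - (b + 1)], x) ∈ cs.zipIdx (b + 1) := by grind
      have := hxg _ (hmem _ ((mem_groups_horn hrep _).2 (Or.inr ⟨_, he, Or.inl rfl⟩)))
        (by simp [premiseGroup, hρ.fix x hxn])
      exact hxY (hC1 _ he
        ((good_premiseGroup (hρ.fix x hxn) (hρ.nargs_ne c hxn) hxY).1 this).2)

end Interface

/-! ### The configurations of an execution in closed form -/

section Closed

variable {V : Type*} [DecidableEq V]

/-- The projection to all variables but those in the list. -/
def Constraint.projectList (φ : Constraint V) (ys : List V) : Constraint V :=
  ys.foldl Constraint.project φ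

/-- The projection that strips the variables of a list. -/
def Instance.projectList (Φ : Instance V) (ys : List V) : Instance V :=
  ys.foldl Instance.project Φ

theorem Constraint.scope_projectList (φ : Constraint V) (ys : List V) (x : V) :
    x ∈ (φ.projectList ys).scope ↔ x ∈ φ.scope ∧ x ∉ ys := by
  induction ys generalizing φ with
  | nil => simp [projectList]
  | cons y ys ih =>
    have h := ih (φ.project y)
    simp only [projectList, foldl_cons] at h ⊢
    rw [h]
    simp only [project, Finset.mem_erase, mem_cons, not_or]
    tauto

theorem Constraint.sols_projectList (φ : Constraint V) (ys : List V) (s : V → ℚ) :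
    s ∈ (φ.projectList ys).sols ↔ ∃ s' ∈ φ.sols, ∀ x, x ∉ ys → s' x = s x := by
  induction ys generalizing φ with
  | nil =>
    constructor
    · intro h
      exact ⟨s, h, fun _ _ => rfl⟩
    · rintro ⟨s', h, h'⟩
      exact φ.sols_congr _ _ (fun x _ => h' x (by simp)) h
  | cons y ys ih =>
    have h := ih (φ.project y)
    simp only [projectList, foldl_cons] at h ⊢
    rw [h]
    constructor
    · rintro ⟨s', ⟨a, ha⟩, h'⟩
      grind
    · rintro ⟨s', hs', h'⟩
      refine ⟨update s' y (s y), ⟨s' y, by simpa using hs'⟩, fun x hx => ?_⟩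
      grind

theorem Instance.constraints_projectList (Φ : Instance V) (ys : List V) :
    (Φ.projectList ys).constraints = Φ.constraints.map fun φ => φ.projectList ys := by
  induction ys generalizing Φ with
  | nil => simp [projectList, Constraint.projectList]
  | cons y ys ih =>
    have h := ih (Φ.project y)
    simp only [projectList, foldl_cons] at h ⊢
    rw [h]
    simp [project, Constraint.projectList, Function.comp_def]

theorem Instance.vars_projectList (Φ : Instance V) (ys : List V) (x : V) :
    x ∈ (Φ.projectList ys).vars ↔ x ∈ Φ.vars ∧ x ∉ ys := by
  induction ys generalizing Φ with
  | nil => simp [projectList]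
  | cons y ys ih =>
    have h := ih (Φ.project y)
    simp only [projectList, foldl_cons] at h ⊢
    rw [h]
    simp only [project, Finset.mem_erase, mem_cons, not_or]
    tauto

theorem Instance.projectList_concat (Φ : Instance V) (ys : List V) (y : V) :
    (Φ.projectList ys).project y = Φ.projectList (ys ++ [y]) := by
  simp [projectList]

theorem Instance.Nice.projectList {Φ : Instance V} (h : Φ.Nice) (ys : List V) :
    (Φ.projectList ys).Nice := by
  induction ys generalizing Φ with
  | nil => exact h
  | cons y ys ih => exact ih (h.project y)

theorem Constraint.ext' {φ ψ : Constraint V} (h : φ.scope = ψ.scope) (h' : φ.sols = ψ.sols) :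
    φ = ψ := by
  cases φ; cases ψ
  simp only at h h'
  subst h h'
  rfl

theorem Instance.ext' {Φ Ψ : Instance V} (h : Φ.vars = Ψ.vars)
    (h' : Φ.constraints = Ψ.constraints) : Φ = Ψ := by
  cases Φ; cases Ψ
  simp only at h h'
  subst h h'
  rfl

theorem Instance.rename_rename (Φ : Instance V) (g h : V → V) :
    (Φ.rename g).rename h = Φ.rename fun x => h (g x) := by
  refine Instance.ext' ?_ ?_
  · simp only [rename, Finset.image_image]
    rfl
  · simp only [rename, List.map_map]
    refine map_congr_left fun φ _ => Constraint.ext' ?_ rfl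
    simp only [Function.comp, Constraint.rename, Finset.image_image]
    rfl

theorem Instance.rename_id (Φ : Instance V) : Φ.rename id = Φ := by
  refine Instance.ext' (by simp [rename]) ?_
  simp only [rename]
  refine (map_congr_left fun φ _ => ?_).trans (List.map_id _)
  exact Constraint.ext' (by simp [Constraint.rename]) rfl

end Closed

section Config

variable {n : ℕ} {σ : Fin n → Fin n} {Y U : Set ℕ} {ys : List (Fin n)}

/-- The instance obtained from `A` by the substitution `σ` and stripping the variables `ys`. -/
def stage (A : List (Atom (Fin n))) (σ : Fin n → Fin n) (ys : List (Fin n)) :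
    Instance (Fin n) :=
  ((Instance.ofAtoms A).rename σ).projectList ys

theorem stage_nice {A : List (Atom (Fin n))} (hA : ∀ a ∈ A, (Constraint.ofAtom a).Nice) :
    (stage A σ ys).Nice := by
  refine Instance.Nice.projectList (Instance.Nice.rename ?_ σ) ys
  intro φ hφ
  obtain ⟨a, ha, rfl⟩ := mem_map.1 hφ
  exact hA a ha

theorem mem_stage_vars {A : List (Atom (Fin n))} (x : Fin n) :
    x ∈ (stage A σ ys).vars ↔ (∃ v, σ v = x) ∧ x ∉ ys := by
  rw [stage, Instance.vars_projectList]
  simp [Instance.rename, Instance.ofAtoms]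

theorem mem_stage_constraints {A : List (Atom (Fin n))} (φ : Constraint (Fin n)) :
    φ ∈ (stage A σ ys).constraints ↔
      ∃ a ∈ A, φ = ((Constraint.ofAtom a).rename σ).projectList ys := by
  rw [stage, Instance.constraints_projectList]
  simp [Instance.rename, Instance.ofAtoms, eq_comm]

theorem minIn_iff_minAt (hY : ∀ v : Fin n, v.val ∈ Y ↔ v ∈ ys) (a : Atom (Fin n)) {x : Fin n}
    (hx : ∃ j, σ (a.args j) = x) (hxY : x ∉ ys) :
    MinIn a.rel (fun i => σ (a.args i)) Y x U ↔
      ∃ s ∈ (((Constraint.ofAtom a).rename σ).projectList ys).sols,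
        (((Constraint.ofAtom a).rename σ).projectList ys).MinAt s x ∧
          ∀ y, (((Constraint.ofAtom a).rename σ).projectList ys).MinAt s y → y.val ∈ U := by
  have hscope : ∀ y, y ∈ (((Constraint.ofAtom a).rename σ).projectList ys).scope ↔
      (∃ j, σ (a.args j) = y) ∧ y ∉ ys := by
    intro y
    rw [Constraint.scope_projectList]
    simp [Constraint.rename, Constraint.ofAtom]
  constructor
  · rintro ⟨s, hs, hmin⟩
    refine ⟨s, (Constraint.sols_projectList _ _ _).2 ⟨s, hs, fun _ _ => rfl⟩,
      ⟨(hscope x).2 ⟨hx, hxY⟩, ?_⟩, ?_⟩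
    · simp_all
    · rintro y ⟨hy, hy'⟩
      grind
  · rintro ⟨s, hs, hmin, hU⟩
    obtain ⟨s', hs', heq⟩ := (Constraint.sols_projectList _ _ _).1 hs
    refine ⟨s', hs', fun i hi => ?_⟩
    have hi' : σ (a.args i) ∉ ys := by rwa [← hY]
    have hmem := (hscope (σ (a.args i))).2 ⟨⟨i, rfl⟩, hi'⟩
    rw [heq _ hxY, heq _ hi']
    refine ⟨hmin.2 _ hmem, fun hle => hU _ ⟨hmem, fun z hz => hle.trans (hmin.2 z hz)⟩⟩

/-- Admissibility in a stage of an execution, expressed by the atoms of the instance. -/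
theorem adm_stage_iff {A : List (Atom (Fin n))} (hY : ∀ v : Fin n, v.val ∈ Y ↔ v ∈ ys) :
    (stage A σ ys).Adm {v | v.val ∈ U} ↔ ∀ x : Fin n, x.val ∈ U → x ∉ ys → ∀ a ∈ A,
      (∃ j, σ (a.args j) = x) → MinIn a.rel (fun i => σ (a.args i)) Y x U := by
  constructor
  · intro h x hx hxY a ha hj
    refine (minIn_iff_minAt hY a hj hxY).2 (h x hx _ ((mem_stage_constraints _).2 ⟨a, ha, rfl⟩) ?_)
    rw [Constraint.scope_projectList]
    simpa [Constraint.rename, Constraint.ofAtom] using ⟨hj, hxY⟩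
  · rintro h x hx φ hφ hxφ
    obtain ⟨a, ha, rfl⟩ := (mem_stage_constraints _).1 hφ
    rw [Constraint.scope_projectList] at hxφ
    have hj : ∃ j, σ (a.args j) = x := by
      simpa [Constraint.rename, Constraint.ofAtom] using hxφ.1
    exact (minIn_iff_minAt hY a hj hxφ.2).1 (h x hx hxφ.2 a ha hj)

end Config

/-! ### From groups to steps of the algorithm -/

section Steps

variable {n : ℕ} {ρ : ℕ → ℕ} {σ : Fin n → Fin n} {Y U : Set ℕ} {ys : List (Fin n)}
  {I : List (RepConstraint n)}

/-- The constraints of the instance. -/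
abbrev conj (I : List (RepConstraint n)) : List (Atom (Fin n)) := I.flatMap RepConstraint.conjuncts

theorem adm_of_gAdm (hρ : Contracts n ρ σ) (hL : Legit ρ Y I)
    (hY : ∀ v : Fin n, v.val ∈ Y ↔ v ∈ ys) (hU : GAdm ρ Y (allGroups n I) U) :
    (stage (conj I) σ ys).Adm {v | v.val ∈ U} := by
  refine (adm_stage_iff hY).2 fun x hx hxY a ha hj => ?_
  obtain ⟨c, hc, hac⟩ := mem_flatMap.1 ha
  obtain ⟨b, hb⟩ := exists_block_of_mem (b := n) hc
  obtain ⟨hxY, hxg⟩ := hU _ hx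
  exact minIn_of_good hρ hL hb hxY
    (fun g hg hgov => hxg g (mem_flatMap.2 ⟨_, hb, hg⟩) hgov) a hac hj

theorem gAdm_of_adm (hρ : Contracts n ρ σ) (hC : Complete ρ Y I)
    (hY : ∀ v : Fin n, v.val ∈ Y ↔ v ∈ ys) (hUn : ∀ x ∈ U, x < n) (hUY : ∀ x ∈ U, x ∉ Y)
    (hU : (stage (conj I) σ ys).Adm {v | v.val ∈ U}) : GAdm ρ Y (allGroups n I) U := by
  intro x hx
  refine ⟨hUY x hx, fun g hg hgov => ?_⟩
  obtain ⟨⟨b, c⟩, hb, hgc⟩ := mem_flatMap.1 hg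
  have hc := mem_of_mem_blocks hb
  refine good_of_minIn (x := ⟨x, hUn x hx⟩) hρ hC hb (hUY x hx) hx (fun a ha hj => ?_) g hgc hgov
  exact (adm_stage_iff hY).1 hU ⟨x, hUn x hx⟩ hx (by rw [← hY]; exact hUY x hx) a
    (mem_flatMap.2 ⟨c, hc, ha⟩) hj

/-- The sets of minimal variables of the options are closed under intersection. -/
theorem Good.inter (hI : ∀ c ∈ I, LLClosed c.rep.rel) (hρ : Contracts n ρ σ)
    (hY : ∀ v : Fin n, v.val ∈ Y ↔ v ∈ ys) {g : Group} (hg : g ∈ allGroups n I) {x : ℕ}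
    (hxY : x ∉ Y) (hgov : x ∈ g.gov.map ρ) {U U' : Set ℕ} (h : g.Good ρ Y x U)
    (h' : g.Good ρ Y x U') : g.Good ρ Y x (U ∩ U') := by
  obtain ⟨⟨b, c⟩, hb, hgc⟩ := mem_flatMap.1 hg
  have hc := mem_of_mem_blocks hb
  have hnb := le_of_mem_blocks hb
  dsimp only at hnb hc
  cases hrep : c.rep with
  | orders ws =>
    rw [mem_groups_orders hrep] at hgc
    subst hgc
    obtain ⟨v, hv, hvx⟩ := mem_map.1 hgov
    obtain ⟨j, rfl⟩ := (mem_ofFn' _ _).1 hv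
    have hjx : (σ (c.args j)).val = x := (hρ.nargs c j).symm.trans hvx
    subst hjx
    have hcon : c.conjuncts = [⟨c.arity, c.arity_pos, (RelRep.orders ws).rel, c.args⟩] := by
      unfold RepConstraint.conjuncts
      rw [hrep]
    have hn := RepConstraint.nice_conjuncts (hI c hc) _ (hcon ▸ mem_singleton.2 rfl)
    have hjy : σ (c.args j) ∉ ys := by rwa [← hY]
    have hgo : ∀ U, (ordersGroup c.nargs ws).Good ρ Y (σ (c.args j)).val U ↔ _ := fun U =>
      (good_ordersGroup (U := U) (a := c.nargs) (fun i => hρ.nargs c i) ws j hxY).trans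
        (minIn_iff_minAt hY ⟨c.arity, c.arity_pos, (RelRep.orders ws).rel, c.args⟩ ⟨j, rfl⟩ hjy)
    rw [hgo] at h h' ⊢
    obtain ⟨s, hs, hsx, hsU⟩ := h
    obtain ⟨t, ht, htx, htU⟩ := h'
    have hn' : ∀ (ys : List (Fin n)) (φ : Constraint (Fin n)),
        φ.Nice → (φ.projectList ys).Nice := by
      intro ys
      induction ys with
      | nil => exact fun φ h => h
      | cons y ys ih => exact fun φ h => ih _ (h.project y)
    obtain ⟨u, hu, hux, huU⟩ := (hn' ys _ (hn.rename σ)).exists_minAt_inter hs ht hsx htx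
    exact ⟨u, hu, hux, fun y hy => ⟨hsU y (huU y hy).1, htU y (huU y hy).2⟩⟩
  | horn cs =>
    rcases (mem_groups_horn hrep _).1 hgc with ⟨j, rfl⟩ | ⟨⟨d, e⟩, he, hge⟩
    · have hjx : x = ρ (c.nargs j) := mem_singleton.1 hgov
      subst hjx
      rw [good_scopeGroup (hρ.fix b hnb) (hρ.nargs_ne c hnb j) hxY] at h h' ⊢
      exact ⟨⟨h.1, h'.1⟩, h.2⟩
    · have hle := mem_zipIdx_le he
      dsimp only at hle hge
      have hne : n ≤ e := by omega
      rcases hge with rfl | rfl | rfl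
      · have hex : x = ρ e := mem_singleton.1 hgov
        rw [hρ.fix e hne] at hex
        subst hex
        rw [good_premiseGroup (hρ.fix x hne) (hρ.nargs_ne c hne) hxY] at h h' ⊢
        exact ⟨⟨h.1, h'.1⟩, h.2⟩
      · have hex : x = ρ (c.nargs d.head) := mem_singleton.1 hgov
        subst hex
        rw [good_headGroup (hρ.fix e hne) (hρ.nargs_ne c hne) hxY] at h h' ⊢
        grind
      · have hex : x = ρ b := mem_singleton.1 hgov
        rw [hρ.fix b hnb] at hex
        subst hex
        rw [good_consistencyGroup (hρ.fix x hnb) (hρ.fix e hne) (by omega) (hρ.nargs_ne c hnb) hxY]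
          at h h' ⊢
        exact ⟨⟨h.1, h'.1⟩, h.2⟩

theorem nice_conj (hI : ∀ c ∈ I, LLClosed c.rep.rel) :
    ∀ a ∈ conj I, (Constraint.ofAtom a).Nice := by
  intro a ha
  obtain ⟨c, hc, hac⟩ := mem_flatMap.1 ha
  exact RepConstraint.nice_conjuncts (hI c hc) a hac

/-- A variable that may be stripped according to the groups is a sink. -/
theorem isSink_of_gAdm (hI : ∀ c ∈ I, LLClosed c.rep.rel) (hρ : Contracts n ρ σ)
    (hL : Legit ρ Y I) (hY : ∀ v : Fin n, v.val ∈ Y ↔ v ∈ ys) {x : Fin n} (hx : σ x = x)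
    (h : GAdm ρ Y (allGroups n I) {x.val}) : (stage (conj I) σ ys).IsSink x := by
  refine ((stage_nice (nice_conj hI)).isSink_iff x).2 ⟨?_, ?_⟩
  · exact (mem_stage_vars x).2 ⟨⟨x, hx⟩, by rw [← hY]; exact (h x.val rfl).1⟩
  · have := adm_of_gAdm hρ hL hY h
    convert this using 1
    ext v
    simp [Fin.ext_iff]

/-- If nothing can be stripped according to the groups, then there is no sink. -/
theorem no_sink_of_exhausted (hI : ∀ c ∈ I, LLClosed c.rep.rel) (hρ : Contracts n ρ σ)
    (hσ : ∀ v, σ (σ v) = σ v)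
    (hY : ∀ v : Fin n, v.val ∈ Y ↔ v ∈ ys)
    (hex : ∀ x < numVars n I, ρ x = x → x ∉ Y → ¬ GAdm ρ Y (allGroups n I) {x}) (x : Fin n) :
    ¬ (stage (conj I) σ ys).IsSink x := by
  intro hx
  obtain ⟨hxv, hxa⟩ := ((stage_nice (nice_conj hI)).isSink_iff x).1 hx
  obtain ⟨⟨v, rfl⟩, hxY⟩ := (mem_stage_vars x).1 hxv
  have hC := complete_of_exhausted hρ (Y := Y) (I := I)
    fun x hx hnx hxY => hex x hx (hρ.fix x hnx) hxY
  have hxY' : (σ v).val ∉ Y := by rwa [hY]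
  refine hex (σ v).val ?_ (by rw [hρ.val, hσ]) hxY' ?_
  · exact (σ v).isLt.trans_le (Nat.le_add_right _ _)
  · refine gAdm_of_adm hρ hC hY (by simp) (by simpa using hxY') ?_
    convert hxa using 1
    ext v
    simp [Fin.ext_iff]

/-- If nothing can be stripped, then the sink components are the minimal nonempty sets that are
admissible according to the groups. -/
theorem isSinkComponent_of_minimal (hI : ∀ c ∈ I, LLClosed c.rep.rel) (hρ : Contracts n ρ σ)
    (hL : Legit ρ Y I) (hY : ∀ v : Fin n, v.val ∈ Y ↔ v ∈ ys)
    (hex : ∀ x < numVars n I, ρ x = x → x ∉ Y → ¬ GAdm ρ Y (allGroups n I) {x})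
    {K : Set (Fin n)} (hne : K.Nonempty) (hfix : ∀ x ∈ K, σ x = x)
    (hK : GAdm ρ Y (allGroups n I) (Fin.val '' K))
    (hmin : ∀ U : Set ℕ, U ⊆ Fin.val '' K → U.Nonempty → GAdm ρ Y (allGroups n I) U →
      Fin.val '' K ⊆ U) : (stage (conj I) σ ys).IsSinkComponent K := by
  have hC := complete_of_exhausted hρ (Y := Y) (I := I)
    fun x hx hnx hxY => hex x hx (hρ.fix x hnx) hxY
  have hpre : ∀ K : Set (Fin n), {v : Fin n | v.val ∈ Fin.val '' K} = K := by
    intro K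
    ext v
    simp [← Fin.ext_iff]
  refine ((stage_nice (nice_conj hI)).isSinkComponent_iff K).2 ⟨hne, ?_, ?_, ?_⟩
  · intro x hx
    exact (mem_stage_vars x).2 ⟨⟨x, hfix x hx⟩, by rw [← hY]; exact (hK x.val ⟨x, hx, rfl⟩).1⟩
  · have := adm_of_gAdm hρ hL hY hK
    rwa [hpre] at this
  · intro U hUK hUne hU x hx
    have hU' : GAdm ρ Y (allGroups n I) (Fin.val '' U) := by
      refine gAdm_of_adm hρ hC hY ?_ ?_ (by rwa [hpre])
      · simp
      · rintro _ ⟨v, hv, rfl⟩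
        exact (hK v.val ⟨v, hUK hv, rfl⟩).1
    obtain ⟨y, hy, hyx⟩ := hmin _ (Set.image_mono hUK) (hUne.image _) hU' ⟨x, hx, rfl⟩
    exact Fin.ext hyx ▸ hy

/-- If nothing can be stripped and there is no nonempty set that is admissible according to the
groups, then there is no sink component. -/
theorem no_sinkComponent (hI : ∀ c ∈ I, LLClosed c.rep.rel) (hρ : Contracts n ρ σ)
    (hσ : ∀ v, σ (σ v) = σ v)
    (hY : ∀ v : Fin n, v.val ∈ Y ↔ v ∈ ys)
    (hex : ∀ x < numVars n I, ρ x = x → x ∉ Y → ¬ GAdm ρ Y (allGroups n I) {x})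
    (hno : ∀ U : Set ℕ, U.Nonempty → (∀ x ∈ U, x < n ∧ ρ x = x) → ¬ GAdm ρ Y (allGroups n I) U)
    (K : Set (Fin n)) : ¬ (stage (conj I) σ ys).IsSinkComponent K := by
  intro hK
  have hC := complete_of_exhausted hρ (Y := Y) (I := I)
    fun x hx hnx hxY => hex x hx (hρ.fix x hnx) hxY
  obtain ⟨hne, hv, hadm, -⟩ := ((stage_nice (nice_conj hI)).isSinkComponent_iff K).1 hK
  refine hno (Fin.val '' K) (hne.image _) ?_ (gAdm_of_adm hρ hC hY ?_ ?_ ?_)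
  · rintro _ ⟨v, hvK, rfl⟩
    obtain ⟨⟨w, rfl⟩, -⟩ := (mem_stage_vars v).1 (hv hvK)
    exact ⟨(σ w).isLt, by rw [hρ.val, hσ]⟩
  · simp
  · rintro _ ⟨v, hvK, rfl⟩
    rw [hY]
    exact ((mem_stage_vars v).1 (hv hvK)).2
  · convert hadm using 1
    ext v
    simp [← Fin.ext_iff]

end Steps

/-! ### A program logic for random access machines -/

/-- The state after an assignment to a register. -/
def State.setReg (σ : State) (r v : ℕ) : State := { σ with regs := update σ.regs r v }

/-- The state after an assignment to an entry of an array. -/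
def State.setArr (σ : State) (a i v : ℕ) : State :=
  { σ with arrays := update σ.arrays a (update (σ.arrays a) i v) }

/-- The state after an output. -/
def State.addOut (σ : State) (v : ℕ) : State := { σ with out := σ.out ++ [v] }

section StateLemmas

variable (σ : State) (r r' a a' i v : ℕ)

@[simp] theorem State.regs_setReg :
    (σ.setReg r v).regs r' = if r' = r then v else σ.regs r' := by
  simp [State.setReg, update_apply]

@[simp] theorem State.arrays_setReg : (σ.setReg r v).arrays = σ.arrays := rfl

@[simp] theorem State.out_setReg : (σ.setReg r v).out = σ.out := rfl

@[simp] theorem State.regs_setArr : (σ.setArr a i v).regs = σ.regs := rfl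

@[simp] theorem State.arrays_setArr :
    (σ.setArr a i v).arrays a' = if a' = a then update (σ.arrays a) i v else σ.arrays a' := by
  simp only [State.setArr, update_apply]

@[simp] theorem State.out_setArr : (σ.setArr a i v).out = σ.out := rfl

@[simp] theorem State.regs_addOut : (σ.addOut v).regs = σ.regs := rfl

@[simp] theorem State.arrays_addOut : (σ.addOut v).arrays = σ.arrays := rfl

@[simp] theorem State.out_addOut : (σ.addOut v).out = σ.out ++ [v] := rfl

end StateLemmas

open State (arrays_setReg regs_setReg arrays_setArr regs_setArr regs_addOut)

/-- Total correctness: `c` halts when started in `σ`, and the number of steps and the final state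
satisfy `Q`. -/
def WP (c : Cmd) (σ : State) (Q : ℕ → State → Prop) : Prop := ∃ t τ, Exec c σ t τ ∧ Q t τ

infixr:30 " ;; " => Cmd.seq

section Rules

variable {σ : State} {Q Q' : ℕ → State → Prop} {c p q : Cmd} {e i : Exp} {r a : ℕ}

theorem WP.mono (h : WP c σ Q) (hQ : ∀ t τ, Q t τ → Q' t τ) : WP c σ Q' := by
  obtain ⟨t, τ, h1, h2⟩ := h
  exact ⟨t, τ, h1, hQ _ _ h2⟩

theorem wp_skip : WP .skip σ Q ↔ Q 1 σ := by
  constructor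
  · rintro ⟨t, τ, h, hQ⟩
    cases h
    exact hQ
  · intro h
    exact ⟨_, _, .skip σ, h⟩

theorem wp_set : WP (.set r e) σ Q ↔ Q 1 (σ.setReg r (e.eval σ)) := by
  constructor
  · rintro ⟨t, τ, h, hQ⟩
    cases h
    exact hQ
  · intro h
    exact ⟨_, _, .set r e σ, h⟩

theorem wp_put : WP (.put a i e) σ Q ↔ Q 1 (σ.setArr a (i.eval σ) (e.eval σ)) := by
  constructor
  · rintro ⟨t, τ, h, hQ⟩
    cases h
    exact hQ
  · intro h
    exact ⟨_, _, .put a i e σ, h⟩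

theorem wp_emit : WP (.emit e) σ Q ↔ Q 1 (σ.addOut (e.eval σ)) := by
  constructor
  · rintro ⟨t, τ, h, hQ⟩
    cases h
    exact hQ
  · intro h
    exact ⟨_, _, .emit e σ, h⟩

theorem wp_seq : WP (p ;; q) σ Q ↔ WP p σ fun t τ => WP q τ fun u υ => Q (t + u) υ := by
  constructor
  · rintro ⟨t, τ, h, hQ⟩
    cases h with
    | seq h1 h2 => exact ⟨_, _, h1, _, _, h2, hQ⟩
  · rintro ⟨t, τ, h1, u, υ, h2, hQ⟩
    exact ⟨_, _, .seq h1 h2, hQ⟩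

theorem wp_cond : WP (.cond e p q) σ Q ↔
    (e.eval σ ≠ 0 → WP p σ fun t τ => Q (t + 1) τ) ∧
      (e.eval σ = 0 → WP q σ fun t τ => Q (t + 1) τ) := by
  constructor
  · rintro ⟨t, τ, h, hQ⟩
    cases h with
    | cond_true h1 h2 => exact ⟨fun _ => ⟨_, _, h2, hQ⟩, fun h => absurd h h1⟩
    | cond_false h1 h2 => exact ⟨fun h => absurd h1 h, fun _ => ⟨_, _, h2, hQ⟩⟩
  · rintro ⟨h1, h2⟩
    by_cases h : e.eval σ = 0
    · obtain ⟨t, τ, h3, hQ⟩ := h2 h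
      exact ⟨_, _, .cond_false h h3, hQ⟩
    · obtain ⟨t, τ, h3, hQ⟩ := h1 h
      exact ⟨_, _, .cond_true h h3, hQ⟩

/-! #### What a program leaves unchanged -/

/-- Whether the program assigns to the register. -/
def Cmd.wrR : Cmd → ℕ → Bool
  | .skip, _ => false
  | .set r _, s => s == r
  | .put _ _ _, _ => false
  | .emit _, _ => false
  | .seq p q, s => p.wrR s || q.wrR s
  | .cond _ p q, s => p.wrR s || q.wrR s
  | .loop _ p, s => p.wrR s

/-- Whether the program writes to the array. -/
def Cmd.wrA : Cmd → ℕ → Bool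
  | .skip, _ => false
  | .set _ _, _ => false
  | .put a _ _, b => b == a
  | .emit _, _ => false
  | .seq p q, s => p.wrA s || q.wrA s
  | .cond _ p q, s => p.wrA s || q.wrA s
  | .loop _ p, s => p.wrA s

/-- Whether the program writes to the output. -/
def Cmd.emits : Cmd → Bool
  | .skip => false
  | .set _ _ => false
  | .put _ _ _ => false
  | .emit _ => true
  | .seq p q => p.emits || q.emits
  | .cond _ p q => p.emits || q.emits
  | .loop _ p => p.emits

/-- The states agree on everything that `c` does not write to. -/
structure Frame (c : Cmd) (σ τ : State) : Prop where
  reg : ∀ r, c.wrR r = false → τ.regs r = σ.regs r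
  arr : ∀ a, c.wrA a = false → τ.arrays a = σ.arrays a
  out : c.emits = false → τ.out = σ.out

theorem Frame.refl (c : Cmd) (σ : State) : Frame c σ σ := ⟨fun _ _ => rfl, fun _ _ => rfl,
    fun _ => rfl⟩

theorem Frame.trans {σ τ υ : State} (h : Frame c σ τ) (h' : Frame c τ υ) : Frame c σ υ :=
  ⟨fun r hr => (h'.reg r hr).trans (h.reg r hr), fun a ha => (h'.arr a ha).trans (h.arr a ha),
    fun ho => (h'.out ho).trans (h.out ho)⟩

theorem Frame.weaken {c c' : Cmd} {σ τ : State} (h : Frame c σ τ)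
    (hr : ∀ r, c'.wrR r = false → c.wrR r = false) (ha : ∀ a, c'.wrA a = false → c.wrA a = false)
    (ho : c'.emits = false → c.emits = false) : Frame c' σ τ :=
  ⟨fun r h' => h.reg r (hr r h'), fun a h' => h.arr a (ha a h'), fun h' => h.out (ho h')⟩

theorem Frame.of_exec {σ τ : State} {t : ℕ} (h : Exec c σ t τ) : Frame c σ τ := by
  induction h with
  | skip => exact Frame.refl _ _
  | set r e σ =>
    refine ⟨fun s hs => ?_, fun _ _ => rfl, fun _ => rfl⟩
    have : s ≠ r := by simpa [Cmd.wrR] using hs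
    simp [update_of_ne this]
  | put a i e σ =>
    refine ⟨fun _ _ => rfl, fun s hs => ?_, fun _ => rfl⟩
    have : s ≠ a := by simpa [Cmd.wrA] using hs
    simp [update_of_ne this]
  | emit e σ => exact ⟨fun _ _ => rfl, fun _ _ => rfl, fun h => by simp [Cmd.emits] at h⟩
  | seq _ _ ih1 ih2 =>
    refine (ih1.weaken ?_ ?_ ?_).trans (ih2.weaken ?_ ?_ ?_) <;>
      simp +contextual [Cmd.wrR, Cmd.wrA, Cmd.emits]
  | cond_true _ _ ih => refine ih.weaken ?_ ?_ ?_ <;> simp +contextual [Cmd.wrR, Cmd.wrA, Cmd.emits]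
  | cond_false _ _ ih => refine ih.weaken ?_ ?_ ?_ <;> simp +contextual [Cmd.wrR, Cmd.wrA,
      Cmd.emits]
  | loop_done _ => exact Frame.refl _ _
  | loop_step _ _ _ ih1 ih2 =>
    exact Frame.trans (c := .loop _ _)
      (ih1.weaken (fun _ h => h) (fun _ h => h) fun h => h) ih2

theorem WP.frame (h : WP c σ Q) : WP c σ fun t τ => Q t τ ∧ Frame c σ τ := by
  obtain ⟨t, τ, h1, h2⟩ := h
  exact ⟨t, τ, h1, h2, Frame.of_exec h1⟩

/-! #### Loops -/

/-- The rule for loops. The invariant `J k t τ` mentions a quantity `k` that decreases and the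
number `t` of steps done so far. -/
theorem wp_loop (J : ℕ → ℕ → State → Prop) {k : ℕ} (h0 : J k 0 σ)
    (step : ∀ k t τ, J k t τ → Frame p σ τ → e.eval τ ≠ 0 →
      WP p τ fun u υ => ∃ k' < k, J k' (t + u + 1) υ)
    (done : ∀ k t τ, J k t τ → Frame p σ τ → e.eval τ = 0 → Q (t + 1) τ) :
    WP (.loop e p) σ Q := by
  have key : ∀ k t τ, J k t τ → Frame p σ τ →
      ∃ u υ, Exec (.loop e p) τ u υ ∧ Q (t + u) υ := by
    intro k
    induction k using Nat.strong_induction_on with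
    | _ k ih =>
      intro t τ hJ hF
      by_cases he : e.eval τ = 0
      · exact ⟨1, τ, .loop_done he, done k t τ hJ hF he⟩
      · obtain ⟨u, υ, h1, k', hk, hJ'⟩ := step k t τ hJ hF he
        obtain ⟨u', υ', h2, hQ⟩ := ih k' hk _ _ hJ' (hF.trans (Frame.of_exec h1))
        refine ⟨_, _, .loop_step he h1 h2, ?_⟩
        grind
  obtain ⟨u, υ, h1, h2⟩ := key k 0 σ h0 (Frame.refl _ _)
  rw [Nat.zero_add] at h2
  exact ⟨u, υ, h1, h2⟩

/-- `for r in [lo, hi) do p`. -/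
def Cmd.for (r : ℕ) (lo hi : Exp) (p : Cmd) : Cmd :=
  .set r lo ;; .loop (.less (.reg r) hi) (p ;; .set r (.plus (.reg r) (.lit 1)))

/-- The rule for loops with a counter, with an invariant that refers to the time spent in the body.
-/
theorem wp_for_time {lo hi : Exp} (b N : ℕ) (J : ℕ → ℕ → State → Prop) (hlo : lo.eval σ = b)
    (hbN : b ≤ N) (hr : p.wrR r = false)
    (hhi : ∀ τ, Frame (Cmd.for r lo hi p) σ τ → hi.eval τ = N)
    (h0 : J b 0 (σ.setReg r b))
    (step : ∀ i t τ, b ≤ i → i < N → J i t τ → τ.regs r = i → Frame (Cmd.for r lo hi p) σ τ →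
      WP p τ fun u υ => J (i + 1) (t + u) (υ.setReg r (i + 1)))
    (done : ∀ t τ, J N t τ → Frame (Cmd.for r lo hi p) σ τ → Q (t + 2 * (N - b) + 2) τ) :
    WP (Cmd.for r lo hi p) σ Q := by
  have hF0 : Frame (Cmd.for r lo hi p) σ (σ.setReg r b) := by
    refine ⟨fun s hs => ?_, fun _ _ => rfl, fun _ => rfl⟩
    have : s ≠ r := by
      rintro rfl
      simp [Cmd.for, Cmd.wrR] at hs
    simp [this]
  have hW : ∀ {τ υ}, Frame (p ;; .set r (.plus (.reg r) (.lit 1))) τ υ →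
      Frame (Cmd.for r lo hi p) τ υ := by
    intro τ υ h
    refine h.weaken ?_ ?_ ?_ <;> simp +contextual [Cmd.for, Cmd.wrR, Cmd.wrA, Cmd.emits]
  rw [Cmd.for, wp_seq, wp_set, hlo]
  refine wp_loop (fun k t τ => ∃ i t', k = N - i ∧ b ≤ i ∧ i ≤ N ∧ t = t' + 2 * (i - b) ∧
    τ.regs r = i ∧ J i t' τ) ⟨b, 0, rfl, le_rfl, hbN, by simp, by simp, h0⟩ ?_ ?_
  · rintro k t τ ⟨i, t', rfl, hbi, hiN, rfl, hir, hJ⟩ hF he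
    have hF' := hF0.trans (hW hF)
    have hlt : i < N := by
      by_contra hge
      simp [Exp.eval, hir, hhi τ hF', hge] at he
    rw [wp_seq]
    refine (step i t' τ hbi hlt hJ hir hF').frame.mono ?_
    rintro u υ ⟨hJ', hFp⟩
    rw [wp_set]
    have hυr : υ.regs r = i := (hFp.reg r hr).trans hir
    refine ⟨N - (i + 1), by omega, i + 1, t' + u, rfl, by omega, by omega, by omega, ?_, ?_⟩
    · simp [Exp.eval, hυr]
    · simpa [Exp.eval, hυr] using hJ'
  · rintro k t τ ⟨i, t', rfl, hbi, hiN, rfl, hir, hJ⟩ hF he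
    have hF' := hF0.trans (hW hF)
    have hge : i = N := by
      by_contra hne
      have hlt : i < N := by omega
      simp [Exp.eval, hir, hhi τ hF', hlt] at he
    grind

/-- The rule for counting loops whose body takes at most `K` steps. -/
theorem wp_for {lo hi : Exp} (b N K : ℕ) (J : ℕ → State → Prop) (hlo : lo.eval σ = b)
    (hbN : b ≤ N) (hr : p.wrR r = false)
    (hhi : ∀ τ, Frame (Cmd.for r lo hi p) σ τ → hi.eval τ = N)
    (h0 : J b (σ.setReg r b))
    (step : ∀ i τ, b ≤ i → i < N → J i τ → τ.regs r = i → Frame (Cmd.for r lo hi p) σ τ →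
      WP p τ fun u υ => u ≤ K ∧ J (i + 1) (υ.setReg r (i + 1)))
    (done : ∀ t τ, t ≤ (K + 2) * (N - b) + 2 → J N τ → Frame (Cmd.for r lo hi p) σ τ → Q t τ) :
    WP (Cmd.for r lo hi p) σ Q := by
  refine wp_for_time b N (fun i t τ => t ≤ K * (i - b) ∧ J i τ) hlo hbN hr hhi ⟨by simp, h0⟩ ?_ ?_
  · rintro i t τ hbi hiN ⟨ht, hJ⟩ hir hF
    refine (step i τ hbi hiN hJ hir hF).mono ?_
    rintro u υ ⟨hu, hJ'⟩
    refine ⟨?_, hJ'⟩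
    have : i + 1 - b = (i - b) + 1 := by omega
    rw [this, Nat.mul_add]
    omega
  · grind

/-! #### Linked lists -/

/-- One more than the last index below `i` at which `w` takes the value `v`, and `0` if there is no
such index. -/
def last (w : ℕ → ℕ) : ℕ → ℕ → ℕ
  | 0, _ => 0
  | i + 1, v => if w i = v then i + 1 else last w i v

theorem last_spec {w : ℕ → ℕ} {i v j : ℕ} (h : last w i v = j + 1) :
    j < i ∧ w j = v ∧ ∀ k, j < k → k < i → w k ≠ v := by
  induction i with
  | zero => simp [last] at h
  | succ i ih =>
    rw [last] at h
    split_ifs at h with h1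
    · simp_all
    · grind

theorem last_eq_zero {w : ℕ → ℕ} {i v : ℕ} (h : last w i v = 0) : ∀ k < i, w k ≠ v := by
  induction i with
  | zero => simp
  | succ i ih =>
    rw [last] at h
    split_ifs at h with h1
    intro k hk
    rcases lt_succ_iff_lt_or_eq.1 hk with h5 | rfl
    · exact ih h k h5
    · exact h1

/-- Run `p` for all elements of a linked list: the register `rp` holds one more than the current
element, or zero at the end, `rc` holds the current element, and the array `nx` the links. -/
def Cmd.walk (rp rc nx : ℕ) (start : Exp) (p : Cmd) : Cmd :=
  .set rp start ;; .loop (.reg rp)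
    (.set rc (.minus (.reg rp) (.lit 1)) ;; p ;; .set rp (.get nx (.reg rc)))

/-- The rule for linked lists. `J i t τ` says that the elements from `i` on have been processed. -/
theorem wp_walk {rp rc nx : ℕ} {start : Exp} (w : ℕ → ℕ) (v N : ℕ) (J : ℕ → ℕ → State → Prop)
    (hstart : start.eval σ = last w N v) (hne : rc ≠ rp) (hrc : p.wrR rc = false)
    (hnx : ∀ τ, Frame (Cmd.walk rp rc nx start p) σ τ → ∀ c < N, w c = v →
      τ.arrays nx c = last w c v)
    (hp : ∀ i t τ x, J i t τ → J i t (τ.setReg rp x))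
    (hc : ∀ i t τ x, J i t τ → J i t (τ.setReg rc x))
    (h0 : J N 0 σ) (skip : ∀ i t τ, i < N → w i ≠ v → J (i + 1) t τ → J i t τ)
    (step : ∀ i t τ, i < N → w i = v → J (i + 1) t τ → τ.regs rc = i →
      Frame (Cmd.walk rp rc nx start p) σ τ → WP p τ fun u υ => J i (t + u + 3) υ)
    (done : ∀ t τ, J 0 t τ → Frame (Cmd.walk rp rc nx start p) σ τ → Q (t + 2) τ) :
    WP (Cmd.walk rp rc nx start p) σ Q := by
  have hF0 : ∀ (τ : State) (x : ℕ), Frame (Cmd.walk rp rc nx start p) τ (τ.setReg rp x) := by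
    intro τ x
    refine ⟨fun s hs => ?_, fun _ _ => rfl, fun _ => rfl⟩
    have : s ≠ rp := by
      rintro rfl
      simp [Cmd.walk, Cmd.wrR] at hs
    simp [this]
  have hF1 : ∀ (τ : State) (x : ℕ), Frame (Cmd.walk rp rc nx start p) τ (τ.setReg rc x) := by
    intro τ x
    refine ⟨fun s hs => ?_, fun _ _ => rfl, fun _ => rfl⟩
    have : s ≠ rc := by
      rintro rfl
      simp [Cmd.walk, Cmd.wrR] at hs
    simp [this]
  have hFp : ∀ {τ υ}, Frame p τ υ → Frame (Cmd.walk rp rc nx start p) τ υ := by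
    intro τ υ h
    refine h.weaken ?_ ?_ ?_ <;> simp +contextual [Cmd.walk, Cmd.wrR, Cmd.wrA, Cmd.emits]
  have hskip : ∀ t τ i j, i ≤ j → j ≤ N → (∀ k, i ≤ k → k < j → w k ≠ v) → J j t τ → J i t τ := by
    intro t τ i j hij
    induction j, hij using Nat.le_induction with
    | base => exact fun _ _ h => h
    | succ j hij ih =>
      intro hjN hk hJ
      exact ih (by omega) (fun k h1 h2 => hk k h1 (by omega))
        (skip j t τ (by omega) (hk j hij (by omega)) hJ)
  rw [Cmd.walk, wp_seq, wp_set, hstart]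
  refine wp_loop (fun k t τ => k ≤ N ∧ τ.regs rp = last w k v ∧ J k t τ ∧
    Frame (Cmd.walk rp rc nx start p) σ τ) ⟨le_rfl, by simp, hp _ _ _ _ h0, hF0 _ _⟩ ?_ ?_
  · rintro k t τ ⟨hkN, hreg, hJ, hF⟩ - he
    obtain ⟨j, hj⟩ := exists_eq_succ_of_ne_zero he
    simp only [Exp.eval] at hj
    obtain ⟨hjk, hjv, hjm⟩ := last_spec (hreg.symm.trans hj)
    have hJ' := hskip t τ (j + 1) k hjk hkN (fun i h1 h2 => hjm i (by omega) h2) hJ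
    rw [wp_seq, wp_set, wp_seq]
    have hev : Exp.eval τ (.minus (.reg rp) (.lit 1)) = j := by simp [Exp.eval, hj]
    rw [hev]
    refine (step j t _ (by omega) hjv (hc _ _ _ _ hJ') (by simp) (hF.trans (hF1 _ _))).frame.mono ?_
    rintro u υ ⟨hJ'', hFu⟩
    rw [wp_set]
    have hFυ := (hF.trans (hF1 τ j)).trans (hFp hFu)
    have hυc : υ.regs rc = j := (hFu.reg rc hrc).trans (by simp)
    have hev' : Exp.eval υ (.get nx (.reg rc)) = last w j v := by
      simp only [Exp.eval, hυc]
      exact hnx υ hFυ j (by omega) hjv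
    rw [hev']
    have ht : t + (1 + (u + 1)) + 1 = t + u + 3 := by omega
    exact ⟨j, hjk, by omega, by simp, by rw [ht]; exact hp _ _ _ _ hJ'', hFυ.trans (hF0 _ _)⟩
  · rintro k t τ ⟨hkN, hreg, hJ, hF⟩ - he
    simp only [Exp.eval] at he
    have := last_eq_zero (hreg.symm.trans he)
    have ht : 1 + (t + 1) = t + 2 := by omega
    rw [ht]
    exact done t τ (hskip t τ 0 k (Nat.zero_le _) hkN (fun i _ h => this i h) hJ) hF

end Rules

/-! ### Tables -/

/-- The groups, stored in arrays. Options and cells are numbered consecutively, and the cells of the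
option `o` have the numbers from `os o` to `os (o + 1) - 1`. The pairs of a group and one of its
governed variables are numbered from `1` on. -/
structure Tab where
  /-- number of variables of the instance -/
  nr : ℕ
  /-- number of variables, including auxiliary ones -/
  nv : ℕ
  /-- one more than the number of pairs -/
  np : ℕ
  /-- number of options -/
  no : ℕ
  /-- number of cells -/
  nc : ℕ
  /-- variable of a cell -/
  cv : ℕ → ℕ
  /-- pair of a cell, or zero -/
  cp : ℕ → ℕ
  /-- rank of a cell -/
  cr : ℕ → ℕ
  /-- option of a cell -/
  co : ℕ → ℕ
  /-- first cell of an option -/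
  os : ℕ → ℕ
  /-- group of a pair -/
  pg : ℕ → ℕ
  /-- variable of a pair -/
  pv : ℕ → ℕ

/-- The numbering is consistent: the cells of an option are consecutive, its ranks are smaller than
the number of its cells, and the pairs of a group are consecutive. The pair `0` stands for no pair.
-/
structure Tab.WF (T : Tab) : Prop where
  nr_le : T.nr ≤ T.nv
  np_pos : 1 ≤ T.np
  os_le : ∀ o < T.no, T.os (o + 1) ≤ T.nc
  co_eq : ∀ o < T.no, ∀ c, T.os o ≤ c → c < T.os (o + 1) → T.co c = o
  co_lt : ∀ c < T.nc, T.co c < T.no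
  os_co_le : ∀ c < T.nc, T.os (T.co c) ≤ c
  lt_os_co : ∀ c < T.nc, c < T.os (T.co c + 1)
  cr_lt : ∀ c < T.nc, T.os (T.co c) + T.cr c < T.os (T.co c + 1)
  co_mono : ∀ c c', c ≤ c' → c' < T.nc → T.co c ≤ T.co c'
  cv_lt : ∀ c < T.nc, T.cv c < T.nv
  cp_lt : ∀ c < T.nc, T.cp c < T.np
  pv_cp : ∀ c < T.nc, T.cp c ≠ 0 → T.pv (T.cp c) = T.cv c
  pv_lt : ∀ p, 1 ≤ p → p < T.np → T.pv p < T.nv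
  os_zero : T.os 0 = 0
  os_mono : ∀ o < T.no, T.os o ≤ T.os (o + 1)
  os_last : T.os T.no = T.nc
  pg_mono : ∀ p p', 1 ≤ p → p ≤ p' → p' < T.np → T.pg p ≤ T.pg p'

/-- The registers `0`, …, `4` and the arrays `1`, …, `8` hold the tables and the substitution `R`.
-/
structure Loaded (T : Tab) (R : ℕ → ℕ) (σ : State) : Prop where
  nr : σ.regs 0 = T.nr
  nv : σ.regs 1 = T.nv
  np : σ.regs 2 = T.np
  no : σ.regs 3 = T.no
  nc : σ.regs 4 = T.nc
  cv : σ.arrays 1 = T.cv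
  cp : σ.arrays 2 = T.cp
  cr : σ.arrays 3 = T.cr
  co : σ.arrays 4 = T.co
  os : σ.arrays 5 = T.os
  pg : σ.arrays 6 = T.pg
  pv : σ.arrays 7 = T.pv
  rho : σ.arrays 8 = R

/-- The program does not write to the tables. -/
def Cmd.keepsTab (c : Cmd) : Bool :=
  (List.range 5).all (fun r => !c.wrR r) && (List.range 9).all fun a => !c.wrA a

theorem Loaded.frame {T : Tab} {R : ℕ → ℕ} {c : Cmd} {σ τ : State} (h : Loaded T R σ)
    (hF : Frame c σ τ) (hc : c.keepsTab = true) : Loaded T R τ := by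
  simp only [Cmd.keepsTab, Bool.and_eq_true, List.all_eq_true, mem_range,
    Bool.not_eq_true'] at hc
  obtain ⟨h1, h2⟩ := hc
  constructor
  · rw [hF.reg _ (h1 _ (by norm_num)), h.nr]
  · rw [hF.reg _ (h1 _ (by norm_num)), h.nv]
  · rw [hF.reg _ (h1 _ (by norm_num)), h.np]
  · rw [hF.reg _ (h1 _ (by norm_num)), h.no]
  · rw [hF.reg _ (h1 _ (by norm_num)), h.nc]
  · rw [hF.arr _ (h2 _ (by norm_num)), h.cv]
  · rw [hF.arr _ (h2 _ (by norm_num)), h.cp]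
  · rw [hF.arr _ (h2 _ (by norm_num)), h.cr]
  · rw [hF.arr _ (h2 _ (by norm_num)), h.co]
  · rw [hF.arr _ (h2 _ (by norm_num)), h.os]
  · rw [hF.arr _ (h2 _ (by norm_num)), h.pg]
  · rw [hF.arr _ (h2 _ (by norm_num)), h.pv]
  · rw [hF.arr _ (h2 _ (by norm_num)), h.rho]

section Semantics

variable (T : Tab) (R : ℕ → ℕ)

/-- The variable of a cell after the substitution. -/
def Tab.w (c : ℕ) : ℕ := R (T.cv c)

/-- The variable of a pair after the substitution. -/
def Tab.u (p : ℕ) : ℕ := R (T.pv p)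

/-- The pair is the first one of its group with this variable. -/
def Tab.Canon (p : ℕ) : Prop :=
  ∀ p', 1 ≤ p' → p' < p → T.pg p' = T.pg p → T.u R p' ≠ T.u R p

/-- The cell is the first one of its option with this variable. -/
def Tab.First (c : ℕ) : Prop := ∀ c' < c, T.co c' = T.co c → T.w R c' ≠ T.w R c

/-- Among the cells before `i`, those of the option `o` with the same variable have the same rank.
-/
def Tab.ValidBelow (i o : ℕ) : Prop :=
  ∀ c < i, ∀ c' < i, T.co c = o → T.co c' = o → T.w R c = T.w R c' → T.cr c = T.cr c'

/-- The place at which the cells of the same option and rank are counted. -/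
def Tab.slot (c : ℕ) : ℕ := T.os (T.co c) + T.cr c

/-- The number of pairs of `v` that are marked by `0` in `F`. -/
def Tab.unfree (F : ℕ → ℕ) (N v : ℕ) : ℕ :=
  ((Finset.range N).filter fun p => F p = 0 ∧ T.u R p = v).card

end Semantics

/-! ### The start of a round -/

section Init

open Exp Cmd

/-- Reset the arrays `NEED = 9`, `HEAD = 11`, `LP = 25`, `INV = 14`, `LV = 17`, `CNT = 15` and
`SUM = 16`. -/
def cmdReset : Cmd :=
  Cmd.for 5 (lit 0) (reg 1) (put 9 (reg 5) (lit 1) ;; put 11 (reg 5) (lit 0) ;;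
    put 25 (reg 5) (lit 0)) ;;
  Cmd.for 5 (lit 0) (reg 3) (put 14 (reg 5) (lit 0) ;; put 17 (reg 5) (lit 0)) ;;
  Cmd.for 5 (lit 0) (reg 4) (put 15 (reg 5) (lit 0) ;; put 16 (reg 5) (lit 0))

/-- The arrays that `cmdReset` initializes. -/
structure ResetDone (T : Tab) (σ : State) : Prop where
  need : ∀ v < T.nv, σ.arrays 9 v = 1
  head : ∀ v < T.nv, σ.arrays 11 v = 0
  lp : ∀ v < T.nv, σ.arrays 25 v = 0
  inv : ∀ o < T.no, σ.arrays 14 o = 0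
  lv : ∀ o < T.no, σ.arrays 17 o = 0
  cnt : ∀ c < T.nc, σ.arrays 15 c = 0
  sum : ∀ c < T.nc, σ.arrays 16 c = 0

variable {T : Tab} {R : ℕ → ℕ} {σ : State}

theorem wp_cmdReset (hL : Loaded T R σ) :
    WP cmdReset σ fun t τ => t ≤ 10 * (T.nv + T.no + T.nc) + 10 ∧ ResetDone T τ := by
  rw [cmdReset, wp_seq]
  refine wp_for 0 T.nv 3 (fun i τ => ∀ v < i, τ.arrays 9 v = 1 ∧ τ.arrays 11 v = 0 ∧
    τ.arrays 25 v = 0) rfl (Nat.zero_le _) rfl (fun τ hF => (hL.frame hF rfl).nv) (by simp) ?_ ?_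
  · intro i τ _ hi hJ hr _
    simp only [wp_seq, wp_put, eval, hr]
    refine ⟨by norm_num, fun v hv => ?_⟩
    simp only [arrays_setReg, arrays_setArr, regs_setArr, hr]
    grind
  intro t τ ht hJ hF
  have hL1 := hL.frame hF rfl
  rw [wp_seq]
  refine wp_for 0 T.no 2 (fun i τ' => ∀ o < i, τ'.arrays 14 o = 0 ∧ τ'.arrays 17 o = 0)
    rfl (Nat.zero_le _) rfl (fun τ hF => (hL1.frame hF rfl).no) (by simp) ?_ ?_
  · intro i τ _ hi hJ hr _
    simp only [wp_seq, wp_put, eval, hr]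
    refine ⟨by norm_num, fun v hv => ?_⟩
    simp only [arrays_setReg, arrays_setArr, regs_setArr, hr]
    grind
  intro t1 τ1 ht1 hJ1 hF1
  have hL2 := hL1.frame hF1 rfl
  refine wp_for 0 T.nc 2 (fun i τ' => ∀ o < i, τ'.arrays 15 o = 0 ∧ τ'.arrays 16 o = 0)
    rfl (Nat.zero_le _) rfl (fun τ hF => (hL2.frame hF rfl).nc) (by simp) ?_ ?_
  · intro i τ _ hi hJ hr _
    simp only [wp_seq, wp_put, eval, hr]
    refine ⟨by norm_num, fun v hv => ?_⟩
    simp only [arrays_setReg, arrays_setArr, regs_setArr, hr]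
    grind
  intro t2 τ2 ht2 hJ2 hF2
  refine ⟨by omega, ?_⟩
  constructor
  · intro v hv
    rw [hF2.arr 9 rfl, hF1.arr 9 rfl]
    exact (hJ v hv).1
  · intro v hv
    rw [hF2.arr 11 rfl, hF1.arr 11 rfl]
    exact (hJ v hv).2.1
  · intro v hv
    rw [hF2.arr 25 rfl, hF1.arr 25 rfl]
    exact (hJ v hv).2.2
  · intro v hv
    rw [hF2.arr 14 rfl]
    exact (hJ1 v hv).1
  · intro v hv
    rw [hF2.arr 17 rfl]
    exact (hJ1 v hv).2
  · simp_all
  · simp_all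

/-- Set `FREE = 10` to `0` for the canonical pairs and to `1` for the others, and add to `NEED` the
number of canonical pairs of each variable. `LP` holds the last pair of each variable. -/
def cmdPairs : Cmd :=
  put 10 (lit 0) (lit 1) ;;
  Cmd.for 5 (lit 1) (reg 2) (
    set 11 (get 8 (get 7 (reg 5))) ;;
    set 12 (get 25 (reg 11)) ;;
    put 25 (reg 11) (reg 5) ;;
    cond (less (lit 0) (reg 12))
      (cond (equal (get 6 (reg 12)) (get 6 (reg 5)))
        (put 10 (reg 5) (lit 1))
        (put 10 (reg 5) (lit 0) ;; put 9 (reg 11) (plus (get 9 (reg 11)) (lit 1))))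
      (put 10 (reg 5) (lit 0) ;; put 9 (reg 11) (plus (get 9 (reg 11)) (lit 1))))

theorem unfree_succ (F : ℕ → ℕ) (N v : ℕ) :
    T.unfree R F (N + 1) v = T.unfree R F N v + if F N = 0 ∧ T.u R N = v then 1 else 0 := by
  unfold Tab.unfree
  rw [Finset.range_add_one, Finset.filter_insert]
  grind

theorem unfree_congr {F F' : ℕ → ℕ} {N : ℕ} (h : ∀ p < N, F p = F' p) (v : ℕ) :
    T.unfree R F N v = T.unfree R F' N v := by
  unfold Tab.unfree
  congr 1
  grind

/-- What holds after the first `i - 1` pairs have been treated. -/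
structure PairsInv (T : Tab) (R : ℕ → ℕ) (i : ℕ) (need free lp : ℕ → ℕ) : Prop where
  free_zero : free 0 = 1
  free_iff : ∀ p, 1 ≤ p → p < i → (free p = 0 ↔ T.Canon R p)
  need_eq : ∀ v < T.nv, need v = 1 + T.unfree R free i v
  lp_eq : ∀ v < T.nv, lp v = last (fun j => T.u R (j + 1)) (i - 1) v

theorem canon_iff (hT : T.WF) {p : ℕ} (hp : p + 1 < T.np) :
    T.Canon R (p + 1) ↔ ¬ (0 < last (fun j => T.u R (j + 1)) p (T.u R (p + 1)) ∧
      T.pg (last (fun j => T.u R (j + 1)) p (T.u R (p + 1))) = T.pg (p + 1)) := by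
  constructor
  · rintro hc ⟨h1, h2⟩
    obtain ⟨j, hj⟩ := exists_eq_succ_of_ne_zero h1.ne'
    obtain ⟨hjp, hju, -⟩ := last_spec hj
    rw [hj] at h2
    exact hc (j + 1) (by omega) (by omega) h2 hju
  · intro h p' hp1 hpp' hpg hu
    obtain ⟨j, rfl⟩ : ∃ j, p' = j + 1 := ⟨p' - 1, by omega⟩
    have hne : last (fun j => T.u R (j + 1)) p (T.u R (p + 1)) ≠ 0 := fun h0 =>
      last_eq_zero h0 j (by omega) hu
    obtain ⟨k, hk⟩ := exists_eq_succ_of_ne_zero hne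
    obtain ⟨hkp, hku, hkm⟩ := last_spec hk
    refine h ⟨by omega, ?_⟩
    rw [hk]
    have hjk : j ≤ k := by grind
    have h1 := hT.pg_mono (j + 1) (k + 1) (by omega) (by omega) (by omega)
    have h2 := hT.pg_mono (k + 1) (p + 1) (by omega) (by omega) hp
    grind

/-- The flag `b` tells that the pair repeats the variable of an earlier pair of its group. Pairs of
a group are consecutive, so it suffices to compare with the last pair of the same variable. -/
theorem PairsInv.step (hT : T.WF) (hR : ∀ v < T.nv, R v < T.nv) {p : ℕ} (hp : p + 1 < T.np)
    {need free lp : ℕ → ℕ} (h : PairsInv T R (p + 1) need free lp) (b : Bool)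
    (hb : b = true ↔ (0 < lp (T.u R (p + 1)) ∧ T.pg (lp (T.u R (p + 1))) = T.pg (p + 1))) :
    PairsInv T R (p + 2)
      (if b then need else update need (T.u R (p + 1)) (need (T.u R (p + 1)) + 1))
      (update free (p + 1) (if b then 1 else 0))
      (update lp (T.u R (p + 1)) (p + 1)) := by
  have hu : T.u R (p + 1) < T.nv := hR _ (hT.pv_lt _ (by omega) hp)
  rw [h.lp_eq _ hu, Nat.add_sub_cancel] at hb
  have hcanon : T.Canon R (p + 1) ↔ b = false := by
    rw [canon_iff hT hp, ← hb]
    simp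
  have hcongr : ∀ v, T.unfree R (update free (p + 1) (if b then 1 else 0)) (p + 1) v
      = T.unfree R free (p + 1) v := fun v =>
    unfree_congr (fun q hq => by rw [update_of_ne hq.ne]) v
  constructor
  · rw [update_of_ne (by omega)]
    exact h.free_zero
  · intro q hq1 hq2
    by_cases h1 : q = p + 1
    · grind
    · rw [update_of_ne h1]
      exact h.free_iff q hq1 (by omega)
  · intro v hv
    rw [unfree_succ, hcongr, update_self]
    cases b with
    | true => simp [h.need_eq v hv]
    | false =>
      simp only [Bool.false_eq_true, if_false, update_apply, true_and]
      by_cases hvu : v = T.u R (p + 1)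
      · subst hvu
        simp [h.need_eq _ hv, add_assoc]
      · simp [h.need_eq v hv, hvu, Ne.symm hvu]
  · intro v hv
    have : p + 2 - 1 = p + 1 := by omega
    rw [this, last, update_apply, h.lp_eq v hv, Nat.add_sub_cancel]
    grind

theorem wp_cmdPairs (hT : T.WF) (hR : ∀ v < T.nv, R v < T.nv) (hL : Loaded T R σ)
    (h0 : ResetDone T σ) :
    WP cmdPairs σ fun t τ => t ≤ 12 * T.np + 10 ∧
      ∃ lp, PairsInv T R T.np (τ.arrays 9) (τ.arrays 10) lp := by
  rw [cmdPairs, wp_seq, wp_put]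
  refine wp_for 1 T.np 9 (fun i τ => PairsInv T R i (τ.arrays 9) (τ.arrays 10) (τ.arrays 25))
    rfl hT.np_pos rfl ?_ ?_ ?_ ?_
  · intro τ hF
    simp only [eval]
    rw [hF.reg 2 rfl]
    exact hL.np
  · simp only [arrays_setReg, arrays_setArr, eval]
    constructor
    · simp
    · omega
    · intro v hv
      simp [h0.need v hv, Tab.unfree, Finset.filter_singleton]
    · intro v hv
      simp [h0.lp v hv, last]
  · intro i τ h1 hi hJ hr hF
    obtain ⟨p, rfl⟩ : ∃ p, i = p + 1 := ⟨i - 1, by omega⟩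
    have e7 : τ.arrays 7 = T.pv := by rw [hF.arr 7 rfl]; exact hL.pv
    have e8 : τ.arrays 8 = R := by rw [hF.arr 8 rfl]; exact hL.rho
    have e6 : τ.arrays 6 = T.pg := by rw [hF.arr 6 rfl]; exact hL.pg
    have hstep := hJ.step hT hR hi
    simp only [wp_seq, wp_set, wp_put, wp_cond, eval, regs_setReg, arrays_setReg,
      regs_setArr, arrays_setArr, hr, e7, e8, e6, if_true, if_false, reduceEqDiff]
    change (_ → _) ∧ (_ → _)
    have hu : R (T.pv (p + 1)) = T.u R (p + 1) := rfl
    rw [hu]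
    refine ⟨fun hlp => ⟨fun hpg => ⟨by norm_num, ?_⟩, fun hpg => ⟨by norm_num, ?_⟩⟩,
      fun hlp => ⟨by norm_num, ?_⟩⟩
    · have := hstep true (by simp at hlp hpg; simp [Nat.pos_of_ne_zero hlp, hpg])
      simpa using this
    · simp_all
    · simp_all
  · grind

end Init

section Cells

open Exp Cmd

/-- Build the lists `HEAD = 11`, `NEXT = 12` of the cells of each variable, set `CF = 13` to `1` for
the cells that are the first ones of their variable in their option and to `0` for the others, set
`INV = 14` to `1` for the invalid options, and count in `CNT = 15` the first cells of each option
and rank, and add up their pairs in `SUM = 16`. -/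
def cmdCells : Cmd :=
  Cmd.for 5 (lit 0) (reg 4) (
    set 11 (get 8 (get 1 (reg 5))) ;;
    set 12 (get 11 (reg 11)) ;;
    put 12 (reg 5) (reg 12) ;;
    put 11 (reg 11) (plus (reg 5) (lit 1)) ;;
    set 6 (lit 1) ;;
    cond (less (lit 0) (reg 12))
      (cond (equal (get 4 (minus (reg 12) (lit 1))) (get 4 (reg 5)))
        (set 6 (lit 0) ;;
          cond (equal (get 3 (minus (reg 12) (lit 1))) (get 3 (reg 5))) skip
            (put 14 (get 4 (reg 5)) (lit 1)))
        skip)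
      skip ;;
    put 13 (reg 5) (reg 6) ;;
    set 12 (plus (get 5 (get 4 (reg 5))) (get 3 (reg 5))) ;;
    cond (reg 6)
      (put 15 (reg 12) (plus (get 15 (reg 12)) (lit 1)) ;;
        put 16 (reg 12) (plus (get 16 (reg 12)) (get 2 (reg 5))))
      skip)

section Defs

variable (T : Tab) (R : ℕ → ℕ)

/-- The number of cells in `A` that are counted at the place `s`. -/
def Tab.cntOf (A : Finset ℕ) (s : ℕ) : ℕ := (A.filter fun c => T.slot c = s).card

/-- The sum of the pairs of the cells in `A` that are counted at the place `s`. -/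
def Tab.sumOf (A : Finset ℕ) (s : ℕ) : ℕ := ∑ c ∈ A.filter fun c => T.slot c = s, T.cp c

open Classical in
/-- The cells before `i` that are the first ones of their variable in their option. -/
noncomputable def Tab.firsts (i : ℕ) : Finset ℕ := (Finset.range i).filter (T.First R)

end Defs

/-- What holds after the cells before `i` have been treated. -/
structure CellsInv (T : Tab) (R : ℕ → ℕ) (i : ℕ) (head next cf inv cnt sum : ℕ → ℕ) : Prop where
  head_eq : ∀ v < T.nv, head v = last (T.w R) i v
  next_eq : ∀ c < i, next c = last (T.w R) c (T.w R c)
  cf_iff : ∀ c < i, (cf c ≠ 0 ↔ T.First R c)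
  inv_iff : ∀ o < T.no, (inv o = 0 ↔ T.ValidBelow R i o)
  cnt_eq : ∀ s < T.nc, cnt s = T.cntOf (T.firsts R i) s
  sum_eq : ∀ s < T.nc, sum s = T.sumOf (T.firsts R i) s

variable {T : Tab} {R : ℕ → ℕ} {σ : State}

theorem Tab.WF.slot_lt (hT : T.WF) {c : ℕ} (hc : c < T.nc) : T.slot c < T.nc :=
  (hT.cr_lt c hc).trans_le (hT.os_le _ (hT.co_lt c hc))

theorem first_iff (hT : T.WF) {i : ℕ} (hi : i < T.nc) :
    T.First R i ↔ ¬ (0 < last (T.w R) i (T.w R i) ∧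
      T.co (last (T.w R) i (T.w R i) - 1) = T.co i) := by
  constructor
  · rintro hF ⟨h1, h2⟩
    obtain ⟨j, hj⟩ := exists_eq_succ_of_ne_zero h1.ne'
    obtain ⟨h3, h4, -⟩ := last_spec hj
    rw [hj] at h2
    exact hF j h3 h2 h4
  · intro h c hc hco hw
    have hne : last (T.w R) i (T.w R i) ≠ 0 := fun h0 => last_eq_zero h0 c hc hw
    obtain ⟨j, hj⟩ := exists_eq_succ_of_ne_zero hne
    obtain ⟨h3, h4, h5⟩ := last_spec hj
    refine h ⟨by omega, ?_⟩
    rw [hj]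
    have hcj : c ≤ j := by grind
    have h6 := hT.co_mono c j hcj (by omega)
    have h7 := hT.co_mono j i h3.le hi
    grind

theorem validBelow_succ {i o : ℕ} :
    T.ValidBelow R (i + 1) o ↔ T.ValidBelow R i o ∧
      (T.co i = o → ∀ c < i, T.co c = o → T.w R c = T.w R i → T.cr c = T.cr i) := by
  constructor
  · intro h
    exact ⟨fun c hc c' hc' => h c (by omega) c' (by omega),
      fun ho c hc hco hw => h c (by omega) i (by omega) hco ho hw⟩
  · rintro ⟨h1, h2⟩ c hc c' hc' ho ho' hw
    rcases lt_succ_iff_lt_or_eq.1 hc with hc | rfl <;>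
      rcases lt_succ_iff_lt_or_eq.1 hc' with hc' | rfl
    · exact h1 c hc c' hc' ho ho' hw
    · exact h2 ho' c hc ho hw
    · exact (h2 ho c' hc' ho' hw.symm).symm
    · rfl

theorem firsts_succ (i : ℕ) [Decidable (T.First R i)] : T.firsts R (i + 1) =
    if T.First R i then insert i (T.firsts R i) else T.firsts R i := by
  unfold Tab.firsts
  grind

theorem cntOf_insert {A : Finset ℕ} {c s : ℕ} (hc : c ∉ A) :
    T.cntOf (insert c A) s = T.cntOf A s + if s = T.slot c then 1 else 0 := by
  unfold Tab.cntOf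
  rw [Finset.filter_insert]
  grind

theorem sumOf_insert {A : Finset ℕ} {c s : ℕ} (hc : c ∉ A) :
    T.sumOf (insert c A) s = T.sumOf A s + if s = T.slot c then T.cp c else 0 := by
  unfold Tab.sumOf
  rw [Finset.filter_insert]
  grind

/-- The flag `f` tells that the cell is the first one of its option with its variable. Cells of an
option are consecutive, so it suffices to compare with the last cell of the same variable; if that
cell belongs to the option and has another rank, the option is invalid. -/
theorem CellsInv.step (hT : T.WF) (hR : ∀ v < T.nv, R v < T.nv) {i : ℕ} (hi : i < T.nc)
    {head next cf inv cnt sum inv' : ℕ → ℕ} (h : CellsInv T R i head next cf inv cnt sum) (f : ℕ)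
    (hf : f ≠ 0 ↔ ¬ (0 < head (T.w R i) ∧ T.co (head (T.w R i) - 1) = T.co i))
    (hi' : inv' = if f = 0 ∧ T.cr (head (T.w R i) - 1) ≠ T.cr i
      then update inv (T.co i) 1 else inv) :
    CellsInv T R (i + 1)
      (update head (T.w R i) (i + 1))
      (update next i (head (T.w R i)))
      (update cf i f) inv'
      (if f ≠ 0 then update cnt (T.slot i) (cnt (T.slot i) + 1) else cnt)
      (if f ≠ 0 then update sum (T.slot i) (sum (T.slot i) + T.cp i) else sum) := by
  classical
  have hw : T.w R i < T.nv := hR _ (hT.cv_lt i hi)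
  have hh := h.head_eq _ hw
  rw [hh] at hf hi'
  have hfirst : T.First R i ↔ f ≠ 0 := by rw [first_iff hT hi, hf]
  have hnot : i ∉ T.firsts R i := by simp [Tab.firsts]
  constructor
  · intro v hv
    rw [last, update_apply, h.head_eq v hv]
    grind
  · intro c hc
    rw [update_apply]
    split_ifs with h1
    · rw [h1, hh]
    · exact h.next_eq c (by omega)
  · intro c hc
    rw [update_apply]
    split_ifs with h1
    · rw [h1, hfirst]
    · exact h.cf_iff c (by omega)
  · intro o ho
    rw [validBelow_succ, ← h.inv_iff o ho, hi']
    by_cases hf0 : f = 0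
    · have hl : 0 < last (T.w R) i (T.w R i) ∧ T.co (last (T.w R) i (T.w R i) - 1) = T.co i := by
        omega
      obtain ⟨j, hj⟩ := exists_eq_succ_of_ne_zero hl.1.ne'
      obtain ⟨h3, h4, h5⟩ := last_spec hj
      rw [hj, Nat.succ_eq_add_one, Nat.add_sub_cancel] at hl ⊢
      by_cases hcr : T.cr j = T.cr i
      · rw [if_neg (by simp [hcr])]
        constructor
        · intro hinv
          refine ⟨hinv, fun hoi c hc hco hwc => ?_⟩
          rw [← hcr]
          exact (h.inv_iff o ho).1 hinv c hc j h3 hco (hl.2.trans hoi) (hwc.trans h4.symm)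
        · exact fun h => h.1
      · grind
    · rw [if_neg (by simp [hf0])]
      refine ⟨fun h => ⟨h, fun hoi c hc hco hwc => ?_⟩, fun h => h.1⟩
      exact absurd hwc (hfirst.2 hf0 c hc (hco.trans hoi.symm))
  · intro s hs
    rw [firsts_succ]
    by_cases hf0 : f ≠ 0
    · rw [if_pos hf0, if_pos (hfirst.2 hf0), cntOf_insert hnot, update_apply]
      split_ifs with h1
      · rw [h1, h.cnt_eq _ (hT.slot_lt hi)]
      · rw [h.cnt_eq s hs, add_zero]
    · rw [if_neg hf0, if_neg (fun h => hf0 (hfirst.1 h)), h.cnt_eq s hs]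
  · intro s hs
    rw [firsts_succ]
    by_cases hf0 : f ≠ 0
    · rw [if_pos hf0, if_pos (hfirst.2 hf0), sumOf_insert hnot, update_apply]
      split_ifs with h1
      · rw [h1, h.sum_eq _ (hT.slot_lt hi)]
      · rw [h.sum_eq s hs, add_zero]
    · rw [if_neg hf0, if_neg (fun h => hf0 (hfirst.1 h)), h.sum_eq s hs]

theorem wp_cmdCells (hT : T.WF) (hR : ∀ v < T.nv, R v < T.nv) (hL : Loaded T R σ)
    (head : ∀ v < T.nv, σ.arrays 11 v = 0) (inv : ∀ o < T.no, σ.arrays 14 o = 0)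
    (cnt : ∀ c < T.nc, σ.arrays 15 c = 0) (sum : ∀ c < T.nc, σ.arrays 16 c = 0) :
    WP cmdCells σ fun t τ => t ≤ 20 * T.nc + 2 ∧
      CellsInv T R T.nc (τ.arrays 11) (τ.arrays 12) (τ.arrays 13) (τ.arrays 14) (τ.arrays 15)
        (τ.arrays 16) := by
  rw [cmdCells]
  refine wp_for 0 T.nc 18 (fun i τ => CellsInv T R i (τ.arrays 11) (τ.arrays 12) (τ.arrays 13)
    (τ.arrays 14) (τ.arrays 15) (τ.arrays 16)) rfl (Nat.zero_le _) rfl ?_ ?_ ?_ ?_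
  · intro τ hF
    simp only [eval]
    rw [hF.reg 4 rfl]
    exact hL.nc
  · simp only [arrays_setReg]
    constructor
    · intro v hv
      simp [head v hv, last]
    · simp
    · simp
    · intro o ho
      simp [inv o ho, Tab.ValidBelow]
    · intro s hs
      simp [cnt s hs, Tab.cntOf, Tab.firsts]
    · intro s hs
      simp [sum s hs, Tab.sumOf, Tab.firsts]
  · intro i τ _ hi hJ hr hF
    have hL' := hL.frame hF rfl
    have hstep := fun inv' f => hJ.step (inv' := inv') hT hR hi f
    have hw : R (T.cv i) = T.w R i := rfl
    have hs : T.os (T.co i) + T.cr i = T.slot i := rfl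
    simp only [wp_seq, wp_set, wp_put, wp_cond, wp_skip, eval, regs_setReg,
      arrays_setReg, regs_setArr, arrays_setArr, hr, hL'.cv, hL'.cp, hL'.cr,
      hL'.co, hL'.os, hL'.rho, if_true, if_false, reduceEqDiff, hw, hs, ne_eq]
    grind
  · simp_all

end Cells

/-! ### Stripping -/

section Strip

open Exp Cmd

section Defs

variable (T : Tab) (R : ℕ → ℕ)

open Classical in
/-- The first cells of their variable in their option whose variable does not belong to `Y`. -/
noncomputable def Tab.alive (Y : Set ℕ) : Finset ℕ := (T.firsts R T.nc).filter fun c => T.w R c ∉ Y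

/-- The cells of the option do not assign different ranks to the same variable. -/
def Tab.Valid (o : ℕ) : Prop := T.ValidBelow R T.nc o

/-- The cell `c` is the only one of minimal rank among the cells of its option in `A`. -/
def Tab.Uniq (A : Finset ℕ) (c : ℕ) : Prop :=
  c ∈ A ∧ ∀ c' ∈ A, T.co c' = T.co c → c' ≠ c → T.cr c < T.cr c'

/-- The pair is good for `U`: in some valid option, its cell has minimal rank among the cells
outside of `Y`, and the variables of the cells of minimal rank belong to `U`. -/
def Tab.FlatGood (Y : Set ℕ) (p : ℕ) (U : Set ℕ) : Prop :=
  ∃ c ∈ T.alive R Y, T.Valid R (T.co c) ∧ T.cp c = p ∧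
    ∀ c' ∈ T.alive R Y, T.co c' = T.co c → T.cr c ≤ T.cr c' ∧ (T.cr c' = T.cr c → T.w R c' ∈ U)

/-- The option has a cell in `A` of rank `LV`, and if this is its only cell of minimal rank in `A`,
then its pair is not marked by `0`. -/
structure Tab.Settled (A : Finset ℕ) (free lv : ℕ → ℕ) (o : ℕ) : Prop where
  uniq : ∀ c, T.co c = o → T.Uniq A c → free (T.cp c) ≠ 0
  level : (∃ c ∈ A, T.co c = o) → ∃ c ∈ A, T.co c = o ∧ T.cr c = lv o

/-- The invariant while variables are stripped. `Y` is the set of variables that have been taken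
from the queue `q`, `A` are the cells that have not been removed, `rel` are the variables that have
been released. -/
structure StripInv (A : Finset ℕ) (Y : Set ℕ) (rel : ℕ → Prop) (need free cnt sum lv q : ℕ → ℕ)
    (qt : ℕ) : Prop where
  sub : A ⊆ T.firsts R T.nc
  cnt_eq : ∀ s < T.nc, cnt s = T.cntOf A s
  sum_eq : ∀ s < T.nc, sum s = T.sumOf A s
  lv_le : ∀ o < T.no, T.os o + lv o ≤ T.os (o + 1)
  lv_min : ∀ c ∈ A, T.Valid R (T.co c) → lv (T.co c) ≤ T.cr c
  free_zero : free 0 ≠ 0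
  free_canon : ∀ p, 1 ≤ p → p < T.np → free p = 0 → T.Canon R p
  free_one : ∀ p, 1 ≤ p → p < T.np → T.Canon R p → free p ≠ 0 →
    T.u R p ∈ Y ∨ ∃ c, T.Uniq A c ∧ T.Valid R (T.co c) ∧ T.cp c = p
  need_rel : ∀ v < T.nv, rel v → need v = T.unfree R free T.np v
  need_not : ∀ v < T.nv, ¬ rel v → need v = T.unfree R free T.np v + 1
  q_iff : ∀ v < T.nv, (need v = 0 ↔ ∃ j < qt, q j = v)
  q_inj : ∀ i < qt, ∀ j < qt, q i = q j → i = j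
  q_lt : ∀ i < qt, q i < T.nv

/-- The progress made on all options together. -/
def Tab.pot (lv : ℕ → ℕ) : ℕ := ∑ o ∈ Finset.range T.no, lv o

end Defs

variable {T : Tab} {R : ℕ → ℕ} {σ : State}

theorem Tab.WF.sum_len_le (hT : T.WF) (f : ℕ → ℕ)
    (hf : ∀ o < T.no, T.os o + f o ≤ T.os (o + 1)) : ∑ o ∈ Finset.range T.no, f o ≤ T.nc := by
  have key : ∀ k ≤ T.no, ∑ o ∈ Finset.range k, f o ≤ T.os k := by
    intro k
    induction k with
    | zero => simp
    | succ k ih =>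
      intro hk
      rw [Finset.sum_range_succ]
      have := ih (by omega)
      have := hf k (by omega)
      omega
  rw [← hT.os_last]
  exact key _ le_rfl

theorem Tab.Uniq.mono {A B : Finset ℕ} {c : ℕ} (h : T.Uniq A c) (hB : B ⊆ A) (hc : c ∈ B) :
    T.Uniq B c :=
  ⟨hc, fun c' hc' => h.2 c' (hB hc')⟩

theorem Tab.slot_eq_iff (hT : T.WF) {c o l : ℕ} (hc : c < T.nc) (ho : o < T.no)
    (hl : T.os o + l < T.os (o + 1)) : T.slot c = T.os o + l ↔ T.co c = o ∧ T.cr c = l := by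
  constructor
  · intro h
    have h1 := hT.co_eq _ (hT.co_lt c hc) (T.slot c) (by simp [Tab.slot]) (hT.cr_lt c hc)
    have h2 := hT.co_eq o ho (T.slot c) (by omega) (by omega)
    have h3 : T.co c = o := h1.symm.trans h2
    refine ⟨h3, ?_⟩
    rw [Tab.slot, h3] at h
    omega
  · rintro ⟨rfl, rfl⟩
    rfl

theorem StripInv.lt_nc {A : Finset ℕ} {Y : Set ℕ} {rel : ℕ → Prop}
    {need free cnt sum lv q : ℕ → ℕ} {qt : ℕ} (h : StripInv T R A Y rel need free cnt sum lv q qt)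
    {c : ℕ} (hc : c ∈ A) : c < T.nc := by
  have := h.sub hc
  simp only [Tab.firsts, Finset.mem_filter, Finset.mem_range] at this
  exact this.1

/-- Advance `LV` for the option in register `13` to the next rank at which there are cells. If there
is only one, mark its pair, and put its variable into the queue if nothing else is needed. -/
def cmdSettle : Cmd :=
  set 14 (plus (get 5 (reg 13)) (get 17 (reg 13))) ;;
  set 15 (get 5 (plus (reg 13) (lit 1))) ;;
  loop (minus (less (reg 14) (reg 15)) (get 15 (reg 14))) (set 14 (plus (reg 14) (lit 1))) ;;
  put 17 (reg 13) (minus (reg 14) (get 5 (reg 13))) ;;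
  cond (less (reg 14) (reg 15))
    (cond (equal (get 15 (reg 14)) (lit 1))
      (set 14 (get 16 (reg 14)) ;;
        cond (get 10 (reg 14)) skip
          (put 10 (reg 14) (lit 1) ;;
            set 15 (get 8 (get 7 (reg 14))) ;;
            put 9 (reg 15) (minus (get 9 (reg 15)) (lit 1)) ;;
            cond (get 9 (reg 15)) skip
              (put 18 (reg 10) (reg 15) ;; set 10 (plus (reg 10) (lit 1)))))
      skip)
    skip

section Settle

variable {A : Finset ℕ} {Y : Set ℕ} {rel : ℕ → Prop} {need free cnt sum lv q : ℕ → ℕ} {qt : ℕ}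

/-- The effect of advancing the level of an option. -/
theorem StripInv.advance (hT : T.WF) (h : StripInv T R A Y rel need free cnt sum lv q qt) {o l : ℕ}
    (ho : o < T.no) (hlv : lv o ≤ l) (hl : T.os o + l ≤ T.os (o + 1))
    (hz : ∀ k, lv o ≤ k → k < l → cnt (T.os o + k) = 0) :
    StripInv T R A Y rel need free cnt sum (update lv o l) q qt := by
  refine { h with lv_le := ?_, lv_min := ?_ }
  · intro o' ho'
    by_cases h1 : o' = o
    · simp_all
    · rw [update_of_ne h1]
      exact h.lv_le o' ho'
  · intro c hc hv
    by_cases h1 : T.co c = o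
    · subst h1
      rw [update_self]
      by_contra hlt
      have hcn := h.lt_nc hc
      have h2 := hz (T.cr c) (h.lv_min c hc hv) (by omega)
      have h3 : T.os (T.co c) + T.cr c < T.nc := hT.slot_lt hcn
      rw [h.cnt_eq _ h3, Tab.cntOf, Finset.card_eq_zero] at h2
      have h4 : c ∈ A.filter fun c' => T.slot c' = T.os (T.co c) + T.cr c :=
        Finset.mem_filter.2 ⟨hc, rfl⟩
      rw [h2] at h4
      simp at h4
    · rw [update_of_ne h1]
      exact h.lv_min c hc hv

/-- If no cell is left, or at least two at the current level, then the option is settled. -/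
theorem StripInv.settled (hT : T.WF) (h : StripInv T R A Y rel need free cnt sum lv q qt) {o : ℕ}
    (ho : o < T.no) (hv : T.Valid R o)
    (hl : T.os o + lv o < T.os (o + 1) → cnt (T.os o + lv o) ≠ 0)
    (h1 : T.os o + lv o < T.os (o + 1) → cnt (T.os o + lv o) = 1 →
      free (sum (T.os o + lv o)) ≠ 0) : T.Settled A free lv o := by
  have hlt : ∀ c ∈ A, T.co c = o → T.os o + lv o < T.os (o + 1) := by
    rintro c hc rfl
    have h2 := h.lv_min c hc hv
    have h3 := hT.cr_lt c (h.lt_nc hc)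
    omega
  have hs : ∀ hl : T.os o + lv o < T.os (o + 1), ∀ c ∈ A,
      (c ∈ A.filter fun c => T.slot c = T.os o + lv o) ↔ T.co c = o ∧ T.cr c = lv o := by
    intro hl c hc
    rw [Finset.mem_filter, Tab.slot_eq_iff hT (h.lt_nc hc) ho hl]
    simp [hc]
  have hlevel : (∃ c ∈ A, T.co c = o) → ∃ c ∈ A, T.co c = o ∧ T.cr c = lv o := by
    rintro ⟨c, hc, hco⟩
    have h2 := hlt c hc hco
    have h3 := hl h2
    rw [h.cnt_eq _ (h2.trans_le (hT.os_le o ho)), Tab.cntOf, Finset.card_ne_zero] at h3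
    grind
  refine ⟨?_, hlevel⟩
  intro c hco hu
  have h2 := hlt c hu.1 hco
  have h2' := h2.trans_le (hT.os_le o ho)
  have hcr : T.cr c = lv o := by
    obtain ⟨c', hc', hco', hcr'⟩ := hlevel ⟨c, hu.1, hco⟩
    by_contra hne
    have h3 := hu.2 c' hc' (hco'.trans hco.symm) (by rintro rfl; exact hne hcr')
    have h4 := h.lv_min c hu.1 (hco ▸ hv)
    rw [hco] at h4
    omega
  have hsing : (A.filter fun c => T.slot c = T.os o + lv o) = {c} := by
    ext c'
    rw [Finset.mem_singleton]
    constructor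
    · intro hc'
      have hA := (Finset.mem_filter.1 hc').1
      obtain ⟨h3, h4⟩ := (hs h2 c' hA).1 hc'
      by_contra hne
      have h5 := hu.2 c' hA (h3.trans hco.symm) hne
      omega
    · rintro rfl
      exact (hs h2 _ hu.1).2 ⟨hco, hcr⟩
  have h3 := h1 h2 (by rw [h.cnt_eq _ h2', Tab.cntOf, hsing, Finset.card_singleton])
  rwa [h.sum_eq _ h2', Tab.sumOf, hsing, Finset.sum_singleton] at h3

/-- The only cell at the current level. -/
theorem StripInv.exists_uniq (hT : T.WF) (h : StripInv T R A Y rel need free cnt sum lv q qt)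
    {o : ℕ} (ho : o < T.no) (hv : T.Valid R o) (hl : T.os o + lv o < T.os (o + 1))
    (h1 : cnt (T.os o + lv o) = 1) :
    ∃ c, T.Uniq A c ∧ T.co c = o ∧ T.cp c = sum (T.os o + lv o) := by
  have hl' := hl.trans_le (hT.os_le o ho)
  rw [h.cnt_eq _ hl', Tab.cntOf, Finset.card_eq_one] at h1
  obtain ⟨c, hc⟩ := h1
  have hcm : c ∈ A.filter fun c => T.slot c = T.os o + lv o := by rw [hc]; simp
  obtain ⟨hcA, hcs⟩ := Finset.mem_filter.1 hcm
  obtain ⟨hco, hcr⟩ := (Tab.slot_eq_iff hT (h.lt_nc hcA) ho hl).1 hcs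
  refine ⟨c, ⟨hcA, fun c' hc' hco' hne => ?_⟩, hco, ?_⟩
  · have h2 := h.lv_min c' hc' (by rw [hco', hco]; exact hv)
    rw [hco', hco] at h2
    rcases Nat.lt_or_eq_of_le h2 with h3 | h3
    · omega
    · have : c' ∈ A.filter fun c => T.slot c = T.os o + lv o :=
        Finset.mem_filter.2 ⟨hc', (Tab.slot_eq_iff hT (h.lt_nc hc') ho hl).2
          ⟨hco'.trans hco, h3.symm⟩⟩
      simp_all
  · rw [h.sum_eq _ hl', Tab.sumOf, hc, Finset.sum_singleton]

theorem unfree_update {N p v : ℕ} (hp : p < N) (hf : free p = 0) :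
    T.unfree R free N v = T.unfree R (update free p 1) N v +
      if v = T.u R p then 1 else 0 := by
  unfold Tab.unfree
  by_cases hv : v = T.u R p
  · rw [if_pos hv]
    have : (Finset.range N).filter (fun p' => free p' = 0 ∧ T.u R p' = v) =
        insert p ((Finset.range N).filter
          fun p' => update free p 1 p' = 0 ∧ T.u R p' = v) := by grind
    simp_all
  · rw [if_neg hv, add_zero]
    congr 1
    grind

/-- Lowering the `need` of `v` by one and putting `v` into the queue if it drops to zero. -/
theorem queue_step (need' need q : ℕ → ℕ) (qt v : ℕ) (hvn : v < T.nv)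
    (q_iff : ∀ v < T.nv, (need v = 0 ↔ ∃ j < qt, q j = v))
    (q_inj : ∀ i < qt, ∀ j < qt, q i = q j → i = j)
    (q_lt : ∀ i < qt, q i < T.nv) (hn : need v ≠ 0)
    (hneed : need' = update need v (need v - 1)) (q' : ℕ → ℕ) (qt' : ℕ)
    (hq : q' = if need v - 1 = 0 then update q qt v else q)
    (hqt : qt' = if need v - 1 = 0 then qt + 1 else qt) :
    (∀ x < T.nv, (need' x = 0 ↔ ∃ j < qt', q' j = x)) ∧
      (∀ i < qt', ∀ j < qt', q' i = q' j → i = j) ∧ (∀ i < qt', q' i < T.nv) ∧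
      (∀ i < qt, q' i = q i) ∧ qt ≤ qt' := by
  have hnot : ∀ j < qt, q j ≠ v := fun j hj hqj => hn ((q_iff v hvn).2 ⟨j, hj, hqj⟩)
  by_cases h0 : need v - 1 = 0
  · rw [if_pos h0] at hq hqt
    subst hq hqt hneed
    refine ⟨?_, ?_, ?_, ?_, by omega⟩
    · intro x hx
      by_cases hxv : x = v
      · subst hxv
        exact iff_of_true (by simpa using h0) ⟨qt, by omega, by simp⟩
      · rw [update_of_ne hxv, q_iff x hx]
        constructor
        · rintro ⟨j, hj, hqj⟩
          exact ⟨j, by omega, by rw [update_of_ne hj.ne]; exact hqj⟩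
        · grind
    · grind
    · grind
    · grind
  · rw [if_neg h0] at hq hqt
    subst hq hqt hneed
    grind

/-- The effect of marking the pair of the only cell at the current level. -/
theorem StripInv.mark (hT : T.WF) (hR : ∀ v < T.nv, R v < T.nv)
    (h : StripInv T R A Y rel need free cnt sum lv q qt) {c : ℕ}
    (hc : T.Uniq A c) (hv : T.Valid R (T.co c)) (hf : free (T.cp c) = 0)
    (q' : ℕ → ℕ) (qt' : ℕ)
    (hq : q' = if need (T.u R (T.cp c)) - 1 = 0 then
      update q qt (T.u R (T.cp c)) else q)
    (hqt : qt' = if need (T.u R (T.cp c)) - 1 = 0 then qt + 1 else qt) :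
    StripInv T R A Y rel
      (update need (T.u R (T.cp c)) (need (T.u R (T.cp c)) - 1))
      (update free (T.cp c) 1) cnt sum lv q' qt' ∧ (∀ i < qt, q' i = q i) ∧ qt ≤ qt' := by
  have hp : T.cp c < T.np := hT.cp_lt c (h.lt_nc hc.1)
  have hp1 : 1 ≤ T.cp c := by
    by_contra h0
    have : T.cp c = 0 := by omega
    rw [this] at hf
    exact h.free_zero hf
  have hu : T.u R (T.cp c) < T.nv := hR _ (hT.pv_lt _ hp1 hp)
  have hun := fun v => unfree_update (T := T) (R := R) (v := v) hp hf
  have hpos : 1 ≤ T.unfree R free T.np (T.u R (T.cp c)) := by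
    rw [hun, if_pos rfl]
    omega
  have hn : need (T.u R (T.cp c)) ≠ 0 := by
    by_cases hr : rel (T.u R (T.cp c))
    · rw [h.need_rel _ hu hr]
      omega
    · rw [h.need_not _ hu hr]
      omega
  obtain ⟨h1, h2, h3, h4, h5⟩ := queue_step _ need q qt _ hu h.q_iff h.q_inj h.q_lt hn rfl
    q' qt' hq hqt
  refine ⟨{ h with
    free_zero := ?_, free_canon := ?_, free_one := ?_, need_rel := ?_, need_not := ?_,
    q_iff := h1, q_inj := h2, q_lt := h3 }, h4, h5⟩
  · rw [update_of_ne (by omega)]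
    exact h.free_zero
  · intro p hp1 hp2 hp3
    by_cases hpc : p = T.cp c
    · grind
    · rw [update_of_ne hpc] at hp3
      exact h.free_canon p hp1 hp2 hp3
  · intro p hp1 hp2 hp3 hp4
    by_cases hpc : p = T.cp c
    · exact .inr ⟨c, hc, hv, hpc.symm⟩
    · rw [update_of_ne hpc] at hp4
      exact h.free_one p hp1 hp2 hp3 hp4
  · intro v hv hr
    have h6 := h.need_rel v hv hr
    grind
  · intro v hv hr
    have h6 := h.need_not v hv hr
    grind

end Settle

section

variable {A : Finset ℕ} {Y : Set ℕ} {rel : ℕ → Prop}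

/-- The invariant for the contents of the arrays. -/
def StripSt (T : Tab) (R : ℕ → ℕ) (A : Finset ℕ) (Y : Set ℕ) (rel : ℕ → Prop) (σ : State) : Prop :=
  StripInv T R A Y rel (σ.arrays 9) (σ.arrays 10) (σ.arrays 15) (σ.arrays 16) (σ.arrays 17)
    (σ.arrays 18) (σ.regs 10)

theorem pot_update {lv : ℕ → ℕ} {o l : ℕ} (ho : o < T.no) :
    T.pot (update lv o l) + lv o = T.pot lv + l := by
  unfold Tab.pot
  rw [Finset.sum_update_of_mem (Finset.mem_range.2 ho),
    ← Finset.sum_erase_add _ _ (Finset.mem_range.2 ho), Finset.sdiff_singleton_eq_erase]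
  omega

/-- The time is paid by the advance of the level of the option, which never decreases. -/
theorem wp_cmdSettle (hT : T.WF) (hR : ∀ v < T.nv, R v < T.nv) (hL : Loaded T R σ)
    (h : StripSt T R A Y rel σ) (ho : σ.regs 13 < T.no) (hv : T.Valid R (σ.regs 13)) :
    WP cmdSettle σ fun t τ => t + 2 * T.pot (σ.arrays 17) ≤ 20 + 2 * T.pot (τ.arrays 17) ∧
      StripSt T R A Y rel τ ∧ T.Settled A (τ.arrays 10) (τ.arrays 17) (σ.regs 13) ∧
      (∀ o, o ≠ σ.regs 13 → τ.arrays 17 o = σ.arrays 17 o) ∧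
      (∀ p, σ.arrays 10 p ≠ 0 → τ.arrays 10 p ≠ 0) ∧
      (∀ i < σ.regs 10, τ.arrays 18 i = σ.arrays 18 i) ∧ σ.regs 10 ≤ τ.regs 10 := by
  obtain ⟨o, hoeq⟩ : ∃ o, σ.regs 13 = o := ⟨_, rfl⟩
  rw [hoeq] at ho hv ⊢
  have hlv := h.lv_le o ho
  rw [cmdSettle, wp_seq, wp_set, wp_seq, wp_set, wp_seq]
  simp only [eval, regs_setReg, arrays_setReg, hL.os, hoeq, if_false, reduceEqDiff]
  refine wp_loop (fun k t τ => ∃ l, σ.arrays 17 o ≤ l ∧ T.os o + l ≤ T.os (o + 1) ∧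
    k = T.os (o + 1) - (T.os o + l) ∧ t = 2 * (l - σ.arrays 17 o) ∧ τ.regs 14 = T.os o + l ∧
    ∀ i, σ.arrays 17 o ≤ i → i < l → σ.arrays 15 (T.os o + i) = 0)
    ⟨_, le_rfl, hlv, rfl, by simp, by simp, fun i h1 h2 => by omega⟩ ?_ ?_
  · rintro k t τ ⟨l, h1, h2, rfl, rfl, h3, h4⟩ hF he
    have h15 : τ.regs 15 = T.os (o + 1) := by rw [hF.reg 15 rfl]; simp
    have hcnt : τ.arrays 15 = σ.arrays 15 := by rw [hF.arr 15 rfl]; simp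
    simp only [eval, h3, h15, hcnt] at he
    have h5 : T.os o + l < T.os (o + 1) := by grind
    rw [if_pos h5] at he
    simp only [wp_set, eval, h3]
    refine ⟨T.os (o + 1) - (T.os o + (l + 1)), by omega, l + 1, by omega, by omega, rfl, by omega,
      by simp [add_assoc], fun i h6 h7 => ?_⟩
    grind
  · rintro k t τ ⟨l, h1, h2, rfl, rfl, h3, h4⟩ hF he
    have h15 : τ.regs 15 = T.os (o + 1) := by rw [hF.reg 15 rfl]; simp
    have h13 : τ.regs 13 = o := by rw [hF.reg 13 rfl]; simp [hoeq]
    have h10 : τ.regs 10 = σ.regs 10 := by rw [hF.reg 10 rfl]; simp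
    have harr : τ.arrays = σ.arrays := by
      funext a
      rw [hF.arr a rfl]
      simp
    simp only [eval, h3, h15, harr] at he
    have h5 : T.os o + l < T.os (o + 1) → σ.arrays 15 (T.os o + l) ≠ 0 := by grind
    have hA := StripInv.advance hT h ho h1 h2 h4
    have hpot := pot_update (lv := σ.arrays 17) (l := l) ho
    have hsub : T.os o + l - T.os o = l := by omega
    simp only [wp_seq, wp_set, wp_put, wp_cond, wp_skip, eval, regs_setReg,
      arrays_setReg, regs_setArr, arrays_setArr, h3, h15, h13, h10, harr, hL.os,
      hL.pv, hL.rho, hsub, if_true, if_false, reduceEqDiff, StripSt]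
    have hne : ∀ o', o' ≠ o → update (σ.arrays 17) o l o' = σ.arrays 17 o' :=
      fun o' ho' => update_of_ne ho' _ _
    refine ⟨fun h6 => ⟨fun h7 => ⟨fun h8 => ?_, fun h8 => ⟨fun h9 => ?_, fun h9 => ?_⟩⟩,
      fun h7 => ?_⟩, fun h6 => ?_⟩
    · refine ⟨by omega, hA, StripInv.settled hT hA ho hv ?_ ?_, hne, fun _ h => h,
          fun _ _ => trivial,
        le_rfl⟩
      · simpa using h5
      · simpa using fun _ _ => h8
    all_goals
      simp only [ite_eq_right_iff, one_ne_zero, imp_false, not_lt, ne_eq] at h6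
    pick_goal 4
    · refine ⟨by omega, hA, StripInv.settled hT hA ho hv ?_ ?_, hne, fun _ h => h,
          fun _ _ => trivial,
        le_rfl⟩
      · simpa using h5
      · simpa using fun h => absurd h (not_lt.2 h6)
    all_goals
      simp only [ite_eq_right_iff, one_ne_zero, imp_false, not_not, ne_eq] at h7
    pick_goal 3
    · refine ⟨by omega, hA, StripInv.settled hT hA ho hv ?_ ?_, hne, fun _ h => h,
          fun _ _ => trivial,
        le_rfl⟩
      · simpa using h5
      · simpa using fun _ h => absurd h h7
    all_goals
      obtain ⟨c, hc, hco, hcp⟩ := hA.exists_uniq hT ho hv (by simpa using h6) (by simpa using h7)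
      rw [update_self] at hcp
      rw [← hcp] at h8
      have hu : R (T.pv (T.cp c)) = T.u R (T.cp c) := rfl
      simp only [← hcp, hu, update_self] at h9 ⊢
      have hmono : ∀ p, σ.arrays 10 p ≠ 0 → update (σ.arrays 10) (T.cp c) 1 p ≠ 0 := by
        grind
    · obtain ⟨hM, hM1, hM2⟩ := hA.mark hT hR hc (hco ▸ hv) h8 _ _ rfl rfl
      rw [if_neg h9, if_neg h9] at hM
      refine ⟨by omega, hM, StripInv.settled hT hM ho hv ?_ ?_, hne, hmono, fun _ _ => trivial,
          le_rfl⟩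
      · simpa using h5
      · simp [← hcp]
    · obtain ⟨hM, hM1, hM2⟩ := hA.mark hT hR hc (hco ▸ hv) h8 _ _ rfl rfl
      rw [if_pos h9] at hM hM1 hM2
      rw [if_pos h9] at hM
      refine ⟨by omega, hM, StripInv.settled hT hM ho hv ?_ ?_, hne, hmono, hM1, by omega⟩
      · simpa using h5
      · simp [← hcp]

end

end Strip

section Strip

open Exp Cmd

variable {T : Tab} {R : ℕ → ℕ} {σ : State}

/-- The arrays `11`, …, `14` hold the lists of cells, the first cells and the invalid options. -/
structure Lists (T : Tab) (R : ℕ → ℕ) (σ : State) : Prop where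
  head_eq : ∀ v < T.nv, σ.arrays 11 v = last (T.w R) T.nc v
  next_eq : ∀ c < T.nc, σ.arrays 12 c = last (T.w R) c (T.w R c)
  cf_iff : ∀ c < T.nc, (σ.arrays 13 c ≠ 0 ↔ T.First R c)
  inv_iff : ∀ o < T.no, (σ.arrays 14 o = 0 ↔ T.Valid R o)

/-- The program does not write to the lists. -/
def Cmd.keepsLists (c : Cmd) : Bool := !c.wrA 11 && !c.wrA 12 && !c.wrA 13 && !c.wrA 14

theorem Lists.frame {c : Cmd} {σ τ : State} (h : Lists T R σ)
    (hF : Frame c σ τ) (hc : c.keepsLists = true) : Lists T R τ := by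
  simp only [Cmd.keepsLists, Bool.and_eq_true, Bool.not_eq_true'] at hc
  obtain ⟨⟨⟨h1, h2⟩, h3⟩, h4⟩ := hc
  constructor
  · rw [hF.arr _ h1]; exact h.head_eq
  · rw [hF.arr _ h2]; exact h.next_eq
  · rw [hF.arr _ h3]; exact h.cf_iff
  · rw [hF.arr _ h4]; exact h.inv_iff

theorem mem_alive {Y : Set ℕ} {c : ℕ} :
    c ∈ T.alive R Y ↔ c < T.nc ∧ T.First R c ∧ T.w R c ∉ Y := by
  simp [Tab.alive, Tab.firsts, and_assoc]

theorem alive_empty : T.alive R ∅ = T.firsts R T.nc := by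
  simp [Tab.alive]

/-- Every option is settled. -/
def Tab.AllSettled (T : Tab) (R : ℕ → ℕ) (A : Finset ℕ) (σ : State) : Prop :=
  ∀ o < T.no, T.Valid R o → T.Settled A (σ.arrays 10) (σ.arrays 17) o

/-- Prepare a round. -/
def cmdInit : Cmd :=
  cmdReset ;; cmdPairs ;; cmdCells ;; set 9 (lit 0) ;; set 10 (lit 0) ;; set 16 (lit 0)

/-- At the start of a round, every cell is alive and nothing is stripped. -/
theorem wp_cmdInit (hT : T.WF) (hR : ∀ v < T.nv, R v < T.nv) (hL : Loaded T R σ) :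
    WP cmdInit σ fun t τ => t ≤ 40 * (T.nv + T.np + T.no + T.nc + 1) ∧ Lists T R τ ∧
      StripSt T R (T.alive R ∅) ∅ (fun _ => False) τ ∧ (∀ o < T.no, τ.arrays 17 o = 0) ∧
      τ.regs 9 = 0 ∧ τ.regs 10 = 0 ∧ τ.regs 16 = 0 := by
  rw [cmdInit, wp_seq]
  refine (wp_cmdReset hL).frame.mono ?_
  rintro t τ ⟨⟨ht, hRD⟩, hF⟩
  have hL1 := hL.frame hF rfl
  rw [wp_seq]
  refine (wp_cmdPairs hT hR hL1 hRD).frame.mono ?_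
  rintro t1 τ1 ⟨⟨ht1, lp, hP⟩, hF1⟩
  have hL2 := hL1.frame hF1 rfl
  rw [wp_seq]
  refine (wp_cmdCells hT hR hL2 (by rw [hF1.arr 11 rfl]; exact hRD.head)
    (by rw [hF1.arr 14 rfl]; exact hRD.inv) (by rw [hF1.arr 15 rfl]; exact hRD.cnt)
    (by rw [hF1.arr 16 rfl]; exact hRD.sum)).frame.mono ?_
  rintro t2 τ2 ⟨⟨ht2, hC⟩, hF2⟩
  have hlv : ∀ o < T.no, τ2.arrays 17 o = 0 := by
    rw [hF2.arr 17 rfl, hF1.arr 17 rfl]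
    exact hRD.lv
  simp only [wp_seq, wp_set, eval]
  refine ⟨by omega, ⟨hC.head_eq, hC.next_eq, hC.cf_iff, hC.inv_iff⟩, ?_, by simpa using hlv,
      by simp,
    by simp, by simp⟩
  rw [alive_empty]
  simp only [StripSt, arrays_setReg, regs_setReg, reduceEqDiff, if_true, if_false]
  have hfree : τ2.arrays 10 = τ1.arrays 10 := hF2.arr 10 rfl
  have hneed : τ2.arrays 9 = τ1.arrays 9 := hF2.arr 9 rfl
  rw [hfree, hneed]
  refine ⟨fun _ h => h, hC.cnt_eq, hC.sum_eq, ?_, ?_, ?_, ?_, ?_, ?_, ?_, ?_, ?_, ?_⟩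
  · intro o ho
    rw [hlv o ho]
    exact hT.os_mono o ho
  · intro c hc _
    simp only [Tab.firsts, Finset.mem_filter, Finset.mem_range] at hc
    rw [hlv _ (hT.co_lt c hc.1)]
    exact Nat.zero_le _
  · rw [hP.free_zero]
    exact one_ne_zero
  · intro p h1 h2 h3
    exact (hP.free_iff p h1 h2).1 h3
  · intro p h1 h2 h3 h4
    exact absurd ((hP.free_iff p h1 h2).2 h3) h4
  · simp
  · intro v hv _
    rw [hP.need_eq v hv, add_comm]
  · intro v hv
    rw [hP.need_eq v hv]
    simp
  · omega
  · omega

/-! #### Settling all options and releasing the variables -/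

/-- Settle all options that are valid. -/
def cmdSettleAll : Cmd := Cmd.for 13 (lit 0) (reg 3) (cond (get 14 (reg 13)) skip cmdSettle)

theorem wp_cmdSettleAll (hT : T.WF) (hR : ∀ v < T.nv, R v < T.nv) (hL : Loaded T R σ)
    (hS : Lists T R σ) {A : Finset ℕ} (h : StripSt T R A ∅ (fun _ => False) σ) :
    WP cmdSettleAll σ fun t τ => t ≤ 23 * T.no + 2 * T.nc + 2 ∧
      StripSt T R A ∅ (fun _ => False) τ ∧ T.AllSettled R A τ := by
  rw [cmdSettleAll]
  refine wp_for_time 0 T.no (fun i t τ => t + 2 * T.pot (σ.arrays 17) ≤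
    21 * i + 2 * T.pot (τ.arrays 17) ∧ StripSt T R A ∅ (fun _ => False) τ ∧
    ∀ o < i, T.Valid R o → T.Settled A (τ.arrays 10) (τ.arrays 17) o) rfl (Nat.zero_le _) rfl
    (fun τ hF => (hL.frame hF rfl).no) ⟨by simp, by simpa [StripSt] using h, by simp⟩ ?_ ?_
  · rintro i t τ - hi ⟨ht, hJ, hJ'⟩ hr hF
    have hL' := hL.frame hF rfl
    have hS' := hS.frame hF rfl
    rw [wp_cond, wp_skip]
    simp only [eval, hr]
    refine ⟨fun h1 => ⟨by simp; omega, by simpa [StripSt] using hJ, fun o ho hv => ?_⟩,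
        fun h1 => ?_⟩
    · rcases lt_succ_iff_lt_or_eq.1 ho with h2 | rfl
      · simpa using hJ' o h2 hv
      · exact absurd ((hS'.inv_iff _ hi).2 hv) h1
    · refine (wp_cmdSettle hT hR hL' hJ (by omega)
        (by rw [hr]; exact (hS'.inv_iff _ hi).1 h1)).mono ?_
      rintro u υ ⟨hu, h2, h3, h4, h5, -, -⟩
      rw [hr] at h3 h4
      refine ⟨by simp; omega, by simpa [StripSt] using h2, fun o ho hv => ?_⟩
      simp only [arrays_setReg]
      rcases lt_succ_iff_lt_or_eq.1 ho with h6 | rfl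
      · have h7 := hJ' o h6 hv
        refine ⟨fun c hc hu => h5 _ (h7.uniq c hc hu), fun hc => ?_⟩
        rw [h4 o h6.ne]
        exact h7.level hc
      · exact h3
  · rintro t τ ⟨ht, hJ, hJ'⟩ hF
    refine ⟨?_, hJ, hJ'⟩
    have := hT.sum_len_le _ hJ.lv_le
    unfold Tab.pot at ht
    omega

/-- Release the representatives. Those among the variables of the instance are counted in register
`16`. -/
def cmdRelease : Cmd :=
  Cmd.for 5 (lit 0) (reg 1)
    (cond (equal (get 8 (reg 5)) (reg 5))
      (put 9 (reg 5) (minus (get 9 (reg 5)) (lit 1)) ;;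
        cond (get 9 (reg 5)) skip (put 18 (reg 10) (reg 5) ;; set 10 (plus (reg 10) (lit 1))) ;;
        cond (less (reg 5) (reg 0)) (set 16 (plus (reg 16) (lit 1))) skip)
      skip)

theorem StripInv.rel_congr {A : Finset ℕ} {Y : Set ℕ} {rel rel' : ℕ → Prop}
    {need free cnt sum lv q : ℕ → ℕ} {qt : ℕ} (h : StripInv T R A Y rel need free cnt sum lv q qt)
    (hr : ∀ v < T.nv, (rel v ↔ rel' v)) :
    StripInv T R A Y rel' need free cnt sum lv q qt :=
  { h with
    need_rel := fun v hv hv' => h.need_rel v hv ((hr v hv).2 hv')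
    need_not := fun v hv hv' => h.need_not v hv fun h' => hv' ((hr v hv).1 h') }

/-- The counter of a variable exceeds the number of its unfree pairs by one until the variable is
released, so that no variable enters the queue before all options have been settled. -/
theorem StripInv.release {A : Finset ℕ} {Y : Set ℕ} {rel : ℕ → Prop}
    {need free cnt sum lv q : ℕ → ℕ} {qt : ℕ} (h : StripInv T R A Y rel need free cnt sum lv q qt)
    {v : ℕ} (hv : v < T.nv) (hr : ¬ rel v) (q' : ℕ → ℕ) (qt' : ℕ)
    (hq : q' = if need v - 1 = 0 then update q qt v else q)
    (hqt : qt' = if need v - 1 = 0 then qt + 1 else qt) :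
    StripInv T R A Y (fun x => rel x ∨ x = v) (update need v (need v - 1)) free cnt sum lv
      q' qt' := by
  have hn : need v ≠ 0 := by
    rw [h.need_not v hv hr]
    omega
  obtain ⟨h1, h2, h3, -, -⟩ := queue_step _ need q qt _ hv h.q_iff h.q_inj h.q_lt hn rfl q' qt' hq
      hqt
  refine { h with need_rel := ?_, need_not := ?_, q_iff := h1, q_inj := h2, q_lt := h3 }
  · intro x hx hx'
    by_cases hxv : x = v
    · subst hxv
      rw [update_self, h.need_not x hx hr]
      omega
    · rw [update_of_ne hxv]
      exact h.need_rel x hx (hx'.resolve_right hxv)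
  · intro x hx hx'
    have hxv : x ≠ v := fun h => hx' (.inr h)
    rw [update_of_ne hxv]
    exact h.need_not x hx fun h => hx' (.inl h)

/-- The number of variables of the instance that are representatives outside of `Y`. -/
noncomputable def Tab.rem (T : Tab) (R : ℕ → ℕ) (Y : Set ℕ) : ℕ := {v | v < T.nr ∧ R v = v ∧ v ∉
    Y}.ncard

theorem wp_cmdRelease (hT : T.WF) (hL : Loaded T R σ) {A : Finset ℕ}
    (h : StripSt T R A ∅ (fun _ => False) σ) (hset : T.AllSettled R A σ) (h16 : σ.regs 16 = 0) :
    WP cmdRelease σ fun t τ => t ≤ 12 * T.nv + 2 ∧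
      StripSt T R A ∅ (fun v => R v = v) τ ∧ T.AllSettled R A τ ∧ τ.regs 16 = T.rem R ∅ := by
  rw [cmdRelease]
  refine wp_for 0 T.nv 10 (fun i τ => StripSt T R A ∅ (fun v => v < i ∧ R v = v) τ ∧
    τ.regs 16 = {v | v < i ∧ v < T.nr ∧ R v = v}.ncard) rfl (Nat.zero_le _) rfl
    (fun τ hF => (hL.frame hF rfl).nv) ⟨by simpa [StripSt] using h, by simp [h16]⟩ ?_ ?_
  · rintro i τ - hi ⟨hJ, hJ'⟩ hr hF
    have hL' := hL.frame hF rfl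
    have hset1 : {v | v < i + 1 ∧ v < T.nr ∧ R v = v} =
        if R i = i ∧ i < T.nr then insert i {v | v < i ∧ v < T.nr ∧ R v = v}
          else {v | v < i ∧ v < T.nr ∧ R v = v} := by
      ext v
      grind
    have hcard : {v | v < i + 1 ∧ v < T.nr ∧ R v = v}.ncard =
        {v | v < i ∧ v < T.nr ∧ R v = v}.ncard + if R i = i ∧ i < T.nr then 1 else 0 := by
      rw [hset1]
      split_ifs
      · exact Set.ncard_insert_of_notMem (by simp)
          ((Set.finite_lt_nat i).subset fun v hv => hv.1)
      · rfl
    have hrel1 : R i = i → ∀ v < T.nv, ((v < i ∧ R v = v) ∨ v = i ↔ v < i + 1 ∧ R v = v) := by grind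
    simp only [wp_seq, wp_set, wp_put, wp_cond, wp_skip, eval, regs_setReg,
      arrays_setReg, regs_setArr, arrays_setArr, hr, hL'.nr, hL'.rho, if_true,
      if_false, reduceEqDiff, update_self, StripSt]
    rw [hcard, ← hJ']
    refine ⟨fun h1 => ⟨fun h2 => ⟨fun h3 => ?_, fun h3 => ?_⟩, fun h2 => ⟨fun h3 => ?_,
        fun h3 => ?_⟩⟩,
      fun h1 => ?_⟩
    all_goals simp only [ite_eq_right_iff, one_ne_zero, imp_false, not_not, ne_eq] at h1
    pick_goal 5
    · refine ⟨by norm_num, hJ.rel_congr fun v hv => ?_, by simp [h1]⟩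
      grind
    all_goals simp only [ite_eq_right_iff, one_ne_zero, imp_false, not_not, ne_eq] at h3
    all_goals
      have hrls := (StripInv.release hJ hi (by simp) _ _ rfl rfl).rel_congr (hrel1 h1)
    · simp_all
    · simp_all
    · simp_all
    · simp_all
  · rintro t τ ht ⟨hJ, hJ'⟩ hF
    refine ⟨by omega, hJ.rel_congr fun v hv => ⟨fun h => h.2, fun h => ⟨hv, h⟩⟩, ?_, ?_⟩
    · intro o ho hv
      rw [hF.arr 10 rfl, hF.arr 17 rfl]
      exact hset o ho hv
    · rw [hJ', Tab.rem]
      congr 1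
      ext v
      simp only [Set.mem_ofPred_eq, Set.mem_empty_iff_false, not_false_eq_true, and_true]
      exact ⟨fun h => h.2, fun h => ⟨h.1.trans_le hT.nr_le, h⟩⟩

end Strip

section Strip

open Exp Cmd

variable {T : Tab} {R : ℕ → ℕ} {σ : State}

/-! #### Removing the cells of a variable -/

theorem StripInv.mono {A : Finset ℕ} {Y Y' : Set ℕ} {rel : ℕ → Prop}
    {need free cnt sum lv q : ℕ → ℕ} {qt : ℕ} (h : StripInv T R A Y rel need free cnt sum lv q qt)
    (hY : Y ⊆ Y') : StripInv T R A Y' rel need free cnt sum lv q qt :=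
  { h with free_one := fun p h1 h2 h3 h4 => (h.free_one p h1 h2 h3 h4).imp_left fun h => hY h }

/-- A cell of a stripped variable is no longer counted. -/
theorem StripInv.remove (hT : T.WF) {B : Finset ℕ} {Y : Set ℕ} {rel : ℕ → Prop}
    {need free cnt sum lv q : ℕ → ℕ} {qt c : ℕ}
    (h : StripInv T R (insert c B) Y rel need free cnt sum lv q qt) (hc : c ∉ B)
    (hw : T.w R c ∈ Y) :
    StripInv T R B Y rel need free (update cnt (T.slot c) (cnt (T.slot c) - 1))
      (update sum (T.slot c) (sum (T.slot c) - T.cp c)) lv q qt := by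
  refine { h with
    sub := fun x hx => h.sub (Finset.mem_insert_of_mem hx), cnt_eq := ?_, sum_eq := ?_,
        lv_min := ?_,
    free_one := ?_ }
  · intro s hs
    have h1 := h.cnt_eq s hs
    rw [cntOf_insert hc] at h1
    grind
  · intro s hs
    have h1 := h.sum_eq s hs
    rw [sumOf_insert hc] at h1
    grind
  · intro c' hc' hv
    exact h.lv_min c' (Finset.mem_insert_of_mem hc') hv
  · intro p h1 h2 h3 h4
    rcases h.free_one p h1 h2 h3 h4 with h5 | ⟨c', h5, h6, rfl⟩
    · exact .inl h5
    · by_cases hcc : c' = c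
      · subst hcc
        left
        rw [Tab.u, hT.pv_cp _ (h.lt_nc h5.1) (by omega)]
        exact hw
      · exact .inr ⟨c', h5.mono (Finset.subset_insert _ _)
          ((Finset.mem_insert.1 h5.1).resolve_left hcc), h6, rfl⟩

theorem Tab.Settled.remove {B : Finset ℕ} {free lv : ℕ → ℕ} {o c : ℕ}
    (h : T.Settled (insert c B) free lv o) (ho : T.co c ≠ o) : T.Settled B free lv o := by
  have hne : ∀ c', T.co c' = o → c' ≠ c := fun c' h1 h2 => ho (h2 ▸ h1)
  constructor
  · intro c' hc' hu
    refine h.uniq c' hc' ⟨Finset.mem_insert_of_mem hu.1, fun x hx hxo hxc => ?_⟩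
    exact hu.2 x ((Finset.mem_insert.1 hx).resolve_left (hne x (hxo.trans hc'))) hxo hxc
  · rintro ⟨c', hc', hco⟩
    obtain ⟨x, hx, hxo, hxl⟩ := h.level ⟨c', Finset.mem_insert_of_mem hc', hco⟩
    grind

/-- Remove the cell in register `8`. -/
def cmdRemove : Cmd :=
  cond (get 13 (reg 8))
    (set 13 (get 4 (reg 8)) ;;
      set 14 (plus (get 5 (reg 13)) (get 3 (reg 8))) ;;
      put 15 (reg 14) (minus (get 15 (reg 14)) (lit 1)) ;;
      put 16 (reg 14) (minus (get 16 (reg 14)) (get 2 (reg 8))) ;;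
      cond (get 14 (reg 13)) skip cmdSettle)
    skip

theorem wp_cmdRemove (hT : T.WF) (hR : ∀ v < T.nv, R v < T.nv) (hL : Loaded T R σ)
    (hS : Lists T R σ) {B : Finset ℕ} {Y : Set ℕ} {rel : ℕ → Prop} {c : ℕ} (hc8 : σ.regs 8 = c)
    (hc : c < T.nc) (hcB : c ∉ B) (hw : T.w R c ∈ Y) (hF : T.First R c)
    (h : StripSt T R (insert c B) Y rel σ) (hset : T.AllSettled R (insert c B) σ) :
    WP cmdRemove σ fun t τ => t + 2 * T.pot (σ.arrays 17) ≤ 30 + 2 * T.pot (τ.arrays 17) ∧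
      StripSt T R B Y rel τ ∧ T.AllSettled R B τ ∧
      (∀ i < σ.regs 10, τ.arrays 18 i = σ.arrays 18 i) ∧ σ.regs 10 ≤ τ.regs 10 := by
  have hrm := StripInv.remove hT h hcB hw
  rw [cmdRemove, wp_cond]
  simp only [eval, hc8]
  refine ⟨fun _ => ?_, fun h0 => absurd h0 ((hS.cf_iff c hc).2 hF)⟩
  simp only [wp_seq, wp_set, wp_put, eval, regs_setReg, arrays_setReg, regs_setArr,
    arrays_setArr, hc8, hL.co, hL.os, hL.cr, hL.cp, if_true, if_false, reduceEqDiff]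
  have hs : T.os (T.co c) + T.cr c = T.slot c := rfl
  rw [hs, wp_cond, wp_skip]
  set υ := (((σ.setReg 13 (T.co c)).setReg 14 (T.slot c)).setArr 15 (T.slot c)
    (σ.arrays 15 (T.slot c) - 1)).setArr 16 (T.slot c) (σ.arrays 16 (T.slot c) - T.cp c) with hυ
  have hLυ : Loaded T R υ := by
    constructor <;> simp [hυ, hL.nr, hL.nv, hL.np, hL.no, hL.nc, hL.cv, hL.cp, hL.cr, hL.co, hL.os,
      hL.pg, hL.pv, hL.rho]
  have hSt : StripSt T R B Y rel υ := by
    simp only [StripSt, hυ, arrays_setArr, arrays_setReg, regs_setArr,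
      regs_setReg, if_true, if_false, reduceEqDiff]
    exact hrm
  have e14 : υ.arrays 14 = σ.arrays 14 := by simp [hυ]
  have e10 : υ.arrays 10 = σ.arrays 10 := by simp [hυ]
  have e17 : υ.arrays 17 = σ.arrays 17 := by simp [hυ]
  have e18 : υ.arrays 18 = σ.arrays 18 := by simp [hυ]
  have r10 : υ.regs 10 = σ.regs 10 := by simp [hυ]
  have r13 : υ.regs 13 = T.co c := by simp [hυ]
  simp only [eval, r13, e14]
  refine ⟨fun h1 => ?_, fun h1 => ?_⟩
  · refine ⟨by rw [e17]; omega, hSt, fun o ho hv => ?_, by simp [e18], r10.ge⟩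
    rw [e10, e17]
    refine (hset o ho hv).remove ?_
    rintro rfl
    exact h1 ((hS.inv_iff _ ho).2 hv)
  · refine (wp_cmdSettle hT hR hLυ hSt (by rw [r13]; exact hT.co_lt c hc)
      (by rw [r13]; exact (hS.inv_iff _ (hT.co_lt c hc)).1 h1)).mono ?_
    rintro t τ ⟨h2, h3, h4, h5, h6, h7, h8⟩
    rw [r13] at h4 h5
    rw [e17] at h2 h5
    rw [e10] at h6
    rw [e18, r10] at h7
    rw [r10] at h8
    refine ⟨by omega, h3, fun o ho hv => ?_, h7, h8⟩
    by_cases hoc : o = T.co c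
    · simp_all
    · have h9 := (hset o ho hv).remove (Ne.symm hoc)
      refine ⟨fun c hc hu => h6 _ (h9.uniq c hc hu), fun hc => ?_⟩
      rw [h5 o hoc]
      exact h9.level hc

open Classical in
/-- What is left of the alive cells when the cells of `v` from number `i` on have been removed. -/
noncomputable def Tab.remain (T : Tab) (R : ℕ → ℕ) (Y : Set ℕ) (v i : ℕ) : Finset ℕ :=
  (T.alive R Y).filter fun c => T.w R c ≠ v ∨ c < i

/-- The number of cells of `v` from number `i` on. -/
def Tab.degFrom (T : Tab) (R : ℕ → ℕ) (v i : ℕ) : ℕ :=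
  ((Finset.range T.nc).filter fun c => i ≤ c ∧ T.w R c = v).card

theorem degFrom_succ {v i : ℕ} (hi : i < T.nc) :
    T.degFrom R v i = T.degFrom R v (i + 1) + if T.w R i = v then 1 else 0 := by
  unfold Tab.degFrom
  by_cases hw : T.w R i = v
  · have : (Finset.range T.nc).filter (fun c => i ≤ c ∧ T.w R c = v) =
        insert i ((Finset.range T.nc).filter fun c => i + 1 ≤ c ∧ T.w R c = v) := by grind
    simp_all
  · rw [if_neg hw, add_zero]
    congr 1
    grind

/-- The walk along the list of the cells of `v` removes them one by one. -/
theorem wp_removeAll (hT : T.WF) (hR : ∀ v < T.nv, R v < T.nv) (hL : Loaded T R σ)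
    (hS : Lists T R σ) {Y : Set ℕ} {rel : ℕ → Prop} {v : ℕ} (hv : σ.regs 11 = v) (hvn : v < T.nv)
    (hvY : v ∉ Y) (h : StripSt T R (T.alive R Y) Y rel σ)
    (hset : T.AllSettled R (T.alive R Y) σ) :
    WP (Cmd.walk 7 8 12 (get 11 (reg 11)) cmdRemove) σ fun t τ =>
      t + 2 * T.pot (σ.arrays 17) ≤ 2 + 33 * T.degFrom R v 0 + 2 * T.pot (τ.arrays 17) ∧
      StripSt T R (T.alive R (insert v Y)) (insert v Y) rel τ ∧
      T.AllSettled R (T.alive R (insert v Y)) τ ∧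
      (∀ i < σ.regs 10, τ.arrays 18 i = σ.arrays 18 i) ∧ σ.regs 10 ≤ τ.regs 10 := by
  classical
  have hremN : T.remain R Y v T.nc = T.alive R Y := by
    ext c
    simp only [Tab.remain, Finset.mem_filter, mem_alive]
    tauto
  have hrem0 : T.remain R Y v 0 = T.alive R (insert v Y) := by
    ext c
    simp only [Tab.remain, Finset.mem_filter, mem_alive, Set.mem_insert_iff]
    simp
    tauto
  have hskip : ∀ i, (T.w R i ≠ v ∨ ¬ T.First R i) → T.remain R Y v (i + 1) = T.remain R Y v i := by
    intro i hi
    ext c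
    simp only [Tab.remain, Finset.mem_filter, mem_alive]
    grind
  have hstep : ∀ i < T.nc, T.w R i = v → T.First R i →
      T.remain R Y v (i + 1) = insert i (T.remain R Y v i) := by
    intro i hi hw hF
    ext c
    simp only [Tab.remain, Finset.mem_filter, mem_alive, Finset.mem_insert]
    constructor
    · grind
    · grind
  refine wp_walk (T.w R) v T.nc (fun i t τ =>
    t + 2 * T.pot (σ.arrays 17) ≤ 33 * T.degFrom R v i + 2 * T.pot (τ.arrays 17) ∧
      StripSt T R (T.remain R Y v i) (insert v Y) rel τ ∧
      T.AllSettled R (T.remain R Y v i) τ ∧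
      (∀ i < σ.regs 10, τ.arrays 18 i = σ.arrays 18 i) ∧ σ.regs 10 ≤ τ.regs 10)
    ?_ (by norm_num) rfl ?_ ?_ ?_ ?_ ?_ ?_ ?_
  · simp only [eval, hv]
    exact hS.head_eq v hvn
  · intro τ hF c hc hcv
    rw [← hcv]
    exact (hS.frame hF rfl).next_eq c hc
  · intro i t τ x hJ
    simpa [StripSt, Tab.AllSettled] using hJ
  · intro i t τ x hJ
    simpa [StripSt, Tab.AllSettled] using hJ
  · rw [hremN]
    exact ⟨by omega, StripInv.mono h (Set.subset_insert _ _), hset, fun _ _ => rfl, le_rfl⟩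
  · rintro i t τ hi hw ⟨h1, h2⟩
    rw [hskip i (.inl hw)] at h2
    rw [degFrom_succ hi, if_neg hw]
    exact ⟨h1, h2⟩
  · rintro i t τ hi hw ⟨h1, h2, h3, h4, h5⟩ hr hF
    have hL' := hL.frame hF rfl
    have hS' := hS.frame hF rfl
    rw [degFrom_succ hi, if_pos hw]
    by_cases hFi : T.First R i
    · rw [hstep i hi hw hFi] at h2 h3
      refine (wp_cmdRemove hT hR hL' hS' hr hi (by simp [Tab.remain, hw]) (by rw [hw]; simp) hFi h2
        h3).mono ?_
      grind
    · rw [hskip i (.inr hFi)] at h2 h3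
      rw [cmdRemove, wp_cond, wp_skip]
      simp only [eval, hr]
      refine ⟨fun h0 => absurd ((hS'.cf_iff i hi).1 h0) hFi, fun _ => ⟨by omega, h2, h3, h4, h5⟩⟩
  · grind

end Strip

section Strip

open Exp Cmd

variable {T : Tab} {R : ℕ → ℕ} {σ : State}

/-! #### The queue -/

/-- All pairs of the variable are good for this variable alone. -/
def Tab.FlatSink (T : Tab) (R : ℕ → ℕ) (Y : Set ℕ) (v : ℕ) : Prop :=
  ∀ p, 1 ≤ p → p < T.np → T.Canon R p → T.u R p = v → T.FlatGood R Y p {v}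

theorem flatGood_of_uniq (hT : T.WF) {Y : Set ℕ} {c : ℕ} (hc : T.Uniq (T.alive R Y) c)
    (hv : T.Valid R (T.co c)) (hp : T.cp c ≠ 0) :
    T.FlatGood R Y (T.cp c) {T.u R (T.cp c)} := by
  have hcn := (mem_alive.1 hc.1).1
  refine ⟨c, hc.1, hv, rfl, fun c' hc' hco => ?_⟩
  by_cases hcc : c' = c
  · subst hcc
    refine ⟨le_rfl, fun _ => ?_⟩
    simp [Tab.u, Tab.w, hT.pv_cp _ hcn hp]
  · have := hc.2 c' hc' hco hcc
    exact ⟨this.le, fun h => by omega⟩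

theorem uniq_of_flatGood {Y : Set ℕ} {p : ℕ} (hp : p ≠ 0)
    (h : T.FlatGood R Y p {T.u R p}) :
    ∃ c, T.Uniq (T.alive R Y) c ∧ T.Valid R (T.co c) ∧ T.cp c = p := by
  obtain ⟨c, hc, hv, rfl, h1⟩ := h
  obtain ⟨hcn, hcF, hcY⟩ := mem_alive.1 hc
  refine ⟨c, ⟨hc, fun c' hc' hco hne => ?_⟩, hv, rfl⟩
  obtain ⟨h2, h3⟩ := h1 c' hc' hco
  rcases Nat.lt_or_eq_of_le h2 with h4 | h4
  · exact h4
  · have h5 := h3 h4.symm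
    obtain ⟨hcn', hcF', -⟩ := mem_alive.1 hc'
    have h6 : T.w R c' = T.w R c := by simp_all
    rcases lt_trichotomy c' c with h8 | h8 | h8
    · exact absurd h6 (hcF c' h8 hco)
    · exact absurd h8 hne
    · exact absurd h6.symm (hcF' c h8 hco.symm)

/-- A marked-by-`0` pair is not good for its variable alone. -/
theorem not_flatGood (hT : T.WF) {Y : Set ℕ} (hset : T.AllSettled R (T.alive R Y) σ) {p : ℕ}
    (hp : p ≠ 0) (hf : σ.arrays 10 p = 0) : ¬ T.FlatGood R Y p {T.u R p} := by
  intro h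
  obtain ⟨c, hc, hv, rfl⟩ := uniq_of_flatGood hp h
  exact (hset _ (hT.co_lt c (mem_alive.1 hc.1).1) hv).uniq c rfl hc hf

/-- The output for the variables taken from the queue. -/
def stripWords (n : ℕ) (L : List ℕ) : List ℕ := L.flatMap fun v => if v < n then [0, v] else []

/-- Take variables from the queue, report them and remove their cells. -/
def cmdQueue : Cmd :=
  loop (less (reg 9) (reg 10))
    (set 11 (get 18 (reg 9)) ;;
      set 9 (plus (reg 9) (lit 1)) ;;
      cond (less (reg 11) (reg 0))
        (emit (lit 0) ;; emit (reg 11) ;; set 16 (minus (reg 16) (lit 1))) skip ;;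
      Cmd.walk 7 8 12 (get 11 (reg 11)) cmdRemove)

/-- The variables that have been taken from the queue. -/
def qlist (σ : State) : List ℕ := (List.range (σ.regs 9)).map (σ.arrays 18)

/-- The state when the queue is empty. `L` lists the variables that have been stripped. -/
structure StripDone (T : Tab) (R : ℕ → ℕ) (L : List ℕ) (σ : State) : Prop where
  inv : StripSt T R (T.alive R {x | x ∈ L}) {x | x ∈ L} (fun v => R v = v) σ
  settled : T.AllSettled R (T.alive R {x | x ∈ L}) σ
  rem_eq : σ.regs 16 = T.rem R {x | x ∈ L}
  mem_lt : ∀ x ∈ L, x < T.nv ∧ R x = x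
  need_iff : ∀ v < T.nv, (σ.arrays 9 v = 0 ↔ v ∈ L)

/-- The number of cells of the variables in `L`. -/
def Tab.degOf (T : Tab) (R : ℕ → ℕ) (L : List ℕ) : ℕ :=
  ((Finset.range T.nc).filter fun c => T.w R c ∈ L).card

theorem degOf_concat {L : List ℕ} {v : ℕ} (hv : v ∉ L) :
    T.degOf R (L ++ [v]) = T.degOf R L + T.degFrom R v 0 := by
  unfold Tab.degOf Tab.degFrom
  rw [← Finset.card_union_of_disjoint]
  · congr 1
    grind
  · rw [Finset.disjoint_left]
    grind

theorem rem_concat {L : List ℕ} {v : ℕ} (hv : v ∉ L) (hRv : R v = v) :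
    T.rem R {x | x ∈ L} = T.rem R {x | x ∈ L ++ [v]} + if v < T.nr then 1 else 0 := by
  unfold Tab.rem
  by_cases hn : v < T.nr
  · rw [if_pos hn]
    have : {x | x < T.nr ∧ R x = x ∧ x ∉ {x | x ∈ L}} =
        insert v {x | x < T.nr ∧ R x = x ∧ x ∉ {x | x ∈ L ++ [v]}} := by
      ext x
      simp only [Set.mem_ofPred_eq, Set.mem_insert_iff, mem_append, mem_singleton]
      grind
    rw [this, Set.ncard_insert_of_notMem (by simp)
      ((Set.finite_lt_nat T.nr).subset fun v hv => hv.1)]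
  · grind

theorem StripInv.qt_le {A : Finset ℕ} {Y : Set ℕ} {rel : ℕ → Prop}
    {need free cnt sum lv q : ℕ → ℕ} {qt : ℕ} (h : StripInv T R A Y rel need free cnt sum lv q qt) :
    qt ≤ T.nv := by
  have := Finset.card_le_card_of_injOn (s := Finset.range qt) (t := Finset.range T.nv) q
    (fun i hi => by simpa using h.q_lt i (by simpa using hi))
    (fun i hi j hj hij => h.q_inj i (by simpa using hi) j (by simpa using hj) hij)
  simpa using this

/-- The time is bounded by the number of variables taken from the queue, the number of their cells
and the levels of the options. The property `M` of the list of stripped variables records what the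
execution of the algorithm has done so far. -/
theorem wp_cmdQueue (hT : T.WF) (hR : ∀ v < T.nv, R v < T.nv) (hL : Loaded T R σ)
    (hS : Lists T R σ) (h : StripSt T R (T.alive R ∅) ∅ (fun v => R v = v) σ)
    (hset : T.AllSettled R (T.alive R ∅) σ) (h9 : σ.regs 9 = 0) (h16 : σ.regs 16 = T.rem R ∅)
    (M : List ℕ → Prop) (hM0 : M [])
    (hM : ∀ L v, M L → v ∉ L → v < T.nv → R v = v → T.FlatSink R {x | x ∈ L} v → M (L ++ [v])) :
    WP cmdQueue σ fun t τ => t ≤ 20 * T.nv + 40 * T.nc + 1 ∧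
      ∃ L, M L ∧ StripDone T R L τ ∧ τ.out = σ.out ++ stripWords T.nr L := by
  have hq0 : qlist σ = [] := by simp [qlist, h9]
  rw [cmdQueue]
  refine wp_loop (fun k t τ => ∃ L, L = qlist τ ∧ k = T.nv - τ.regs 9 ∧ τ.regs 9 ≤ τ.regs 10 ∧ M L ∧
    StripSt T R (T.alive R {x | x ∈ L}) {x | x ∈ L} (fun v => R v = v) τ ∧
    T.AllSettled R (T.alive R {x | x ∈ L}) τ ∧ τ.out = σ.out ++ stripWords T.nr L ∧
    τ.regs 16 = T.rem R {x | x ∈ L} ∧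
    t + 2 * T.pot (σ.arrays 17) ≤ 20 * τ.regs 9 + 33 * T.degOf R L + 2 * T.pot (τ.arrays 17))
    ⟨[], hq0.symm, rfl, by omega, hM0, by simpa using h, by simpa using hset, by simp [stripWords],
      by simpa using h16, by omega⟩ ?_ ?_
  · rintro k t τ ⟨L, hLq, rfl, hle, hML, hJ, hJs, hout, hrem, ht⟩ hF he
    have hL' := hL.frame hF rfl
    have hS' := hS.frame hF rfl
    have hlt : τ.regs 9 < τ.regs 10 := by
      by_contra hge
      simp [eval, hge] at he
    set v := τ.arrays 18 (τ.regs 9) with hv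
    have hvn : v < T.nv := hJ.q_lt _ hlt
    have hmem : ∀ x, x ∈ L ↔ ∃ j < τ.regs 9, τ.arrays 18 j = x := by
      intro x
      rw [hLq]
      simp [qlist]
    have hvL : v ∉ L := by
      rw [hmem]
      rintro ⟨j, hj, hjv⟩
      have := hJ.q_inj j (by omega) _ hlt hjv
      omega
    have hneed : τ.arrays 9 v = 0 := (hJ.q_iff v hvn).2 ⟨_, hlt, rfl⟩
    have hRv : R v = v := by
      by_contra hne
      have := hJ.need_not v hvn hne
      omega
    have hsink : T.FlatSink R {x | x ∈ L} v := by
      intro p hp1 hp2 hpc hpu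
      have hfree : τ.arrays 10 p ≠ 0 := by
        intro hf
        have h1 := hJ.need_rel v hvn hRv
        rw [hneed, Tab.unfree, eq_comm, Finset.card_eq_zero] at h1
        simp_all
      rcases hJ.free_one p hp1 hp2 hpc hfree with h1 | ⟨c, h1, h2, rfl⟩
      · grind
      · have := flatGood_of_uniq hT h1 h2 (by omega)
        rwa [hpu] at this
    have hset : {x | x ∈ L ++ [v]} = insert v {x | x ∈ L} := by
      ext x
      simp [or_comm]
    have hdeg := degOf_concat (T := T) (R := R) hvL
    have hremv := rem_concat (T := T) hvL hRv
    rw [wp_seq, wp_set, wp_seq, wp_set, wp_seq]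
    -- the part of the body before the walk
    have hpre : ∀ υ : State, (υ.regs 0 = T.nr) → υ.regs 11 = v →
        WP (cond (less (reg 11) (reg 0))
          (emit (lit 0) ;; emit (reg 11) ;; set 16 (minus (reg 16) (lit 1))) skip) υ fun t ω =>
          t ≤ 4 ∧ ω.arrays = υ.arrays ∧ (∀ r, r ≠ 16 → ω.regs r = υ.regs r) ∧
          ω.out = υ.out ++ stripWords T.nr [v] ∧
          ω.regs 16 = υ.regs 16 - if v < T.nr then 1 else 0 := by
      intro υ h0 h11
      simp only [wp_seq, wp_set, wp_emit, wp_cond, wp_skip, eval, h0, h11, regs_addOut]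
      refine ⟨fun h1 => ?_, fun h1 => ?_⟩
      · have h2 : v < T.nr := by simp_all
        refine ⟨by norm_num, rfl, fun r hr => by simp [hr], by simp [stripWords, h2], by simp [h2]⟩
      · have h2 : ¬ v < T.nr := by simp_all
        refine ⟨by norm_num, trivial, fun r hr => by simp, by simp [stripWords, h2], by simp [h2]⟩
    refine (hpre _ (by simp [hL'.nr]) (by simp [eval, hv])).mono ?_
    rintro u υ ⟨hu, ha, hr, ho, h16'⟩
    have hLυ : Loaded T R υ := by
      constructor
      iterate 5
        rw [hr _ (by norm_num)]
        simp [hL'.nr, hL'.nv, hL'.np, hL'.no, hL'.nc]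
      all_goals
        rw [ha]
        simp [hL'.cv, hL'.cp, hL'.cr, hL'.co, hL'.os, hL'.pg, hL'.pv, hL'.rho]
    have hSυ : Lists T R υ := by
      constructor
      · rw [ha]; exact hS'.head_eq
      · rw [ha]; exact hS'.next_eq
      · rw [ha]; exact hS'.cf_iff
      · rw [ha]; exact hS'.inv_iff
    have h10 : υ.regs 10 = τ.regs 10 := by rw [hr _ (by norm_num)]; simp
    have h9' : υ.regs 9 = τ.regs 9 + 1 := by rw [hr _ (by norm_num)]; simp [eval]
    have hJυ : StripSt T R (T.alive R {x | x ∈ L}) {x | x ∈ L} (fun v => R v = v) υ := by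
      simp only [StripSt, ha, h10]
      simpa [StripSt] using hJ
    have hJsυ : T.AllSettled R (T.alive R {x | x ∈ L}) υ := by
      simp only [Tab.AllSettled, ha]
      simpa [Tab.AllSettled] using hJs
    refine (wp_removeAll hT hR hLυ hSυ (v := v) (by rw [hr _ (by norm_num)]; simp [eval,
        hv]) hvn hvL
      hJυ hJsυ).frame.mono ?_
    rintro u' ω ⟨⟨h1, h2, h3, h4, h5⟩, hFω⟩
    have hω9 : ω.regs 9 = τ.regs 9 + 1 := by rw [hFω.reg 9 rfl, h9']
    have hpotυ : υ.arrays 17 = τ.arrays 17 := by rw [ha]; simp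
    have hq18 : υ.arrays 18 = τ.arrays 18 := by rw [ha]; simp
    rw [hpotυ] at h1
    rw [hq18] at h4
    have hvn' := h2.qt_le
    refine ⟨T.nv - ω.regs 9, by omega, L ++ [v], ?_, rfl, by omega, hM L v hML hvL hvn hRv hsink,
        ?_,
      ?_, ?_, ?_, ?_⟩
    · rw [qlist, hω9, List.range_succ, map_append, List.map_singleton, h4 _ (by omega), hLq,
        qlist]
      congr 1
      refine map_congr_left fun j hj => ?_
      grind
    · grind
    · grind
    · rw [hFω.out rfl, ho]
      simp [hout, stripWords]
    · rw [hFω.reg 16 rfl, h16']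
      simp only [regs_setReg, reduceEqDiff, if_false]
      rw [hrem, hremv]
      omega
    · omega
  · rintro k t τ ⟨L, hLq, rfl, hle, hML, hJ, hJs, hout, hrem, ht⟩ hF he
    have hge : τ.regs 9 = τ.regs 10 := by
      by_contra hne
      have : τ.regs 9 < τ.regs 10 := by omega
      simp [eval, this] at he
    have hneed : ∀ v < T.nv, (τ.arrays 9 v = 0 ↔ v ∈ L) := by
      intro v hv
      rw [hJ.q_iff v hv, hLq]
      simp [qlist, hge]
    refine ⟨?_, L, hML, ⟨hJ, hJs, hrem, ?_, hneed⟩, hout⟩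
    · have h1 := hJ.qt_le
      have h2 := hT.sum_len_le _ hJ.lv_le
      have h3 : T.degOf R L ≤ T.nc := by
        refine (Finset.card_filter_le _ _).trans ?_
        simp
      unfold Tab.pot at ht
      omega
    · intro x hx
      have hxn : x < T.nv := by
        rw [hLq] at hx
        simp only [qlist, mem_map, mem_range] at hx
        obtain ⟨j, hj, rfl⟩ := hx
        exact hJ.q_lt j (by omega)
      refine ⟨hxn, ?_⟩
      by_contra hne
      have h1 := hJ.need_not x hxn hne
      grind

/-- A variable that has not been stripped has a pair that is marked by `0`. -/
theorem StripDone.exists_pair {L : List ℕ} (h : StripDone T R L σ) {v : ℕ} (hv : v < T.nv)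
    (hRv : R v = v) (hvL : v ∉ L) :
    ∃ p, 1 ≤ p ∧ p < T.np ∧ T.Canon R p ∧ T.u R p = v ∧ σ.arrays 10 p = 0 := by
  have h1 : σ.arrays 9 v ≠ 0 := fun h0 => hvL ((h.need_iff v hv).1 h0)
  rw [h.inv.need_rel v hv hRv, Tab.unfree, Finset.card_ne_zero] at h1
  obtain ⟨p, hp⟩ := h1
  simp only [Finset.mem_filter, Finset.mem_range] at hp
  have hp1 : 1 ≤ p := by
    by_contra h0
    obtain rfl : p = 0 := by omega
    exact h.inv.free_zero hp.2.1
  exact ⟨p, hp1, hp.1, h.inv.free_canon p hp1 hp.1 hp.2.1, hp.2.2, hp.2.1⟩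

theorem StripDone.not_flatSink (hT : T.WF) {L : List ℕ} (h : StripDone T R L σ) {v : ℕ}
    (hv : v < T.nv) (hRv : R v = v) (hvL : v ∉ L) : ¬ T.FlatSink R {x | x ∈ L} v := by
  intro hs
  obtain ⟨p, hp1, hp2, hp3, rfl, hp5⟩ := h.exists_pair hv hRv hvL
  exact not_flatGood hT h.settled (by omega) hp5 (hs p hp1 hp2 hp3 rfl)

/-- The part of a round in which variables are stripped. -/
def cmdStrip : Cmd := cmdInit ;; cmdSettleAll ;; cmdRelease ;; cmdQueue

theorem wp_cmdStrip (hT : T.WF) (hR : ∀ v < T.nv, R v < T.nv) (hL : Loaded T R σ)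
    (M : List ℕ → Prop) (hM0 : M [])
    (hM : ∀ L v, M L → v ∉ L → v < T.nv → R v = v → T.FlatSink R {x | x ∈ L} v → M (L ++ [v])) :
    WP cmdStrip σ fun t τ => t ≤ 120 * (T.nv + T.np + T.no + T.nc + 1) ∧ Lists T R τ ∧
      ∃ L, M L ∧ StripDone T R L τ ∧ τ.out = σ.out ++ stripWords T.nr L := by
  rw [cmdStrip, wp_seq]
  refine (wp_cmdInit hT hR hL).frame.mono ?_
  rintro t τ ⟨⟨h1, h2, h3, -, h4, h5, h6⟩, hF⟩
  have hL1 := hL.frame hF rfl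
  rw [wp_seq]
  refine (wp_cmdSettleAll hT hR hL1 h2 h3).frame.mono ?_
  rintro t1 τ1 ⟨⟨k1, k2, k3⟩, hF1⟩
  have hL2 := hL1.frame hF1 rfl
  have h2' := h2.frame hF1 rfl
  rw [wp_seq]
  refine (wp_cmdRelease hT hL2 k2 k3 (by rw [hF1.reg 16 rfl, h6])).frame.mono ?_
  rintro t2 τ2 ⟨⟨l1, l2, l3, l4⟩, hF2⟩
  have hL3 := hL2.frame hF2 rfl
  have h2'' := h2'.frame hF2 rfl
  refine (wp_cmdQueue hT hR hL3 h2'' l2 l3 (by rw [hF2.reg 9 rfl, hF1.reg 9 rfl, h4]) l4 M hM0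
    hM).frame.mono ?_
  rintro t3 τ3 ⟨⟨m1, L, m2, m3, m4⟩, hF3⟩
  refine ⟨by omega, h2''.frame hF3 rfl, L, m2, m3, ?_⟩
  rw [m4, hF2.out rfl, hF1.out rfl, hF.out rfl]

end Strip

/-! ### Searching -/

section Search

open Exp Cmd

variable {T : Tab} {R : ℕ → ℕ} {σ : State}

/-- Cells marked in `a` and `b` that belong to the same option give an edge from the variable of
the former to the variable of the latter. -/
def Tab.Link (T : Tab) (R : ℕ → ℕ) (a b : ℕ → ℕ) (x y : ℕ) : Prop :=
  ∃ c < T.nc, ∃ c' < T.nc, a c ≠ 0 ∧ b c' ≠ 0 ∧ T.co c = T.co c' ∧ T.w R c = x ∧ T.w R c' = y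

/-- The queue `q` holds the marked variables, without repetition. -/
structure MarkInv (T : Tab) (q mk : ℕ → ℕ) (qt : ℕ) : Prop where
  q_iff : ∀ v < T.nv, (mk v ≠ 0 ↔ ∃ j < qt, q j = v)
  q_inj : ∀ i < qt, ∀ j < qt, q i = q j → i = j
  q_lt : ∀ i < qt, q i < T.nv

/-- The invariant of the search; `P` is a property of all marked variables. -/
structure SearchInv (T : Tab) (R : ℕ → ℕ) (a b : ℕ → ℕ) (P : ℕ → Prop) (q mk hit : ℕ → ℕ)
    (qt : ℕ) : Prop where
  mark : MarkInv T q mk qt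
  hit_out : ∀ c < T.nc, hit (T.co c) ≠ 0 → b c ≠ 0 → mk (T.w R c) ≠ 0
  prop : ∀ v < T.nv, mk v ≠ 0 → P v

/-- Mark the variable in register `15`. -/
def cmdMark : Cmd :=
  cond (get 23 (reg 15)) skip
    (put 23 (reg 15) (lit 1) ;; put 18 (reg 10) (reg 15) ;; set 10 (plus (reg 10) (lit 1)))

theorem MarkInv.le {q mk : ℕ → ℕ} {qt : ℕ} (h : MarkInv T q mk qt) : qt ≤ T.nv := by
  have := Finset.card_le_card_of_injOn (s := Finset.range qt) (t := Finset.range T.nv) q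
    (fun i hi => by simpa using h.q_lt i (by simpa using hi))
    (fun i hi j hj hij => h.q_inj i (by simpa using hi) j (by simpa using hj) hij)
  simpa using this

theorem MarkInv.insert {q mk : ℕ → ℕ} {qt v : ℕ} (h : MarkInv T q mk qt) (hv : v < T.nv)
    (hm : mk v = 0) : MarkInv T (update q qt v) (update mk v 1) (qt + 1) := by
  have hnot : ∀ j < qt, q j ≠ v := fun j hj hqj => (h.q_iff v hv).2 ⟨j, hj, hqj⟩ hm
  constructor
  · intro x hx
    by_cases hxv : x = v
    · subst hxv
      exact iff_of_true (by simp) ⟨qt, by omega, by simp⟩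
    · rw [update_of_ne hxv, h.q_iff x hx]
      constructor
      · rintro ⟨j, hj, hqj⟩
        exact ⟨j, by omega, by rw [update_of_ne hj.ne]; exact hqj⟩
      · grind
  · intro i hi j hj hij
    rcases lt_succ_iff_lt_or_eq.1 hi with h1 | rfl <;>
      rcases lt_succ_iff_lt_or_eq.1 hj with h' | rfl
    · rw [update_of_ne h1.ne, update_of_ne h'.ne] at hij
      exact h.q_inj i h1 j h' hij
    · grind
    · grind
    · rfl
  · intro i hi
    rcases lt_succ_iff_lt_or_eq.1 hi with h1 | rfl
    · rw [update_of_ne h1.ne]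
      exact h.q_lt i h1
    · rwa [update_self]

/-- The effect of marking a variable. -/
structure Marked (v : ℕ) (σ τ : State) : Prop where
  self : τ.arrays 23 v ≠ 0
  other : ∀ x, x ≠ v → τ.arrays 23 x = σ.arrays 23 x
  q_eq : ∀ j < σ.regs 10, τ.arrays 18 j = σ.arrays 18 j
  le : σ.regs 10 ≤ τ.regs 10

theorem Marked.mono {v : ℕ} {σ τ : State} (h : Marked v σ τ) {x : ℕ} (hx : σ.arrays 23 x ≠ 0) :
    τ.arrays 23 x ≠ 0 := by
  by_cases hxv : x = v
  · rw [hxv]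
    exact h.self
  · rw [h.other x hxv]
    exact hx

theorem wp_cmdMark (h : MarkInv T (σ.arrays 18) (σ.arrays 23) (σ.regs 10)) {v : ℕ}
    (h15 : σ.regs 15 = v) (hv : v < T.nv) :
    WP cmdMark σ fun t τ => t ≤ 4 ∧
      MarkInv T (τ.arrays 18) (τ.arrays 23) (τ.regs 10) ∧ Marked v σ τ := by
  rw [cmdMark]
  simp only [wp_seq, wp_set, wp_put, wp_cond, wp_skip, eval, regs_setReg,
    arrays_setReg, regs_setArr, arrays_setArr, h15, if_true, if_false,
    reduceEqDiff]
  refine ⟨fun h1 => ⟨by norm_num, h, h1, fun _ _ => rfl, fun _ _ => rfl, le_rfl⟩,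
    fun h1 => ⟨by norm_num, h.insert hv h1, by simp, fun x hx => by simp [hx], fun j hj => ?_,
      by simp⟩⟩
  simp [hj.ne]

theorem SearchInv.marked {a b : ℕ → ℕ} {P : ℕ → Prop} {hit : ℕ → ℕ} {v : ℕ} {τ : State}
    (h : SearchInv T R a b P (σ.arrays 18) (σ.arrays 23) hit (σ.regs 10))
    (hm : MarkInv T (τ.arrays 18) (τ.arrays 23) (τ.regs 10)) (hv : Marked v σ τ) (hP : P v) :
    SearchInv T R a b P (τ.arrays 18) (τ.arrays 23) hit (τ.regs 10) := by
  refine ⟨hm, fun c hc h1 h2 => hv.mono (h.hit_out c hc h1 h2), fun x hx hx' => ?_⟩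
  by_cases hxv : x = v
  · rwa [hxv]
  · rw [hv.other x hxv] at hx'
    exact h.prop x hx hx'

/-- Mark the variables of the cells of the option in register `13` that are marked in the array
`b`. -/
def cmdExpand (b : ℕ) : Cmd :=
  Cmd.for 14 (get 5 (reg 13)) (get 5 (plus (reg 13) (lit 1)))
    (cond (get b (reg 14)) (set 15 (get 8 (get 1 (reg 14))) ;; cmdMark) skip)

/-- If the cell in register `8` is marked in `a`, treat its option, unless this has been done
before. -/
def cmdVisit (a b : ℕ) : Cmd :=
  cond (get a (reg 8))
    (set 13 (get 4 (reg 8)) ;;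
      cond (get 24 (reg 13)) skip (cmdExpand b ;; put 24 (reg 13) (lit 1)))
    skip

/-- Treat all variables in the queue. -/
def cmdSearch (a b : ℕ) : Cmd :=
  loop (less (reg 9) (reg 10))
    (set 11 (get 18 (reg 9)) ;;
      set 9 (plus (reg 9) (lit 1)) ;;
      Cmd.walk 7 8 12 (get 11 (reg 11)) (cmdVisit a b))

section

variable {a b : ℕ} {fa fb : ℕ → ℕ} {P : ℕ → Prop}

theorem wp_cmdExpand (hT : T.WF) (hR : ∀ v < T.nv, R v < T.nv) (hb : b = 21 ∨ b = 22)
    (hL : Loaded T R σ) (hfb : σ.arrays b = fb) {o : ℕ} (h13 : σ.regs 13 = o) (ho : o < T.no)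
    (hP : ∀ c < T.nc, T.co c = o → fb c ≠ 0 → P (T.w R c))
    (h : SearchInv T R fa fb P (σ.arrays 18) (σ.arrays 23) (σ.arrays 24) (σ.regs 10)) :
    WP (cmdExpand b) σ fun t τ => t ≤ 8 * (T.os (o + 1) - T.os o) + 2 ∧
      SearchInv T R fa fb P (τ.arrays 18) (τ.arrays 23) (τ.arrays 24) (τ.regs 10) ∧
      (∀ c < T.nc, T.co c = o → fb c ≠ 0 → τ.arrays 23 (T.w R c) ≠ 0) ∧
      (∀ x, σ.arrays 23 x ≠ 0 → τ.arrays 23 x ≠ 0) ∧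
      (∀ j < σ.regs 10, τ.arrays 18 j = σ.arrays 18 j) ∧ σ.regs 10 ≤ τ.regs 10 := by
  have hkeep : ∀ τ, Frame (cmdExpand b) σ τ → τ.arrays b = fb := by
    intro τ hF
    rw [← hfb]
    rcases hb with rfl | rfl <;> exact hF.arr _ rfl
  rw [cmdExpand] at hkeep ⊢
  refine wp_for (T.os o) (T.os (o + 1)) 6 (fun i τ =>
    SearchInv T R fa fb P (τ.arrays 18) (τ.arrays 23) (τ.arrays 24) (τ.regs 10) ∧
      (∀ c < i, T.os o ≤ c → fb c ≠ 0 → τ.arrays 23 (T.w R c) ≠ 0) ∧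
      (∀ x, σ.arrays 23 x ≠ 0 → τ.arrays 23 x ≠ 0) ∧
      (∀ j < σ.regs 10, τ.arrays 18 j = σ.arrays 18 j) ∧ σ.regs 10 ≤ τ.regs 10)
    (by simp [eval, h13, hL.os]) (hT.os_mono o ho) rfl ?_ ?_ ?_ ?_
  · intro τ hF
    have := hL.frame hF rfl
    simp only [eval, this.os]
    rw [hF.reg 13 rfl, h13]
  · simp_all
  · rintro i τ hi1 hi2 ⟨hJ, hJ1, hJ2, hJ3, hJ4⟩ hr hF
    have hL' := hL.frame hF rfl
    have hin : i < T.nc := hi2.trans_le (hT.os_le o ho)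
    have hco := hT.co_eq o ho i hi1 hi2
    have hw : R (T.cv i) = T.w R i := rfl
    rw [wp_cond, wp_skip, wp_seq, wp_set]
    simp only [eval, hr, hkeep τ hF, hL'.rho, hL'.cv, hw]
    refine ⟨fun h1 => ?_, fun h1 => ?_⟩
    · refine (wp_cmdMark (v := T.w R i) (by simpa using hJ.mark) (by simp)
        (hR _ (hT.cv_lt i hin))).frame.mono ?_
      rintro u υ ⟨⟨h2, h3, h4⟩, hFu⟩
      simp only [arrays_setReg, regs_setReg, reduceEqDiff, if_false]
      have hM : Marked (T.w R i) τ υ := by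
        obtain ⟨k1, k2, k3, k4⟩ := h4
        exact ⟨k1, by simpa using k2, by simpa using k3, by simpa using k4⟩
      have e24 : υ.arrays 24 = τ.arrays 24 := by rw [hFu.arr 24 rfl]; simp
      refine ⟨by omega, ?_, ?_, fun x hx => hM.mono (hJ2 x hx), ?_, hJ4.trans hM.le⟩
      · rw [e24]
        exact hJ.marked h3 hM (hP i hin hco h1)
      · intro c hc1 hc2 hc3
        rcases lt_succ_iff_lt_or_eq.1 hc1 with h5 | rfl
        · exact hM.mono (hJ1 c h5 hc2 hc3)
        · exact hM.self
      · intro j hj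
        rw [hM.q_eq j (by omega), hJ3 j hj]
    · simp only [arrays_setReg, regs_setReg, reduceEqDiff, if_false]
      grind
  · rintro t τ ht ⟨hJ, hJ1, hJ2⟩ hF
    refine ⟨ht, hJ, fun c hc hco hcb => hJ1 c ?_ ?_ hcb, hJ2⟩
    · rw [← hco]
      exact hT.lt_os_co c hc
    · rw [← hco]
      exact hT.os_co_le c hc

/-- The total length of the options that have been treated. -/
def Tab.hitLen (T : Tab) (hit : ℕ → ℕ) : ℕ :=
  ∑ o ∈ Finset.range T.no, if hit o ≠ 0 then T.os (o + 1) - T.os o else 0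

theorem hitLen_le (hT : T.WF) (hit : ℕ → ℕ) : T.hitLen hit ≤ T.nc := by
  refine hT.sum_len_le _ fun o ho => ?_
  have := hT.os_mono o ho
  split_ifs <;> omega

theorem hitLen_update {hit : ℕ → ℕ} {o : ℕ} (ho : o < T.no) (h0 : hit o = 0) :
    T.hitLen (update hit o 1) = T.hitLen hit + (T.os (o + 1) - T.os o) := by
  unfold Tab.hitLen
  rw [← Finset.sum_erase_add _ _ (Finset.mem_range.2 ho),
    ← Finset.sum_erase_add (a := o) (Finset.range T.no) _ (Finset.mem_range.2 ho)]
  have : ∑ x ∈ (Finset.range T.no).erase o,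
      (if update hit o 1 x ≠ 0 then T.os (x + 1) - T.os x else 0) =
      ∑ x ∈ (Finset.range T.no).erase o, (if hit x ≠ 0 then T.os (x + 1) - T.os x else 0) := by
    refine Finset.sum_congr rfl fun x hx => ?_
    simp_all
  rw [this]
  simp [h0]

theorem wp_cmdVisit (hT : T.WF) (hR : ∀ v < T.nv, R v < T.nv)
    (hb : b = 21 ∨ b = 22) (hL : Loaded T R σ) (hfa : σ.arrays a = fa) (hfb : σ.arrays b = fb)
    {c : ℕ} (h8 : σ.regs 8 = c) (hc : c < T.nc)
    (hP : ∀ c' < T.nc, T.co c' = T.co c → fa c ≠ 0 → fb c' ≠ 0 → P (T.w R c'))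
    (h : SearchInv T R fa fb P (σ.arrays 18) (σ.arrays 23) (σ.arrays 24) (σ.regs 10)) :
    WP (cmdVisit a b) σ fun t τ =>
      t + 8 * T.hitLen (σ.arrays 24) ≤ 10 + 8 * T.hitLen (τ.arrays 24) ∧
      SearchInv T R fa fb P (τ.arrays 18) (τ.arrays 23) (τ.arrays 24) (τ.regs 10) ∧
      (fa c ≠ 0 → τ.arrays 24 (T.co c) ≠ 0) ∧
      (∀ o, σ.arrays 24 o ≠ 0 → τ.arrays 24 o ≠ 0) ∧
      (∀ x, σ.arrays 23 x ≠ 0 → τ.arrays 23 x ≠ 0) ∧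
      (∀ j < σ.regs 10, τ.arrays 18 j = σ.arrays 18 j) ∧ σ.regs 10 ≤ τ.regs 10 := by
  rw [cmdVisit, wp_cond, wp_skip, wp_seq, wp_set, wp_cond, wp_skip]
  simp only [eval, h8, hfa, hL.co, regs_setReg, arrays_setReg, if_true]
  refine ⟨fun h1 => ⟨fun h2 => ?_, fun h2 => ?_⟩, fun h1 => ?_⟩
  · exact ⟨by omega, h, fun _ => h2, fun _ h => h, fun _ h => h, fun _ _ => trivial, le_rfl⟩
  · rw [wp_seq]
    have hLυ : Loaded T R (σ.setReg 13 (T.co c)) := by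
      constructor <;> simp [hL.nr, hL.nv, hL.np, hL.no, hL.nc, hL.cv, hL.cp, hL.cr, hL.co, hL.os,
        hL.pg, hL.pv, hL.rho]
    have hoc := hT.co_lt c hc
    refine (wp_cmdExpand (fa := fa) (fb := fb) (P := P) hT hR hb hLυ (by simpa using hfb) (o :=
        T.co c)
      (by simp) hoc (fun c' hc' hco h3 => hP c' hc' hco h1 h3)
      (by simpa using h)).frame.mono ?_
    rintro u υ ⟨⟨h3, h4, h5, h6, h7, h9⟩, hF⟩
    have h13 : υ.regs 13 = T.co c := by rw [hF.reg 13 rfl]; simp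
    have e24 : υ.arrays 24 = σ.arrays 24 := by rw [hF.arr 24 rfl]; simp
    have hlen := hitLen_update hoc h2
    simp only [wp_put, eval, h13, arrays_setArr, regs_setArr, if_true, if_false,
      reduceEqDiff, e24]
    rw [hlen]
    refine ⟨by omega, ⟨h4.mark, ?_, h4.prop⟩, fun _ => by simp, ?_, by simpa using h6,
      by simpa using h7, by simpa using h9⟩
    · intro c' hc' h10 h11
      by_cases hco : T.co c' = T.co c
      · exact h5 c' hc' hco h11
      · rw [update_of_ne hco, ← e24] at h10
        exact h4.hit_out c' hc' h10 h11
    · grind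
  · exact ⟨by omega, h, fun h2 => absurd h1 h2, fun _ h => h, fun _ h => h, fun _ _ => trivial,
        le_rfl⟩

/-- The variables before number `qh` in the queue have been treated. -/
def Popped (T : Tab) (R : ℕ → ℕ) (fa q hit : ℕ → ℕ) (qh : ℕ) : Prop :=
  ∀ i < qh, ∀ c < T.nc, fa c ≠ 0 → T.w R c = q i → hit (T.co c) ≠ 0

/-- A bound on the number of steps of the search so far. -/
def searchPot (T : Tab) (R : ℕ → ℕ) (σ : State) : ℕ :=
  20 * σ.regs 9 + 20 * T.degOf R (qlist σ) + 8 * T.hitLen (σ.arrays 24)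

theorem searchPot_le (hT : T.WF) (h : σ.regs 9 ≤ T.nv) :
    searchPot T R σ ≤ 20 * T.nv + 28 * T.nc := by
  have h1 := hitLen_le hT (σ.arrays 24)
  have h2 : T.degOf R (qlist σ) ≤ T.nc := by
    refine (Finset.card_filter_le _ _).trans ?_
    simp
  unfold searchPot
  omega

/-- The search marks the variables that can be reached by links. Since every option is treated only
once, the time is linear in the number of variables and cells. -/
theorem wp_cmdSearch (hT : T.WF) (hR : ∀ v < T.nv, R v < T.nv) (ha : a = 21 ∨ a = 22)
    (hb : b = 21 ∨ b = 22) (hL : Loaded T R σ) (hS : Lists T R σ) (hfa : σ.arrays a = fa)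
    (hfb : σ.arrays b = fb) (hP : ∀ x y, P x → T.Link R fa fb x y → P y)
    (hle : σ.regs 9 ≤ σ.regs 10) (hpop : Popped T R fa (σ.arrays 18) (σ.arrays 24) (σ.regs 9))
    (h : SearchInv T R fa fb P (σ.arrays 18) (σ.arrays 23) (σ.arrays 24) (σ.regs 10)) :
    WP (cmdSearch a b) σ fun t τ => t + searchPot T R σ ≤ searchPot T R τ + 1 ∧
      SearchInv T R fa fb P (τ.arrays 18) (τ.arrays 23) (τ.arrays 24) (τ.regs 10) ∧
      τ.regs 9 = τ.regs 10 ∧ Popped T R fa (τ.arrays 18) (τ.arrays 24) (τ.regs 9) ∧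
      (∀ x, σ.arrays 23 x ≠ 0 → τ.arrays 23 x ≠ 0) ∧
      (∀ j < σ.regs 10, τ.arrays 18 j = σ.arrays 18 j) ∧ σ.regs 10 ≤ τ.regs 10 := by
  rw [cmdSearch]
  refine wp_loop (fun k t τ => k = T.nv - τ.regs 9 ∧ τ.regs 9 ≤ τ.regs 10 ∧
    t + searchPot T R σ ≤ searchPot T R τ ∧
    SearchInv T R fa fb P (τ.arrays 18) (τ.arrays 23) (τ.arrays 24) (τ.regs 10) ∧
    Popped T R fa (τ.arrays 18) (τ.arrays 24) (τ.regs 9) ∧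
    (∀ x, σ.arrays 23 x ≠ 0 → τ.arrays 23 x ≠ 0) ∧
    (∀ j < σ.regs 10, τ.arrays 18 j = σ.arrays 18 j) ∧ σ.regs 10 ≤ τ.regs 10)
    ⟨rfl, hle, by omega, h, hpop, fun _ h => h, fun _ _ => rfl, le_rfl⟩ ?_ ?_
  · rintro k t τ ⟨rfl, h1, h2, h3, h4, h5, h6, h7⟩ hF he
    have hlt : τ.regs 9 < τ.regs 10 := by
      by_contra hge
      simp [eval, hge] at he
    have hL' := hL.frame hF rfl
    have hS' := hS.frame hF rfl
    have hfa' : τ.arrays a = fa := by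
      rw [← hfa]
      rcases ha with rfl | rfl <;> exact hF.arr _ rfl
    have hfb' : τ.arrays b = fb := by
      rw [← hfb]
      rcases hb with rfl | rfl <;> exact hF.arr _ rfl
    obtain ⟨v, hv⟩ : ∃ v, τ.arrays 18 (τ.regs 9) = v := ⟨_, rfl⟩
    have hvn : v < T.nv := hv ▸ h3.mark.q_lt _ hlt
    have hPv : P v := h3.prop v hvn ((h3.mark.q_iff v hvn).2 ⟨_, hlt, hv⟩)
    have hvL : v ∉ qlist τ := by
      simp only [qlist, mem_map, mem_range, not_exists, not_and]
      intro j hj hjv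
      have := h3.mark.q_inj j (by omega) _ hlt (hjv.trans hv.symm)
      omega
    rw [wp_seq, wp_set, wp_seq, wp_set]
    simp only [eval, hv, regs_setReg, reduceEqDiff, if_false]
    set υ := (τ.setReg 11 v).setReg 9 (τ.regs 9 + 1) with hυ
    have hLυ : Loaded T R υ := by
      constructor <;> simp [hυ, hL'.nr, hL'.nv, hL'.np, hL'.no, hL'.nc, hL'.cv, hL'.cp, hL'.cr,
        hL'.co, hL'.os, hL'.pg, hL'.pv, hL'.rho]
    have hSυ : Lists T R υ := ⟨hS'.head_eq, hS'.next_eq, hS'.cf_iff, hS'.inv_iff⟩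
    have e18 : υ.arrays 18 = τ.arrays 18 := by simp [hυ]
    have r9 : υ.regs 9 = τ.regs 9 + 1 := by simp [hυ]
    have r10 : υ.regs 10 = τ.regs 10 := by simp [hυ]
    refine WP.mono (Q := fun u ω => u + 8 * T.hitLen (τ.arrays 24) ≤
        2 + 13 * T.degFrom R v 0 + 8 * T.hitLen (ω.arrays 24) ∧
      SearchInv T R fa fb P (ω.arrays 18) (ω.arrays 23) (ω.arrays 24) (ω.regs 10) ∧
      (∀ c < T.nc, fa c ≠ 0 → T.w R c = v → ω.arrays 24 (T.co c) ≠ 0) ∧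
      (∀ o, τ.arrays 24 o ≠ 0 → ω.arrays 24 o ≠ 0) ∧
      (∀ x, τ.arrays 23 x ≠ 0 → ω.arrays 23 x ≠ 0) ∧
      (∀ j < τ.regs 10, ω.arrays 18 j = τ.arrays 18 j) ∧ τ.regs 10 ≤ ω.regs 10 ∧
      ω.regs 9 = τ.regs 9 + 1) ?_ ?_
    · refine wp_walk (T.w R) v T.nc (fun i t ω =>
        t + 8 * T.hitLen (τ.arrays 24) ≤ 13 * T.degFrom R v i + 8 * T.hitLen (ω.arrays 24) ∧
        SearchInv T R fa fb P (ω.arrays 18) (ω.arrays 23) (ω.arrays 24) (ω.regs 10) ∧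
        (∀ c < T.nc, i ≤ c → fa c ≠ 0 → T.w R c = v → ω.arrays 24 (T.co c) ≠ 0) ∧
        (∀ o, τ.arrays 24 o ≠ 0 → ω.arrays 24 o ≠ 0) ∧
        (∀ x, τ.arrays 23 x ≠ 0 → ω.arrays 23 x ≠ 0) ∧
        (∀ j < τ.regs 10, ω.arrays 18 j = τ.arrays 18 j) ∧ τ.regs 10 ≤ ω.regs 10)
        ?_ (by norm_num) rfl ?_ ?_ ?_ ?_ ?_ ?_ ?_
      · simp only [eval, hυ, regs_setReg, arrays_setReg, if_true, reduceEqDiff,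
          if_false]
        exact hS'.head_eq v hvn
      · intro ω hFω c hc hcv
        rw [← hcv]
        exact (hSυ.frame hFω rfl).next_eq c hc
      · simp
      · simp
      · simp_all
      · rintro i t ω hi hw ⟨k1, k2, k3, k4⟩
        rw [degFrom_succ hi, if_neg hw]
        grind
      · rintro i t ω hi hw ⟨k1, k2, k3, k4, k5, k6, k7⟩ hr hFω
        have hfaω : ω.arrays a = fa := by
          rw [← hfa']
          rcases ha with rfl | rfl <;> exact hFω.arr _ rfl
        have hfbω : ω.arrays b = fb := by
          rw [← hfb']
          rcases hb with rfl | rfl <;> exact hFω.arr _ rfl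
        refine (wp_cmdVisit hT hR hb (hLυ.frame hFω rfl) hfaω hfbω hr hi
          (fun c' hc' hco h8 h9 => hP v _ hPv ⟨i, hi, c', hc', h8, h9, hco.symm, hw,
              rfl⟩) k2).mono ?_
        rintro u χ ⟨l1, l2, l3, l4, l5, l6, l7⟩
        rw [degFrom_succ hi, if_pos hw]
        grind
      · rintro t ω ⟨k1, k2, k3, k4, k5, k6, k7⟩ hFω
        refine ⟨by omega, k2, fun c hc hca hcv => k3 c hc (Nat.zero_le _) hca hcv, k4, k5, k6, k7,
            ?_⟩
        rw [hFω.reg 9 rfl, r9]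
    · rintro u ω ⟨k1, k2, k3, k4, k5, k6, k7, k8⟩
      have hle' := k2.mark.le
      have hq : qlist ω = qlist τ ++ [v] := by
        rw [qlist, k8, List.range_succ, map_append, List.map_singleton, k6 _ hlt, hv, qlist]
        congr 1
        refine map_congr_left fun j hj => ?_
        grind
      have hdeg := degOf_concat (T := T) (R := R) hvL
      refine ⟨T.nv - ω.regs 9, by omega, rfl, by omega, ?_, k2, ?_, fun x hx => k5 x (h5 x hx),
        fun j hj => (k6 j (by omega)).trans (h6 j hj), by omega⟩
      · unfold searchPot at h2 ⊢
        rw [hq, hdeg, k8]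
        omega
      · rw [k8]
        intro i hi c hc hca hcq
        rw [k6 i (by omega)] at hcq
        rcases lt_succ_iff_lt_or_eq.1 hi with h8 | rfl
        · exact k4 _ (h4 i h8 c hc hca hcq)
        · exact k3 c hc hca (hcq.trans hv)
  · rintro k t τ ⟨rfl, h1, h2, h3, h4, h5⟩ hF he
    have hge : τ.regs 9 = τ.regs 10 := by
      by_contra hne
      have : τ.regs 9 < τ.regs 10 := by omega
      simp [eval, this] at he
    exact ⟨by omega, h3, hge, h4, h5⟩

/-- After the search, the marked variables are closed under links. -/
theorem SearchInv.closed (hR : ∀ v < T.nv, R v < T.nv) (hT : T.WF) {q mk hit : ℕ → ℕ} {qt : ℕ}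
    (h : SearchInv T R fa fb P q mk hit qt) (hpop : Popped T R fa q hit qt) {x y : ℕ}
    (hx : mk x ≠ 0) (hxy : T.Link R fa fb x y) : mk y ≠ 0 := by
  obtain ⟨c, hc, c', hc', h1, h2, h3, rfl, rfl⟩ := hxy
  obtain ⟨j, hj, hjv⟩ := (h.mark.q_iff _ (hR _ (hT.cv_lt c hc))).1 hx
  refine h.hit_out c' hc' ?_ h2
  rw [← h3]
  exact hpop j hj c hc h1 hjv.symm

end

end Search

/-! ### The best options -/

section Best

open Exp Cmd

variable {T : Tab} {R : ℕ → ℕ} {σ : State}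

/-- The cell has minimal rank among the alive cells of its valid option. -/
def Tab.Low (T : Tab) (R : ℕ → ℕ) (Y : Set ℕ) (c : ℕ) : Prop :=
  c ∈ T.alive R Y ∧ T.Valid R (T.co c) ∧
    ∀ c' ∈ T.alive R Y, T.co c' = T.co c → T.cr c ≤ T.cr c'

/-- Mark in `MEM = 21` the alive cells of minimal rank of the valid options, and find for each pair
marked by `0` an option with the smallest number of such cells: this number is stored in `BC = 19`,
and the number of the option plus one in `BO = 20`. -/
def cmdBest : Cmd :=
  Cmd.for 5 (lit 0) (reg 2) (put 19 (reg 5) (lit 0)) ;;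
  Cmd.for 5 (lit 0) (reg 4) (
    set 11 (get 8 (get 1 (reg 5))) ;;
    set 12 (get 4 (reg 5)) ;;
    put 21 (reg 5) (lit 0) ;;
    cond (get 13 (reg 5)) (cond (get 14 (reg 12)) skip
      (cond (equal (get 3 (reg 5)) (get 17 (reg 12))) (cond (get 9 (reg 11))
        (put 21 (reg 5) (lit 1) ;;
          set 13 (get 2 (reg 5)) ;;
          set 14 (get 15 (plus (get 5 (reg 12)) (get 3 (reg 5)))) ;;
          cond (get 10 (reg 13)) skip
            (cond (plus (equal (get 19 (reg 13)) (lit 0)) (less (reg 14) (get 19 (reg 13))))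
              (put 19 (reg 13) (reg 14) ;; put 20 (reg 13) (plus (reg 12) (lit 1))) skip))
        skip) skip)) skip) ;;
  Cmd.for 5 (lit 0) (reg 4) (
    set 13 (get 2 (reg 5)) ;;
    put 22 (reg 5) (lit 0) ;;
    cond (get 21 (reg 5)) (cond (get 10 (reg 13)) skip
      (cond (equal (get 20 (reg 13)) (plus (get 4 (reg 5)) (lit 1))) (put 22 (reg 5) (lit 1)) skip))
      skip)

/-- What holds after the cells before `i` have been treated. -/
structure BestInv (T : Tab) (R : ℕ → ℕ) (Y : Set ℕ) (free cnt : ℕ → ℕ) (i : ℕ)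
    (mem bc bo : ℕ → ℕ) : Prop where
  mem_iff : ∀ c < i, (mem c ≠ 0 ↔ T.Low R Y c)
  le : ∀ c < i, T.Low R Y c → free (T.cp c) = 0 →
    bc (T.cp c) ≠ 0 ∧ bc (T.cp c) ≤ cnt (T.slot c)
  spec : ∀ p < T.np, free p = 0 → bc p ≠ 0 →
    ∃ c < i, T.Low R Y c ∧ T.cp c = p ∧ bo p = T.co c + 1 ∧ bc p = cnt (T.slot c)

theorem BestInv.step {Y : Set ℕ} {free cnt : ℕ → ℕ} {i : ℕ}
    {mem bc bo : ℕ → ℕ} (h : BestInv T R Y free cnt i mem bc bo) (hlow : T.Low R Y i)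
    (hcnt : cnt (T.slot i) ≠ 0) {bc' bo' : ℕ → ℕ}
    (hb : (free (T.cp i) ≠ 0 ∨ (bc (T.cp i) ≠ 0 ∧ bc (T.cp i) ≤ cnt (T.slot i))) ∧
        bc' = bc ∧ bo' = bo ∨
      free (T.cp i) = 0 ∧ (bc (T.cp i) = 0 ∨ cnt (T.slot i) < bc (T.cp i)) ∧
        bc' = update bc (T.cp i) (cnt (T.slot i)) ∧
        bo' = update bo (T.cp i) (T.co i + 1)) :
    BestInv T R Y free cnt (i + 1) (update mem i 1) bc' bo' := by
  constructor
  · intro c hc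
    by_cases hci : c = i
    · simp_all
    · rw [update_of_ne hci]
      exact h.mem_iff c (by omega)
  · intro c hc hl hf
    rcases hb with ⟨h1, rfl, rfl⟩ | ⟨h1, h2, rfl, rfl⟩
    · rcases lt_succ_iff_lt_or_eq.1 hc with h3 | rfl
      · exact h.le c h3 hl hf
      · omega
    · by_cases hci : T.cp c = T.cp i
      · rw [hci, update_self]
        refine ⟨hcnt, ?_⟩
        rcases lt_succ_iff_lt_or_eq.1 hc with h3 | rfl
        · obtain ⟨h4, h5⟩ := h.le c h3 hl hf
          grind
        · exact le_rfl
      · rw [update_of_ne hci]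
        refine h.le c ?_ hl hf
        grind
  · intro p hp hf hne
    rcases hb with ⟨h1, rfl, rfl⟩ | ⟨h1, h2, rfl, rfl⟩
    · obtain ⟨c, hc, h3⟩ := h.spec p hp hf hne
      exact ⟨c, by omega, h3⟩
    · by_cases hpi : p = T.cp i
      · grind
      · rw [update_of_ne hpi] at hne ⊢
        rw [update_of_ne hpi]
        obtain ⟨c, hc, h3⟩ := h.spec p hp hf hne
        exact ⟨c, by omega, h3⟩

theorem BestInv.skip {Y : Set ℕ} {free cnt : ℕ → ℕ} {i : ℕ}
    {mem bc bo : ℕ → ℕ} (h : BestInv T R Y free cnt i mem bc bo) (hlow : ¬ T.Low R Y i) :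
    BestInv T R Y free cnt (i + 1) (update mem i 0) bc bo := by
  constructor
  · intro c hc
    by_cases hci : c = i
    · simp_all
    · rw [update_of_ne hci]
      exact h.mem_iff c (by omega)
  · intro c hc hl
    rcases lt_succ_iff_lt_or_eq.1 hc with h3 | rfl
    · exact h.le c h3 hl
    · exact absurd hl hlow
  · intro p hp hf hne
    obtain ⟨c, hc, h3⟩ := h.spec p hp hf hne
    exact ⟨c, by omega, h3⟩

theorem StripDone.low_iff (hT : T.WF) (hR : ∀ v < T.nv, R v < T.nv) {L : List ℕ}
    (h : StripDone T R L σ) (hS : Lists T R σ) {c : ℕ} (hc : c < T.nc) :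
    T.Low R {x | x ∈ L} c ↔ σ.arrays 13 c ≠ 0 ∧ σ.arrays 14 (T.co c) = 0 ∧
      T.cr c = σ.arrays 17 (T.co c) ∧ σ.arrays 9 (T.w R c) ≠ 0 := by
  have hA : c ∈ T.alive R {x | x ∈ L} ↔ σ.arrays 13 c ≠ 0 ∧ σ.arrays 9 (T.w R c) ≠ 0 := by
    rw [mem_alive, hS.cf_iff c hc, Ne, h.need_iff (T.w R c) (hR _ (hT.cv_lt c hc))]
    simp [hc]
  have ho := hT.co_lt c hc
  rw [hS.inv_iff _ ho]
  constructor
  · rintro ⟨h1, h2, h3⟩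
    obtain ⟨h4, h5⟩ := hA.1 h1
    refine ⟨h4, h2, ?_, h5⟩
    obtain ⟨c', hc', hco, hcr⟩ := (h.settled _ ho h2).level ⟨c, h1, rfl⟩
    have h6 := h3 c' hc' hco
    have h7 := h.inv.lv_min c h1 h2
    omega
  · rintro ⟨h1, h2, h3, h4⟩
    refine ⟨hA.2 ⟨h1, h4⟩, h2, fun c' hc' hco => ?_⟩
    rw [h3, ← hco]
    exact h.inv.lv_min c' hc' (hco ▸ h2)

/-- The result of `cmdBest`. -/
structure BestDone (T : Tab) (R : ℕ → ℕ) (Y : Set ℕ) (σ : State) : Prop where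
  inv : BestInv T R Y (σ.arrays 10) (σ.arrays 15) T.nc (σ.arrays 21) (σ.arrays 19) (σ.arrays 20)
  bst_iff : ∀ c < T.nc, (σ.arrays 22 c ≠ 0 ↔
    σ.arrays 21 c ≠ 0 ∧ σ.arrays 10 (T.cp c) = 0 ∧ σ.arrays 20 (T.cp c) = T.co c + 1)

/-- The first loop over the cells finds an option with a smallest first class for each pair that is
not free, and the second one marks the cells of these options. -/
theorem wp_cmdBest (hT : T.WF) (hR : ∀ v < T.nv, R v < T.nv) (hL : Loaded T R σ)
    (hS : Lists T R σ) {L : List ℕ} (h : StripDone T R L σ) :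
    WP cmdBest σ fun t τ => t ≤ 30 * (T.np + T.nc + 1) ∧ BestDone T R {x | x ∈ L} τ := by
  rw [cmdBest, wp_seq]
  refine wp_for 0 T.np 1 (fun i τ => ∀ p < i, τ.arrays 19 p = 0) rfl (Nat.zero_le _) rfl
    (fun τ hF => (hL.frame hF rfl).np) (by simp) ?_ ?_
  · intro i τ _ hi hJ hr _
    simp only [wp_put, eval, hr]
    refine ⟨le_rfl, fun p hp => ?_⟩
    simp only [arrays_setReg, arrays_setArr, if_true, update_apply]
    grind
  intro t τ ht hJ hF
  have hL1 := hL.frame hF rfl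
  have hcnt : τ.arrays 15 = σ.arrays 15 := hF.arr 15 rfl
  have hfree : τ.arrays 10 = σ.arrays 10 := hF.arr 10 rfl
  rw [wp_seq]
  refine wp_for 0 T.nc 14 (fun i τ => BestInv T R {x | x ∈ L} (σ.arrays 10) (σ.arrays 15) i
    (τ.arrays 21) (τ.arrays 19) (τ.arrays 20)) rfl (Nat.zero_le _) rfl
    (fun τ hF => (hL1.frame hF rfl).nc) ?_ ?_ ?_
  · refine ⟨by simp, by simp, fun p hp _ hne => ?_⟩
    simp_all
  · intro i τ1 _ hi hJ1 hr hF1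
    have hL' := hL1.frame hF1 rfl
    have hlow := h.low_iff hT hR hS hi
    have e9 : τ1.arrays 9 = σ.arrays 9 := by rw [hF1.arr 9 rfl, hF.arr 9 rfl]
    have e10 : τ1.arrays 10 = σ.arrays 10 := by rw [hF1.arr 10 rfl, hF.arr 10 rfl]
    have e13 : τ1.arrays 13 = σ.arrays 13 := by rw [hF1.arr 13 rfl, hF.arr 13 rfl]
    have e14 : τ1.arrays 14 = σ.arrays 14 := by rw [hF1.arr 14 rfl, hF.arr 14 rfl]
    have e15 : τ1.arrays 15 = σ.arrays 15 := by rw [hF1.arr 15 rfl, hF.arr 15 rfl]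
    have e17 : τ1.arrays 17 = σ.arrays 17 := by rw [hF1.arr 17 rfl, hF.arr 17 rfl]
    have hw : R (T.cv i) = T.w R i := rfl
    have hs : T.os (T.co i) + T.cr i = T.slot i := rfl
    simp only [wp_seq, wp_set, wp_put, wp_cond, wp_skip, eval, regs_setReg,
      arrays_setReg, regs_setArr, arrays_setArr, hr, hL'.cv, hL'.cp, hL'.cr,
      hL'.co, hL'.os, hL'.rho, e9, e10, e13, e14, e15, e17, if_true, if_false, reduceEqDiff,
      hw, hs]
    have hupd : ∀ x y : ℕ, update (update (τ1.arrays 21) i x) i y =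
        update (τ1.arrays 21) i y := fun x y => by simp
    simp only [hupd]
    by_cases hl : T.Low R {x | x ∈ L} i
    · obtain ⟨h1, h2, h3, h4⟩ := hlow.1 hl
      have hcn : σ.arrays 15 (T.slot i) ≠ 0 := by
        rw [h.inv.cnt_eq _ (hT.slot_lt hi), Tab.cntOf, Finset.card_ne_zero]
        exact ⟨i, Finset.mem_filter.2 ⟨hl.1, rfl⟩⟩
      refine ⟨fun _ => ⟨fun h5 => absurd h2 h5, fun _ => ⟨fun _ => ⟨fun _ => ⟨fun h5 => ?_,
        fun h5 => ⟨fun h6 => ?_, fun h6 => ?_⟩⟩, fun h5 => absurd h5 h4⟩,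
        fun h5 => by simp [h3] at h5⟩⟩, fun h5 => absurd h5 h1⟩
      · exact ⟨by norm_num, hJ1.step hl hcn (.inl ⟨.inl h5, rfl, rfl⟩)⟩
      · refine ⟨by norm_num, hJ1.step hl hcn (.inr ⟨h5, ?_, rfl, rfl⟩)⟩
        grind
      · refine ⟨by norm_num, hJ1.step hl hcn (.inl ⟨.inr ?_, rfl, rfl⟩)⟩
        simp_all
    · have hsk := hJ1.skip hl
      simp_all
  intro t1 τ1 ht1 hJ1 hF1
  have hL2 := hL1.frame hF1 rfl
  refine wp_for 0 T.nc 6 (fun i τ => ∀ c < i, (τ.arrays 22 c ≠ 0 ↔ τ1.arrays 21 c ≠ 0 ∧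
    τ1.arrays 10 (T.cp c) = 0 ∧ τ1.arrays 20 (T.cp c) = T.co c + 1)) rfl (Nat.zero_le _) rfl
    (fun τ hF => (hL2.frame hF rfl).nc) (by simp) ?_ ?_
  · intro i τ2 _ hi hJ2 hr hF2
    have hL' := hL2.frame hF2 rfl
    have e10 : τ2.arrays 10 = τ1.arrays 10 := hF2.arr 10 rfl
    have e20 : τ2.arrays 20 = τ1.arrays 20 := hF2.arr 20 rfl
    have e21 : τ2.arrays 21 = τ1.arrays 21 := hF2.arr 21 rfl
    simp only [wp_seq, wp_set, wp_put, wp_cond, wp_skip, eval, regs_setReg,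
      arrays_setReg, regs_setArr, arrays_setArr, hr, hL'.cp,
      hL'.co, e10, e20, e21, if_true, if_false, reduceEqDiff]
    grind
  intro t2 τ2 ht2 hJ2 hF2
  have e10 : τ2.arrays 10 = τ1.arrays 10 := hF2.arr 10 rfl
  have e15 : τ2.arrays 15 = τ1.arrays 15 := hF2.arr 15 rfl
  have e19 : τ2.arrays 19 = τ1.arrays 19 := hF2.arr 19 rfl
  have e20 : τ2.arrays 20 = τ1.arrays 20 := hF2.arr 20 rfl
  have e21 : τ2.arrays 21 = τ1.arrays 21 := hF2.arr 21 rfl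
  have f10 : τ1.arrays 10 = σ.arrays 10 := by rw [hF1.arr 10 rfl, hfree]
  have f15 : τ1.arrays 15 = σ.arrays 15 := by rw [hF1.arr 15 rfl, hcnt]
  refine ⟨by omega, ?_, ?_⟩
  · simp_all
  · simp_all

end Best

/-! ### Finding a component -/

section Comp

open Exp Cmd Relation

variable {T : Tab} {R : ℕ → ℕ} {σ : State}

/-- The variable is a representative outside of `Y`. -/
def Tab.Live (T : Tab) (R : ℕ → ℕ) (Y : Set ℕ) (x : ℕ) : Prop := x < T.nv ∧ R x = x ∧ x ∉ Y

/-- All pairs of the variables in `U` are good for `U`. -/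
def Tab.FlatAdm (T : Tab) (R : ℕ → ℕ) (Y U : Set ℕ) : Prop :=
  ∀ x ∈ U, T.Live R Y x ∧
    ∀ p, 1 ≤ p → p < T.np → T.Canon R p → T.u R p = x → T.FlatGood R Y p U

/-- Some pair of the variable is good for no set of variables. -/
def Tab.Dead (T : Tab) (R : ℕ → ℕ) (free bc : ℕ → ℕ) (x : ℕ) : Prop :=
  ∃ p, 1 ≤ p ∧ p < T.np ∧ free p = 0 ∧ bc p = 0 ∧ T.u R p = x

theorem Tab.Link.symm {a b : ℕ → ℕ} {x y : ℕ} (h : T.Link R a b x y) : T.Link R b a y x := by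
  obtain ⟨c, hc, c', hc', h1, h2, h3, h4, h5⟩ := h
  exact ⟨c', hc', c, hc, h2, h1, h3.symm, h5, h4⟩

section Semantics

variable {L : List ℕ} {mk bst mem free bc bo cnt : ℕ → ℕ} {Y : Set ℕ}

/-- A set that is closed under the links to the members of the best options, and that contains no
variable without such an option, is admissible. -/
theorem flatAdm_of_closed (hT : T.WF) {rel : ℕ → Prop} {need sum lv q : ℕ → ℕ} {qt : ℕ}
    (h : StripInv T R (T.alive R Y) Y rel need free cnt sum lv q qt)
    (hB : BestInv T R Y free cnt T.nc mem bc bo)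
    (hbst : ∀ c < T.nc, (bst c ≠ 0 ↔ mem c ≠ 0 ∧ free (T.cp c) = 0 ∧ bo (T.cp c) = T.co c + 1))
    {U : Set ℕ} (hU : ∀ x ∈ U, T.Live R Y x) (hd : ∀ x ∈ U, ¬ T.Dead R free bc x)
    (hcl : ∀ x ∈ U, ∀ y, T.Link R bst mem x y → y ∈ U) : T.FlatAdm R Y U := by
  intro x hx
  refine ⟨hU x hx, ?_⟩
  rintro p hp1 hp2 hpc rfl
  by_cases hf : free p = 0
  · have hbc : bc p ≠ 0 := fun h0 => hd _ hx ⟨p, hp1, hp2, hf, h0, rfl⟩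
    obtain ⟨c, hc, hlow, rfl, hbo, -⟩ := hB.spec p hp2 hf hbc
    have hb : bst c ≠ 0 := (hbst c hc).2 ⟨(hB.mem_iff c hc).2 hlow, hf, hbo⟩
    refine ⟨c, hlow.1, hlow.2.1, rfl, fun c' hc' hco => ⟨hlow.2.2 c' hc' hco, fun hcr => ?_⟩⟩
    have hcn' := (mem_alive.1 hc').1
    have hlow' : T.Low R Y c' :=
      ⟨hc', hco ▸ hlow.2.1, fun d hd hdo => hcr ▸ hlow.2.2 d hd (hdo.trans hco)⟩
    refine hcl _ hx _ ⟨c, hc, c', hcn', hb, (hB.mem_iff c' hcn').2 hlow', hco.symm, ?_, rfl⟩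
    rw [Tab.u, hT.pv_cp c hc (by omega)]
    rfl
  · rcases h.free_one p hp1 hp2 hpc hf with h1 | ⟨c, h1, h2, rfl⟩
    · exact absurd h1 (hU _ hx).2.2
    · obtain ⟨d, hd1, hd2, hd3, hd4⟩ := flatGood_of_uniq hT h1 h2 (by omega)
      refine ⟨d, hd1, hd2, hd3, fun c' hc' hco => ⟨(hd4 c' hc' hco).1, fun hcr => ?_⟩⟩
      simp_all

/-- `FlatGood` is closed under intersections. -/
def Tab.InterGood (T : Tab) (R : ℕ → ℕ) (Y : Set ℕ) : Prop :=
  ∀ p, 1 ≤ p → p < T.np → T.Canon R p → ∀ U U', T.FlatGood R Y p U → T.FlatGood R Y p U' →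
    T.FlatGood R Y p (U ∩ U')

theorem exists_low {p : ℕ} {U : Set ℕ} (h : T.FlatGood R Y p U) :
    ∃ c, T.Low R Y c ∧ T.cp c = p ∧ ∀ c', T.Low R Y c' → T.co c' = T.co c → T.w R c' ∈ U := by
  obtain ⟨c, h1, h2, h3, h4⟩ := h
  have hlow : T.Low R Y c := ⟨h1, h2, fun c' hc' hco => (h4 c' hc' hco).1⟩
  refine ⟨c, hlow, h3, fun c' hc' hco => (h4 c' hc'.1 hco).2 ?_⟩
  exact le_antisymm (hc'.2.2 c h1 hco.symm) (hlow.2.2 c' hc'.1 hco)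

theorem FlatAdm.not_dead {rel : ℕ → Prop} {need sum lv q : ℕ → ℕ} {qt : ℕ}
    (h : StripInv T R (T.alive R Y) Y rel need free cnt sum lv q qt)
    (hB : BestInv T R Y free cnt T.nc mem bc bo) {U : Set ℕ} (hU : T.FlatAdm R Y U) {x : ℕ}
    (hx : x ∈ U) : ¬ T.Dead R free bc x := by
  rintro ⟨p, hp1, hp2, hf, hbc, rfl⟩
  obtain ⟨c, hlow, rfl, -⟩ :=
    exists_low ((hU _ hx).2 p hp1 hp2 (h.free_canon p hp1 hp2 hf) rfl)
  exact (hB.le c (mem_alive.1 hlow.1).1 hlow hf).1 hbc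

/-- The cells of minimal rank in an option of smallest size occur in every admissible set. -/
theorem FlatAdm.closed (hT : T.WF) (hI : T.InterGood R Y) {rel : ℕ → Prop}
    {need sum lv q : ℕ → ℕ} {qt : ℕ}
    (h : StripInv T R (T.alive R Y) Y rel need free cnt sum lv q qt)
    (hB : BestInv T R Y free cnt T.nc mem bc bo)
    (hbst : ∀ c < T.nc, (bst c ≠ 0 ↔ mem c ≠ 0 ∧ free (T.cp c) = 0 ∧ bo (T.cp c) = T.co c + 1))
    {U : Set ℕ} (hU : T.FlatAdm R Y U) {x y : ℕ} (hx : x ∈ U) (hxy : T.Link R bst mem x y) :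
    y ∈ U := by
  classical
  obtain ⟨c, hc, c', hc', hb, hm, hco, hwx, rfl⟩ := hxy
  obtain ⟨hmc, hf, hbo⟩ := (hbst c hc).1 hb
  have hlow := (hB.mem_iff c hc).1 hmc
  have hlow' := (hB.mem_iff c' hc').1 hm
  have hp1 : 1 ≤ T.cp c := by
    by_contra h0
    have h1 : T.cp c = 0 := by omega
    rw [h1] at hf
    exact h.free_zero hf
  have hp2 := hT.cp_lt c hc
  have hcan := h.free_canon _ hp1 hp2 hf
  have hux : T.u R (T.cp c) = x := by
    rw [← hwx, Tab.u, hT.pv_cp c hc (by omega)]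
    rfl
  have hslot : ∀ d, T.Low R Y d → ∀ e, e ∈ (T.alive R Y).filter (fun e => T.slot e = T.slot d) ↔
      T.Low R Y e ∧ T.co e = T.co d := by
    intro d hd e
    have hdn := (mem_alive.1 hd.1).1
    rw [Finset.mem_filter]
    constructor
    · rintro ⟨h1, h2⟩
      obtain ⟨h3, h4⟩ := (Tab.slot_eq_iff hT (mem_alive.1 h1).1 (hT.co_lt d hdn)
        (hT.cr_lt d hdn)).1 h2
      exact ⟨⟨h1, h3 ▸ hd.2.1, fun z hz hzo => h4 ▸ hd.2.2 z hz (hzo.trans h3)⟩, h3⟩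
    · rintro ⟨h1, h2⟩
      refine ⟨h1.1, ?_⟩
      rw [Tab.slot, Tab.slot, h2,
        le_antisymm (h1.2.2 d hd.1 h2.symm) (hd.2.2 e h1.1 h2)]
  have hinj : ∀ d, T.Low R Y d →
      Set.InjOn (T.w R) ((T.alive R Y).filter (fun e => T.slot e = T.slot d) : Finset ℕ) := by
    intro d hd e he e' he' hee
    obtain ⟨h1, h2⟩ := (hslot d hd e).1 he
    obtain ⟨h3, h4⟩ := (hslot d hd e').1 he'
    rcases lt_trichotomy e e' with h5 | h5 | h5
    · exact absurd hee ((mem_alive.1 h3.1).2.1 e h5 (h2.trans h4.symm))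
    · exact h5
    · exact absurd hee.symm ((mem_alive.1 h1.1).2.1 e' h5 (h4.trans h2.symm))
  obtain ⟨hbc, -⟩ := hB.le c hc hlow hf
  obtain ⟨c0, hc0, hlow0, hcp0, hbo0, hcnt0⟩ := hB.spec _ hp2 hf hbc
  have hco0 : T.co c0 = T.co c := by omega
  have hgood1 : T.FlatGood R Y (T.cp c) {z | ∃ e, T.Low R Y e ∧ T.co e = T.co c ∧ T.w R e = z} := by
    refine ⟨c, hlow.1, hlow.2.1, rfl, fun e he heo => ⟨hlow.2.2 e he heo, fun hcr => ?_⟩⟩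
    exact ⟨e, ⟨he, heo ▸ hlow.2.1, fun z hz hzo => hcr ▸ hlow.2.2 z hz (hzo.trans heo)⟩, heo, rfl⟩
  obtain ⟨c2, hlow2, hcp2, hmem2⟩ := exists_low (hI _ hp1 hp2 hcan _ _
    ((hU x hx).2 _ hp1 hp2 hcan hux) hgood1)
  have hle := (hB.le c2 (mem_alive.1 hlow2.1).1 hlow2 (by rw [hcp2]; exact hf)).2
  rw [hcp2, hcnt0, h.cnt_eq _ (hT.slot_lt hc0), h.cnt_eq _ (hT.slot_lt (mem_alive.1 hlow2.1).1),
    Tab.cntOf, Tab.cntOf, ← Finset.card_image_of_injOn (hinj c0 hlow0),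
    ← Finset.card_image_of_injOn (hinj c2 hlow2)] at hle
  have hsub : ((T.alive R Y).filter (fun e => T.slot e = T.slot c2)).image (T.w R) ⊆
      ((T.alive R Y).filter (fun e => T.slot e = T.slot c0)).image (T.w R) := by
    intro z hz
    obtain ⟨e, he, rfl⟩ := Finset.mem_image.1 hz
    obtain ⟨h1, h2⟩ := (hslot c2 hlow2 e).1 he
    obtain ⟨e', h3, h4, h5⟩ := (hmem2 e h1 h2).2
    grind
  have heq := Finset.eq_of_subset_of_card_le hsub hle
  have hy : T.w R c' ∈ ((T.alive R Y).filter (fun e => T.slot e = T.slot c0)).image (T.w R) :=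
    Finset.mem_image_of_mem _ ((hslot c0 hlow0 c').2 ⟨hlow', hco.symm.trans hco0.symm⟩)
  grind

end Semantics

/-! #### The roots -/

/-- Reset the marks of the search. -/
def cmdUnmark : Cmd :=
  Cmd.for 5 (lit 0) (reg 1) (put 23 (reg 5) (lit 0)) ;;
  Cmd.for 5 (lit 0) (reg 3) (put 24 (reg 5) (lit 0)) ;;
  set 9 (lit 0) ;; set 10 (lit 0)

theorem wp_cmdUnmark (hL : Loaded T R σ) :
    WP cmdUnmark σ fun t τ => t ≤ 3 * (T.nv + T.no) + 6 ∧ (∀ v < T.nv, τ.arrays 23 v = 0) ∧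
      (∀ o < T.no, τ.arrays 24 o = 0) ∧ τ.regs 9 = 0 ∧ τ.regs 10 = 0 := by
  rw [cmdUnmark, wp_seq]
  refine wp_for 0 T.nv 1 (fun i τ => ∀ v < i, τ.arrays 23 v = 0) rfl (Nat.zero_le _) rfl
    (fun τ hF => (hL.frame hF rfl).nv) (by simp) ?_ ?_
  · intro i τ _ hi hJ hr _
    simp only [wp_put, eval, hr]
    refine ⟨le_rfl, fun p hp => ?_⟩
    simp only [arrays_setReg, arrays_setArr, if_true, update_apply]
    grind
  intro t τ ht hJ hF
  have hL1 := hL.frame hF rfl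
  rw [wp_seq]
  refine wp_for 0 T.no 1 (fun i τ => ∀ v < i, τ.arrays 24 v = 0) rfl (Nat.zero_le _) rfl
    (fun τ hF => (hL1.frame hF rfl).no) (by simp) ?_ ?_
  · intro i τ _ hi hJ hr _
    simp only [wp_put, eval, hr]
    refine ⟨le_rfl, fun p hp => ?_⟩
    simp only [arrays_setReg, arrays_setArr, if_true, update_apply]
    grind
  intro t1 τ1 ht1 hJ1 hF1
  simp only [wp_seq, wp_set, eval]
  refine ⟨by omega, ?_, by simpa using hJ1, by simp, by simp⟩
  simp only [arrays_setReg]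
  rw [hF1.arr 23 rfl]
  exact hJ

theorem markInv_zero {q mk : ℕ → ℕ} (h : ∀ v < T.nv, mk v = 0) : MarkInv T q mk 0 :=
  ⟨fun v hv => by simp [h v hv], fun i hi => by omega, fun i hi => by omega⟩

/-- Mark the variables with a pair that is good for no set. -/
def cmdMarkDead : Cmd :=
  Cmd.for 5 (lit 1) (reg 2) (cond (get 10 (reg 5)) skip
    (cond (get 19 (reg 5)) skip (set 15 (get 8 (get 7 (reg 5))) ;; cmdMark)))

theorem wp_cmdMarkDead (hT : T.WF) (hR : ∀ v < T.nv, R v < T.nv) (hL : Loaded T R σ)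
    (h23 : ∀ v < T.nv, σ.arrays 23 v = 0) (h10 : σ.regs 10 = 0) :
    WP cmdMarkDead σ fun t τ => t ≤ 10 * T.np + 2 ∧
      MarkInv T (τ.arrays 18) (τ.arrays 23) (τ.regs 10) ∧
      (∀ v < T.nv, τ.arrays 23 v ≠ 0 → T.Dead R (σ.arrays 10) (σ.arrays 19) v) ∧
      ∀ v, T.Dead R (σ.arrays 10) (σ.arrays 19) v → τ.arrays 23 v ≠ 0 := by
  rw [cmdMarkDead]
  refine wp_for 1 T.np 8 (fun i τ => MarkInv T (τ.arrays 18) (τ.arrays 23) (τ.regs 10) ∧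
      (∀ v < T.nv, τ.arrays 23 v ≠ 0 → T.Dead R (σ.arrays 10) (σ.arrays 19) v) ∧
      ∀ p, 1 ≤ p → p < i → σ.arrays 10 p = 0 → σ.arrays 19 p = 0 → τ.arrays 23 (T.u R p) ≠ 0)
    rfl hT.np_pos rfl (fun τ hF => (hL.frame hF rfl).np) ?_ ?_ ?_
  · simp only [arrays_setReg, regs_setReg, reduceEqDiff, if_false, h10]
    exact ⟨markInv_zero h23, fun v hv h => absurd (h23 v hv) h, fun p h1 h2 => by omega⟩
  · rintro i τ hi1 hi2 ⟨h1, h2, h3⟩ hr hF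
    have hL' := hL.frame hF rfl
    have e10 : τ.arrays 10 = σ.arrays 10 := hF.arr 10 rfl
    have e19 : τ.arrays 19 = σ.arrays 19 := hF.arr 19 rfl
    have hu : R (T.pv i) = T.u R i := rfl
    simp only [wp_cond, wp_skip, wp_seq, wp_set, eval, hr, e10, e19, hL'.rho, hL'.pv, hu]
    have hun : T.u R i < T.nv := hR _ (hT.pv_lt i hi1 hi2)
    refine ⟨fun h4 => ?_, fun h4 => ⟨fun h5 => ?_, fun h5 => ?_⟩⟩
    · simp only [arrays_setReg, regs_setReg, reduceEqDiff, if_false]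
      grind
    · simp only [arrays_setReg, regs_setReg, reduceEqDiff, if_false]
      grind
    · refine (wp_cmdMark (v := T.u R i) (by simpa using h1) (by simp) hun).mono ?_
      rintro u υ ⟨k1, k2, k3⟩
      have k4 : ∀ x, τ.arrays 23 x ≠ 0 → υ.arrays 23 x ≠ 0 := fun x hx => k3.mono (by simpa using
          hx)
      simp only [arrays_setReg, regs_setReg, reduceEqDiff, if_false]
      refine ⟨by omega, k2, fun v hv hv' => ?_, fun p hp1 hp2 hp3 hp4 => ?_⟩
      · by_cases hvu : v = T.u R i
        · exact ⟨i, hi1, hi2, h4, h5, hvu.symm⟩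
        · have h6 := k3.other v hvu
          simp_all
      · rcases lt_succ_iff_lt_or_eq.1 hp2 with h6 | rfl
        · exact k4 _ (h3 p hp1 h6 hp3 hp4)
        · exact k3.self
  · rintro t τ ht ⟨h1, h2, h3⟩ hF
    refine ⟨by omega, h1, h2, ?_⟩
    rintro v ⟨p, hp1, hp2, hp3, hp4, rfl⟩
    exact h3 p hp1 hp2 hp3 hp4

/-- Search backwards from each live variable that has not been marked. Register `17` is zero, or one
more than the last such variable. -/
def cmdRoots : Cmd :=
  set 17 (lit 0) ;;
  Cmd.for 5 (lit 0) (reg 1)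
    (cond (equal (get 8 (reg 5)) (reg 5))
      (cond (get 9 (reg 5))
        (cond (get 23 (reg 5)) skip
          (set 15 (reg 5) ;; cmdMark ;; cmdSearch 21 22 ;; set 17 (plus (reg 5) (lit 1))))
        skip)
      skip)

/-- The last root reaches no dead variable, and is reached by all variables that it reaches.
`F` is the relation whose edges are followed backwards. -/
structure RootInv (T : Tab) (R : ℕ → ℕ) (Y : Set ℕ) (F : ℕ → ℕ → Prop) (D : ℕ → Prop) (i : ℕ)
    (mk : ℕ → ℕ) (root : ℕ) : Prop where
  all : ∀ v < i, T.Live R Y v → mk v ≠ 0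
  none : root = 0 → ∀ v < T.nv, mk v ≠ 0 → ∃ d, D d ∧ ReflTransGen F v d
  some : ∀ r, root = r + 1 → T.Live R Y r ∧ mk r ≠ 0 ∧ (∀ d, D d → ¬ ReflTransGen F r d) ∧
    ∀ v < T.nv, mk v ≠ 0 → ReflTransGen F r v → ReflTransGen F v r

/-- If an earlier root were reached from the last one, the backward search from the former would
have marked the latter. So the last root is reached from all variables that it reaches. -/
theorem wp_cmdRoots (hT : T.WF) (hR : ∀ v < T.nv, R v < T.nv) (hL : Loaded T R σ)
    (hS : Lists T R σ) {Y : Set ℕ} (hY : ∀ v < T.nv, (σ.arrays 9 v = 0 ↔ v ∈ Y))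
    {mem bst : ℕ → ℕ} (hmem : σ.arrays 21 = mem) (hbst : σ.arrays 22 = bst) {D : ℕ → Prop}
    (hD : ∀ d, D d → d < T.nv ∧ σ.arrays 23 d ≠ 0)
    (hD' : ∀ v < T.nv, σ.arrays 23 v ≠ 0 → ∃ d, D d ∧ ReflTransGen (T.Link R bst mem) v d)
    (hle : σ.regs 9 = σ.regs 10) (hpop : Popped T R mem (σ.arrays 18) (σ.arrays 24) (σ.regs 9))
    (h : SearchInv T R mem bst (fun _ => True) (σ.arrays 18) (σ.arrays 23) (σ.arrays 24)
      (σ.regs 10)) :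
    WP cmdRoots σ fun t τ => t + searchPot T R σ ≤ searchPot T R τ + 15 * T.nv + 3 ∧
      τ.regs 9 ≤ T.nv ∧
      RootInv T R Y (T.Link R bst mem) D T.nv (τ.arrays 23) (τ.regs 17) := by
  rw [cmdRoots, wp_seq, wp_set]
  refine wp_for_time 0 T.nv (fun i t τ =>
    t + searchPot T R σ ≤ searchPot T R τ + 13 * i ∧ τ.regs 9 = τ.regs 10 ∧
    Popped T R mem (τ.arrays 18) (τ.arrays 24) (τ.regs 9) ∧
    SearchInv T R mem bst (fun _ => True) (τ.arrays 18) (τ.arrays 23) (τ.arrays 24) (τ.regs 10) ∧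
    (∀ d, D d → τ.arrays 23 d ≠ 0) ∧
    RootInv T R Y (T.Link R bst mem) D i (τ.arrays 23) (τ.regs 17)) rfl (Nat.zero_le _) rfl ?_ ?_
        ?_ ?_
  · intro τ hF
    simp only [eval]
    rw [hF.reg 1 rfl]
    simp [hL.nv]
  · simp only [regs_setReg, arrays_setReg, reduceEqDiff, if_true, if_false, eval,
      searchPot, qlist]
    exact ⟨by omega, hle, hpop, h, fun d hd => (hD d hd).2, by omega, fun _ => hD',
      fun r hr => by omega⟩
  · rintro i t τ - hi ⟨h1, h2, h3, h4, h5, h6⟩ hr hF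
    have hL0 : Loaded T R (σ.setReg 17 (eval σ (lit 0))) := by
      constructor <;> simp [hL.nr, hL.nv, hL.np, hL.no, hL.nc, hL.cv, hL.cp, hL.cr, hL.co, hL.os,
        hL.pg, hL.pv, hL.rho]
    have hS0 : Lists T R (σ.setReg 17 (eval σ (lit 0))) :=
      ⟨hS.head_eq, hS.next_eq, hS.cf_iff, hS.inv_iff⟩
    have hL' := hL0.frame hF rfl
    have hS' := hS0.frame hF rfl
    have e9 : τ.arrays 9 = σ.arrays 9 := by rw [hF.arr 9 rfl]; simp
    have e21 : τ.arrays 21 = mem := by rw [hF.arr 21 rfl]; simp [hmem]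
    have e22 : τ.arrays 22 = bst := by rw [hF.arr 22 rfl]; simp [hbst]
    have hlive : T.Live R Y i ↔ R i = i ∧ σ.arrays 9 i ≠ 0 := by
      rw [Ne, hY i hi]
      simp [Tab.Live, hi]
    have hstay : (T.Live R Y i → τ.arrays 23 i ≠ 0) →
        RootInv T R Y (T.Link R bst mem) D (i + 1) (τ.arrays 23) (τ.regs 17) := by
      intro h7
      refine ⟨fun v hv hl => ?_, h6.none, h6.some⟩
      rcases lt_succ_iff_lt_or_eq.1 hv with h8 | rfl
      · exact h6.all v h8 hl
      · exact h7 hl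
    simp only [wp_cond, wp_skip, eval, hr, hL'.rho, e9]
    refine ⟨fun h7 => ⟨fun h8 => ⟨fun h9 => ?_, fun h9 => ?_⟩, fun h8 => ?_⟩, fun h7 => ?_⟩
    · simp only [regs_setReg, arrays_setReg, reduceEqDiff, if_false, searchPot,
        qlist] at h1 ⊢
      grind
    · have hRi : R i = i := by simp_all
      have hli := hlive.2 ⟨hRi, h8⟩
      rw [wp_seq, wp_set, wp_seq]
      simp only [eval, hr]
      refine (wp_cmdMark (v := i) (by simpa using h4.mark) (by simp) hi).frame.mono ?_
      rintro u υ ⟨⟨k1, k2, k3⟩, hFu⟩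
      have hM : Marked i τ υ := by
        obtain ⟨l1, l2, l3, l4⟩ := k3
        exact ⟨l1, by simpa using l2, by simpa using l3, by simpa using l4⟩
      have hL2 : Loaded T R υ := by
        refine Loaded.frame (σ := τ.setReg 15 i) ?_ hFu rfl
        constructor <;> simp [hL'.nr, hL'.nv, hL'.np, hL'.no, hL'.nc, hL'.cv, hL'.cp, hL'.cr,
          hL'.co, hL'.os, hL'.pg, hL'.pv, hL'.rho]
      have hS2 : Lists T R υ :=
        Lists.frame (σ := τ.setReg 15 i) ⟨hS'.head_eq, hS'.next_eq, hS'.cf_iff, hS'.inv_iff⟩ hFu rfl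
      have f24 : υ.arrays 24 = τ.arrays 24 := by rw [hFu.arr 24 rfl]; simp
      have f21 : υ.arrays 21 = mem := by rw [hFu.arr 21 rfl]; simp [e21]
      have f22 : υ.arrays 22 = bst := by rw [hFu.arr 22 rfl]; simp [e22]
      have f9 : υ.regs 9 = τ.regs 9 := by rw [hFu.reg 9 rfl]; simp
      have hq : ∀ j < τ.regs 9, υ.arrays 18 j = τ.arrays 18 j := fun j hj => hM.q_eq j (by omega)
      have hpop' : Popped T R mem (υ.arrays 18) (υ.arrays 24) (υ.regs 9) := by
        intro j hj c hc hca hcw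
        rw [f9] at hj
        rw [hq j hj] at hcw
        rw [f24]
        exact h3 j hj c hc hca hcw
      have hqlist : qlist υ = qlist τ := by
        rw [qlist, qlist, f9]
        simp_all
      have hpot : searchPot T R υ = searchPot T R τ := by
        unfold searchPot
        rw [hqlist, f9, f24]
      -- what was marked before is closed under the edges that are followed
      have hback : ∀ x y, ReflTransGen (T.Link R bst mem) x y → τ.arrays 23 y ≠ 0 →
          τ.arrays 23 x ≠ 0 := by
        intro x y hxy
        induction hxy with
        | refl => exact fun h => h
        | tail _ hbc ih =>
          intro hy
          exact ih (h4.closed hR hT (by rwa [← h2]) hy hbc.symm)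
      have hP : SearchInv T R mem bst
          (fun x => τ.arrays 23 x ≠ 0 ∨ ReflTransGen (T.Link R bst mem) x i)
          (υ.arrays 18) (υ.arrays 23) (υ.arrays 24) (υ.regs 10) := by
        rw [f24]
        refine SearchInv.marked (σ := τ) ⟨h4.mark, h4.hit_out, fun v _ hv => .inl hv⟩ k2 hM
          (.inr .refl)
      rw [wp_seq]
      refine (wp_cmdSearch hT hR (.inl rfl) (.inr rfl) hL2 hS2 f21 f22 ?_
        (by rw [f9, h2]; exact hM.le) hpop' hP).frame.mono ?_
      · rintro x y (hx | hx) hxy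
        · exact .inl (hback _ _ (ReflTransGen.single hxy.symm) hx)
        · exact .inr (ReflTransGen.head hxy.symm hx)
      rintro u' ω ⟨⟨l1, l2, l3, l4, l5, l6, l7⟩, hFω⟩
      have g5 : ω.regs 5 = i := by rw [hFω.reg 5 rfl, hFu.reg 5 rfl]; simp [hr]
      rw [wp_set]
      simp only [eval, g5, regs_setReg, arrays_setReg, reduceEqDiff, if_true, if_false]
      have hpot2 : searchPot T R ((ω.setReg 17 (i + 1)).setReg 5 (i + 1)) = searchPot T R ω := by
        simp [searchPot, qlist]
      rw [hpot2]
      refine ⟨by omega, l3, l4, ⟨l2.mark, l2.hit_out, fun _ _ _ => trivial⟩,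
        fun d hd => l5 d (hM.mono (h5 d hd)), ⟨?_, fun h10 => by omega, ?_⟩⟩
      · intro v hv hl
        rcases lt_succ_iff_lt_or_eq.1 hv with h8 | rfl
        · exact l5 v (hM.mono (h6.all v h8 hl))
        · exact l5 v hM.self
      · intro r hr
        obtain rfl : r = i := by omega
        refine ⟨hli, l5 r hM.self, fun d hd hrd => hback _ _ hrd (h5 d hd) h9,
            fun v hv hmv hrv => ?_⟩
        rcases l2.prop v hv hmv with h10 | h10
        · exact absurd h9 (hback _ _ hrv h10)
        · exact h10
    · simp only [regs_setReg, arrays_setReg, reduceEqDiff, if_false, searchPot,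
        qlist] at h1 ⊢
      grind
    · simp only [regs_setReg, arrays_setReg, reduceEqDiff, if_false, searchPot,
        qlist] at h1 ⊢
      grind
  · rintro t τ ⟨h1, h2, h3, h4, h5, h6⟩ hF
    have := h4.mark.le
    exact ⟨by omega, by omega, h6⟩

end Comp

section Comp

open Exp Cmd Relation

variable {T : Tab} {R : ℕ → ℕ} {σ : State}

/-- Search for a component. Register `17` is zero if there is none; otherwise the queue holds its
members. -/
def cmdComp : Cmd :=
  cmdBest ;; cmdUnmark ;; cmdMarkDead ;; cmdSearch 21 22 ;; cmdRoots ;;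
  cond (reg 17) (cmdUnmark ;; set 15 (minus (reg 17) (lit 1)) ;; cmdMark ;; cmdSearch 22 21) skip

/-- The result of the search for a component. -/
def CompDone (T : Tab) (R : ℕ → ℕ) (Y : Set ℕ) (σ : State) : Prop :=
  (σ.regs 17 = 0 ∧ ∀ U, T.FlatAdm R Y U → U = ∅) ∨
    ∃ r, σ.regs 17 = r + 1 ∧ MarkInv T (σ.arrays 18) (σ.arrays 23) (σ.regs 10) ∧
      0 < σ.regs 10 ∧ σ.arrays 18 0 = r ∧
      T.FlatAdm R Y {v | v < T.nv ∧ σ.arrays 23 v ≠ 0} ∧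
      ∀ U ⊆ {v | v < T.nv ∧ σ.arrays 23 v ≠ 0}, U.Nonempty → T.FlatAdm R Y U →
        {v | v < T.nv ∧ σ.arrays 23 v ≠ 0} ⊆ U

/-- Combines the two searches: the variables reached from the last root form a minimal nonempty
admissible set. -/
theorem wp_cmdComp (hT : T.WF) (hR : ∀ v < T.nv, R v < T.nv) (hRR : ∀ v < T.nv, R (R v) = R v)
    (hL : Loaded T R σ) (hS : Lists T R σ) {L : List ℕ} (h : StripDone T R L σ)
    (hI : T.InterGood R {x | x ∈ L}) :
    WP cmdComp σ fun t τ => t ≤ 200 * (T.nv + T.np + T.no + T.nc + 1) ∧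
      CompDone T R {x | x ∈ L} τ := by
  rw [cmdComp, wp_seq]
  refine (wp_cmdBest hT hR hL hS h).frame.mono ?_
  rintro t1 τ1 ⟨⟨ht1, hB⟩, hF1⟩
  have hL1 := hL.frame hF1 rfl
  have hS1 := hS.frame hF1 rfl
  rw [wp_seq]
  refine (wp_cmdUnmark hL1).frame.mono ?_
  rintro t2 τ2 ⟨⟨ht2, h23, h24, h9, h10⟩, hF2⟩
  have hL2 := hL1.frame hF2 rfl
  have hS2 := hS1.frame hF2 rfl
  rw [wp_seq]
  refine (wp_cmdMarkDead hT hR hL2 h23 h10).frame.mono ?_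
  rintro t3 τ3 ⟨⟨ht3, hM, hD1, hD2⟩, hF3⟩
  have hL3 := hL2.frame hF3 rfl
  have hS3 := hS2.frame hF3 rfl
  obtain ⟨mem, hmem⟩ : ∃ m, τ1.arrays 21 = m := ⟨_, rfl⟩
  obtain ⟨bst, hbst⟩ : ∃ m, τ1.arrays 22 = m := ⟨_, rfl⟩
  obtain ⟨bc, hbc⟩ : ∃ m, τ1.arrays 19 = m := ⟨_, rfl⟩
  obtain ⟨bo, hbo⟩ : ∃ m, τ1.arrays 20 = m := ⟨_, rfl⟩
  have e10 : τ1.arrays 10 = σ.arrays 10 := hF1.arr 10 rfl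
  have e15 : τ1.arrays 15 = σ.arrays 15 := hF1.arr 15 rfl
  obtain ⟨hBI, hbiff⟩ := hB
  rw [hmem, hbc, hbo, e10, e15] at hBI
  rw [hmem, hbo, hbst, e10] at hbiff
  have f10 : τ2.arrays 10 = σ.arrays 10 := by rw [hF2.arr 10 rfl, e10]
  have f19 : τ2.arrays 19 = bc := by rw [hF2.arr 19 rfl, hbc]
  rw [f10, f19] at hD1 hD2
  have g9 : τ3.arrays 9 = σ.arrays 9 := by rw [hF3.arr 9 rfl, hF2.arr 9 rfl, hF1.arr 9 rfl]
  have g21 : τ3.arrays 21 = mem := by rw [hF3.arr 21 rfl, hF2.arr 21 rfl, hmem]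
  have g22 : τ3.arrays 22 = bst := by rw [hF3.arr 22 rfl, hF2.arr 22 rfl, hbst]
  have g24 : τ3.arrays 24 = τ2.arrays 24 := hF3.arr 24 rfl
  have g9' : τ3.regs 9 = 0 := by rw [hF3.reg 9 rfl, h9]
  have hSI : SearchInv T R mem bst (fun _ => True) (τ3.arrays 18) (τ3.arrays 23) (τ3.arrays 24)
      (τ3.regs 10) := by
    refine ⟨hM, fun c hc h1 => ?_, fun _ _ _ => trivial⟩
    rw [g24] at h1
    exact absurd (h24 _ (hT.co_lt c hc)) h1
  set D := T.Dead R (σ.arrays 10) bc with hDdef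
  have hDlt : ∀ d, D d → d < T.nv := by
    rintro d ⟨p, hp1, hp2, -, -, rfl⟩
    exact hR _ (hT.pv_lt p hp1 hp2)
  rw [wp_seq]
  refine (wp_cmdSearch (fa := mem) (fb := bst)
    (P := fun x => ∃ d, D d ∧ ReflTransGen (T.Link R bst mem) x d) hT hR (.inl rfl) (.inr rfl)
    hL3 hS3 g21 g22 ?_ (by omega) (by intro i hi; omega)
    ⟨hM, hSI.hit_out, fun v hv hv' => ⟨v, hD1 v hv hv', .refl⟩⟩).frame.mono ?_
  · rintro x y ⟨d, hd, hxd⟩ hxy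
    exact ⟨d, hd, hxd.head hxy.symm⟩
  rintro t4 τ4 ⟨⟨ht4, hSI4, h910, hpop4, hmono4, -, -⟩, hF4⟩
  have hL4 := hL3.frame hF4 rfl
  have hS4 := hS3.frame hF4 rfl
  rw [wp_seq]
  refine (wp_cmdRoots (Y := {x | x ∈ L}) (D := D) hT hR hL4 hS4 ?_
    (by rw [hF4.arr 21 rfl, g21]) (by rw [hF4.arr 22 rfl, g22])
    (fun d hd => ⟨hDlt d hd, hmono4 d (hD2 d hd)⟩) hSI4.prop h910 hpop4
    ⟨hSI4.mark, hSI4.hit_out, fun _ _ _ => trivial⟩).frame.mono ?_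
  · rw [hF4.arr 9 rfl, g9]
    exact h.need_iff
  rintro t5 τ5 ⟨⟨ht5, hle5, hroot⟩, hF5⟩
  have hL5 := hL4.frame hF5 rfl
  have hS5 := hS4.frame hF5 rfl
  have hpot5 := searchPot_le (R := R) hT hle5
  have hSI4m := hSI4.mark.le
  have hpot4 : searchPot T R τ4 ≤ 20 * T.nv + 28 * T.nc := searchPot_le hT (by omega)
  -- every link leads to a live variable
  have hlink : ∀ x y, T.Link R bst mem x y → T.Live R {x | x ∈ L} y := by
    rintro x y ⟨c, hc, c', hc', -, h2, -, -, rfl⟩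
    have h3 := mem_alive.1 ((hBI.mem_iff c' hc').1 h2).1
    exact ⟨hR _ (hT.cv_lt c' hc'), hRR _ (hT.cv_lt c' hc'), h3.2.2⟩
  have hclosed : ∀ U, T.FlatAdm R {x | x ∈ L} U → ∀ x ∈ U, ∀ y,
      ReflTransGen (T.Link R bst mem) x y → y ∈ U := by
    intro U hU x hx y hxy
    induction hxy with
    | refl => exact hx
    | tail _ hbc ih => exact FlatAdm.closed hT hI h.inv hBI hbiff hU ih hbc
  rw [wp_cond, wp_skip]
  simp only [eval]
  refine ⟨fun h17 => ?_, fun h17 => ?_⟩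
  · obtain ⟨r, hr⟩ := exists_eq_succ_of_ne_zero h17
    obtain ⟨hrl, -, hrD, hrs⟩ := hroot.some r hr
    rw [wp_seq]
    refine (wp_cmdUnmark hL5).frame.mono ?_
    rintro t6 τ6 ⟨⟨ht6, k23, k24, k9, k10⟩, hF6⟩
    have hL6 := hL5.frame hF6 rfl
    have hS6 := hS5.frame hF6 rfl
    have r17 : τ6.regs 17 = r + 1 := by rw [hF6.reg 17 rfl]; exact hr
    rw [wp_seq, wp_set, wp_seq]
    have hev : eval τ6 (minus (reg 17) (lit 1)) = r := by simp [eval, r17]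
    rw [hev]
    refine (wp_cmdMark (T := T) (v := r) (by simpa [k10] using markInv_zero k23) (by simp)
      hrl.1).frame.mono ?_
    rintro t7 τ7 ⟨⟨ht7, m1, m2⟩, hF7⟩
    have hL7 : Loaded T R τ7 := by
      refine Loaded.frame (σ := τ6.setReg 15 r) ?_ hF7 rfl
      constructor <;> simp [hL6.nr, hL6.nv, hL6.np, hL6.no, hL6.nc, hL6.cv, hL6.cp, hL6.cr,
        hL6.co, hL6.os, hL6.pg, hL6.pv, hL6.rho]
    have hS7 : Lists T R τ7 :=
      Lists.frame (σ := τ6.setReg 15 r) ⟨hS6.head_eq, hS6.next_eq, hS6.cf_iff, hS6.inv_iff⟩ hF7 rfl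
    have l21 : τ7.arrays 21 = mem := by
      rw [hF7.arr 21 rfl, arrays_setReg, hF6.arr 21 rfl, hF5.arr 21 rfl, hF4.arr 21 rfl, g21]
    have l22 : τ7.arrays 22 = bst := by
      rw [hF7.arr 22 rfl, arrays_setReg, hF6.arr 22 rfl, hF5.arr 22 rfl, hF4.arr 22 rfl, g22]
    have l24 : τ7.arrays 24 = τ6.arrays 24 := by rw [hF7.arr 24 rfl]; rfl
    have l9 : τ7.regs 9 = 0 := by rw [hF7.reg 9 rfl]; simp [k9]
    have l17 : τ7.regs 17 = r + 1 := by rw [hF7.reg 17 rfl]; simp [r17]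
    have hmk7 : ∀ v < T.nv, τ7.arrays 23 v ≠ 0 → v = r := by
      intro v hv hv'
      by_contra hne
      have := m2.other v hne
      rw [arrays_setReg] at this
      grind
    obtain ⟨j, hj, hjr⟩ := (m1.q_iff r hrl.1).1 m2.self
    have hj0 : τ7.arrays 18 0 = r := by
      refine hmk7 _ (m1.q_lt 0 (by omega)) ((m1.q_iff _ (m1.q_lt 0 (by omega))).2 ⟨0, by omega,
          rfl⟩)
    refine (wp_cmdSearch (fa := bst) (fb := mem) (P := fun x => ReflTransGen (T.Link R bst mem) r x)
      hT hR (.inr rfl) (.inl rfl) hL7 hS7 l22 l21 ?_ (by omega) (by intro i hi; omega)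
      ⟨m1, ?_, ?_⟩).frame.mono ?_
    · grind
    · intro c hc h1
      rw [l24] at h1
      exact absurd (k24 _ (hT.co_lt c hc)) h1
    · grind
    rintro t8 τ8 ⟨⟨ht8, n1, n2, n3, n4, n5, n6⟩, hF8⟩
    have n1m := n1.mark.le
    have hpot8 : searchPot T R τ8 ≤ 20 * T.nv + 28 * T.nc := searchPot_le hT (by omega)
    refine ⟨by omega, .inr ⟨r, by rw [hF8.reg 17 rfl, l17], n1.mark, by omega,
      by rw [n5 0 (by omega), hj0], ?_, ?_⟩⟩
    · have hrmk : τ8.arrays 23 r ≠ 0 := n4 r m2.self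
      refine flatAdm_of_closed hT h.inv hBI hbiff ?_ ?_ ?_
      · rintro x ⟨hx, hx'⟩
        have hrx := n1.prop x hx hx'
        grind
      · rintro x ⟨hx, hx'⟩ hxd
        exact hrD x hxd (n1.prop x hx hx')
      · rintro x ⟨hx, hx'⟩ y hxy
        exact ⟨(hlink x y hxy).1, n1.closed hR hT (by rwa [← n2]) hx' hxy⟩
    · rintro U hUS ⟨y, hy⟩ hU x ⟨hx, hx'⟩
      obtain ⟨hyn, hymk⟩ := hUS hy
      have hry := n1.prop y hyn hymk
      have hyl := (hU y hy).1
      have hyr := hrs y hyn (hroot.all y hyn hyl) hry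
      exact hclosed U hU y hy x (hyr.trans (n1.prop x hx hx'))
  · refine ⟨by omega, .inl ⟨h17, fun U hU => ?_⟩⟩
    by_contra hne
    obtain ⟨x, hx⟩ := Set.nonempty_iff_ne_empty.2 hne
    have hxl := (hU x hx).1
    obtain ⟨d, hd, hxd⟩ := hroot.none h17 x hxl.1 (hroot.all x hxl.1 hxl)
    exact FlatAdm.not_dead h.inv hBI hU (hclosed U hU x hx d hxd) hd

/-! ### Rounds -/

/-- Report the result of the search for a component and contract the component. -/
def cmdReport : Cmd :=
  cond (reg 17)
    (emit (lit 1) ;; emit (reg 10) ;;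
      Cmd.for 5 (lit 0) (reg 10) (emit (get 18 (reg 5))) ;;
      Cmd.for 5 (lit 0) (reg 1)
        (cond (get 23 (get 8 (reg 5))) (put 8 (reg 5) (minus (reg 17) (lit 1))) skip))
    (emit (lit 2) ;; emit (lit 0) ;; set 18 (lit 0))

theorem wp_cmdReport (hR : ∀ v < T.nv, R v < T.nv) (hL : Loaded T R σ) {Y : Set ℕ}
    (h : CompDone T R Y σ) :
    WP cmdReport σ fun t τ => t ≤ 10 * T.nv + 10 ∧
      ((∀ U, T.FlatAdm R Y U → U = ∅) ∧ τ.out = σ.out ++ [2, 0] ∧ τ.regs 18 = 0 ∨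
        ∃ r S, (r :: S).Nodup ∧ T.FlatAdm R Y {x | x ∈ r :: S} ∧
          (∀ U ⊆ {x | x ∈ r :: S}, U.Nonempty → T.FlatAdm R Y U → {x | x ∈ r :: S} ⊆ U) ∧
          τ.out = σ.out ++ 1 :: (r :: S).length :: r :: S ∧ τ.regs 18 = σ.regs 18 ∧
          Loaded T (fun v => if v < T.nv ∧ R v ∈ r :: S then r else R v) τ) := by
  rw [cmdReport, wp_cond]
  simp only [eval]
  rcases h with ⟨h17, hno⟩ | ⟨r, h17, hM, hq0, hqr, hA, hmin⟩
  · refine ⟨fun h => absurd h17 h, fun _ => ?_⟩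
    simp only [wp_seq, wp_emit, wp_set, eval]
    exact ⟨by omega, .inl ⟨hno, by simp, by simp⟩⟩
  refine ⟨fun _ => ?_, fun h => by omega⟩
  simp only [wp_seq, wp_emit, eval, regs_addOut]
  obtain ⟨Q, hQ⟩ : ∃ Q, Q = (List.range (σ.regs 10)).map (σ.arrays 18) := ⟨_, rfl⟩
  have hQmem : ∀ x, x ∈ Q ↔ ∃ j < σ.regs 10, σ.arrays 18 j = x := by
    intro x
    rw [hQ]
    simp
  have hQset : {x | x ∈ Q} = {v | v < T.nv ∧ σ.arrays 23 v ≠ 0} := by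
    ext x
    simp only [Set.mem_ofPred_eq, hQmem]
    constructor
    · rintro ⟨j, hj, rfl⟩
      have := hM.q_lt j hj
      exact ⟨this, (hM.q_iff _ this).2 ⟨j, hj, rfl⟩⟩
    · rintro ⟨hx, hx'⟩
      exact (hM.q_iff x hx).1 hx'
  have hQr : ∃ S, Q = r :: S := by
    obtain ⟨k, hk⟩ := exists_eq_succ_of_ne_zero hq0.ne'
    rw [hQ, hk, List.range_succ_eq_map, map_cons, hqr]
    exact ⟨_, rfl⟩
  have hQnd : Q.Nodup := by
    rw [hQ]
    refine List.Nodup.map_on (fun i hi j hj hij => ?_) List.nodup_range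
    exact hM.q_inj i (mem_range.1 hi) j (mem_range.1 hj) hij
  have hQlen : Q.length = σ.regs 10 := by simp [hQ]
  have hqle := hM.le
  refine wp_for 0 (σ.regs 10) 1 (fun i τ =>
    τ.out = σ.out ++ [1, σ.regs 10] ++ (List.range i).map (σ.arrays 18)) rfl (Nat.zero_le _) rfl
    (fun τ hF => by simp only [eval]; rw [hF.reg 10 rfl]; simp) (by simp) ?_ ?_
  · intro i τ _ hi hJ hr hF
    simp only [wp_emit, eval, hr]
    have e18 : τ.arrays 18 = σ.arrays 18 := by rw [hF.arr 18 rfl]; rfl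
    refine ⟨le_rfl, ?_⟩
    simp [hJ, e18, List.range_succ]
  intro t τ ht hJ hF
  have hL0 : Loaded T R ((σ.addOut 1).addOut (σ.regs 10)) := by
    constructor <;> simp [hL.nr, hL.nv, hL.np, hL.no, hL.nc, hL.cv, hL.cp, hL.cr, hL.co, hL.os,
      hL.pg, hL.pv, hL.rho]
  have hL1 := hL0.frame hF rfl
  have e23 : τ.arrays 23 = σ.arrays 23 := by rw [hF.arr 23 rfl]; rfl
  have e17 : τ.regs 17 = r + 1 := by rw [hF.reg 17 rfl]; simp [h17]
  refine wp_for 0 T.nv 2 (fun i τ' => τ'.arrays 8 =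
      fun v => if v < i ∧ σ.arrays 23 (R v) ≠ 0 then r else R v) rfl (Nat.zero_le _) rfl
    (fun τ' hF' => by simp only [eval]; rw [hF'.reg 1 rfl]; exact hL1.nv)
    (by simp [hL1.rho]) ?_ ?_
  · intro i τ' _ hi hJ' hr hF'
    have f23 : τ'.arrays 23 = σ.arrays 23 := by rw [hF'.arr 23 rfl, e23]
    have f17 : τ'.regs 17 = r + 1 := by rw [hF'.reg 17 rfl, e17]
    have hRi : τ'.arrays 8 i = R i := by simp [hJ']
    simp only [wp_cond, wp_skip, wp_put, eval, hr, hRi, f23, f17]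
    refine ⟨fun h1 => ⟨le_rfl, ?_⟩, fun h1 => ⟨by norm_num, ?_⟩⟩
    · simp only [arrays_setReg, arrays_setArr, if_true]
      funext v
      grind
    · simp only [arrays_setReg]
      grind
  intro t' τ' ht' hJ' hF'
  obtain ⟨S, hS⟩ := hQr
  refine ⟨by omega, .inr ⟨r, S, ?_, ?_, ?_, ?_, ?_, ?_⟩⟩
  · rwa [← hS]
  · rwa [← hS, hQset]
  · simp_all
  · rw [hF'.out rfl, hJ, ← hS, hQlen, ← hQ]
    simp
  · rw [hF'.reg 18 rfl, hF.reg 18 rfl]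
    rfl
  · have hR' : τ'.arrays 8 = fun v => if v < T.nv ∧ R v ∈ r :: S then r else R v := by
      rw [hJ']
      funext v
      by_cases hv : v < T.nv
      · have : R v ∈ Q ↔ σ.arrays 23 (R v) ≠ 0 := by
          have h1 := Set.ext_iff.1 hQset (R v)
          grind
        simp_all
      · simp [hv]
    constructor
    · rw [hF'.reg 0 rfl, hL1.nr]
    · rw [hF'.reg 1 rfl, hL1.nv]
    · rw [hF'.reg 2 rfl, hL1.np]
    · rw [hF'.reg 3 rfl, hL1.no]
    · rw [hF'.reg 4 rfl, hL1.nc]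
    · rw [hF'.arr 1 rfl, hL1.cv]
    · rw [hF'.arr 2 rfl, hL1.cp]
    · rw [hF'.arr 3 rfl, hL1.cr]
    · rw [hF'.arr 4 rfl, hL1.co]
    · rw [hF'.arr 5 rfl, hL1.os]
    · rw [hF'.arr 6 rfl, hL1.pg]
    · rw [hF'.arr 7 rfl, hL1.pv]
    · exact hR'

/-- Strip variables as long as possible; then answer, or contract a component. -/
def cmdRound : Cmd :=
  cmdStrip ;; cond (reg 16) (cmdComp ;; cmdReport) (emit (lit 2) ;; emit (lit 1) ;; set 18 (lit 0))

/-- The outcome of a round in which the variables in `L` are stripped. -/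
structure RoundDone (T : Tab) (R : ℕ → ℕ) (L : List ℕ) (σ τ : State) : Prop where
  mem_lt : ∀ x ∈ L, x < T.nv ∧ R x = x
  exhausted : ∀ v < T.nv, R v = v → v ∉ L → ¬ T.FlatSink R {x | x ∈ L} v
  outcome :
    (∀ v < T.nr, R v = v → v ∈ L) ∧ τ.out = σ.out ++ stripWords T.nr L ++ [2, 1] ∧ τ.regs 18 = 0 ∨
    (∃ v < T.nr, R v = v ∧ v ∉ L) ∧
      ((∀ U, T.FlatAdm R {x | x ∈ L} U → U = ∅) ∧
        τ.out = σ.out ++ stripWords T.nr L ++ [2, 0] ∧ τ.regs 18 = 0 ∨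
      ∃ r S, (r :: S).Nodup ∧ T.FlatAdm R {x | x ∈ L} {x | x ∈ r :: S} ∧
        (∀ U ⊆ {x | x ∈ r :: S}, U.Nonempty → T.FlatAdm R {x | x ∈ L} U →
          {x | x ∈ r :: S} ⊆ U) ∧
        τ.out = σ.out ++ stripWords T.nr L ++ 1 :: (r :: S).length :: r :: S ∧
        τ.regs 18 = σ.regs 18 ∧
        Loaded T (fun v => if v < T.nv ∧ R v ∈ r :: S then r else R v) τ)

theorem wp_cmdRound (hT : T.WF) (hR : ∀ v < T.nv, R v < T.nv) (hRR : ∀ v < T.nv, R (R v) = R v)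
    (hL : Loaded T R σ) (M : List ℕ → Prop) (hM0 : M [])
    (hM : ∀ L v, M L → v ∉ L → v < T.nv → R v = v → T.FlatSink R {x | x ∈ L} v → M (L ++ [v]))
    (hI : ∀ L, M L → T.InterGood R {x | x ∈ L}) :
    WP cmdRound σ fun t τ => t ≤ 400 * (T.nv + T.np + T.no + T.nc + 1) ∧
      ∃ L, M L ∧ RoundDone T R L σ τ := by
  rw [cmdRound, wp_seq]
  refine (wp_cmdStrip hT hR hL M hM0 hM).frame.mono ?_
  rintro t1 τ1 ⟨⟨ht1, hS1, L, hML, hD, hout1⟩, hF1⟩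
  have hL1 := hL.frame hF1 rfl
  have hex : ∀ v < T.nv, R v = v → v ∉ L → ¬ T.FlatSink R {x | x ∈ L} v :=
    fun v hv hRv hvL => hD.not_flatSink hT hv hRv hvL
  have hfin : {v | v < T.nr ∧ R v = v ∧ v ∉ {x | x ∈ L}}.Finite :=
    (Set.finite_lt_nat T.nr).subset fun v hv => hv.1
  rw [wp_cond]
  simp only [eval, hD.rem_eq]
  refine ⟨fun h0 => ?_, fun h0 => ?_⟩
  · have hne : ∃ v < T.nr, R v = v ∧ v ∉ L := by
      obtain ⟨v, h1, h2, h3⟩ := (Set.ncard_pos hfin).1 (Nat.pos_of_ne_zero h0)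
      exact ⟨v, h1, h2, h3⟩
    rw [wp_seq]
    refine (wp_cmdComp hT hR hRR hL1 hS1 hD (hI L hML)).frame.mono ?_
    rintro t2 τ2 ⟨⟨ht2, hC⟩, hF2⟩
    have hL2 := hL1.frame hF2 rfl
    refine (wp_cmdReport hR hL2 hC).mono ?_
    rintro t3 τ3 ⟨ht3, h3⟩
    rw [hF2.out rfl, hF2.reg 18 rfl, hF1.reg 18 rfl, hout1] at h3
    exact ⟨by omega, L, hML, hD.mem_lt, hex, .inr ⟨hne, h3⟩⟩
  · simp only [wp_seq, wp_emit, wp_set, eval]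
    refine ⟨by omega, L, hML, hD.mem_lt, hex, .inl ⟨?_, by simp [hout1], by simp⟩⟩
    intro v hv hRv
    by_contra hvL
    have : v ∈ {v | v < T.nr ∧ R v = v ∧ v ∉ {x | x ∈ L}} := ⟨hv, hRv, hvL⟩
    rw [Tab.rem, Set.ncard_eq_zero hfin] at h0
    rw [h0] at this
    exact this

end Comp

/-! ### Tables of groups -/

/-- Number the pairs of a cell from `b` on. -/
def Cell.shift (b : ℕ) (c : Cell) : Cell := ⟨c.var, if c.pair = 0 then 0 else b + c.pair - 1,
    c.rank⟩

/-- The pairs, each with the number of the first pair of its group, and the options of groups. -/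
abbrev Layout := List (ℕ × ℕ) × List (List Cell)

/-- Append the pairs and the options of a group. -/
def addGroup (S : Layout) (g : Group) : Layout :=
  (S.1 ++ g.gov.map fun v => (S.1.length, v), S.2 ++ g.opts.map fun o => o.map (Cell.shift
      S.1.length))

/-- The pair with number `0` belongs to no group. -/
def layout (G : List Group) : Layout := G.foldl addGroup ([(0, 0)], [])

/-- The pairs of the group are numbered from `b` on. -/
structure Placed (S : Layout) (g : Group) (b : ℕ) : Prop where
  pos : 1 ≤ b
  le : b + g.gov.length ≤ S.1.length
  pairs : ∀ (i : ℕ) (v : ℕ), g.gov[i]? = some v → S.1[b + i]? = some (b, v)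
  opts : ∀ o ∈ g.opts, o.map (Cell.shift b) ∈ S.2
  own : ∀ o ∈ S.2, ∀ c ∈ o, b ≤ c.pair → c.pair < b + g.gov.length →
    ∃ o' ∈ g.opts, o = o'.map (Cell.shift b)

/-- The layout consists of the given groups. -/
structure Laid (S : Layout) (G : List Group) : Prop where
  pos : 1 ≤ S.1.length
  placed : ∀ g ∈ G, ∃ b, Placed S g b
  of_pair : ∀ p, 1 ≤ p → p < S.1.length → ∃ g ∈ G, ∃ b i,
      p = b + i ∧ i < g.gov.length ∧ Placed S g b
  of_opt : ∀ o ∈ S.2, ∃ g ∈ G, ∃ b, Placed S g b ∧ ∃ o' ∈ g.opts, o = o'.map (Cell.shift b)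

/-- The group speaks about variables below `N`, and the ranks in its options are small. -/
structure Group.WF (N : ℕ) (g : Group) : Prop where
  gov_lt : ∀ v ∈ g.gov, v < N
  var_lt : ∀ o ∈ g.opts, ∀ c ∈ o, c.var < N
  rank_lt : ∀ o ∈ g.opts, ∀ c ∈ o, c.rank < o.length
  pair : ∀ o ∈ g.opts, ∀ c ∈ o, ∀ i, c.pair = i + 1 → g.gov[i]? = some c.var

theorem Group.WF.shift_pair {N : ℕ} {g : Group} (h : g.WF N) {b : ℕ} {o : List Cell}
    (ho : o ∈ g.opts) {c : Cell} (hc : c ∈ o.map (Cell.shift b)) :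
    c.pair = 0 ∨ b ≤ c.pair ∧ c.pair < b + g.gov.length := by
  obtain ⟨d, hd, rfl⟩ := mem_map.1 hc
  unfold Cell.shift
  dsimp only
  split_ifs with h0
  · exact .inl rfl
  · right
    obtain ⟨i, hi⟩ := exists_eq_succ_of_ne_zero h0
    have := (getElem?_eq_some_iff.1 (h.pair o ho d hd i hi)).1
    omega

theorem Laid.addGroup {N : ℕ} {S : Layout} {G : List Group} (h : Laid S G) {g : Group}
    (hG : ∀ g ∈ G, g.WF N) (hg : g.WF N) : Laid (addGroup S g) (G ++ [g]) := by
  have hlen : (TCSP.addGroup S g).1.length = S.1.length + g.gov.length := by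
    simp [TCSP.addGroup]
  have hpl : Placed (TCSP.addGroup S g) g S.1.length := by
    refine ⟨h.pos, hlen.ge, fun i v hv => ?_, fun o ho => ?_, fun o hoS c hc h1 h2 => ?_⟩
    · simp [TCSP.addGroup, getElem?_append_right, hv]
    · exact List.mem_append_right _ (mem_map_of_mem ho)
    · rcases mem_append.1 hoS with h3 | h3
      · exfalso
        obtain ⟨g', hg', b, hb, o', ho', rfl⟩ := h.of_opt o h3
        have h5 := h.pos
        have h6 := hb.le
        rcases (hG g' hg').shift_pair ho' hc with h4 | h4 <;> omega
      · grind
  have hmono : ∀ {g' b}, Placed S g' b → Placed (TCSP.addGroup S g) g' b := by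
    intro g' b hp
    have h5 := hp.le
    refine ⟨hp.pos, by omega, fun i v hv => ?_, fun o ho => mem_append_left _ (hp.opts o ho),
      fun o hoS c hc h1 h2 => ?_⟩
    · have := hp.pairs i v hv
      rw [TCSP.addGroup, getElem?_append_left (getElem?_eq_some_iff.1 this).1]
      exact this
    · rcases mem_append.1 hoS with h3 | h3
      · exact hp.own o h3 c hc h1 h2
      · exfalso
        obtain ⟨o', ho', rfl⟩ := mem_map.1 h3
        have h6 := hp.pos
        rcases hg.shift_pair ho' hc with h4 | h4 <;> omega
  refine ⟨?_, ?_, ?_, ?_⟩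
  · have := h.pos
    omega
  · intro g' hg'
    rcases mem_append.1 hg' with h1 | h1
    · obtain ⟨b, hb⟩ := h.placed g' h1
      exact ⟨b, hmono hb⟩
    · grind
  · intro p hp1 hp2
    by_cases hp : p < S.1.length
    · obtain ⟨g', hg', b, i, rfl, hi, hb⟩ := h.of_pair p hp1 hp
      grind
    · exact ⟨g, by simp, S.1.length, p - S.1.length, by omega, by omega, hpl⟩
  · intro o ho
    rcases mem_append.1 ho with h3 | h3
    · obtain ⟨g', hg', b, hb, h4⟩ := h.of_opt o h3
      grind
    · grind

theorem laid_layout {N : ℕ} (G : List Group) (hG : ∀ g ∈ G, g.WF N) : Laid (layout G) G := by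
  have key : ∀ (H : List Group) (S : Layout) (G' : List Group), (∀ g ∈ G', g.WF N) →
      (∀ g ∈ H, g.WF N) → Laid S G' → Laid (H.foldl addGroup S) (G' ++ H) := by
    intro H
    induction H with
    | nil =>
      intro S G' _ _ h
      simpa using h
    | cons g H ih =>
      intro S G' hG' hH h
      have := ih (addGroup S g) (G' ++ [g])
        (by
          intro x hx
          rcases mem_append.1 hx with h1 | h1
          · exact hG' x h1
          · rw [mem_singleton] at h1
            subst h1
            exact hH _ mem_cons_self)
        (fun x hx => hH x (mem_cons_of_mem _ hx))
        (h.addGroup hG' (hH g mem_cons_self))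
      simpa using this
  have := key G ([(0, 0)], []) [] (by simp) hG
    ⟨by simp, by simp, fun p h1 h2 => by simp at h2; omega, by simp⟩
  simpa [layout] using this

/-- The tables hold the layout. -/
structure Tab.Holds (T : Tab) (n N : ℕ) (S : Layout) : Prop where
  nr : T.nr = n
  nv : T.nv = N
  np : T.np = S.1.length
  no : T.no = S.2.length
  nc : T.nc = T.os S.2.length
  os_zero : T.os 0 = 0
  os_succ : ∀ (o : ℕ) (l : List Cell), S.2[o]? = some l → T.os (o + 1) = T.os o + l.length
  co : ∀ (o j : ℕ) (l : List Cell) (c : Cell), S.2[o]? = some l → l[j]? = some c →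
    T.co (T.os o + j) = o ∧ T.cv (T.os o + j) = c.var ∧ T.cp (T.os o + j) = c.pair ∧
      T.cr (T.os o + j) = c.rank
  pairs : ∀ (p : ℕ) (x : ℕ × ℕ), S.1[p]? = some x → T.pg p = x.1 ∧ T.pv p = x.2

section

variable {T : Tab} {n N : ℕ} {S : Layout} {G : List Group}

theorem Tab.Holds.exists_cell (h : T.Holds n N S) {k : ℕ} (hk : k < T.nc) :
    ∃ o j l c, S.2[o]? = some l ∧ l[j]? = some c ∧ k = T.os o + j := by
  have key : ∀ m ≤ S.2.length, k < T.os m →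
      ∃ o j l c, S.2[o]? = some l ∧ l[j]? = some c ∧ k = T.os o + j := by
    intro m
    induction m with
    | zero =>
      intro _ h0
      rw [h.os_zero] at h0
      omega
    | succ m ih =>
      intro hm hlt
      by_cases hkm : k < T.os m
      · exact ih (by omega) hkm
      · have hl : S.2[m]? = some (S.2[m]'(by omega)) := getElem?_eq_getElem (by omega)
        rw [h.os_succ m _ hl] at hlt
        exact ⟨m, k - T.os m, _, _, hl, getElem?_eq_getElem (by omega), by omega⟩
  rw [h.nc] at hk
  exact key _ le_rfl hk

theorem Tab.Holds.os_mono (h : T.Holds n N S) {o o' : ℕ} (hoo : o ≤ o') (ho : o' ≤ S.2.length) :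
    T.os o ≤ T.os o' := by
  induction o', hoo using Nat.le_induction with
  | base => exact le_rfl
  | succ m hm ih =>
    have hl : S.2[m]? = some (S.2[m]'(by omega)) := getElem?_eq_getElem (by omega)
    have := h.os_succ m _ hl
    have := ih (by omega)
    omega

theorem Tab.Holds.lt_nc (h : T.Holds n N S) {o j : ℕ} {l : List Cell} {c : Cell}
    (hl : S.2[o]? = some l) (hc : l[j]? = some c) : T.os o + j < T.nc := by
  have h1 := (getElem?_eq_some_iff.1 hl).1
  have h2 := (getElem?_eq_some_iff.1 hc).1
  have h3 := h.os_succ o l hl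
  have h4 := h.os_mono (o := o + 1) (o' := S.2.length) (by omega) le_rfl
  rw [h.nc]
  omega

/-- The tables of a layout are numbered consistently. -/
theorem Tab.Holds.wf (h : T.Holds n N S) (hS : Laid S G) (hG : ∀ g ∈ G, g.WF N) (hn : n ≤ N) :
    T.WF := by
  have hcell : ∀ k < T.nc, ∃ o j l c, S.2[o]? = some l ∧ l[j]? = some c ∧ k = T.os o + j ∧
      T.co k = o ∧ T.cv k = c.var ∧ T.cp k = c.pair ∧ T.cr k = c.rank := by
    intro k hk
    obtain ⟨o, j, l, c, h1, h2, rfl⟩ := h.exists_cell hk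
    exact ⟨o, j, l, c, h1, h2, rfl, h.co o j l c h1 h2⟩
  have hopt : ∀ (o j : ℕ) (l : List Cell) (c : Cell), S.2[o]? = some l → l[j]? = some c →
      ∃ g ∈ G, ∃ b, Placed S g b ∧ ∃ o' ∈ g.opts, l = o'.map (Cell.shift b) ∧ ∃ c' ∈ o',
        c = c'.shift b := by
    intro o j l c h1 h2
    obtain ⟨g, hg, b, hb, o', ho', rfl⟩ := hS.of_opt l (mem_of_getElem? h1)
    grind
  have hpair : ∀ p, 1 ≤ p → p < T.np → ∃ g ∈ G, ∃ b i v, p = b + i ∧ g.gov[i]? = some v ∧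
      Placed S g b ∧ T.pg p = b ∧ T.pv p = v := by
    intro p h1 h2
    rw [h.np] at h2
    obtain ⟨g, hg, b, i, rfl, hi, hb⟩ := hS.of_pair p h1 h2
    have hv : g.gov[i]? = some (g.gov[i]) := getElem?_eq_getElem hi
    obtain ⟨h3, h4⟩ := h.pairs _ _ (hb.pairs i _ hv)
    grind
  constructor
  · rw [h.nr, h.nv]
    exact hn
  · rw [h.np]
    exact hS.pos
  · intro o ho
    rw [h.no] at ho
    rw [h.nc]
    exact h.os_mono (by omega) le_rfl
  · intro o ho c hc1 hc2
    rw [h.no] at ho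
    have hl : S.2[o]? = some (S.2[o]'ho) := getElem?_eq_getElem ho
    rw [h.os_succ o _ hl] at hc2
    have := (h.co o (c - T.os o) _ _ hl (getElem?_eq_getElem (by omega))).1
    rwa [Nat.add_sub_cancel' hc1] at this
  · intro k hk
    obtain ⟨o, j, l, c, h1, h2, -, h3, -⟩ := hcell k hk
    rw [h3, h.no]
    exact (getElem?_eq_some_iff.1 h1).1
  · grind
  · intro k hk
    obtain ⟨o, j, l, c, h1, h2, h3, h4, -⟩ := hcell k hk
    have := (getElem?_eq_some_iff.1 h2).1
    rw [h4, h.os_succ o l h1]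
    omega
  · intro k hk
    obtain ⟨o, j, l, c, h1, h2, h3, h4, -, -, h5⟩ := hcell k hk
    obtain ⟨g, hg, b, -, o', ho', rfl, c', hc', rfl⟩ := hopt o j l c h1 h2
    rw [h4, h.os_succ o _ h1, h5]
    have := (hG g hg).rank_lt o' ho' c' hc'
    simpa [Cell.shift] using this
  · intro k k' hkk hk'
    obtain ⟨o, j, l, c, h1, h2, h3, h4, -⟩ := hcell k (by omega)
    obtain ⟨o', j', l', c', h1', h2', h3', h4', -⟩ := hcell k' hk'
    rw [h4, h4']
    by_contra hlt
    have h5 := h.os_mono (o := o' + 1) (o' := o) (by omega) (getElem?_eq_some_iff.1 h1).1.le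
    rw [h.os_succ o' l' h1'] at h5
    grind
  · intro k hk
    obtain ⟨o, j, l, c, h1, h2, h3, h4, h5, -, -⟩ := hcell k hk
    obtain ⟨g, hg, b, -, o', ho', rfl, c', hc', rfl⟩ := hopt o j l c h1 h2
    rw [h5, h.nv]
    exact (hG g hg).var_lt o' ho' c' hc'
  · intro k hk
    obtain ⟨o, j, l, c, h1, h2, h3, h4, -, h5, -⟩ := hcell k hk
    obtain ⟨g, hg, b, hb, o', ho', rfl, c', hc', rfl⟩ := hopt o j l c h1 h2
    rw [h5, h.np]
    unfold Cell.shift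
    dsimp only
    split_ifs with h0
    · exact hS.pos
    · obtain ⟨i, hi⟩ := exists_eq_succ_of_ne_zero h0
      have := (getElem?_eq_some_iff.1
        (hb.pairs i _ ((hG g hg).pair o' ho' c' hc' i hi))).1
      omega
  · intro k hk h0
    obtain ⟨o, j, l, c, h1, h2, h3, h4, h6, h5, -⟩ := hcell k hk
    obtain ⟨g, hg, b, hb, o', ho', rfl, c', hc', rfl⟩ := hopt o j l c h1 h2
    rw [h5] at h0 ⊢
    rw [h6]
    unfold Cell.shift at h0 ⊢
    dsimp only at h0 ⊢
    split_ifs at h0 ⊢ with h7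
    · exact absurd rfl h0
    · obtain ⟨i, hi⟩ := exists_eq_succ_of_ne_zero h7
      have h8 := h.pairs _ _ (hb.pairs i _ ((hG g hg).pair o' ho' c' hc' i hi))
      have h9 : b + c'.pair - 1 = b + i := by omega
      rw [h9]
      exact h8.2
  · intro p hp1 hp2
    obtain ⟨g, hg, b, i, v, -, hv, -, -, h3⟩ := hpair p hp1 hp2
    rw [h3, h.nv]
    exact (hG g hg).gov_lt v (mem_of_getElem? hv)
  · exact h.os_zero
  · intro o ho
    rw [h.no] at ho
    exact h.os_mono (by omega) (by omega)
  · rw [h.no, h.nc]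
  · intro p p' hp1 hpp hp2
    obtain ⟨g, hg, b, i, v, h1, hv, hb, h2, -⟩ := hpair p hp1 (by omega)
    obtain ⟨g', hg', b', i', v', h1', hv', hb', h2', -⟩ := hpair p' (by omega) hp2
    rw [h2, h2']
    by_contra hlt
    have hi := (getElem?_eq_some_iff.1 hv).1
    have hi' := (getElem?_eq_some_iff.1 hv').1
    have h3 := hb.pairs 0 _ (getElem?_eq_getElem (by omega))
    have h4 := hb'.pairs (b - b') _ (getElem?_eq_getElem (by omega))
    grind

end

section

variable {T : Tab} {n N : ℕ} {S : Layout} {G : List Group} {ρ R : ℕ → ℕ} {Y U : Set ℕ}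

/-- In every valid option, the first cell of a governed variable has the pair of this variable. -/
def Group.Keyed (ρ : ℕ → ℕ) (g : Group) : Prop :=
  ∀ o ∈ g.opts, OptValid ρ o → ∀ (j : ℕ) (c : Cell), o[j]? = some c →
    (∀ j' < j, ∀ c', o[j']? = some c' → ρ c'.var ≠ ρ c.var) → ρ c.var ∈ g.gov.map ρ →
    ∃ i, c.pair = i + 1 ∧ ∀ i' < i, ∀ v, g.gov[i']? = some v → ρ v ≠ ρ c.var

theorem exists_first {P : ℕ → Prop} (h : ∃ j, P j) : ∃ j, P j ∧ ∀ j' < j, ¬ P j' := by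
  classical
  exact ⟨Nat.find h, Nat.find_spec h, fun j' hj' => Nat.find_min h hj'⟩

/-- An option of a table in terms of the list of its cells. -/
structure OptAt (T : Tab) (R ρ : ℕ → ℕ) (b o : ℕ) (l : List Cell) : Prop where
  o_lt : o < T.no
  cell : ∀ (j : ℕ) (c : Cell), l[j]? = some c → T.os o + j < T.nc ∧ T.co (T.os o + j) = o ∧
    T.w R (T.os o + j) = ρ c.var ∧ T.cp (T.os o + j) = (if c.pair = 0 then 0 else b + c.pair - 1) ∧
    T.cr (T.os o + j) = c.rank
  of_cell : ∀ k < T.nc, T.co k = o → ∃ j c, l[j]? = some c ∧ k = T.os o + j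

theorem Tab.Holds.optAt (h : T.Holds n N S) (hρ : ∀ v < N, ρ v = R v) {b o : ℕ} {l : List Cell}
    (hl : S.2[o]? = some (l.map (Cell.shift b))) (hN : ∀ c ∈ l, c.var < N) : OptAt T R ρ b o l := by
  constructor
  · rw [h.no]
    exact (getElem?_eq_some_iff.1 hl).1
  · intro j c hc
    have hc' : (l.map (Cell.shift b))[j]? = some (c.shift b) := by simp [hc]
    obtain ⟨h1, h2, h3, h4⟩ := h.co o j _ _ hl hc'
    refine ⟨h.lt_nc hl hc', h1, ?_, h3, h4⟩
    rw [Tab.w, h2, hρ _ (hN c (mem_of_getElem? hc))]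
    rfl
  · intro k hk hko
    obtain ⟨o', j, l', c, h1, h2, rfl⟩ := h.exists_cell hk
    rw [(h.co o' j l' c h1 h2).1] at hko
    grind

theorem OptAt.valid_iff {b o : ℕ} {l : List Cell} (h : OptAt T R ρ b o l) :
    T.Valid R o ↔ OptValid ρ l := by
  constructor
  · intro hv c hc c' hc' hcc
    obtain ⟨j, hj⟩ := mem_iff_getElem?.1 hc
    obtain ⟨j', hj'⟩ := mem_iff_getElem?.1 hc'
    obtain ⟨h1, h2, h3, -, h4⟩ := h.cell j c hj
    obtain ⟨h1', h2', h3', -, h4'⟩ := h.cell j' c' hj'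
    rw [← h4, ← h4']
    exact hv _ h1 _ h1' h2 h2' (by rw [h3, h3', hcc])
  · intro hv k hk k' hk' hko hko' hw
    obtain ⟨j, c, hj, rfl⟩ := h.of_cell k hk hko
    obtain ⟨j', c', hj', rfl⟩ := h.of_cell k' hk' hko'
    obtain ⟨h1, h2, h3, -, h4⟩ := h.cell j c hj
    obtain ⟨h1', h2', h3', -, h4'⟩ := h.cell j' c' hj'
    rw [h4, h4']
    exact hv c (mem_of_getElem? hj) c' (mem_of_getElem? hj') (by rw [← h3, ← h3', hw])

/-- The first cell of a variable in an option. -/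
theorem OptAt.exists_alive {b o : ℕ} {l : List Cell} (h : OptAt T R ρ b o l) {c : Cell}
    (hc : c ∈ l) (hY : ρ c.var ∉ Y) : ∃ j c', l[j]? = some c' ∧ ρ c'.var = ρ c.var ∧
      (∀ j' < j, ∀ c'', l[j']? = some c'' → ρ c''.var ≠ ρ c'.var) ∧
      T.os o + j ∈ T.alive R Y := by
  obtain ⟨i, hi⟩ := mem_iff_getElem?.1 hc
  obtain ⟨j, ⟨c', hj, hcc⟩, hmin⟩ := exists_first
    (P := fun j => ∃ c', l[j]? = some c' ∧ ρ c'.var = ρ c.var) ⟨i, c, hi, rfl⟩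
  refine ⟨j, c', hj, hcc, fun j' hj' c'' h1 h2 => hmin j' hj' ⟨c'', h1, h2.trans hcc⟩, ?_⟩
  obtain ⟨h1, h2, h3, -, -⟩ := h.cell j c' hj
  refine mem_alive.2 ⟨h1, fun k hk hko hw => ?_, by rwa [h3, hcc]⟩
  rw [h2] at hko
  obtain ⟨j', c'', hj', rfl⟩ := h.of_cell k (by omega) hko
  rw [(h.cell j' c'' hj').2.2.1, h3] at hw
  grind

/-- The meaning of a group agrees with the meaning of its pairs in the tables. -/
theorem flatGood_iff (h : T.Holds n N S) (hρ : ∀ v < N, ρ v = R v) {g : Group}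
    (hg : g.WF N) (hk : g.Keyed ρ) {b i v : ℕ} (hb : Placed S g b) (hi : g.gov[i]? = some v)
    (hcan : ∀ i' < i, ∀ v', g.gov[i']? = some v' → ρ v' ≠ ρ v) :
    T.FlatGood R Y (b + i) U ↔ g.Good ρ Y (ρ v) U := by
  have hil := (getElem?_eq_some_iff.1 hi).1
  have hbpos := hb.pos
  have hvN := hg.gov_lt v (mem_of_getElem? hi)
  constructor
  · rintro ⟨k, hk1, hk2, hk3, hk4⟩
    obtain ⟨hkn, hkF, hkY⟩ := mem_alive.1 hk1
    obtain ⟨o, j, l, c, h1, h2, rfl⟩ := h.exists_cell hkn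
    obtain ⟨h3, h4, h5, h6⟩ := h.co o j l c h1 h2
    rw [h3] at hk2 hk4
    have hcp : c.pair = b + i := h5.symm.trans hk3
    obtain ⟨o', ho', rfl⟩ := hb.own l (mem_of_getElem? h1) c (mem_of_getElem? h2)
      (by omega) (by omega)
    have hO := h.optAt hρ h1 (hg.var_lt o' ho')
    rw [List.getElem?_map, Option.map_eq_some_iff] at h2
    obtain ⟨c', hc', rfl⟩ := h2
    obtain ⟨h7, h8, h9, h10, h11⟩ := hO.cell j c' hc'
    have hcv : ρ c'.var = ρ v := by
      have h12 : c'.pair = i + 1 := by grind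
      have h13 := hg.pair o' ho' c' (mem_of_getElem? hc') i h12
      simp_all
    rw [h9, hcv] at hkY
    have hval := hO.valid_iff.1 hk2
    have hrank : ∀ d ∈ o', ρ d.var ∉ Y → ∃ j' d', o'[j']? = some d' ∧ ρ d'.var = ρ d.var ∧
        d'.rank = d.rank ∧ T.os o + j' ∈ T.alive R Y := by
      intro d hd hdY
      obtain ⟨j', d', hd', hdd, -, hal⟩ := hO.exists_alive hd hdY
      exact ⟨j', d', hd', hdd, hval _ (mem_of_getElem? hd') _ hd hdd, hal⟩
    refine ⟨o', ho', hval, ⟨hkY, c', mem_of_getElem? hc', hcv, fun d hd hdY => ?_⟩,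
      fun u ⟨huY, d, hd, hdu, hdmin⟩ => ?_⟩
    · obtain ⟨j', d', hd', -, hr, hal⟩ := hrank d hd hdY
      obtain ⟨-, k2, -, -, k5⟩ := hO.cell j' d' hd'
      grind
    · obtain ⟨j', d', hd', hdd, hr, hal⟩ := hrank d hd (by rwa [hdu])
      obtain ⟨-, k2, k3, -, k5⟩ := hO.cell j' d' hd'
      grind
  · rintro ⟨o', ho', hval, ⟨hY, d, hd, hdv, hdmin⟩, hU⟩
    obtain ⟨o, ho⟩ := mem_iff_getElem?.1 (hb.opts o' ho')
    have hO := h.optAt hρ ho (hg.var_lt o' ho')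
    obtain ⟨j, c, hc, hcd, hfirst, hal⟩ := hO.exists_alive hd (by rwa [hdv])
    obtain ⟨h1, h2, h3, h4, h5⟩ := hO.cell j c hc
    have hcmem := mem_of_getElem? hc
    have hcr : c.rank = d.rank := hval c hcmem d hd hcd
    obtain ⟨i0, hi0, hmin0⟩ := hk o' ho' hval j c hc hfirst (by
      rw [hcd, hdv]
      exact mem_map_of_mem (mem_of_getElem? hi))
    have hgi := hg.pair o' ho' c hcmem i0 hi0
    have hii : i0 = i := by grind
    refine ⟨_, hal, by rw [h2]; exact hO.valid_iff.2 hval, by rw [h4, hi0, hii]; simp,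
      fun k hk hko => ?_⟩
    obtain ⟨hkn, hkF, hkY⟩ := mem_alive.1 hk
    rw [h2] at hko
    obtain ⟨j', e, he, rfl⟩ := hO.of_cell k hkn hko
    obtain ⟨k1, k2, k3, k4, k5⟩ := hO.cell j' e he
    have hemem := mem_of_getElem? he
    rw [k3] at hkY ⊢
    rw [h5, k5, hcr]
    refine ⟨hdmin e hemem hkY, fun heq => hU _ ⟨hkY, e, hemem, rfl, fun e' he' heY => ?_⟩⟩
    rw [heq]
    exact hdmin e' he' heY

/-- The pair of a governed variable is canonical if the variable does not occur earlier. -/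
theorem canon_iff_gov (h : T.Holds n N S) (hS : Laid S G) (hG : ∀ g ∈ G, g.WF N)
    (hρ : ∀ v < N, ρ v = R v) {g : Group} (hg : g ∈ G)
    {b i v : ℕ} (hb : Placed S g b) (hi : g.gov[i]? = some v) :
    T.Canon R (b + i) ↔ ∀ i' < i, ∀ v', g.gov[i']? = some v' → ρ v' ≠ ρ v := by
  have hu : ∀ (i' v' : ℕ), g.gov[i']? = some v' → T.pg (b + i') = b ∧ T.u R (b + i') = ρ v' := by
    intro i' v' h1
    obtain ⟨h2, h3⟩ := h.pairs _ _ (hb.pairs i' v' h1)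
    refine ⟨h2, ?_⟩
    rw [Tab.u, h3, hρ _ ((hG g hg).gov_lt v' (mem_of_getElem? h1))]
  obtain ⟨h1, h2⟩ := hu i v hi
  have hil := (getElem?_eq_some_iff.1 hi).1
  have hble := hb.le
  constructor
  · intro hc i' hi' v' hv'
    obtain ⟨h3, h4⟩ := hu i' v' hv'
    have := hc (b + i') (by have := hb.pos; omega) (by omega) (by rw [h3, h1])
    rwa [h4, h2] at this
  · intro hc p' hp1 hp2 hpg
    obtain ⟨g', hg', b', i', rfl, hi', hb'⟩ := hS.of_pair p' hp1 (by omega)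
    have h3 := (h.pairs _ _ (hb'.pairs i' _ (getElem?_eq_getElem hi'))).1
    grind

theorem flatGood_pair (h : T.Holds n N S) (hS : Laid S G) (hG : ∀ g ∈ G, g.WF N)
    (hk : ∀ g ∈ G, g.Keyed ρ) (hρ : ∀ v < N, ρ v = R v) {p : ℕ} (hp1 : 1 ≤ p) (hp2 : p < T.np)
    (hc : T.Canon R p) : ∃ g ∈ G, T.u R p ∈ g.gov.map ρ ∧
      ∀ U, T.FlatGood R Y p U ↔ g.Good ρ Y (T.u R p) U := by
  rw [h.np] at hp2
  obtain ⟨g, hg, b, i, rfl, hi, hb⟩ := hS.of_pair p hp1 hp2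
  have hgi : g.gov[i]? = some g.gov[i] := getElem?_eq_getElem hi
  have hu : T.u R (b + i) = ρ g.gov[i] := by
    rw [Tab.u, (h.pairs _ _ (hb.pairs i _ hgi)).2, hρ _ ((hG g hg).gov_lt _ (List.getElem_mem hi))]
  refine ⟨g, hg, ?_, fun U => ?_⟩
  · grind
  · rw [hu]
    exact flatGood_iff h hρ (hG g hg) (hk g hg) hb hgi
      ((canon_iff_gov h hS hG hρ hg hb hgi).1 hc)

theorem good_of_flat (h : T.Holds n N S) (hS : Laid S G) (hG : ∀ g ∈ G, g.WF N)
    (hk : ∀ g ∈ G, g.Keyed ρ) (hρ : ∀ v < N, ρ v = R v) {x : ℕ}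
    (hx : ∀ p, 1 ≤ p → p < T.np → T.Canon R p → T.u R p = x → T.FlatGood R Y p U) :
    ∀ g ∈ G, x ∈ g.gov.map ρ → g.Good ρ Y x U := by
  intro g hg hxg
  obtain ⟨w, hw, rfl⟩ := mem_map.1 hxg
  obtain ⟨i1, hi1⟩ := mem_iff_getElem?.1 hw
  obtain ⟨i, ⟨v, hi, hvw⟩, hmin⟩ := exists_first
    (P := fun i => ∃ v, g.gov[i]? = some v ∧ ρ v = ρ w) ⟨i1, w, hi1, rfl⟩
  have hcan : ∀ i' < i, ∀ v', g.gov[i']? = some v' → ρ v' ≠ ρ v := fun i' hi' v' hv' he =>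
    hmin i' hi' ⟨v', hv', he.trans hvw⟩
  obtain ⟨b, hb⟩ := hS.placed g hg
  have hil := (getElem?_eq_some_iff.1 hi).1
  have hble := hb.le
  have hbpos := hb.pos
  rw [← hvw]
  refine (flatGood_iff h hρ (hG g hg) (hk g hg) hb hi hcan).1 (hx _ (by omega)
    (by rw [h.np]; omega) ((canon_iff_gov h hS hG hρ hg hb hi).2 hcan) ?_)
  rw [Tab.u, (h.pairs _ _ (hb.pairs i _ hi)).2,
    ← hρ _ ((hG g hg).gov_lt _ (mem_of_getElem? hi)), hvw]

theorem gAdm_of_flatAdm (h : T.Holds n N S) (hS : Laid S G) (hG : ∀ g ∈ G, g.WF N)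
    (hk : ∀ g ∈ G, g.Keyed ρ) (hρ : ∀ v < N, ρ v = R v) (hU : T.FlatAdm R Y U) : GAdm ρ Y G U :=
  fun x hx => ⟨(hU x hx).1.2.2, good_of_flat h hS hG hk hρ (hU x hx).2⟩

theorem flatAdm_of_gAdm (h : T.Holds n N S) (hS : Laid S G) (hG : ∀ g ∈ G, g.WF N)
    (hk : ∀ g ∈ G, g.Keyed ρ) (hρ : ∀ v < N, ρ v = R v) (hU : GAdm ρ Y G U)
    (hlive : ∀ x ∈ U, x < N ∧ R x = x) : T.FlatAdm R Y U := by
  intro x hx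
  obtain ⟨hxY, hxg⟩ := hU x hx
  refine ⟨⟨by rw [h.nv]; exact (hlive x hx).1, (hlive x hx).2, hxY⟩, ?_⟩
  rintro p hp1 hp2 hc rfl
  obtain ⟨g, hg, h1, h2⟩ := flatGood_pair (Y := Y) h hS hG hk hρ hp1 hp2 hc
  exact (h2 U).2 (hxg g hg h1)

theorem flatSink_iff (h : T.Holds n N S) (hS : Laid S G) (hG : ∀ g ∈ G, g.WF N)
    (hk : ∀ g ∈ G, g.Keyed ρ) (hρ : ∀ v < N, ρ v = R v) {v : ℕ} (hv : v < N) (hRv : R v = v)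
    (hvY : v ∉ Y) : T.FlatSink R Y v ↔ GAdm ρ Y G {v} := by
  constructor
  · intro hs x hx
    rw [Set.mem_singleton_iff] at hx
    subst hx
    exact ⟨hvY, good_of_flat h hS hG hk hρ hs⟩
  · intro hU
    exact (flatAdm_of_gAdm h hS hG hk hρ hU (by
      intro x hx
      rw [Set.mem_singleton_iff] at hx
      subst hx
      exact ⟨hv, hRv⟩) v rfl).2

theorem interGood (h : T.Holds n N S) (hS : Laid S G) (hG : ∀ g ∈ G, g.WF N)
    (hk : ∀ g ∈ G, g.Keyed ρ) (hρ : ∀ v < N, ρ v = R v)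
    (hI : ∀ g ∈ G, ∀ x ∉ Y, x ∈ g.gov.map ρ → ∀ U U', g.Good ρ Y x U → g.Good ρ Y x U' →
      g.Good ρ Y x (U ∩ U')) : T.InterGood R Y := by
  intro p hp1 hp2 hc U U' hU hU'
  obtain ⟨g, hg, h1, h2⟩ := flatGood_pair (Y := Y) h hS hG hk hρ hp1 hp2 hc
  have hxY : T.u R p ∉ Y := by
    obtain ⟨o, -, -, ⟨h3, -⟩, -⟩ := (h2 U).1 hU
    exact h3
  grind

end

/-! ### The groups of an instance are well formed -/

section

variable {n : ℕ} {ρ : ℕ → ℕ} {σ : Fin n → Fin n} {k N d e : ℕ} {a : Fin k → ℕ}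
  {c : HornClause k}

theorem Group.keyed_singleton {x : ℕ} {os : List (List Cell)}
    (h : ∀ o ∈ os, OptValid ρ o → ∃ l₁ r l₂, o = l₁ ++ ⟨x, 1, r⟩ :: l₂ ∧ ∀ c ∈ l₁, ρ c.var ≠ ρ x) :
    Group.Keyed ρ ⟨[x], os⟩ := by
  intro o ho hv j c hj hfirst hc
  obtain ⟨l₁, r, l₂, rfl, h1⟩ := h o ho hv
  have hcx : ρ c.var = ρ x := by simpa using hc
  refine ⟨0, ?_, fun i hi => absurd hi (Nat.not_lt_zero i)⟩
  rcases lt_trichotomy j l₁.length with h2 | h2 | h2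
  · grind
  · subst h2
    grind
  · exact absurd hcx.symm (hfirst _ h2 ⟨x, 1, r⟩ (by simp))

theorem Group.wf_singleton {x : ℕ} {os : List (List Cell)} (hx : x < N)
    (h : ∀ o ∈ os, ∀ c ∈ o, c.var < N ∧ c.rank < o.length ∧ (c.pair = 0 ∨ c.pair = 1 ∧ c.var = x)) :
    Group.WF N ⟨[x], os⟩ := by
  refine ⟨by simpa using hx, fun o ho c hc => (h o ho c hc).1, fun o ho c hc => (h o ho c hc).2.1,
    fun o ho c hc i hi => ?_⟩
  grind

theorem wf_premiseGroup (ha : ∀ i, a i < N) (he : e < N) (c : HornClause k) :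
    (premiseGroup a e c).WF N := by
  refine Group.wf_singleton he fun o ho => ?_
  grind

theorem wf_headGroup (ha : ∀ i, a i < N) (he : e < N) (c : HornClause k) :
    (headGroup a e c).WF N := by
  refine Group.wf_singleton (ha _) fun o ho => ?_
  grind

theorem wf_consistencyGroup (ha : ∀ i, a i < N) (hd : d < N) (he : e < N) (c : HornClause k) :
    (consistencyGroup a d e c).WF N := by
  refine Group.wf_singleton hd fun o ho => ?_
  grind

theorem wf_scopeGroup {x : ℕ} (hd : d < N) (hx : x < N) : (scopeGroup d x).WF N :=
  Group.wf_singleton hx fun o ho => by simp_all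

theorem wf_ordersGroup (ha : ∀ i, a i < N) (ws : List (WeakOrder k)) :
    (ordersGroup a ws).WF N := by
  constructor
  · simp [ordersGroup, ha]
  · simp [ordersGroup, ha]
  · simp [ordersGroup]
  · simp only [ordersGroup, mem_map, forall_exists_index, and_imp, forall_apply_eq_imp_iff₂,
      List.forall_mem_ofFn_iff]
    simp

theorem keyed_premiseGroup (c : HornClause k) : (premiseGroup a e c).Keyed ρ := by
  refine Group.keyed_singleton fun o ho _ => ?_
  obtain ⟨p, -, rfl⟩ := mem_map.1 ho
  exact ⟨[], 0, _, rfl, by simp⟩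

theorem keyed_headGroup (hne : ρ e ≠ ρ (a c.head)) : (headGroup a e c).Keyed ρ := by
  refine Group.keyed_singleton fun o ho hv => ?_
  simp only [mem_cons, mem_append, mem_map] at ho
  rcases ho with rfl | ⟨z, -, rfl⟩ | ho
  · exact ⟨[⟨e, 0, 0⟩], 1, [], rfl, by simpa using hne⟩
  · refine ⟨[⟨a z, 0, 0⟩], 1, [], rfl, ?_⟩
    simp only [mem_singleton, forall_eq]
    intro h
    have := hv ⟨a z, 0, 0⟩ (by simp) ⟨a c.head, 1, 1⟩ (by simp) h
    simp at this
  · split_ifs at ho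
    · exact ⟨[], 0, _, mem_singleton.1 ho, by simp⟩
    · simp at ho

theorem keyed_consistencyGroup (he : ρ e ≠ ρ d) (c : HornClause k) :
    (consistencyGroup a d e c).Keyed ρ := by
  refine Group.keyed_singleton fun o ho _ => ?_
  simp only [mem_cons, mem_append, mem_map] at ho
  rcases ho with rfl | ho | ⟨z, -, rfl⟩
  · exact ⟨[⟨e, 0, 0⟩], 1, [], rfl, by simpa using he⟩
  · split_ifs at ho
    · exact ⟨[], 0, [], by simpa using ho, by simp⟩
    · simp at ho
  · exact ⟨[], 0, _, rfl, by simp⟩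

theorem keyed_scopeGroup {x : ℕ} (hx : ρ d ≠ ρ x) : (scopeGroup d x).Keyed ρ :=
  Group.keyed_singleton fun _ ho _ =>
    ⟨[⟨d, 0, 0⟩], 1, [], mem_singleton.1 ho, by simpa using hx⟩

theorem keyed_ordersGroup (ws : List (WeakOrder k)) : (ordersGroup a ws).Keyed ρ := by
  intro o ho _ j c hj hfirst _
  obtain ⟨w, -, rfl⟩ := mem_map.1 ho
  have hjk : j < k := by simpa using (getElem?_eq_some_iff.1 hj).1
  have hget : ∀ i (hi : i < k), (ofFn fun i : Fin k => (⟨a i, i + 1, w i⟩ : Cell))[i]? =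
      some ⟨a ⟨i, hi⟩, i + 1, w ⟨i, hi⟩⟩ := by
    intro i hi
    simp [hi]
  rw [hget j hjk, Option.some.injEq] at hj
  subst hj
  refine ⟨j, rfl, fun i' hi' v hv => ?_⟩
  have := hfirst i' hi' _ (hget i' (by omega))
  have hv' : a ⟨i', by omega⟩ = v := by
    simpa [ordersGroup, show i' < k by omega] using hv
  rwa [← hv']

theorem wf_allGroups {I : List (RepConstraint n)} {g : Group} (hg : g ∈ allGroups n I) :
    g.WF (numVars n I) := by
  obtain ⟨⟨b, c⟩, hc, hg⟩ := mem_flatMap.1 hg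
  have hle := add_dummies_le_numVars hc
  have ha : ∀ i, c.nargs i < numVars n I := fun i =>
    (c.args i).isLt.trans_le ((le_of_mem_blocks hc).trans ((Nat.le_add_right _ _).trans hle))
  cases hrep : c.rep with
  | orders ws =>
    rw [(mem_groups_orders hrep g).1 hg]
    exact wf_ordersGroup ha ws
  | horn cs =>
    rw [dummies_horn hrep] at hle
    rcases (mem_groups_horn hrep g).1 hg with ⟨i, rfl⟩ | ⟨q, hq, h⟩
    · exact wf_scopeGroup (by omega) (ha i)
    · have := mem_zipIdx_le hq
      rcases h with rfl | rfl | rfl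
      · exact wf_premiseGroup ha (by omega) _
      · exact wf_headGroup ha (by omega) _
      · exact wf_consistencyGroup ha (by omega) (by omega) _

theorem keyed_allGroups {I : List (RepConstraint n)} (hρ : Contracts n ρ σ) {g : Group}
    (hg : g ∈ allGroups n I) : g.Keyed ρ := by
  obtain ⟨⟨b, c⟩, hc, hg⟩ := mem_flatMap.1 hg
  have hb := le_of_mem_blocks hc
  cases hrep : c.rep with
  | orders ws =>
    rw [(mem_groups_orders hrep g).1 hg]
    exact keyed_ordersGroup ws
  | horn cs =>
    have hne : ∀ e i, n ≤ e → ρ e ≠ ρ (c.nargs i) := fun e i he => by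
      rw [hρ.fix e he]
      exact (hρ.nargs_ne c he i).symm
    rcases (mem_groups_horn hrep g).1 hg with ⟨i, rfl⟩ | ⟨q, hq, h⟩
    · exact keyed_scopeGroup (hne b i hb)
    · have := mem_zipIdx_le hq
      dsimp only at hb this
      rcases h with rfl | rfl | rfl
      · exact keyed_premiseGroup _
      · exact keyed_headGroup (hne _ _ (by omega))
      · refine keyed_consistencyGroup ?_ _
        rw [hρ.fix _ hb, hρ.fix q.2 (by omega)]
        omega

end

/-! ### Programs that build the tables -/

/-- An intermediate state of the construction of the tables: the number of variables, the pairs and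
the finished options, the cells of the unfinished option, and the temporary registers. -/
structure Scan where
  nv : ℕ
  lay : Layout
  cur : List Cell
  tmp : ℕ → ℕ

/-- A machine state that stands for the scan, with the input `f`, when expressions are evaluated. -/
def Scan.state (f : ℕ → ℕ) (M : Scan) : State where
  regs r := if r = 1 then M.nv else if r = 2 then M.lay.1.length else M.tmp r
  arrays _ := f
  out := []

/-- The expression reads only the input, the registers `1` and `2`, and the temporary registers. -/
def Exp.plain : Exp → Bool
  | .lit _ => true
  | .reg r => r == 1 || r == 2 || decide (19 ≤ r)
  | .get a i => a == 0 && i.plain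
  | .plus e e' => e.plain && e'.plain
  | .minus e e' => e.plain && e'.plain
  | .less e e' => e.plain && e'.plain
  | .equal e e' => e.plain && e'.plain

/-- The machine state contains the tables built so far. -/
structure Scan.Rep (f : ℕ → ℕ) (M : Scan) (σ : State) : Prop where
  input : σ.arrays 0 = f
  tmp : ∀ r, 19 ≤ r → σ.regs r = M.tmp r
  nv : σ.regs 1 = M.nv
  np : σ.regs 2 = M.lay.1.length
  no : σ.regs 3 = M.lay.2.length
  nc : σ.regs 4 = σ.arrays 5 M.lay.2.length + M.cur.length
  os_zero : σ.arrays 5 0 = 0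
  os_succ : ∀ (o : ℕ) (l : List Cell), M.lay.2[o]? = some l →
    σ.arrays 5 (o + 1) = σ.arrays 5 o + l.length
  co : ∀ (o j : ℕ) (l : List Cell) (c : Cell), (M.lay.2 ++ [M.cur])[o]? = some l →
    l[j]? = some c → σ.arrays 5 o + j < σ.regs 4 ∧
      σ.arrays 4 (σ.arrays 5 o + j) = o ∧ σ.arrays 1 (σ.arrays 5 o + j) = c.var ∧
      σ.arrays 2 (σ.arrays 5 o + j) = c.pair ∧ σ.arrays 3 (σ.arrays 5 o + j) = c.rank
  pairs : ∀ (p : ℕ) (x : ℕ × ℕ), M.lay.1[p]? = some x →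
    σ.arrays 6 p = x.1 ∧ σ.arrays 7 p = x.2

/-- The program turns the scan `M` into `M'` within `t` steps. -/
def Cmd.Turns (f : ℕ → ℕ) (p : Cmd) (t : ℕ) (M M' : Scan) : Prop :=
  ∀ σ, M.Rep f σ → WP p σ fun u τ => u ≤ t ∧ M'.Rep f τ

section

variable {f : ℕ → ℕ} {M M' M'' : Scan} {σ : State} {p q : Cmd} {e v g r : Exp} {t u : ℕ}

theorem Exp.eval_congr {σ' : State} (he : e.plain = true) (ha : σ.arrays 0 = σ'.arrays 0)
    (hr : ∀ r, r = 1 ∨ r = 2 ∨ 19 ≤ r → σ.regs r = σ'.regs r) : e.eval σ = e.eval σ' := by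
  induction e with
  | lit c => rfl
  | reg r => exact hr r (by simpa [Exp.plain, or_assoc] using he)
  | get a i ih =>
    simp only [Exp.plain, Bool.and_eq_true, beq_iff_eq] at he
    simp only [Exp.eval, he.1, ha, ih he.2]
  | _ e e' ih ih' =>
    simp only [Exp.plain, Bool.and_eq_true] at he
    simp only [Exp.eval, ih he.1, ih' he.2]

theorem Scan.Rep.eval (h : M.Rep f σ) (he : e.plain = true) : e.eval σ = e.eval (M.state f) := by
  refine Exp.eval_congr he h.input ?_
  rintro r (rfl | rfl | hr)
  · exact h.nv
  · exact h.np
  · rw [h.tmp r hr, Scan.state]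
    grind

/-- Writing to the tables does not change the values of plain expressions. -/
theorem Exp.eval_setArr {a i x : ℕ} (he : e.plain = true) (ha : a ≠ 0) :
    e.eval (σ.setArr a i x) = e.eval σ :=
  Exp.eval_congr he (by rw [arrays_setArr, if_neg ha.symm]) fun _ _ => rfl

theorem Cmd.Turns.seq (h : p.Turns f t M M') (h' : q.Turns f u M' M'') :
    (p ;; q).Turns f (t + u) M M'' := by
  intro σ hσ
  refine wp_seq.2 ((h σ hσ).mono fun t' τ hτ => (h' τ hτ.2).mono fun u' υ hυ => ⟨?_, hυ.2⟩)
  have := hτ.1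
  have := hυ.1
  omega

theorem Cmd.Turns.mono (h : p.Turns f t M M') (htu : t ≤ u) (hM : M' = M'') :
    p.Turns f u M M'' := fun σ hσ => (h σ hσ).mono fun _ _ hτ => ⟨hτ.1.trans htu, hM ▸ hτ.2⟩

theorem turns_skip : Cmd.skip.Turns f 1 M M := fun _ hσ => wp_skip.2 ⟨le_rfl, hσ⟩

theorem turns_cond_true (he : e.plain = true) (h0 : e.eval (M.state f) ≠ 0)
    (h : p.Turns f t M M') : (Cmd.cond e p q).Turns f (t + 1) M M' := fun σ hσ =>
  wp_cond.2 ⟨fun _ => (h σ hσ).mono fun _ _ hτ => ⟨Nat.succ_le_succ hτ.1, hτ.2⟩,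
    fun h1 => absurd ((hσ.eval he).symm.trans h1) h0⟩

theorem turns_cond_false (he : e.plain = true) (h0 : e.eval (M.state f) = 0)
    (h : q.Turns f t M M') : (Cmd.cond e p q).Turns f (t + 1) M M' := fun σ hσ =>
  wp_cond.2 ⟨fun h1 => absurd ((hσ.eval he).trans h0) h1,
    fun _ => (h σ hσ).mono fun _ _ hτ => ⟨Nat.succ_le_succ hτ.1, hτ.2⟩⟩

theorem turns_set {i : ℕ} (hi : 19 ≤ i) (he : e.plain = true) :
    (Cmd.set i e).Turns f 1 M { M with tmp := update M.tmp i (e.eval (M.state f)) } := by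
  intro σ h
  refine wp_set.2 ⟨le_rfl, ?_⟩
  rw [h.eval he]
  have hr : ∀ j, j < 19 → (σ.setReg i (e.eval (M.state f))).regs j = σ.regs j := by
    intro j hj
    rw [regs_setReg, if_neg (by omega)]
  refine ⟨h.input, fun r h1 => ?_, ?_, ?_, ?_, ?_, h.os_zero, h.os_succ, ?_, h.pairs⟩
  · rw [regs_setReg, h.tmp r h1]
    exact (update_apply _ _ _ _).symm
  · rw [hr _ (by norm_num), h.nv]
  · rw [hr _ (by norm_num), h.np]
  · rw [hr _ (by norm_num), h.no]
  · rw [hr _ (by norm_num), h.nc]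
    rfl
  · rw [hr _ (by norm_num)]
    exact h.co

open Exp Cmd

/-- Increment the register. -/
def cmdInc (r : ℕ) : Cmd := Cmd.set r (plus (reg r) (lit 1))

theorem turns_newVar : (cmdInc 1).Turns f 1 M { M with nv := M.nv + 1 } := by
  intro σ h
  refine wp_set.2 ⟨le_rfl, ?_⟩
  have hr : ∀ j x, j ≠ 1 → (σ.setReg 1 x).regs j = σ.regs j := by simp_all
  refine ⟨h.input, fun r h1 => ?_, ?_, ?_, ?_, ?_, h.os_zero, h.os_succ, ?_, h.pairs⟩
  · rw [hr _ _ (by omega), h.tmp r h1]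
  · simp [Exp.eval, h.nv]
  · rw [hr _ _ (by norm_num), h.np]
  · rw [hr _ _ (by norm_num), h.no]
  · rw [hr _ _ (by norm_num), h.nc]
    rfl
  · rw [hr _ _ (by norm_num)]
    exact h.co

/-- Append a pair. -/
def cmdPair (g v : Exp) : Cmd := put 6 (reg 2) g ;; put 7 (reg 2) v ;; cmdInc 2

theorem turns_pair (hg : g.plain = true) (hv : v.plain = true) :
    (cmdPair g v).Turns f 3 M { M with
      lay := (M.lay.1 ++ [(g.eval (M.state f), v.eval (M.state f))], M.lay.2) } := by
  intro σ h
  simp only [cmdPair, cmdInc, wp_seq, wp_set, wp_put]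
  rw [Exp.eval_setArr hv (by norm_num), h.eval hg, h.eval hv]
  refine ⟨le_rfl, ?_⟩
  simp only [Exp.eval, regs_setArr, h.np]
  constructor <;> simp only [regs_setReg, regs_setArr, arrays_setReg,
    arrays_setArr, reduceEqDiff, if_true, if_false]
  · exact h.input
  · intro r h1
    rw [if_neg (by omega), h.tmp r h1]
  · exact h.nv
  · simp
  · exact h.no
  · exact h.nc
  · exact h.os_zero
  · exact h.os_succ
  · exact h.co
  · intro p x hp
    rcases lt_trichotomy p M.lay.1.length with h1 | h1 | h1
    · rw [getElem?_append_left h1] at hp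
      rw [update_of_ne h1.ne, update_of_ne h1.ne]
      exact h.pairs p x hp
    · grind
    · simp_all

/-- Append a cell to the unfinished option. -/
def cmdCell (v g r : Exp) : Cmd :=
  put 4 (reg 4) (reg 3) ;; put 1 (reg 4) v ;; put 2 (reg 4) g ;; put 3 (reg 4) r ;; cmdInc 4

theorem turns_cell (hv : v.plain = true) (hg : g.plain = true) (hr : r.plain = true) :
    (cmdCell v g r).Turns f 5 M { M with cur := M.cur ++
      [⟨v.eval (M.state f), g.eval (M.state f), r.eval (M.state f)⟩] } := by
  intro σ h
  simp only [cmdCell, cmdInc, wp_seq, wp_set, wp_put]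
  simp only [Exp.eval_setArr, hv, hg, hr, ne_eq, OfNat.ofNat_ne_zero, one_ne_zero,
    not_false_eq_true, h.eval]
  refine ⟨le_rfl, ?_⟩
  simp only [Exp.eval, regs_setArr, h.no]
  constructor <;> simp only [regs_setReg, regs_setArr, arrays_setReg,
    arrays_setArr, reduceEqDiff, if_true, if_false]
  · exact h.input
  · intro r h1
    rw [if_neg (by omega), h.tmp r h1]
  · exact h.nv
  · exact h.np
  · exact h.no
  · rw [h.nc, length_append, length_singleton, Nat.add_assoc]
  · exact h.os_zero
  · exact h.os_succ
  · intro o j l c hl hc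
    by_cases hnew : o = M.lay.2.length ∧ j = M.cur.length
    · obtain ⟨rfl, rfl⟩ := hnew
      simp only [getElem?_append_right le_rfl, Nat.sub_self, getElem?_cons_zero,
        Option.some.injEq] at hl
      subst hl
      simp only [getElem?_append_right le_rfl, Nat.sub_self, getElem?_cons_zero,
        Option.some.injEq] at hc
      simp [← hc, ← h.nc]
    · obtain ⟨l', hl', hc'⟩ : ∃ l', (M.lay.2 ++ [M.cur])[o]? = some l' ∧ l'[j]? = some c := by grind
      obtain ⟨h1, h2⟩ := h.co o j l' c hl' hc'
      grind
  · exact h.pairs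

/-- Finish an option. -/
def cmdClose : Cmd := cmdInc 3 ;; put 5 (reg 3) (reg 4)

theorem turns_close :
    cmdClose.Turns f 2 M { M with lay := (M.lay.1, M.lay.2 ++ [M.cur]), cur := [] } := by
  intro σ h
  simp only [cmdClose, cmdInc, wp_seq, wp_set, wp_put]
  refine ⟨le_rfl, ?_⟩
  simp only [Exp.eval, regs_setReg, reduceEqDiff, if_true, if_false,
    h.no]
  have hup : ∀ o ≤ M.lay.2.length, update (σ.arrays 5) (M.lay.2.length + 1) (σ.regs 4) o =
      σ.arrays 5 o := fun o ho => update_of_ne (by omega) _ _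
  constructor <;> simp only [regs_setReg, regs_setArr, arrays_setReg,
    arrays_setArr, reduceEqDiff, if_true, if_false]
  · exact h.input
  · intro r h1
    rw [if_neg (by omega), h.tmp r h1]
  · exact h.nv
  · exact h.np
  · simp
  · simp
  · rw [hup _ (Nat.zero_le _), h.os_zero]
  · intro o l hl
    rcases Nat.lt_or_ge o M.lay.2.length with h1 | h1
    · rw [getElem?_append_left h1] at hl
      rw [hup _ h1, hup _ h1.le, h.os_succ o l hl]
    · rw [getElem?_append_right h1, getElem?_singleton] at hl
      split_ifs at hl with h2
      obtain rfl := Option.some.inj hl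
      obtain rfl : o = M.lay.2.length := by omega
      rw [update_self, hup _ le_rfl, h.nc]
  · intro o j l c hl hc
    rcases Nat.lt_or_ge o (M.lay.2.length + 1) with h1 | h1
    · rw [getElem?_append_left (by simpa using h1)] at hl
      rw [hup o (by omega)]
      exact h.co o j l c hl hc
    · grind
  · exact h.pairs

/-- The rule for loops over lists. -/
theorem turns_loop {α : Type*} (xs : List α) (P : List α → Scan → Prop) (cost : α → ℕ)
    (he : e.plain = true) (h0 : P [] M)
    (hcount : ∀ l l' M, xs = l ++ l' → P l M → (e.eval (M.state f) = 0 ↔ l' = []))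
    (hstep : ∀ l x l' M, xs = l ++ x :: l' → P l M →
      ∃ M', p.Turns f (cost x) M M' ∧ P (l ++ [x]) M') :
    ∃ M', (Cmd.loop e p).Turns f ((xs.map cost).sum + xs.length + 1) M M' ∧ P xs M' := by
  have key : ∀ l' l M, xs = l ++ l' → P l M →
      ∃ M', (Cmd.loop e p).Turns f ((l'.map cost).sum + l'.length + 1) M M' ∧ P xs M' := by
    intro l'
    induction l' with
    | nil =>
      intro l M hl hP
      refine ⟨M, fun σ hσ => ⟨1, σ, .loop_done ?_, by simp, hσ⟩, by simpa [hl] using hP⟩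
      rw [hσ.eval he]
      exact (hcount _ _ _ hl hP).2 rfl
    | cons x l' ih =>
      intro l M hl hP
      obtain ⟨M₁, h1, hP1⟩ := hstep l x l' M hl hP
      obtain ⟨M₂, h2, hP2⟩ := ih (l ++ [x]) M₁ (by simpa using hl) hP1
      refine ⟨M₂, fun σ hσ => ?_, hP2⟩
      obtain ⟨t, τ, h3, h4, h5⟩ := h1 σ hσ
      obtain ⟨u, υ, h6, h7, h8⟩ := h2 τ h5
      refine ⟨_, υ, .loop_step (fun h9 => ?_) h3 h6, ?_, h8⟩
      · rw [hσ.eval he] at h9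
        grind
      · grind
  exact key xs [] M rfl h0

end

/-! ### Reading the input -/

/-- From position `pos` on, the input contains the given words. -/
def Input (f : ℕ → ℕ) (pos : ℕ) (L : List ℕ) : Prop := ∀ i x, L[i]? = some x → f (pos + i) = x

section

variable {f : ℕ → ℕ} {pos : ℕ} {L L' : List ℕ} {x : ℕ}

theorem input_cons : Input f pos (x :: L) ↔ f pos = x ∧ Input f (pos + 1) L := by
  constructor
  · refine fun h => ⟨h 0 x rfl, fun i y hy => ?_⟩
    rw [Nat.add_assoc, Nat.add_comm 1]
    exact h (i + 1) y hy
  · rintro ⟨h1, h2⟩ (_ | i) y hy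
    · exact h1.trans (Option.some.inj hy)
    · rw [Nat.add_comm i, ← Nat.add_assoc]
      exact h2 i y hy

theorem input_append : Input f pos (L ++ L') ↔ Input f pos L ∧ Input f (pos + L.length) L' := by
  induction L generalizing pos with
  | nil => simp [Input]
  | cons x L ih =>
    rw [List.cons_append, input_cons, input_cons, ih, and_assoc, length_cons, Nat.add_assoc,
      Nat.add_comm 1]

end

/-- The program turns `M`, within `t` steps, into a scan with the given number of variables, layout,
unfinished option and position in the input, and keeps the temporary registers below `b`. -/
def Cmd.Yields (f : ℕ → ℕ) (p : Cmd) (t : ℕ) (M : Scan) (b v : ℕ) (S : Layout) (l : List Cell)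
    (w : ℕ) : Prop :=
  ∃ M', p.Turns f t M M' ∧ (M'.nv = v ∧ M'.lay = S ∧ M'.cur = l ∧ M'.tmp 19 = w) ∧
    ∀ r, 19 < r → r < b → M'.tmp r = M.tmp r

open Exp Cmd

/-- Run `p` with the values from `0` on in register `31`, as often as register `m` says. -/
def Cmd.index (m : ℕ) (p : Cmd) : Cmd :=
  .set 31 (lit 0) ;; .loop (less (reg 31) (reg m)) (p ;; cmdInc 31)

section

variable {f : ℕ → ℕ} {M : Scan} {p : Cmd}

theorem yields_index {α : Type*} (xs : List α) {m : ℕ} (hm : 19 < m) (hm' : m < 31)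
    (hlen : M.tmp m = xs.length) (K : ℕ) (S : List α → Layout) (cur : List α → List Cell)
    (w : List α → ℕ) (h0 : M.lay = S [] ∧ M.cur = cur [] ∧ M.tmp 19 = w [])
    (hstep : ∀ l x l' M', xs = l ++ x :: l' →
      (M'.nv = M.nv ∧ M'.lay = S l ∧ M'.cur = cur l ∧ M'.tmp 19 = w l) → M'.tmp 31 = l.length →
      (∀ r, 19 < r → r < 31 → M'.tmp r = M.tmp r) →
      p.Yields f K M' 32 M'.nv (S (l ++ [x])) (cur (l ++ [x])) (w (l ++ [x]))) :
    (Cmd.index m p).Yields f ((K + 2) * xs.length + 2) M 31 M.nv (S xs) (cur xs) (w xs) := by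
  have key := turns_loop (f := f) (e := less (reg 31) (reg m)) (p := p ;; cmdInc 31)
    (M := { M with tmp := update M.tmp 31 0 }) xs
    (fun l M' => (M'.nv = M.nv ∧ M'.lay = S l ∧ M'.cur = cur l ∧ M'.tmp 19 = w l) ∧
      M'.tmp 31 = l.length ∧ ∀ r, 19 < r → r < 31 → M'.tmp r = M.tmp r) (fun _ => K + 1)
    (by simp [Exp.plain]; omega) ?_ ?_ ?_
  · obtain ⟨M', h1, h2, h3, h4⟩ := key
    refine ⟨M', ((turns_set (by norm_num) rfl).seq h1).mono ?_ rfl, h2, h4⟩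
    simp only [List.map_const', List.sum_replicate, smul_eq_mul]
    ring_nf
    rfl
  · grind
  · rintro l l' M' rfl ⟨-, h2, h3⟩
    have h4 : M'.tmp m = l.length + l'.length := by rw [h3 m hm hm', hlen, length_append]
    have h5 : m ≠ 1 := by omega
    have h6 : m ≠ 2 := by omega
    simp only [Exp.eval, Scan.state, h2, h4, h5, h6, if_false, reduceEqDiff]
    cases l' <;> simp
  · rintro l x l' M' hl ⟨h1, h2, h3⟩
    obtain ⟨M'', h4, h5, h6⟩ := hstep l x l' M' hl h1 h2 h3
    refine ⟨_, h4.seq (turns_set (by norm_num) rfl), ⟨h5.1.trans h1.1, h5.2.1, h5.2.2.1, ?_⟩, ?_,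
      fun r hr hr' => ?_⟩
    · simpa using h5.2.2.2
    · simp [Exp.eval, Scan.state, h6 31, h2]
    · grind

theorem Cmd.Turns.yields {t t' v w b : ℕ} {S : Layout} {l : List Cell} {M' : Scan}
    (h : p.Turns f t M M') (ht : t ≤ t')
    (hM : (M'.nv = v ∧ M'.lay = S ∧ M'.cur = l ∧ M'.tmp 19 = w) ∧
      ∀ r, 19 < r → r < b → M'.tmp r = M.tmp r) : p.Yields f t' M b v S l w :=
  ⟨M', h.mono ht rfl, hM⟩

/-- The variable at the argument place that is stored at position `e` of the input. -/
def argAt (e : Exp) : Exp := get 0 (plus (reg 23) (get 0 e))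

/-- The word of the input at distance `j` from the current position. -/
def word (j : ℕ) : Exp := get 0 (plus (reg 19) (lit j))

/-- Advance in the input. -/
def cmdAdvance (e : Exp) : Cmd := Cmd.set 19 (plus (reg 19) e)

/-- The pair that was created last. -/
def lastPair : Exp := minus (reg 2) (lit 1)

theorem Cmd.Yields.seq {q : Cmd} {t u t' v w b v' w' : ℕ} {S S' : Layout} {l l' : List Cell}
    (h : p.Yields f t M b v S l w)
    (h' : ∀ M', (M'.nv = v ∧ M'.lay = S ∧ M'.cur = l ∧ M'.tmp 19 = w) →
      (∀ r, 19 < r → r < b → M'.tmp r = M.tmp r) → q.Yields f u M' b v' S' l' w')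
    (ht : t + u ≤ t') : (p ;; q).Yields f t' M b v' S' l' w' := by
  obtain ⟨M', h1, h2, h3⟩ := h
  obtain ⟨M'', h4, h5, h6⟩ := h' M' h2 h3
  exact ⟨M'', (h1.seq h4).mono ht rfl, h5, fun r hr hr' => (h6 r hr hr').trans (h3 r hr hr')⟩

theorem Cmd.Yields.mono {t t' v w b b' : ℕ} {S S' : Layout} {l : List Cell}
    (h : p.Yields f t M b v S l w) (ht : t ≤ t') (hb : b' ≤ b) (hS : S = S') :
    p.Yields f t' M b' v S' l w := by
  obtain ⟨M', h1, h2, h3⟩ := h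
  subst hS
  exact ⟨M', h1.mono ht rfl, h2, fun r hr hr' => h3 r hr (by omega)⟩

theorem yields_cond {q : Cmd} {t v w b r : ℕ} {S : Layout} {l : List Cell} (c : Bool) (hr : 19 ≤ r)
    (hc : M.tmp r = c.toNat) (h1 : c = true → p.Yields f t M b v S l w)
    (h2 : c = false → q.Yields f t M b v S l w) :
    (Cmd.cond (reg r) p q).Yields f (t + 1) M b v S l w := by
  have hpl : (reg r).plain = true := by simp [Exp.plain, hr]
  have hev : (reg r).eval (M.state f) = c.toNat := by
    simp only [Exp.eval, Scan.state, ← hc]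
    grind
  cases c with
  | true =>
    obtain ⟨M', h3, h4⟩ := h1 rfl
    exact ⟨M', turns_cond_true hpl (by simp [hev]) h3, h4⟩
  | false =>
    obtain ⟨M', h3, h4⟩ := h2 rfl
    exact ⟨M', turns_cond_false hpl hev h3, h4⟩

theorem yields_pair {g v : Exp} (hg : g.plain = true) (hv : v.plain = true) :
    (cmdPair g v).Yields f 3 M 32 M.nv
      (M.lay.1 ++ [(g.eval (M.state f), v.eval (M.state f))], M.lay.2) M.cur (M.tmp 19) :=
  (turns_pair hg hv).yields le_rfl ⟨⟨rfl, rfl, rfl, rfl⟩, fun _ _ _ => rfl⟩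

/-- Append the group by which the variable `x` waits for the variable `d`. -/
def cmdWait (d x : Exp) : Cmd :=
  cmdPair (reg 2) x ;; cmdCell d (lit 0) (lit 0) ;; cmdCell x lastPair (lit 1) ;; cmdClose

theorem yields_wait {d x : Exp} (u y : ℕ) (hcur : M.cur = []) (hd : d.plain = true)
    (hx : x.plain = true)
    (hd' : ∀ M', M'.tmp = M.tmp → d.eval (Scan.state f M') = u)
    (hx' : ∀ M', M'.tmp = M.tmp → x.eval (Scan.state f M') = y) :
    (cmdWait d x).Yields f 15 M 32 M.nv (addGroup M.lay (scopeGroup u y)) [] (M.tmp 19) := by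
  refine ((turns_pair rfl hx).seq <| (turns_cell hd rfl rfl).seq <|
    (turns_cell hx rfl rfl).seq turns_close).yields le_rfl ⟨⟨rfl, ?_, rfl, rfl⟩, fun _ _ _ => rfl⟩
  simp only [hd', hx', hcur]
  simp [Exp.eval, Scan.state, lastPair, addGroup, scopeGroup, Cell.shift]

/-- Append the group of the auxiliary variable of a clause. -/
def cmdPremise : Cmd :=
  cmdPair (reg 2) (reg 27) ;;
  Cmd.index 29 (cmdCell (reg 27) lastPair (lit 0) ;; cmdCell (argAt (reg 19)) (lit 0) (lit 1) ;;
    cmdCell (argAt (plus (reg 19) (lit 1))) (lit 0) (lit 2) ;; cmdClose ;; cmdAdvance (lit 2))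

/-- Append the group of the head variable of a clause. -/
def cmdHead : Cmd :=
  cmdWait (reg 27) (reg 30) ;;
  Cmd.index 29 (cmdCell (argAt (plus (reg 19) (reg 31))) (lit 0) (lit 0) ;;
    cmdCell (reg 30) lastPair (lit 1) ;; cmdClose) ;;
  Cmd.cond (reg 28)
    (cmdCell (reg 30) lastPair (lit 0) ;;
      Cmd.index 29 (cmdCell (argAt (plus (reg 19) (reg 31))) (lit 0) (lit 0)) ;; cmdClose) skip

/-- Append the group by which the conjunction demands that a clause is satisfiable. -/
def cmdConsistency : Cmd :=
  cmdWait (reg 27) (reg 24) ;;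
  Cmd.cond (reg 28) (cmdCell (reg 24) lastPair (lit 0) ;; cmdClose) skip ;;
  Cmd.index 29 (cmdCell (reg 24) lastPair (lit 0) ;;
    cmdCell (argAt (plus (reg 19) (reg 31))) (lit 0) (lit 1) ;; cmdCell (reg 30) (lit 0) (lit 2) ;;
    cmdClose)

section clause

variable {k : ℕ} {a : Fin k → ℕ} {c : HornClause k}

theorem yields_premise (ha : ∀ i : Fin k, f (M.tmp 23 + i) = a i) (hlen : M.tmp 29 = c.eqs.length)
    (hin : Input f (M.tmp 19) (c.eqs.flatMap fun p => [p.1.val, p.2.val])) (hcur : M.cur = []) :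
    cmdPremise.Yields f (21 * c.eqs.length + 5) M 31 M.nv
      (addGroup M.lay (premiseGroup a (M.tmp 27) c)) []
      (M.tmp 19 + (c.eqs.flatMap fun p => [p.1.val, p.2.val]).length) := by
  refine ((yields_pair rfl rfl).mono le_rfl (by norm_num) rfl).seq (fun M₁ h1 h2 => ?_)
    (u := 21 * c.eqs.length + 2) (by omega)
  rw [← h1.1]
  refine yields_index c.eqs (by norm_num) (by norm_num)
    ((h2 29 (by norm_num) (by norm_num)).trans hlen) 19
    (fun l => addGroup M.lay (premiseGroup a (M.tmp 27) { c with eqs := l }))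
    (fun _ => []) (fun l => M.tmp 19 + (l.flatMap fun p => [p.1.val, p.2.val]).length) ?_ ?_
  · simp [Exp.eval, Scan.state, premiseGroup, addGroup, hcur, h1]
  · rintro l x l' M' hl ⟨-, h3, h4, h5⟩ h6 h7
    rw [hl, flatMap_append, input_append, flatMap_cons, input_append] at hin
    obtain ⟨-, hin, -⟩ := hin
    rw [input_cons, input_cons] at hin
    have e : ∀ r, 19 < r → r < 31 → M'.tmp r = M.tmp r :=
      fun r hr hr' => (h7 r hr hr').trans (h2 r hr hr')
    refine ((turns_cell rfl rfl rfl).seq <| (turns_cell rfl rfl rfl).seq <|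
      (turns_cell rfl rfl rfl).seq <| turns_close.seq <| turns_set (by norm_num) rfl).yields
      (by norm_num) ⟨⟨rfl, ?_, rfl, ?_⟩, ?_⟩
    · simp only [← h5] at hin
      simp [Exp.eval, Scan.state, argAt, lastPair, premiseGroup, addGroup, Cell.shift, h3, h4, e,
          hin,
        ha]
    · simp [Exp.eval, Scan.state, h5]
      omega
    · grind

theorem input_tail {pos : ℕ} (ha : ∀ i : Fin k, f (M.tmp 23 + i) = a i)
    (hin : Input f pos (c.tail.map fun z => z.val)) {l l' : List (Fin k)} {x : Fin k}
    (hl : c.tail = l ++ x :: l') : f (M.tmp 23 + f (pos + l.length)) = a x := by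
  rw [hl, map_append, input_append, map_cons, input_cons, List.length_map] at hin
  rw [hin.2.1, ha]

theorem yields_head (ha : ∀ i : Fin k, f (M.tmp 23 + i) = a i) (hlen : M.tmp 29 = c.tail.length)
    (hweak : M.tmp 28 = c.weak.toNat) (hhead : M.tmp 30 = a c.head)
    (hin : Input f (M.tmp 19) (c.tail.map fun z => z.val)) (hcur : M.cur = []) :
    cmdHead.Yields f (21 * c.tail.length + 40) M 31 M.nv
      (addGroup M.lay (headGroup a (M.tmp 27) c)) [] (M.tmp 19) := by
  refine ((yields_wait (M.tmp 27) (M.tmp 30) hcur rfl rfl (by simp +contextual [Exp.eval,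
      Scan.state])
    (by simp +contextual [Exp.eval, Scan.state])).mono le_rfl (by norm_num) rfl).seq
    (fun M₁ h1 h2 => ?_) (u := 21 * c.tail.length + 25) (by omega)
  refine Cmd.Yields.seq (t := 14 * c.tail.length + 2) (u := 7 * c.tail.length + 23) (h1.1 ▸
    yields_index c.tail (by norm_num) (by norm_num) ((h2 29 (by norm_num) (by norm_num)).trans
        hlen) 12
    (fun l => addGroup M.lay (headGroup a (M.tmp 27) { c with tail := l, weak := false }))
    (fun _ => []) (fun l => M.tmp 19) ?_ ?_)
    (fun M₂ h3 h4 => ?_) (by omega)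
  rotate_left
  · simp [headGroup, h1, hhead, scopeGroup]
  · rintro l x l' M' hl ⟨-, h3, h4, h5⟩ h6 h7
    have e : ∀ r, 19 < r → r < 31 → M'.tmp r = M.tmp r :=
      fun r hr hr' => (h7 r hr hr').trans (h2 r hr hr')
    refine ((turns_cell rfl rfl rfl).seq <| (turns_cell rfl rfl rfl).seq turns_close).yields
      (by norm_num) ⟨⟨rfl, ?_, rfl, h5⟩, fun _ _ _ => rfl⟩
    simp [Exp.eval, Scan.state, argAt, lastPair, headGroup, addGroup, Cell.shift, h3, h4, h5, h6, e,
      input_tail ha hin hl, hhead]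
  · have e : ∀ r, 19 < r → r < 31 → M₂.tmp r = M.tmp r :=
      fun r hr hr' => (h4 r hr hr').trans (h2 r hr hr')
    refine (yields_cond (t := 7 * c.tail.length + 22) c.weak (by norm_num)
      ((e 28 (by norm_num) (by norm_num)).trans hweak) (fun hw => ?_) fun hw => ?_).mono
      le_rfl le_rfl rfl
    · refine Cmd.Yields.seq (t := 5) (u := 7 * c.tail.length + 4)
        ((turns_cell rfl rfl rfl).yields le_rfl ⟨⟨rfl, rfl, rfl, rfl⟩, fun _ _ _ => rfl⟩)
        (fun M₃ h5 h6 => ?_) (by omega)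
      have e' : ∀ r, 19 < r → r < 31 → M₃.tmp r = M.tmp r :=
        fun r hr hr' => (h6 r hr hr').trans (e r hr hr')
      refine Cmd.Yields.seq (t := 7 * c.tail.length + 2) (u := 2) (yields_index c.tail (by norm_num)
        (by norm_num) ((e' 29 (by norm_num) (by norm_num)).trans hlen) 5 (fun _ => M₃.lay)
        (fun l => (⟨a c.head, 1, 0⟩ :: l.map fun z => ⟨a z, 0, 0⟩ : List Cell).map
          (Cell.shift M.lay.1.length)) (fun l => M.tmp 19) ?_ ?_) (fun M₄ h7 h8 => ?_) le_rfl
      · simp [Exp.eval, Scan.state, lastPair, h3, h5, e, hhead, Cell.shift, addGroup, headGroup]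
      · rintro l x l' M' hl ⟨-, k3, k4, k5⟩ k6 k7
        refine (turns_cell rfl rfl rfl).yields le_rfl ⟨⟨rfl, k3, ?_, k5⟩, fun _ _ _ => rfl⟩
        have e3 : M'.tmp 23 = M.tmp 23 := (k7 23 (by norm_num) (by norm_num)).trans
          (e' 23 (by norm_num) (by norm_num))
        simp [Exp.eval, Scan.state, argAt, k4, k5, k6, e3, Cell.shift, input_tail ha hin hl]
      · refine turns_close.yields le_rfl ⟨⟨?_, ?_, rfl, h7.2.2.2⟩, fun _ _ _ => rfl⟩
        · rw [h7.1, h5.1, h3.1]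
        · rw [h7.2.1, h7.2.2.1, h5.2.1, h3.2.1]
          simp [addGroup, headGroup, hw]
    · refine turns_skip.yields (by omega) ⟨⟨h3.1, ?_, h3.2.2⟩, fun _ _ _ => rfl⟩
      rw [h3.2.1]
      simp [headGroup, hw]

theorem yields_consistency (ha : ∀ i : Fin k, f (M.tmp 23 + i) = a i)
    (hlen : M.tmp 29 = c.tail.length) (hweak : M.tmp 28 = c.weak.toNat)
    (hhead : M.tmp 30 = a c.head) (hin : Input f (M.tmp 19) (c.tail.map fun z => z.val))
    (hcur : M.cur = []) :
    cmdConsistency.Yields f (19 * c.tail.length + 25) M 31 M.nv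
      (addGroup M.lay (consistencyGroup a (M.tmp 24) (M.tmp 27) c)) [] (M.tmp 19) := by
  refine ((yields_wait (M.tmp 27) (M.tmp 24) hcur rfl rfl (by simp +contextual [Exp.eval,
      Scan.state])
    (by simp +contextual [Exp.eval, Scan.state])).mono le_rfl (by norm_num) rfl).seq
    (fun M₁ h1 h2 => ?_) (u := 19 * c.tail.length + 10) (by omega)
  refine Cmd.Yields.seq (t := 8) (u := 19 * c.tail.length + 2) (w := M.tmp 19) (v := M.nv) (l := [])
    (S := addGroup M.lay (consistencyGroup a (M.tmp 24) (M.tmp 27) { c with tail := [] }))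
    (yields_cond (t := 7) c.weak (by norm_num)
      ((h2 28 (by norm_num) (by norm_num)).trans hweak) (fun hw => ?_) fun hw => ?_)
    (fun M₂ h3 h4 => ?_) (by omega)
  · refine ((turns_cell rfl rfl rfl).seq turns_close).yields le_rfl
      ⟨⟨h1.1, ?_, rfl, h1.2.2.2⟩, fun _ _ _ => rfl⟩
    simp [Exp.eval, Scan.state, lastPair, addGroup, scopeGroup, consistencyGroup, Cell.shift, hw,
        h1,
      h2 24]
  · refine turns_skip.yields (by norm_num) ⟨⟨h1.1, ?_, h1.2.2⟩, fun _ _ _ => rfl⟩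
    rw [h1.2.1]
    simp [consistencyGroup, scopeGroup, hw]
  · have e : ∀ r, 19 < r → r < 31 → M₂.tmp r = M.tmp r :=
      fun r hr hr' => (h4 r hr hr').trans (h2 r hr hr')
    rw [← h3.1]
    refine yields_index c.tail (by norm_num) (by norm_num)
      ((e 29 (by norm_num) (by norm_num)).trans hlen) 17
      (fun l => addGroup M.lay (consistencyGroup a (M.tmp 24) (M.tmp 27) { c with tail := l }))
      (fun _ => []) (fun l => M.tmp 19) h3.2 ?_
    rintro l x l' M' hl ⟨-, k3, k4, k5⟩ k6 k7
    have e' : ∀ r, 19 < r → r < 31 → M'.tmp r = M.tmp r :=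
      fun r hr hr' => (k7 r hr hr').trans (e r hr hr')
    refine ((turns_cell rfl rfl rfl).seq <| (turns_cell rfl rfl rfl).seq <|
      (turns_cell rfl rfl rfl).seq turns_close).yields
      (by norm_num) ⟨⟨rfl, ?_, rfl, k5⟩, fun _ _ _ => rfl⟩
    simp [Exp.eval, Scan.state, argAt, lastPair, consistencyGroup, addGroup, Cell.shift, k3, k4, k5,
      k6, e', input_tail ha hin hl, hhead]

end clause

end

open Exp Cmd

/-- Append the groups of a clause. -/
def cmdClause : Cmd :=
  (Cmd.set 27 (reg 1) ;; cmdInc 1 ;; Cmd.set 28 (word 0) ;; Cmd.set 29 (word 1) ;;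
    cmdAdvance (lit 2)) ;;
  cmdPremise ;;
  (Cmd.set 30 (argAt (reg 19)) ;; Cmd.set 29 (word 1) ;; cmdAdvance (lit 2)) ;;
  cmdHead ;; cmdConsistency ;; cmdAdvance (reg 29) ;; Cmd.set 25 (minus (reg 25) (lit 1))

/-- Append the groups of a conjunction of clauses. -/
def cmdHorn : Cmd :=
  (Cmd.set 24 (reg 1) ;; cmdInc 1) ;;
  Cmd.index 22 (cmdWait (reg 24) (get 0 (plus (reg 23) (reg 31)))) ;;
  Cmd.loop (reg 25) cmdClause

/-- Append an option given by the ranks of the arguments. -/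
def cmdOrder : Cmd :=
  Cmd.index 22 (cmdCell (get 0 (plus (reg 23) (reg 31))) (plus (reg 27) (reg 31)) (word 0) ;;
    cmdAdvance (lit 1)) ;;
  cmdClose ;; Cmd.set 25 (minus (reg 25) (lit 1))

/-- Append the group of a set of weak linear orders. -/
def cmdOrders : Cmd :=
  Cmd.set 27 (reg 2) ;; Cmd.index 22 (cmdPair (reg 27) (get 0 (plus (reg 23) (reg 31)))) ;;
  Cmd.loop (reg 25) cmdOrder

/-- Append the groups of a constraint. -/
def cmdConstraint : Cmd :=
  (Cmd.set 22 (word 0) ;; Cmd.set 23 (plus (reg 19) (lit 1)) ;; Cmd.set 19 (plus (reg 23) (reg 22))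
      ;;
    Cmd.set 26 (word 0) ;; Cmd.set 25 (word 1) ;; cmdAdvance (lit 2)) ;;
  Cmd.cond (reg 26) cmdHorn cmdOrders ;; Cmd.set 20 (minus (reg 20) (lit 1))

section

variable {f : ℕ → ℕ} {M : Scan} {k : ℕ} {a : Fin k → ℕ}

/-- Reading a clause writes its three groups. -/
theorem turns_clause {c : HornClause k} (ha : ∀ i : Fin k, f (M.tmp 23 + i) = a i)
    (hin : Input f (M.tmp 19) c.encode) (hcur : M.cur = []) :
    ∃ M', cmdClause.Turns f (40 * c.encode.length) M M' ∧ M'.nv = M.nv + 1 ∧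
      M'.lay = (clauseGroups a (M.tmp 24) M.nv c).foldl addGroup M.lay ∧ M'.cur = [] ∧
      M'.tmp 19 = M.tmp 19 + c.encode.length ∧ M'.tmp 25 = M.tmp 25 - 1 ∧
      ∀ r, 19 < r → r < 25 → M'.tmp r = M.tmp r := by
  have hlen : c.encode.length =
      4 + (c.eqs.flatMap fun p => [p.1.val, p.2.val]).length + c.tail.length := by
    simp [HornClause.encode]
    omega
  have hE : c.eqs.length ≤ (c.eqs.flatMap fun p => [p.1.val, p.2.val]).length := by
    simp
    omega
  simp only [HornClause.encode, List.cons_append, input_cons, input_append] at hin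
  obtain ⟨i1, i2, i3, i4, i5, i6⟩ := hin
  obtain ⟨M₁, h1, a1, a2, a3, a4, a5, a6, a7, a8⟩ : ∃ M₁, (Cmd.set 27 (reg 1) ;; cmdInc 1 ;;
      Cmd.set 28 (word 0) ;; Cmd.set 29 (word 1) ;; cmdAdvance (lit 2)).Turns f 5 M M₁ ∧
      M₁.nv = M.nv + 1 ∧ M₁.lay = M.lay ∧ M₁.cur = [] ∧ M₁.tmp 19 = M.tmp 19 + 1 + 1 ∧
      M₁.tmp 27 = M.nv ∧ M₁.tmp 28 = c.weak.toNat ∧ M₁.tmp 29 = c.eqs.length ∧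
      ∀ r, 19 < r → r < 27 → M₁.tmp r = M.tmp r := by
    refine ⟨_, ((turns_set (by norm_num) rfl).seq <| turns_newVar.seq <|
      (turns_set (by norm_num) rfl).seq <| (turns_set (by norm_num) rfl).seq <|
      turns_set (by norm_num) rfl), rfl, rfl, hcur, ?_, ?_, ?_, ?_, fun r hr hr' => ?_⟩
    · simp [Exp.eval, Scan.state]
    · simp [Exp.eval, Scan.state]
    · simp [Exp.eval, Scan.state, word, i1]
    · simp [Exp.eval, Scan.state, word, i2]
    · simp [hr.ne', hr'.ne, (show r ≠ 28 by omega), (show r ≠ 29 by omega)]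
  obtain ⟨M₂, h2, ⟨b1, b2, b3, b4⟩, b5⟩ := yields_premise (M := M₁) (a := a) (c := c)
    (by simpa only [a8 23 (by norm_num) (by norm_num)] using ha) a7 (by rwa [a4]) a3
  obtain ⟨M₃, h3, c1, c2, c3, c4, c5, c6, c7⟩ : ∃ M₃, (Cmd.set 30 (argAt (reg 19)) ;;
      Cmd.set 29 (word 1) ;; cmdAdvance (lit 2)).Turns f 3 M₂ M₃ ∧
      M₃.nv = M₂.nv ∧ M₃.lay = M₂.lay ∧ M₃.cur = [] ∧ M₃.tmp 19 = M₂.tmp 19 + 1 + 1 ∧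
      M₃.tmp 30 = a c.head ∧ M₃.tmp 29 = c.tail.length ∧
      ∀ r, 19 < r → r < 29 → M₃.tmp r = M₂.tmp r := by
    refine ⟨_, ((turns_set (by norm_num) rfl).seq <| (turns_set (by norm_num) rfl).seq <|
      turns_set (by norm_num) rfl), rfl, rfl, b3, ?_, ?_, ?_, fun r hr hr' => ?_⟩
    · simp [Exp.eval, Scan.state]
    · rw [← a4, ← b4] at i4
      simp [Exp.eval, Scan.state, argAt, i4, b5, a8, ha]
    · rw [← a4, ← b4] at i5
      simp [Exp.eval, Scan.state, word, i5]
    · simp [hr.ne', hr'.ne, (show r ≠ 30 by omega)]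
  have d : ∀ r, 19 < r → r < 27 → M₃.tmp r = M.tmp r := fun r hr hr' => by grind
  have ha3 : ∀ i : Fin k, f (M₃.tmp 23 + i) = a i := by simp_all
  have hin3 : Input f (M₃.tmp 19) (c.tail.map fun z => z.val) := by
    rwa [c4, b4, a4]
  have hw3 : M₃.tmp 28 = c.weak.toNat := by simp_all
  have he3 : M₃.tmp 27 = M.nv := by simp_all
  obtain ⟨M₄, h4, ⟨d1, d2, d3, d4⟩, d5⟩ := yields_head ha3 c6 hw3 c5 hin3 c3
  obtain ⟨M₅, h5, ⟨e1, e2, e3, e4⟩, e5⟩ := yields_consistency (M := M₄) (a := a) (c := c)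
    (by simpa only [d5 23 (by norm_num) (by norm_num)] using ha3)
    ((d5 29 (by norm_num) (by norm_num)).trans c6) ((d5 28 (by norm_num) (by norm_num)).trans hw3)
    ((d5 30 (by norm_num) (by norm_num)).trans c5) (by rwa [d4]) d3
  have h29 : M₅.tmp 29 = c.tail.length := by simp_all
  have g : ∀ r, 19 < r → r < 27 → M₅.tmp r = M.tmp r := fun r hr hr' => by grind
  refine ⟨_, (h1.seq <| h2.seq <| h3.seq <| h4.seq <| h5.seq <|
    (turns_set (by norm_num) rfl).seq (turns_set (by norm_num) rfl)).mono ?_ rfl, ?_, ?_, e3, ?_,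
        ?_,
    fun r hr hr' => ?_⟩
  · omega
  · simp only [e1, d1, c1, b1, a1]
  · simp only [e2, d2, c2, b2, a2, a5, he3, d5 24 (by norm_num) (by norm_num),
      d5 27 (by norm_num) (by norm_num), d 24 (by norm_num) (by norm_num)]
    rfl
  · simp [Exp.eval, Scan.state, h29]
    omega
  · simp [Exp.eval, Scan.state, g]
  · grind

theorem sum_map_mul_length {α : Type*} (K : ℕ) (xs : List α) (enc : α → List ℕ) :
    (xs.map fun x => K * (enc x).length).sum = K * (xs.flatMap enc).length := by
  rw [List.sum_map_mul_left, List.length_flatMap]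

theorem length_le_flatMap {α : Type*} (xs : List α) (enc : α → List ℕ) (h : ∀ x,
    1 ≤ (enc x).length) :
    xs.length ≤ (xs.flatMap enc).length := by
  induction xs with
  | nil => simp
  | cons x xs ih =>
    have := h x
    simp only [flatMap_cons, length_append, length_cons]
    omega

/-- Reading a conjunction writes the groups by which its variables wait for `d`, and the groups of
all clauses. -/
theorem turns_horn {cs : List (HornClause k)} (ha : ∀ i : Fin k, f (M.tmp 23 + i) = a i)
    (hk : M.tmp 22 = k) (hin : Input f (M.tmp 19) (cs.flatMap HornClause.encode))
    (hlen : M.tmp 25 = cs.length) (hcur : M.cur = []) :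
    ∃ M', cmdHorn.Turns f (41 * (cs.flatMap HornClause.encode).length + 17 * k + 5) M M' ∧
      M'.nv = M.nv + (1 + cs.length) ∧
      M'.lay = ((ofFn a).map (scopeGroup M.nv) ++ (cs.zipIdx (M.nv + 1)).flatMap fun p =>
        clauseGroups a M.nv p.2 p.1).foldl addGroup M.lay ∧ M'.cur = [] ∧
      M'.tmp 19 = M.tmp 19 + (cs.flatMap HornClause.encode).length ∧
      ∀ r, 19 < r → r < 24 → M'.tmp r = M.tmp r := by
  obtain ⟨M₁, h1, a1, a2, a3, a4, a5, a6⟩ : ∃ M₁, (Cmd.set 24 (reg 1) ;; cmdInc 1).Turns f 2 M M₁ ∧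
      M₁.nv = M.nv + 1 ∧ M₁.lay = M.lay ∧ M₁.cur = [] ∧ M₁.tmp 19 = M.tmp 19 ∧ M₁.tmp 24 = M.nv ∧
      ∀ r, 19 < r → r ≠ 24 → M₁.tmp r = M.tmp r := by
    refine ⟨_, (turns_set (by norm_num) rfl).seq turns_newVar, rfl, rfl, hcur, ?_, ?_,
      fun r hr hr' => ?_⟩
    · simp
    · simp [Exp.eval, Scan.state]
    · simp [hr']
  obtain ⟨M₂, h2, ⟨b1, b2, b3, b4⟩, b5⟩ := yields_index (f := f) (M := M₁)
    (p := cmdWait (reg 24) (get 0 (plus (reg 23) (reg 31)))) (ofFn a) (m := 22) (by norm_num)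
    (by norm_num) (by rw [a6 22 (by norm_num) (by norm_num), hk, length_ofFn]) 15
    (fun l => (l.map (scopeGroup M.nv)).foldl addGroup M.lay) (fun _ => []) (fun _ => M.tmp 19)
    ⟨a2, a3, a4⟩ (by
      rintro l x l' M' hl ⟨-, k3, k4, k5⟩ k6 k7
      have e3 : M'.tmp 23 = M.tmp 23 :=
        (k7 23 (by norm_num) (by norm_num)).trans (a6 23 (by norm_num) (by norm_num))
      have e4 : M'.tmp 24 = M.nv := (k7 24 (by norm_num) (by norm_num)).trans a5
      have hlk : l.length < k := by
        have := congrArg List.length hl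
        simp at this
        omega
      have hx : f (M.tmp 23 + l.length) = x := by
        have h3 : (ofFn a)[l.length]? = some x := by simp [hl]
        grind
      have := yields_wait (f := f) (M := M') (d := reg 24) (x := get 0 (plus (reg 23) (reg 31)))
        M.nv x k4 rfl rfl (by intro M'' h; simp [Exp.eval, Scan.state, h, e4])
        (by intro M'' h; simp [Exp.eval, Scan.state, h, e3, k6, hx])
      rw [k3, k5] at this
      simpa using this)
  rw [length_ofFn] at h2
  have b6 : ∀ r, 19 < r → r < 31 → r ≠ 24 → M₂.tmp r = M.tmp r := fun r hr hr' hr'' => by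
    rw [b5 r hr hr', a6 r hr hr'']
  have b7 : M₂.tmp 24 = M.nv := (b5 24 (by norm_num) (by norm_num)).trans a5
  obtain ⟨M₃, h3, c1, c2, c3, c4, -, c5⟩ := turns_loop (f := f) (e := reg 25) (p := cmdClause)
    (M := M₂) cs (fun l M' => M'.nv = M.nv + 1 + l.length ∧ M'.lay = ((ofFn a).map
      (scopeGroup M.nv) ++ (l.zipIdx (M.nv + 1)).flatMap fun p => clauseGroups a M.nv p.2 p.1).foldl
        addGroup M.lay ∧ M'.cur = [] ∧
      M'.tmp 19 = M.tmp 19 + (l.flatMap HornClause.encode).length ∧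
      M'.tmp 25 = cs.length - l.length ∧ ∀ r, 19 < r → r < 25 → M'.tmp r = M₂.tmp r)
    (fun c => 40 * c.encode.length) rfl
    ⟨by simp [b1, a1], by simp [b2], b3, by simp [b4],
      by rw [b6 25 (by norm_num) (by norm_num) (by norm_num), hlen]; rfl, fun _ _ _ => rfl⟩
    (by
      rintro l l' M' hl ⟨-, -, -, -, k5, -⟩
      simp [Exp.eval, Scan.state, k5, hl])
    (by
      rintro l c l' M' hl ⟨k1, k2, k3, k4, k5, k6⟩
      rw [hl, flatMap_append, input_append, flatMap_cons, input_append] at hin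
      have e3 : M'.tmp 23 = M.tmp 23 := (k6 23 (by norm_num) (by norm_num)).trans
        (b6 23 (by norm_num) (by norm_num) (by norm_num))
      have e4 : M'.tmp 24 = M.nv := (k6 24 (by norm_num) (by norm_num)).trans b7
      obtain ⟨M'', h, g1, g2, g3, g4, g5, g6⟩ := turns_clause (M := M') (a := a) (c := c)
        (by rwa [e3]) (by rw [k4]; exact hin.2.1) k3
      refine ⟨M'', h, ?_, ?_, g3, ?_, ?_, fun r hr hr' => (g6 r hr hr').trans (k6 r hr hr')⟩
      · rw [g1, k1, length_append, length_singleton, Nat.add_assoc]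
      · grind
      · rw [g4, k4, flatMap_append, length_append, flatMap_singleton, Nat.add_assoc]
      · rw [g5, k5, length_append, length_singleton]
        omega)
  have hcl := length_le_flatMap cs HornClause.encode (fun c => by simp [HornClause.encode])
  refine ⟨M₃, (h1.seq <| h2.seq h3).mono ?_ rfl, by rw [c1, Nat.add_assoc], c2, c3, c4,
    fun r hr hr' => (c5 r hr (by omega)).trans (b6 r hr (by omega) (by omega))⟩
  rw [sum_map_mul_length]
  omega

theorem turns_order {w : WeakOrder k} {b : ℕ} (ha : ∀ i : Fin k, f (M.tmp 23 + i) = a i)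
    (hk : M.tmp 22 = k) (hb : M.tmp 27 = b)
    (hin : Input f (M.tmp 19) (ofFn fun i => (w i).val)) (hcur : M.cur = []) :
    ∃ M', cmdOrder.Turns f (8 * k + 5) M M' ∧ M'.nv = M.nv ∧
      M'.lay = (M.lay.1, M.lay.2 ++ [(ofFn fun i => (⟨a i, i + 1, w i⟩ : Cell)).map
        (Cell.shift b)]) ∧ M'.cur = [] ∧ M'.tmp 19 = M.tmp 19 + k ∧ M'.tmp 25 = M.tmp 25 - 1 ∧
      ∀ r, 19 < r → r < 31 → r ≠ 25 → M'.tmp r = M.tmp r := by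
  obtain ⟨M₁, h1, ⟨a1, a2, a3, a4⟩, a5⟩ := yields_index (f := f) (M := M)
    (p := cmdCell (get 0 (plus (reg 23) (reg 31))) (plus (reg 27) (reg 31)) (word 0) ;;
      cmdAdvance (lit 1)) (finRange k) (m := 22) (by norm_num) (by norm_num)
    (by rw [hk, length_finRange]) 6 (fun _ => M.lay)
    (fun l => l.map fun i => (⟨a i, b + i, w i⟩ : Cell)) (fun l => M.tmp 19 + l.length)
    (by simp [hcur]) (by
      rintro l x l' M' hl ⟨-, k3, k4, k5⟩ k6 k7
      have hx : l.length = x := by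
        have h3 : (finRange k)[l.length]? = some x := by simp [hl]
        grind
      have hfx : f (M.tmp 19 + x) = w x := hin x _ (by simp)
      refine ((turns_cell rfl rfl rfl).seq (turns_set (by norm_num) rfl)).yields le_rfl
        ⟨⟨rfl, k3, ?_, ?_⟩, fun r hr hr' => ?_⟩
      · simp [Exp.eval, Scan.state, word, k4, k5, k6, k7, hb, hx, ha, hfx]
      · simp [Exp.eval, Scan.state, k5, Nat.add_assoc]
      · simp [hr.ne'])
  refine ⟨_, (h1.seq <| turns_close.seq (turns_set (by norm_num) rfl)).mono ?_ rfl, a1, ?_, rfl, ?_,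
    ?_, fun r hr hr' hr'' => ?_⟩
  · rw [length_finRange]
  · simp only [a2, a3, List.ofFn_eq_map, List.map_map]
    simp [Cell.shift, Function.comp_def, ← Nat.add_assoc]
  · simpa using a4
  · simp [Exp.eval, Scan.state, a5]
  · simp [hr'', a5 r hr hr']

theorem turns_orders {ws : List (WeakOrder k)} (hk0 : 0 < k)
    (ha : ∀ i : Fin k, f (M.tmp 23 + i) = a i) (hk : M.tmp 22 = k)
    (hin : Input f (M.tmp 19) (ws.flatMap fun w => ofFn fun i => (w i).val))
    (hlen : M.tmp 25 = ws.length) (hcur : M.cur = []) :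
    ∃ M', cmdOrders.Turns f (14 * (ws.flatMap fun w => ofFn fun i => (w i).val).length +
        5 * k + 4) M M' ∧
      M'.nv = M.nv ∧ M'.lay = addGroup M.lay (ordersGroup a ws) ∧ M'.cur = [] ∧
      M'.tmp 19 = M.tmp 19 + (ws.flatMap fun w => ofFn fun i => (w i).val).length ∧
      ∀ r, 19 < r → r < 24 → M'.tmp r = M.tmp r := by
  have h1 := turns_set (f := f) (M := M) (i := 27) (e := reg 2) (by norm_num) rfl
  set M₁ : Scan := { M with tmp := update M.tmp 27 ((reg 2).eval (M.state f)) } with hM₁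
  have b0 : M₁.tmp 27 = M.lay.1.length := by simp [hM₁, Exp.eval, Scan.state]
  have b0' : ∀ r, r ≠ 27 → M₁.tmp r = M.tmp r := fun r hr => by simp [hM₁, hr]
  obtain ⟨M₂, h2, ⟨b1, b2, b3, b4⟩, b5⟩ := yields_index (f := f) (M := M₁)
    (p := cmdPair (reg 27) (get 0 (plus (reg 23) (reg 31)))) (finRange k) (m := 22)
    (by norm_num) (by norm_num) (by rw [b0' 22 (by norm_num), hk, length_finRange]) 3
    (fun l => (M.lay.1 ++ l.map fun i => (M.lay.1.length, a i), M.lay.2)) (fun _ => [])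
    (fun _ => M.tmp 19) (by simp [hM₁, hcur]) (by
      rintro l x l' M' hl ⟨-, k3, k4, k5⟩ k6 k7
      have hx : l.length = x := by
        have h3 : (finRange k)[l.length]? = some x := by simp [hl]
        grind
      have := yields_pair (f := f) (M := M') (g := reg 27) (v := get 0 (plus (reg 23) (reg 31)))
          rfl rfl
      rw [k3, k4, k5] at this
      refine this.mono le_rfl le_rfl ?_
      simp [Exp.eval, Scan.state, k6, k7, b0, b0', hx, ha])
  rw [length_finRange] at h2
  have b6 : ∀ r, 19 < r → r < 31 → r ≠ 27 → M₂.tmp r = M.tmp r := fun r hr hr' hr'' => by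
    rw [b5 r hr hr', b0' r hr'']
  obtain ⟨M₃, h3, c1, c2, c3, c4, -, c5⟩ := turns_loop (f := f) (e := reg 25) (p := cmdOrder)
    (M := M₂) ws (fun l M' => M'.nv = M.nv ∧ M'.lay = addGroup M.lay (ordersGroup a l) ∧
      M'.cur = [] ∧
      M'.tmp 19 = M.tmp 19 + (l.flatMap fun w => ofFn fun i => (w i).val).length ∧
      M'.tmp 25 = ws.length - l.length ∧ ∀ r, 19 < r → r < 31 → r ≠ 25 → M'.tmp r = M₂.tmp r)
    (fun w => 13 * (ofFn fun i => (w i).val).length) rfl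
    ⟨b1, by simp [b2, addGroup, ordersGroup, List.ofFn_eq_map, Function.comp_def], b3, by simp [b4],
      by rw [b6 25 (by norm_num) (by norm_num) (by norm_num), hlen]; rfl, fun _ _ _ _ => rfl⟩
    (by
      rintro l l' M' hl ⟨-, -, -, -, k5, -⟩
      simp [Exp.eval, Scan.state, k5, hl])
    (by
      rintro l c l' M' hl ⟨k1, k2, k3, k4, k5, k6⟩
      rw [hl, flatMap_append, input_append, flatMap_cons, input_append] at hin
      have e3 : M'.tmp 23 = M.tmp 23 := (k6 23 (by norm_num) (by norm_num) (by norm_num)).trans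
        (b6 23 (by norm_num) (by norm_num) (by norm_num))
      have e2 : M'.tmp 22 = M.tmp 22 := (k6 22 (by norm_num) (by norm_num) (by norm_num)).trans
        (b6 22 (by norm_num) (by norm_num) (by norm_num))
      have e4 : M'.tmp 27 = M.lay.1.length :=
        (k6 27 (by norm_num) (by norm_num) (by norm_num)).trans
          ((b5 27 (by norm_num) (by norm_num)).trans b0)
      obtain ⟨M'', h, g1, g2, g3, g4, g5, g6⟩ := turns_order (M := M') (a := a) (w := c)
        (by rwa [e3]) (e2.trans hk) e4 (by rw [k4]; exact hin.2.1) k3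
      refine ⟨M'', h.mono (by rw [length_ofFn]; omega) rfl, g1.trans k1, ?_, g3, ?_, ?_,
        fun r hr hr' hr'' => (g6 r hr hr' hr'').trans (k6 r hr hr' hr'')⟩
      · rw [g2, k2]
        simp [addGroup, ordersGroup]
      · grind
      · rw [g5, k5, length_append, length_singleton]
        omega)
  have hcl := length_le_flatMap ws (fun w => ofFn fun i => (w i).val) (fun c => by simp; omega)
  refine ⟨M₃, (h1.seq <| h2.seq h3).mono ?_ rfl, c1, c2, c3, c4,
    fun r hr hr' => (c5 r hr (by omega) (by omega)).trans (b6 r hr (by omega) (by omega))⟩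
  rw [sum_map_mul_length]
  omega

/-- Reading a constraint writes its groups and moves the input position behind it. -/
theorem turns_constraint {n : ℕ} {c : RepConstraint n} (hin : Input f (M.tmp 19) c.encode)
    (hcur : M.cur = []) :
    ∃ M', cmdConstraint.Turns f (60 * c.encode.length) M M' ∧ M'.nv = M.nv + c.dummies ∧
      M'.lay = (c.groups M.nv).foldl addGroup M.lay ∧ M'.cur = [] ∧
      M'.tmp 19 = M.tmp 19 + c.encode.length ∧ M'.tmp 20 = M.tmp 20 - 1 := by
  obtain ⟨k, hk0, args, rep⟩ := c
  simp only [RepConstraint.encode, List.cons_append, input_cons, input_append, length_ofFn] at hin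
  obtain ⟨i1, i2, i3⟩ := hin
  obtain ⟨i4, i5, i6⟩ : f (M.tmp 19 + 1 + k) = (match rep with | .orders _ => 0 | .horn _ => 1) ∧
      f (M.tmp 19 + 1 + k + 1) = (match rep with | .orders ws => ws.length | .horn cs => cs.length)
          ∧
      Input f (M.tmp 19 + 1 + k + 1 + 1) (match rep with
        | .orders ws => ws.flatMap fun w => ofFn fun i => (w i).val
        | .horn cs => cs.flatMap HornClause.encode) := by
    cases rep <;> simpa only [RelRep.encode, input_cons] using i3
  obtain ⟨M₁, h1, a1, a2, a3, a4, a5, a6, a7, a8, a9⟩ : ∃ M₁, (Cmd.set 22 (word 0) ;;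
      Cmd.set 23 (plus (reg 19) (lit 1)) ;; Cmd.set 19 (plus (reg 23) (reg 22)) ;;
      Cmd.set 26 (word 0) ;; Cmd.set 25 (word 1) ;; cmdAdvance (lit 2)).Turns f 6 M M₁ ∧
      M₁.nv = M.nv ∧ M₁.lay = M.lay ∧ M₁.cur = [] ∧ M₁.tmp 19 = M.tmp 19 + 1 + k + 1 + 1 ∧
      M₁.tmp 22 = k ∧ M₁.tmp 23 = M.tmp 19 + 1 ∧ M₁.tmp 26 = f (M.tmp 19 + 1 + k) ∧
      M₁.tmp 25 = f (M.tmp 19 + 1 + k + 1) ∧ M₁.tmp 20 = M.tmp 20 := by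
    refine ⟨_, ((turns_set (by norm_num) rfl).seq <| (turns_set (by norm_num) rfl).seq <|
      (turns_set (by norm_num) rfl).seq <| (turns_set (by norm_num) rfl).seq <|
      (turns_set (by norm_num) rfl).seq <| turns_set (by norm_num) rfl), rfl, rfl, hcur, ?_, ?_, ?_,
      ?_, ?_, ?_⟩ <;> simp [Exp.eval, Scan.state, word, i1]
  have ha : ∀ i : Fin k, f (M₁.tmp 23 + i) = (args i).val := by
    intro i
    rw [a6]
    exact i2 i _ (by simp)
  cases rep with
  | orders ws =>
    obtain ⟨M₂, h2, b1, b2, b3, b4, b5⟩ := turns_orders (M := M₁) hk0 ha a5 (by rw [a4]; exact i6)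
      (by rw [a8]; exact i5) a3
    refine ⟨_, (h1.seq <| (turns_cond_false (e := reg 26) rfl ?_ h2).seq
      (turns_set (by norm_num) rfl)).mono ?_ rfl, ?_, ?_, b3, ?_, ?_⟩
    · simpa [Exp.eval, Scan.state, a7] using i4
    · simp only [RepConstraint.encode, RelRep.encode, length_append, length_cons,
        length_ofFn]
      omega
    · rw [b1, a1]
      rfl
    · rw [b2, a2]
      rfl
    · simp [b4, a4, RepConstraint.encode, RelRep.encode]
      omega
    · simp [Exp.eval, Scan.state, b5, a9]
  | horn cs =>
    obtain ⟨M₂, h2, b1, b2, b3, b4, b5⟩ := turns_horn (M := M₁) ha a5 (by rw [a4]; exact i6)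
      (by rw [a8]; exact i5) a3
    refine ⟨_, (h1.seq <| (turns_cond_true (e := reg 26) rfl ?_ h2).seq
      (turns_set (by norm_num) rfl)).mono ?_ rfl, ?_, ?_, b3, ?_, ?_⟩
    · simp [Exp.eval, Scan.state, a7, i4]
    · simp only [RepConstraint.encode, RelRep.encode, length_append, length_cons,
        length_ofFn]
      omega
    · rw [b1, a1]
      rfl
    · rw [b2, a2, a1]
      rfl
    · simp [b4, a4, RepConstraint.encode, RelRep.encode]
      omega
    · simp [Exp.eval, Scan.state, b5, a9]

end

open Exp Cmd

/-- The program changes the register only by increments. -/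
def Cmd.Increments (r : ℕ) : Cmd → Prop
  | .set s e => s ≠ r ∨ e = plus (reg r) (lit 1)
  | .seq p q => p.Increments r ∧ q.Increments r
  | .cond _ p q => p.Increments r ∧ q.Increments r
  | .loop _ p => p.Increments r
  | _ => True

/-- A register that is changed only by additions of `1` grows by at most the number of steps. This
bounds the sizes of the tables by the time that it takes to write them. -/
theorem Exec.le_add {c : Cmd} {σ τ : State} {t r : ℕ} (h : Exec c σ t τ) (hc : c.Increments r) :
    τ.regs r ≤ σ.regs r + t := by
  induction h with
  | skip => simp
  | set s e σ =>
    simp only [update_apply]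
    split_ifs with h1
    · subst h1
      rcases hc with h1 | rfl
      · exact absurd rfl h1
      · exact le_rfl
    · exact Nat.le_add_right _ _
  | put => exact Nat.le_add_right _ _
  | emit => exact Nat.le_add_right _ _
  | seq _ _ ih1 ih2 =>
    have := ih1 hc.1
    have := ih2 hc.2
    omega
  | cond_true _ _ ih =>
    have := ih hc.1
    omega
  | cond_false _ _ ih =>
    have := ih hc.2
    omega
  | loop_done => exact Nat.le_add_right _ _
  | loop_step _ _ _ ih1 ih2 =>
    have := ih1 hc
    have := ih2 hc
    omega

section

variable {n : ℕ} {I : List (RepConstraint n)}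

theorem blocks_append (b : ℕ) (l : List (RepConstraint n)) (c : RepConstraint n) :
    blocks b (l ++ [c]) = blocks b l ++ [(numVars b l, c)] := by
  induction l generalizing b with
  | nil => rfl
  | cons c' l ih => simp [blocks, ih, numVars, Nat.add_assoc]

/-- Read the input and build the tables, with the identity as substitution. -/
def cmdLoad : Cmd :=
  (Cmd.set 0 (get 0 (lit 0)) ;; Cmd.set 1 (reg 0) ;; Cmd.set 2 (lit 1) ;;
    Cmd.set 20 (get 0 (lit 1)) ;; Cmd.set 19 (lit 2)) ;;
  Cmd.loop (reg 20) cmdConstraint ;;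
  Cmd.for 5 (lit 0) (reg 1) (put 8 (reg 5) (reg 5))

theorem turns_constraints {f : ℕ → ℕ} {M : Scan} (hin : Input f 2 (I.flatMap RepConstraint.encode))
    (hnv : M.nv = n) (hlay : M.lay = ([(0, 0)], [])) (hcur : M.cur = []) (hpos : M.tmp 19 = 2)
    (hlen : M.tmp 20 = I.length) :
    ∃ M', (Cmd.loop (reg 20) cmdConstraint).Turns f (61 * (encodeInput I).length) M M' ∧
      M'.nv = numVars n I ∧ M'.lay = layout (allGroups n I) ∧ M'.cur = [] := by
  obtain ⟨M', h, h1, h2, h3, -⟩ := turns_loop (f := f) (e := reg 20) (p := cmdConstraint) (M := M) I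
    (fun l M' => M'.nv = numVars n l ∧ M'.lay = layout (allGroups n l) ∧ M'.cur = [] ∧
      M'.tmp 19 = 2 + (l.flatMap RepConstraint.encode).length ∧ M'.tmp 20 = I.length - l.length)
    (fun c => 60 * c.encode.length) rfl
    ⟨by simpa [numVars] using hnv, by simp [hlay, layout, allGroups, blocks], hcur, hpos, hlen⟩
    (by
      rintro l l' M' hl ⟨-, -, -, -, k5⟩
      simp [Exp.eval, Scan.state, k5, hl])
    (by
      rintro l c l' M' hl ⟨k1, k2, k3, k4, k5⟩
      rw [hl, flatMap_append, input_append, flatMap_cons, input_append] at hin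
      obtain ⟨M'', h, g1, g2, g3, g4, g5⟩ := turns_constraint (M := M') (c := c)
        (by rw [k4]; exact hin.2.1) k3
      refine ⟨M'', h, ?_, ?_, g3, ?_, ?_⟩
      · rw [g1, k1]
        simp [numVars, Nat.add_assoc]
      · rw [g2, k1, k2]
        simp [allGroups, blocks_append, layout]
      · rw [g4, k4, flatMap_append, length_append, flatMap_singleton, Nat.add_assoc]
      · rw [g5, k5, length_append, length_singleton]
        omega)
  have hcl := length_le_flatMap I RepConstraint.encode (fun c => by simp [RepConstraint.encode])
  refine ⟨M', h.mono ?_ rfl, h1, h2, h3⟩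
  rw [sum_map_mul_length]
  simp only [encodeInput, length_cons]
  omega

theorem wp_cmdLoad : WP cmdLoad (State.init (encodeInput I)) fun t τ =>
    t ≤ 400 * (n + (encodeInput I).length) ∧ τ.out = [] ∧
      ∃ T : Tab, T.Holds n (numVars n I) (layout (allGroups n I)) ∧
        Loaded T (fun v => if v < numVars n I then v else 0) τ ∧
        T.nv + T.np + T.no + T.nc ≤ 300 * (n + (encodeInput I).length) ∧
        T.np ≤ 62 * (encodeInput I).length := by
  set f := fun i => (encodeInput I).getD i 0 with hf
  have hin : Input f 0 (encodeInput I) := by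
    intro i x hx
    simp [hf, List.getD, hx]
  simp only [encodeInput, input_cons] at hin
  obtain ⟨i1, i2, i3⟩ := hin
  refine wp_seq.2 ?_
  refine WP.mono (Q := fun t τ => t = 5 ∧ τ.regs 0 = n ∧ τ.regs 1 = n ∧ τ.regs 2 = 1 ∧ τ.regs 3 = 0
      ∧
    τ.regs 4 = 0 ∧ τ.regs 20 = I.length ∧ τ.regs 19 = 2 ∧ τ.arrays = (State.init (encodeInput
        I)).arrays ∧
    τ.out = []) ?_ ?_
  · simp only [wp_seq, wp_set]
    simp [Exp.eval, State.init, ← i1, ← i2, hf]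
  rintro t σ ⟨rfl, r0, r1, r2, r3, r4, r20, r19, har, hout⟩
  refine wp_seq.2 ?_
  obtain ⟨M', hM', h1, h2, h3⟩ := turns_constraints (I := I) (f := f)
    (M := ⟨n, ([(0, 0)], []), [], σ.regs⟩) i3 rfl rfl rfl r19 r20
  obtain ⟨u, υ, hex, hu, hrep⟩ := hM' σ (by
    constructor
    case co =>
      intro o j l c h4 h5
      rw [List.nil_append, getElem?_singleton] at h4
      split_ifs at h4
      simp [← Option.some.inj h4] at h5
    case pairs =>
      intro p x h4
      rw [getElem?_singleton] at h4
      split_ifs at h4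
      simp [← Option.some.inj h4, har, State.init]
    all_goals simp [har, State.init, hf, r1, r2, r3, r4])
  have hF := Frame.of_exec hex
  refine ⟨u, υ, hex, ?_⟩
  have hinc : ∀ r, 1 ≤ r → r ≤ 4 → υ.regs r ≤ σ.regs r + u := by
    intro r h5 h6
    refine hex.le_add ?_
    interval_cases r <;> simp [Cmd.Increments, cmdConstraint, cmdHorn, cmdOrders, cmdOrder,
        cmdClause,
      cmdPremise, cmdHead, cmdConsistency, cmdWait, cmdPair, cmdCell, cmdClose, cmdInc, cmdAdvance,
      Cmd.index]
  have u1 := hinc 1 (by norm_num) (by norm_num)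
  have u2 := hinc 2 (by norm_num) (by norm_num)
  have u3 := hinc 3 (by norm_num) (by norm_num)
  have u4 := hinc 4 (by norm_num) (by norm_num)
  have hlen : 1 ≤ (encodeInput I).length := by simp [encodeInput]
  have hnv : υ.regs 1 = numVars n I := hrep.nv.trans h1
  refine wp_for 0 (υ.regs 1) 1 (fun i τ => ∀ v, τ.arrays 8 v = if v < i then v else 0) rfl
    (Nat.zero_le _) rfl (fun τ hτ => hτ.reg 1 rfl) ?_ ?_ ?_
  · intro v
    have : υ.arrays 8 = σ.arrays 8 := hF.arr 8 rfl
    simp [this, har, State.init]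
  · intro i τ _ hi hJ hr hFτ
    refine wp_put.2 ⟨le_rfl, fun v => ?_⟩
    simp only [Exp.eval, hr, arrays_setReg, arrays_setArr, if_true,
      update_apply, hJ]
    split_ifs <;> omega
  · intro t τ ht hJ hFτ
    refine ⟨by omega, by rw [hFτ.out rfl, hF.out rfl, hout],
      ⟨n, υ.regs 1, υ.regs 2, υ.regs 3, υ.regs 4, υ.arrays 1, υ.arrays 2, υ.arrays 3, υ.arrays 4,
        υ.arrays 5, υ.arrays 6, υ.arrays 7⟩, ?_, ?_, ?_, ?_⟩
    · have h4 := hrep.np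
      have h5 := hrep.no
      have h6 := hrep.nc
      have h7 := hrep.os_succ
      have h8 := hrep.co
      have h9 := hrep.pairs
      rw [h2] at h4 h5 h6 h7 h8 h9
      rw [h3] at h6
      exact ⟨rfl, hnv, h4, h5, h6, hrep.os_zero, h7, fun o j l c h10 h11 =>
        (h8 o j l c (by rw [getElem?_append_left (getElem?_eq_some_iff.1 h10).1]; exact h10)
          h11).2, h9⟩
    · exact ⟨(hFτ.reg 0 rfl).trans ((hF.reg 0 rfl).trans r0), hFτ.reg 1 rfl, hFτ.reg 2 rfl,
        hFτ.reg 3 rfl, hFτ.reg 4 rfl, hFτ.arr 1 rfl, hFτ.arr 2 rfl, hFτ.arr 3 rfl, hFτ.arr 4 rfl,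
        hFτ.arr 5 rfl, hFτ.arr 6 rfl, hFτ.arr 7 rfl, funext fun v => by rw [hJ v, hnv]⟩
    all_goals
      dsimp only
      omega

end

/-! ### The implementation of `Solve` -/

section

variable {n : ℕ}

theorem Run.append {V : Type*} [DecidableEq V] {c c' c'' : Config V} {es es' : List (Event V)}
    (h : Run c es c') (h' : Run c' es' c'') : Run c (es ++ es') c'' := by
  induction h with
  | nil => exact h'
  | cons h1 _ ih => exact .cons h1 (ih h')

theorem Run.single {V : Type*} [DecidableEq V] {c c' : Config V} {e : Event V} (h : Step c e c') :
    Run c [e] c' := .cons h (.nil _)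

/-- The extension of a map of the variables by the identity on the auxiliary variables. -/
def ext (σ : Fin n → Fin n) (v : ℕ) : ℕ := if h : v < n then (σ ⟨v, h⟩).val else v

theorem contracts_ext (σ : Fin n → Fin n) : Contracts n (ext σ) σ :=
  ⟨fun v => by simp [ext], fun v hv => by simp [ext, not_lt.2 hv]⟩

/-- The variables of the instance that occur in the list. -/
def reals (n : ℕ) (L : List ℕ) : List (Fin n) :=
  L.filterMap fun v => if h : v < n then some ⟨v, h⟩ else none

theorem mem_reals {L : List ℕ} {v : Fin n} : v ∈ reals n L ↔ v.val ∈ L := by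
  simp only [reals, List.mem_filterMap, Option.dite_none_right_eq_some, Option.some.injEq]
  grind

theorem map_val_reals {L : List ℕ} (h : ∀ x ∈ L, x < n) : (reals n L).map Fin.val = L := by
  induction L with
  | nil => rfl
  | cons x L ih =>
    have hx := h x mem_cons_self
    have := ih fun y hy => h y (mem_cons_of_mem _ hy)
    simp only [reals, List.filterMap_cons, hx, dif_pos, map_cons] at this ⊢
    rw [this]

theorem encode_strips (L : List ℕ) :
    ((reals n L).map Event.strip).flatMap Event.encode = stripWords n L := by
  induction L with
  | nil => rfl
  | cons x L ih =>
    rw [stripWords, flatMap_cons, ← stripWords, ← ih]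
    by_cases h : x < n <;> simp [reals, h, Event.encode]

/-- The variables of the instance that are governed by a group. -/
def Tab.governed (T : Tab) (n : ℕ) : Finset (Fin n) :=
  Finset.univ.filter fun v => v.val ∈ (Finset.range T.np).image T.pv

theorem Tab.card_governed_le (T : Tab) : (T.governed n).card ≤ n ∧ (T.governed n).card ≤ T.np := by
  refine ⟨by simpa using Finset.card_le_univ (T.governed n), ?_⟩
  have h1 : (T.governed n).map Fin.valEmbedding ⊆ (Finset.range T.np).image T.pv := by
    intro x hx
    obtain ⟨v, hv, rfl⟩ := Finset.mem_map.1 hx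
    exact (Finset.mem_filter.1 hv).2
  simpa using (Finset.card_le_card h1).trans Finset.card_image_le

variable {I : List (RepConstraint n)} {T : Tab} {σ : Fin n → Fin n} {R : ℕ → ℕ} {s : State}

/-- The configuration at the beginning of a call of `Solve`. -/
abbrev callConfig (I : List (RepConstraint n)) (σ : Fin n → Fin n) : Config (Fin n) :=
  .running (stage (conj I) σ []) (stage (conj I) σ [])

/-- The outcome of a round: an answer, or the contraction of a sink component. The number of
representatives of the governed variables decreases with each contraction. -/
def RoundResult (I : List (RepConstraint n)) (T : Tab) (σ : Fin n → Fin n) (s τ : State) : Prop :=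
  (∃ es b, Run (callConfig I σ) es (.done b) ∧ τ.out = s.out ++ es.flatMap Event.encode ∧
    τ.regs 18 = 0) ∨
  ∃ es σ' R', Run (callConfig I σ) es (callConfig I σ') ∧
    τ.out = s.out ++ es.flatMap Event.encode ∧ τ.regs 18 = s.regs 18 ∧ (∀ v, σ' (σ' v) = σ' v) ∧
    (∀ v < numVars n I, ext σ' v = R' v) ∧ Loaded T R' τ ∧
    ((T.governed n).image σ').card < ((T.governed n).image σ).card

theorem wp_round (hI : ∀ c ∈ I, LLClosed c.rep.rel)
    (hT : T.Holds n (numVars n I) (layout (allGroups n I))) (hσ : ∀ v, σ (σ v) = σ v)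
    (hR : ∀ v < numVars n I, ext σ v = R v) (hL : Loaded T R s) :
    WP cmdRound s fun t τ => t ≤ 400 * (T.nv + T.np + T.no + T.nc + 1) ∧
      RoundResult I T σ s τ := by
  have hρ := contracts_ext σ
  have hG : ∀ g ∈ allGroups n I, g.WF (numVars n I) := fun g hg => wf_allGroups hg
  have hk : ∀ g ∈ allGroups n I, g.Keyed (ext σ) := fun g hg => keyed_allGroups hρ hg
  have hS := laid_layout _ hG
  have hnN : n ≤ numVars n I := Nat.le_add_right _ _
  have hWF := hT.wf hS hG hnN
  have hnv := hT.nv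
  have hnr := hT.nr
  have hval : ∀ v : Fin n, R v = (σ v).val := fun v => by
    rw [← hR v (v.isLt.trans_le hnN), hρ.val]
  have hge : ∀ v < numVars n I, n ≤ v → R v = v := fun v hv h => by rw [← hR v hv, hρ.fix v h]
  have hRlt : ∀ v < T.nv, R v < T.nv := by
    intro v hv
    rw [hnv] at hv ⊢
    by_cases h : v < n
    · rw [hval ⟨v, h⟩]
      omega
    · rwa [hge v hv (not_lt.1 h)]
  have hRR : ∀ v < T.nv, R (R v) = R v := by
    intro v hv
    rw [hnv] at hv
    by_cases h : v < n
    · rw [hval ⟨v, h⟩, hval, hσ]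
    · rw [hge v hv (not_lt.1 h), hge v hv (not_lt.1 h)]
  refine (wp_cmdRound hWF hRlt hRR hL (fun L => Legit (ext σ) {x | x ∈ L} I ∧
    Run (callConfig I σ) ((reals n L).map Event.strip)
      (.running (stage (conj I) σ []) (stage (conj I) σ (reals n L)))) ⟨?_, .nil _⟩ ?_ ?_).mono ?_
  · intro p _ cs _
    simp
  · rintro L v ⟨hleg, hrun⟩ hvL hv hRv hsink
    have hg := (flatSink_iff hT hS hG hk hR (by omega) hRv hvL).1 hsink
    have hset : {x | x ∈ L ++ [v]} = insert v {x | x ∈ L} := by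
      ext x
      simp [or_comm]
    refine ⟨by rw [hset]; exact hleg.insert hρ hg, ?_⟩
    by_cases hvn : v < n
    · have he : reals n (L ++ [v]) = reals n L ++ [⟨v, hvn⟩] := by simp [reals, hvn]
      rw [he, map_append]
      refine hrun.append (.single ?_)
      rw [show stage (conj I) σ (reals n L ++ [⟨v, hvn⟩]) =
        (stage (conj I) σ (reals n L)).project ⟨v, hvn⟩ from (Instance.projectList_concat ..).symm]
      exact .strip _ _ _ (isSink_of_gAdm hI hρ hleg (fun v => mem_reals.symm)
        (Fin.ext ((hval ⟨v, hvn⟩).symm.trans hRv)) hg)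
    · have he : reals n (L ++ [v]) = reals n L := by simp [reals, hvn]
      rwa [he]
  · rintro L -
    exact interGood hT hS hG hk hR fun g hg x hx hxg U U' =>
      Good.inter hI hρ (ys := reals n L) (fun v => mem_reals.symm) hg hx hxg
  rintro t τ ⟨ht, L, ⟨hleg, hrun⟩, hD⟩
  refine ⟨ht, ?_⟩
  have hY : ∀ v : Fin n, v.val ∈ {x | x ∈ L} ↔ v ∈ reals n L := fun v => mem_reals.symm
  have hex : ∀ x < numVars n I, ext σ x = x → x ∉ {x | x ∈ L} →
      ¬ GAdm (ext σ) {x | x ∈ L} (allGroups n I) {x} := by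
    intro x hx hxx hxL hg
    have hRx : R x = x := (hR x hx).symm.trans hxx
    exact hD.exhausted x (by omega) hRx hxL ((flatSink_iff hT hS hG hk hR hx hRx hxL).2 hg)
  have hnosink := no_sink_of_exhausted hI hρ hσ hY hex
  have hvars : (∃ v < T.nr, R v = v ∧ v ∉ L) → (stage (conj I) σ (reals n L)).vars ≠ ∅ := by
    rintro ⟨v, hv, hRv, hvL⟩ h0
    rw [hnr] at hv
    have : (⟨v, hv⟩ : Fin n) ∈ (stage (conj I) σ (reals n L)).vars :=
      (mem_stage_vars _).2 ⟨⟨⟨v, hv⟩, Fin.ext ((hval ⟨v, hv⟩).symm.trans hRv)⟩, by rwa [mem_reals]⟩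
    rw [h0] at this
    simp at this
  rcases hD.outcome with ⟨h1, h2, h3⟩ | ⟨h0, ⟨h1, h2, h3⟩ | ⟨r, S, hnd, hadm, hmin, hout, h18,
      hload⟩⟩
  · refine .inl ⟨_, true, hrun.append (.single (.accept _ _ hnosink ?_)), ?_, h3⟩
    · refine Finset.eq_empty_of_forall_notMem fun x hx => ?_
      obtain ⟨⟨v, rfl⟩, hx⟩ := (mem_stage_vars x).1 hx
      grind
    · rw [h2, flatMap_append, encode_strips, hnr, append_assoc]
      rfl
  · refine .inl ⟨_, false, hrun.append (.single (.reject _ _ hnosink (hvars h0)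
      (no_sinkComponent hI hρ hσ hY hex fun U hne hU hg => hne.ne_empty (h1 U
        (flatAdm_of_gAdm hT hS hG hk hR hg fun x hx => ?_))))), ?_, h3⟩
    · grind
    · rw [h2, flatMap_append, encode_strips, hnr, append_assoc]
      rfl
  · have hlive : ∀ x ∈ r :: S, x < numVars n I ∧ R x = x ∧ x ∉ L := fun x hx => by
      have := (hadm x hx).1
      rwa [Tab.Live, hnv] at this
    have hgadm := gAdm_of_flatAdm hT hS hG hk hR hadm
    have hltn : ∀ x ∈ r :: S, x < n := GAdm.lt_of_exhausted hρ hleg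
      (complete_of_exhausted hρ fun x hx hnx hxL => hex x hx (hρ.fix x hnx) hxL) hgadm
      fun x hx => (hlive x hx).1
    obtain ⟨r', S', rfl, rfl⟩ : ∃ (r' : Fin n) (S' : List (Fin n)), r = r'.val ∧
        S = S'.map Fin.val := by
      have := map_val_reals hltn
      cases hl : reals n (r :: S) with
      | nil => simp [hl] at this
      | cons r' S' =>
        rw [hl, map_cons, List.cons.injEq] at this
        exact ⟨r', S', this.1.symm, this.2.symm⟩
    rw [← map_cons] at hnd hadm hmin hout hload hlive hgadm
    have himg : {x | x ∈ (r' :: S').map Fin.val} = Fin.val '' {x | x ∈ r' :: S'} := by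
      ext x
      simp [eq_comm]
    have hfix : ∀ x ∈ r' :: S', σ x = x := fun x hx =>
      Fin.ext ((hval x).symm.trans (hlive x (mem_map_of_mem hx)).2.1)
    have hmem : ∀ v : Fin n, v.val ∈ (r' :: S').map Fin.val ↔ v ∈ r' :: S' := fun v =>
      List.mem_map_of_injective Fin.val_injective
    have hcomp : (stage (conj I) σ (reals n L)).IsSinkComponent {x | x ∈ r' :: S'} := by
      refine isSinkComponent_of_minimal hI hρ hleg hY hex ⟨r', mem_cons_self⟩ hfix
        (himg ▸ hgadm) fun U hU hne hg => ?_
      rw [← himg] at hU ⊢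
      exact hmin U hU hne (flatAdm_of_gAdm hT hS hG hk hR hg fun x hx =>
        ⟨(hlive x (hU hx)).1, (hlive x (hU hx)).2.1⟩)
    set c : Fin n → Fin n := fun x => if x ∈ r' :: S' then r' else x with hc
    have hcS : ∀ x, c x ∈ r' :: S' → c x = r' := by grind
    have hcc : ∀ x, c x = r' ∨ c x = x := fun x => by
      simp only [hc]
      split_ifs <;> simp
    -- a representative that cannot be stripped is governed by a group
    have hgov : ∀ x ∈ r' :: S', x ∈ (T.governed n).image σ := by
      intro x hx
      obtain ⟨h4, h5, h6⟩ := hlive x (mem_map_of_mem hx)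
      have h7 := hD.exhausted x (by omega) h5 h6
      simp only [Tab.FlatSink, not_forall] at h7
      obtain ⟨p, hp1, hp2, -, hpx, -⟩ := h7
      have hpn : T.pv p < n := by
        by_contra h
        have := hge _ (hnv ▸ hWF.pv_lt p hp1 hp2) (not_lt.1 h)
        rw [Tab.u, this] at hpx
        omega
      refine Finset.mem_image.2 ⟨⟨T.pv p, hpn⟩, ?_, Fin.ext ((hval _).symm.trans hpx)⟩
      exact Finset.mem_filter.2 ⟨Finset.mem_univ _,
          Finset.mem_image_of_mem _ (Finset.mem_range.2 hp2)⟩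
    -- otherwise the component is a sink
    obtain ⟨y, hy, hyr⟩ : ∃ y ∈ S', y ≠ r' := by
      cases S' with
      | nil =>
        refine absurd ?_ (hnosink r')
        simpa [Instance.IsSink, Set.ofPred_eq_eq_singleton] using hcomp
      | cons y S' =>
        refine ⟨y, mem_cons_self, fun h => ?_⟩
        simp [h] at hnd
    have hnd' : (r' :: S').Nodup := List.Nodup.of_map _ hnd
    refine .inr ⟨_, fun v => c (σ v), _, hrun.append (.single (e := .contract (r' :: S')) ?_), ?_,
        h18, fun v => ?_, fun v hv => ?_,
      hload, ?_⟩
    · have := Step.contract (stage (conj I) σ []) _ hnosink (hvars h0) r' S' hnd' hcomp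
      rw [Instance.contract, stage, Instance.projectList, List.foldl_nil,
        Instance.rename_rename] at this
      exact this
    · rw [hout, flatMap_append, encode_strips, hnr, append_assoc]
      simp [Event.encode]
    · rcases hcc (σ v) with h | h
      · grind
      · simp only [h, hσ]
    · by_cases hvn : v < n
      · have h5 : R v = σ ⟨v, hvn⟩ := hval ⟨v, hvn⟩
        simp only [ext, dif_pos hvn, h5, hmem, hc, hnv, hv, true_and]
        split_ifs <;> rfl
      · have h5 := hge v hv (not_lt.1 hvn)
        rw [ext, dif_neg hvn, h5, if_neg]
        grind
    · refine Finset.card_lt_card (Finset.ssubset_iff_subset_ne.2 ⟨fun x hx => ?_, fun heq => ?_⟩)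
      · obtain ⟨v, hv, rfl⟩ := Finset.mem_image.1 hx
        grind
      · have := hgov y (mem_cons_of_mem _ hy)
        rw [← heq] at this
        obtain ⟨v, -, hv⟩ := Finset.mem_image.1 this
        grind

/-- The total time: `t'` for at most `B + 1` rounds on tables of size `N`, and `a` for reading the
input. -/
theorem rounds_bound {n m N a B t t' : ℕ} (hn : 1 ≤ n) (hm : 1 ≤ m) (hBn : B ≤ n)
    (hBm : B ≤ 62 * m) (hN : N ≤ 300 * (n + m)) (ha : a ≤ 400 * (n + m))
    (ht : t = a + (1 + (t' + 1))) (ht' : t' ≤ (400 * (N + 1) + 1) * (B + 1)) :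
    t ≤ 10 ^ 7 * (n * m) := by
  have h1 : n + m ≤ 2 * (n * m) := by nlinarith
  have h2 : (n + m) * (B + 1) ≤ 66 * (n * m) := by nlinarith
  have h3 : (400 * (N + 1) + 1) * (B + 1) ≤ (120401 * (n + m)) * (B + 1) :=
    Nat.mul_le_mul_right _ (by omega)
  rw [Nat.mul_assoc] at h3
  omega

/-- The implementation of `Solve`. -/
def cmdSolve : Cmd := cmdLoad ;; .set 18 (.lit 1) ;; .loop (.reg 18) cmdRound

/-- The number of representatives of governed variables bounds the number of the remaining rounds.
-/
theorem wp_cmdSolve (hI : ∀ c ∈ I, LLClosed c.rep.rel) :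
    WP cmdSolve (State.init (encodeInput I)) fun t τ =>
      (∃ es b, Run (Config.start (conj I)) es (.done b) ∧ τ.out = es.flatMap Event.encode) ∧
      (0 < n → t ≤ 10 ^ 7 * (n * (encodeInput I).length)) := by
  refine wp_seq.2 (wp_cmdLoad.mono ?_)
  rintro t s ⟨ht, hout, T, hT, hL, hsize, hnp⟩
  refine wp_seq.2 (wp_set.2 ?_)
  obtain ⟨W, hW⟩ : ∃ W, W = 400 * (T.nv + T.np + T.no + T.nc + 1) + 1 := ⟨_, rfl⟩
  obtain ⟨B, hB⟩ : ∃ B, B = (T.governed n).card := ⟨_, rfl⟩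
  have hstart : Config.start (conj I) = callConfig I id := by
    simp [callConfig, stage, Instance.rename_id, Instance.projectList, Config.start]
  refine wp_loop (fun k t τ => t + W * k ≤ W * (B + 1) ∧
    ((k = 0 ∧ τ.regs 18 = 0 ∧ ∃ es b, Run (Config.start (conj I)) es (.done b) ∧
        τ.out = es.flatMap Event.encode) ∨
      ∃ es σ R, k = ((T.governed n).image σ).card + 1 ∧ τ.regs 18 = 1 ∧
        Run (Config.start (conj I)) es (callConfig I σ) ∧ τ.out = es.flatMap Event.encode ∧
        (∀ v, σ (σ v) = σ v) ∧ (∀ v < numVars n I, ext σ v = R v) ∧ Loaded T R τ))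
    (k := B + 1) ⟨by simp, .inr ⟨[], id, _, by simp [hB], by simp [Exp.eval], hstart ▸ .nil _, hout,
      fun _ => rfl, fun v hv => ?_, hL.frame (c := .set 18 (.lit 1)) ?_ rfl⟩⟩ ?_ ?_
  · by_cases h : v < n <;> simp [ext, hv]
  · exact Frame.of_exec (.set _ _ _)
  · rintro k t τ ⟨hk, ⟨-, h0, -⟩ | ⟨es, σ, R, rfl, h18, hrun, ho, hσ, hR, hL⟩⟩ - he
    · exact absurd h0 he
    · refine (wp_round hI hT hσ hR hL).mono ?_
      rintro u υ ⟨hu, ⟨es', b, hrun', ho', h0⟩ |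
        ⟨es', σ', R', hrun', ho', h18', hσ', hR', hL', hlt⟩⟩
      · refine ⟨0, Nat.succ_pos _, ?_, .inl ⟨rfl, h0, es ++ es', b, hrun.append hrun', ?_⟩⟩
        · grind
        · rw [ho', ho, flatMap_append]
      · refine ⟨_, Nat.succ_lt_succ hlt, ?_, .inr ⟨es ++ es', σ', R', rfl, h18'.trans h18,
          hrun.append hrun', by rw [ho', ho, flatMap_append], hσ', hR', hL'⟩⟩
        have := Nat.mul_le_mul_left W hlt
        grind
  · intro _ t' τ h _ he
    obtain ⟨hk, ⟨-, -, h⟩ | ⟨es, σ, R, -, h18, -⟩⟩ := h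
    · refine ⟨h, fun hn => ?_⟩
      obtain ⟨hBn, hBp⟩ := T.card_governed_le (n := n)
      have hm : 1 ≤ (encodeInput I).length := by simp [encodeInput]
      exact rounds_bound hn hm (by omega) (by omega) hsize ht rfl
        (hW ▸ hB ▸ Nat.le_of_add_right_le hk)
    · simp only [Exp.eval, h18] at he
      exact absurd he one_ne_zero

end

end TCSP

theorem mainTheorem1 :
    (∀ (V : Type*) [Fintype V] [DecidableEq V] (Φ : List (TCSP.Atom V)),
      (∀ φ ∈ Φ, TCSP.IsTemporal φ.rel ∧ TCSP.LLClosed φ.rel) → TCSP.SolveDecides Φ) ∧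
    (∃ (P : TCSP.Cmd) (C : ℕ), ∀ (n : ℕ) (I : List (TCSP.RepConstraint n)),
      (∀ c ∈ I, TCSP.LLClosed c.rep.rel) →
      ∃ (t : ℕ) (τ : TCSP.State) (es : List (TCSP.Event (Fin n))) (b : Bool),
        TCSP.Exec P (TCSP.State.init (TCSP.encodeInput I)) t τ ∧
        TCSP.Run (TCSP.Config.start (I.flatMap TCSP.RepConstraint.conjuncts)) es (.done b) ∧
        τ.out = es.flatMap TCSP.Event.encode ∧
        (b = true ↔ TCSP.Satisfiable (I.map TCSP.RepConstraint.atom)) ∧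
        (0 < n → t ≤ C * (n * (TCSP.encodeInput I).length))) := by
  refine ⟨fun V _ _ Φ h => TCSP.solveDecides h, TCSP.cmdSolve, 10 ^ 7, fun n I hI => ?_⟩
  obtain ⟨t, τ, hexec, ⟨es, b, hrun, hout⟩, ht⟩ := TCSP.wp_cmdSolve hI
  refine ⟨t, τ, es, b, hexec, hrun, hout, ?_, ht⟩
  rw [← TCSP.satisfiable_conjuncts]
  exact (TCSP.correct_start (TCSP.nice_conj hI)).run hrun
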